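/- **Setting.** A prederivator is a 2-functor $\mathscr D$ from small categories to categories (contravariant on functors, covariant on natural transformations); morphisms are pseudonatural transformations, and $\cong$ between morphisms means isomorphic by an invertible modification. A derivator satisfies the usual axioms (Der1)–(Der4); it is stable if it is pointed and its cartesian and cocartesian coherent squares coincide. Write $\mathbb 1$ for the terminal category, $[1]=(0\to1)$, $\square=[1]\times[1]$, $\mathscr D^B(K)=\mathscr D(B\times K)$, $u_!\dashv u^*\dashv u_*$ for the Kan extensions along $u$, and $\Sigma$ for suspension. The morphism $\mathrm{cof}\colon\mathscr D^{[1]}\to\mathscr D^{[1]}$ sends $x\to y$ to $y\to z$, where $z$ is the cofiber of $x\to y$, and $\mathrm{fib}\colon\mathscr D^{[1]}\to\mathscr D^{[1]}$ sends $x\to y$ to $w\to x$, where $w$ is the fiber of $x\to y$. Under the two identifications $\mathscr D^\square\cong(\mathscr D^{[1]})^{[1]}$, the morphism $\mathrm{cof}$ of $\mathscr D^{[1]}$ induces $\mathrm{cof}_1,\mathrm{cof}_2\colon\mathscr D^\square\to\mathscr D^\square$ (cofibers in the first and in the second direction). Let $C_0\subset\mathbb Z^3$ be the poset of all points $(n+\epsilon_1,n+\epsilon_2,n+\epsilon_3)$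 with $n\in\mathbb Z$, $\epsilon_i\in\{0,1\}$, and let $C\subset\mathbb Z^3$ consist of $C_0$ and the points $(n,n+2,n+1)$, $(n+2,n+1,n)$, $(n+1,n,n+2)$, $n\in\mathbb Z$. Let $\mathscr D^{C,\mathrm{ex}}\subset\mathscr D^C$ be the full subprederivator of the diagrams in which all small squares of $C$ (squares in $C$ whose sides are unit steps in two different coordinate directions) are bicartesian and all objects at points of $C\setminus C_0$ are zero. Let $r,\mathrm{sh}\colon C\to C$ be $r(n_1,n_2,n_3)=(n_3,n_1,n_2)$ and $\mathrm{sh}(n_1,n_2,n_3)=(n_1+1,n_2+1,n_3+1)$; they induce $r^*,\mathrm{sh}^*\colon\mathscr D^{C,\mathrm{ex}}\to\mathscr D^{C,\mathrm{ex}}$. Put $V=\{000,100,010,001\}\subset C$, let $i\colon V\to C$ be the inclusion, and let $j\colon\square\to C$ be $00,01,10,11\mapsto010,011,110,112$. Once $i^*\colon\mathscr D^{C,\mathrm{ex}}\to\mathscr D^V$ and $j^*\colon\mathscr D^{C,\mathrm{ex}}\to\mathscr D^\square$ are known to be equivalences, let $F$ and $G$ be their inverses. Let $E$ be the poset obtained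 from the subposet $[1]^4\cup\{0211,2101,1021,2111,1211,1121\}$ of $\mathbb Z^4$ by freely adjoining $(-\infty,0)<0000$, $(-\infty,1)<0001$ with $(-\infty,0)<(-\infty,1)$. Let $E_1=\{(-\infty,0),1100,0110,1010,1110\}$, $E_2=E_1\cup([1]^3\times\{0\})$, $E_3=E_2\cup\{(-\infty,1)\}$, $E_4=E_3\cup([1]^3\times\{1\})$, $E_5=E_4\cup\{0211,2101,1021\}$, $E_6=E$. Let $v_1\colon V\to E_1$ be $000\mapsto(-\infty,0)$, $100\mapsto1100$, $010\mapsto0110$, $001\mapsto1010$, and let $v_k\colon E_{k-1}\to E_k$ be the inclusion for $k\ge2$. Put $$H=(v_6)_!(v_5)_*(v_4)_!(v_3)_*(v_2)_*(v_1)_*\colon\mathscr D^V\to\mathscr D^E,\qquad T'=w_0^*H\ \text{ with } w_0(n_1,n_2,n_3)=(n_1,n_2,n_3,1),$$ $$T=F\,T'\,i^*\colon\mathscr D^{C,\mathrm{ex}}\to\mathscr D^{C,\mathrm{ex}},\qquad \tau=r^*T^{-1},\qquad \mathbb S=r^*\,\mathrm{sh}^*.$$ **Proposition.** Let $\mathscr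 D$ be a stable derivator. For $\mathscr D$, $\mathscr D^{[1]}$ and $\mathscr D^\square$ all restriction morphisms $u^*$ (including evaluations at objects) have left and right adjoints $u_!$, $u_*$ among morphisms of prederivators; $i^*,j^*$ are equivalences; and $T$, $r^*$, $\tau$ are equivalences. Moreover: 1. $G\circ\mathrm{cof}_1\cong r^*\circ\tau^{-1}\circ G$ and $G\circ\mathrm{cof}_2\cong(r^*)^{-1}\circ\tau^{-1}\circ G$. 2. Suppose $\mathscr D$ is monoidal, i.e. it carries a pseudomonoid structure whose tensor product preserves left Kan extensions in each variable separately, and let $\otimes\colon\mathscr D^{[1]}\times\mathscr D^{[1]}\to\mathscr D^\square$ be the external product. Then, pseudonaturally in $X,Y\in\mathscr D^{[1]}$, $$G(\mathrm{cof}\,X\otimes\mathrm{cof}\,Y)\cong\mathbb S\,G(X\otimes Y),\qquad G\,\Sigma(\mathrm{fib}\,X\otimes\mathrm{fib}\,Y)\cong\tau^{-1}G(X\otimes Y).$$ 3. In the situation of 2, there are morphisms $u,v,w\colon\mathscr D^{[1]}\times\mathscr D^{[1]}\to\mathscr D$ such that, for $X=(x\to y)$ and $X'=(x'\to y')$ with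 cofibers $z$ and $z'$, the coherent diagram $G(X\otimes X')$ is objectwise the extended (TC3) diagram, and $\tau^{-1}G(X\otimes X')$ is objectwise the extended (TC3') diagram. That is, pseudonaturally in $X,X'$, the values at the points $c\in C_0$ are as in the following table, and for both diagrams the value at $c+(3,3,3)$ is isomorphic to $\Sigma^2$ of the value at $c$, for every $c\in C$ (as elements of $\mathscr D^{C,\mathrm{ex}}$, both vanish on $C\setminus C_0$). | $c$ | (TC3) | (TC3') | |---|---|---| | 000 | $\Sigma^{-1}w$ | $u$ | | 100 | $\Sigma^{-1}(y\otimes z')$ | $x\otimes y'$ | | 010 | $x\otimes x'$ | $\Sigma^{-1}(z\otimes z')$ | | 001 | $\Sigma^{-1}(z\otimes y')$ | $y\otimes x'$ | | 110 | $y\otimes x'$ | $x\otimes z'$ | | 101 | $\Sigma^{-1}(z\otimes z')$ | $y\otimes y'$ | | 011 | $x\otimes y'$ | $z\otimes x'$ | | 111 | $v$ | $w$ | | 211 | $x\otimes z'$ | $z\otimes y'$ | | 121 | $z\otimes x'$ | $y\otimes z'$ | | 112 | $y\otimes y'$ | $\Sigma(x\otimes x')$ | | 221 | $\Sigma(x\otimes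 x')$ | $z\otimes z'$ | | 212 | $y\otimes z'$ | $\Sigma(x\otimes y')$ | | 122 | $z\otimes y'$ | $\Sigma(y\otimes x')$ | | 222 | $\Sigma u$ | $\Sigma v$ | | 322 | $z\otimes z'$ | $\Sigma(y\otimes y')$ | | 232 | $\Sigma(y\otimes x')$ | $\Sigma(x\otimes z')$ | | 223 | $\Sigma(x\otimes y')$ | $\Sigma(z\otimes x')$ | | 332 | $\Sigma(z\otimes x')$ | $\Sigma(y\otimes z')$ | | 323 | $\Sigma(x\otimes z')$ | $\Sigma(z\otimes y')$ | | 233 | $\Sigma(y\otimes y')$ | $\Sigma^2(x\otimes x')$ | -/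

import Mathlib

open CategoryTheory Bicategory Opposite Bicategory.Opposite
open scoped Pseudofunctor.StrongTrans

universe w₁ w₂ w₃ w₄ v₁ v₂ v₃ v₄ u₁ u₂ u₃ u₄ v u

namespace Der

noncomputable section

/-! ### Bicategorical preliminaries -/

section
variable {A : Type u₁} [Bicategory.{w₁, v₁} A] {B : Type u₂} [Bicategory.{w₂, v₂} B]
  {C : Type u₃} [Bicategory.{w₃, v₃} C]

theorem map₂_ρ_inv (D : B ⥤ᵖ C) {a b : B} (f : a ⟶ b) :
    D.map₂ (ρ_ f).inv = (ρ_ (D.map f)).inv ≫ D.map f ◁ (D.mapId b).inv ≫ (D.mapComp f (𝟙 b)).inv := by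
  rw [← cancel_mono (D.map₂ (ρ_ f).hom), ← PrelaxFunctor.map₂_comp, Iso.inv_hom_id, PrelaxFunctor.map₂_id, Pseudofunctor.map₂_right_unitor]
  simp
theorem map₂_α_inv (D : B ⥤ᵖ C) {a b c d : B} (f : a ⟶ b) (g : b ⟶ c) (h : c ⟶ d) :
    D.map₂ (α_ f g h).inv = (D.mapComp f (g ≫ h)).hom ≫ D.map f ◁ (D.mapComp g h).hom ≫
      (α_ _ _ _).inv ≫ (D.mapComp f g).inv ▷ D.map h ≫ (D.mapComp (f ≫ g) h).inv := by
  rw [D.mapComp_assoc_right_hom_assoc]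
  simp
/-- Whiskering of a pseudonatural transformation with a pseudofunctor. -/
def whisk {Φ Ψ : A ⥤ᵖ B} (α : Φ ⟶ Ψ) (D : B ⥤ᵖ C) : Φ.comp D ⟶ Ψ.comp D where
  app a := D.map (α.app a)
  naturality {a b} f := (D.mapComp _ _).symm ≪≫ D.map₂Iso (α.naturality f) ≪≫ D.mapComp _ _
  naturality_naturality := by
    intro a b f g η
    have h := congrArg D.map₂ (α.naturality_naturality η)
    simp only [PrelaxFunctor.map₂_comp, Pseudofunctor.map₂_whisker_left,
      Pseudofunctor.map₂_whisker_right, Category.assoc] at h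
    change D.map₂ (Φ.map₂ η) ▷ D.map (α.app b) ≫ (D.mapComp _ _).inv ≫ D.map₂ (α.naturality g).hom ≫ (D.mapComp _ _).hom
      = ((D.mapComp _ _).inv ≫ D.map₂ (α.naturality f).hom ≫ (D.mapComp _ _).hom) ≫
        D.map (α.app a) ◁ D.map₂ (Ψ.map₂ η)
    rw [← cancel_epi (D.mapComp _ _).hom, ← cancel_mono (D.mapComp _ _).inv]
    simpa using h
  naturality_id := by
    intro a
    have h := congrArg D.map₂ (α.naturality_id a)
    simp only [PrelaxFunctor.map₂_comp, Pseudofunctor.map₂_whisker_left,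
      Pseudofunctor.map₂_whisker_right, Category.assoc,
      Pseudofunctor.map₂_left_unitor, map₂_ρ_inv D] at h
    change ((D.mapComp _ _).inv ≫ D.map₂ (α.naturality (𝟙 a)).hom ≫ (D.mapComp _ _).hom) ≫
        D.map (α.app a) ◁ (D.map₂ (Ψ.mapId a).hom ≫ (D.mapId _).hom) =
      (D.map₂ (Φ.mapId a).hom ≫ (D.mapId _).hom) ▷ D.map (α.app a) ≫ _
    rw [← cancel_epi (D.mapComp _ _).hom]
    simp at h ⊢
    have h' := congrArg (· ≫ (D.mapComp (α.app a) (𝟙 (Ψ.obj a))).hom ≫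
      D.map (α.app a) ◁ (D.mapId (Ψ.obj a)).hom) h
    simp only [Category.assoc, Iso.inv_hom_id_assoc, whiskerLeft_inv_hom, Category.comp_id] at h'
    rw [h']
    congr 1
    exact (Category.assoc _ _ _).symm
  naturality_comp := by
    intro a b c f g
    have h := congrArg D.map₂ (α.naturality_comp f g)
    simp only [PrelaxFunctor.map₂_comp, Pseudofunctor.map₂_whisker_left,
      Pseudofunctor.map₂_whisker_right, Category.assoc,
      Pseudofunctor.map₂_associator, map₂_α_inv D] at h
    change ((D.mapComp _ _).inv ≫ D.map₂ (α.naturality (f ≫ g)).hom ≫ (D.mapComp _ _).hom) ≫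
        D.map (α.app a) ◁ (D.map₂ (Ψ.mapComp f g).hom ≫ (D.mapComp _ _).hom) =
      (D.map₂ (Φ.mapComp f g).hom ≫ (D.mapComp _ _).hom) ▷ D.map (α.app c) ≫ (α_ _ _ _).hom ≫
       D.map (Φ.map f) ◁ ((D.mapComp _ _).inv ≫ D.map₂ (α.naturality g).hom ≫ (D.mapComp _ _).hom)
        ≫ (α_ _ _ _).inv ≫ ((D.mapComp _ _).inv ≫ D.map₂ (α.naturality f).hom ≫ (D.mapComp _ _).hom) ▷ D.map (Ψ.map g) ≫ (α_ _ _ _).hom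
    simp at h ⊢
    have h' := congrArg (fun t => (D.mapComp (Φ.map (f ≫ g)) (α.app c)).inv ≫ t ≫
      (D.mapComp (α.app a) (Ψ.map f ≫ Ψ.map g)).hom ≫
      D.map (α.app a) ◁ (D.mapComp (Ψ.map f) (Ψ.map g)).hom) h
    simpa only [Category.assoc, Iso.inv_hom_id_assoc, whiskerLeft_inv_hom, Category.comp_id] using h'
end

/-- The 2-functor `K ↦ B × K` on small categories. -/
def prodIdx (B : Type) [SmallCategory B] : Cat.{0, 0}ᵒᵖ ⥤ᵖ Cat.{0, 0}ᵒᵖ where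
  obj K := op (Cat.of (B × K.unop))
  map f := ((𝟭 B).prod f.unop.toFunctor).toCatHom.op
  map₂ η := op2 (NatTrans.toCatHom₂ (NatTrans.prod (𝟙 (𝟭 B)) η.unop2.toNatTrans))
  mapId K := Iso.op2_unop (Cat.Hom.isoMk (NatIso.ofComponents (fun _ => Iso.refl _)))
  mapComp f g := Iso.op2_unop (Cat.Hom.isoMk (NatIso.ofComponents (fun _ => Iso.refl _)))
  map₂_id f := by
    refine congrArg op2 (Cat.Hom₂.ext (NatTrans.ext (funext fun x => ?_)))
    exact Prod.ext rfl rfl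
  map₂_comp f g := by
    refine congrArg op2 (Cat.Hom₂.ext (NatTrans.ext (funext fun x => ?_)))
    refine Prod.ext (Category.id_comp _).symm rfl
  map₂_whisker_left f g h η := by
    refine congrArg op2 (Cat.Hom₂.ext (NatTrans.ext (funext fun x => ?_)))
    refine Prod.ext ?_ ?_
    · change 𝟙 _ = 𝟙 _ ≫ 𝟙 _ ≫ 𝟙 _
      simp
    · change _ = 𝟙 _ ≫ _ ≫ 𝟙 _
      rw [Category.id_comp, Category.comp_id]; rfl
  map₂_whisker_right η h := by
    refine congrArg op2 (Cat.Hom₂.ext (NatTrans.ext (funext fun x => ?_)))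
    refine Prod.ext ?_ ?_
    · change 𝟙 _ = 𝟙 _ ≫ 𝟙 _ ≫ 𝟙 _
      simp
    · change _ = 𝟙 _ ≫ _ ≫ 𝟙 _
      rw [Category.id_comp, Category.comp_id]; rfl
  map₂_associator f g h := by
    refine congrArg op2 (Cat.Hom₂.ext (NatTrans.ext (funext fun x => ?_)))
    refine Prod.ext ?_ ?_
    · change 𝟙 _ = 𝟙 _ ≫ 𝟙 _ ≫ 𝟙 _ ≫ 𝟙 _ ≫ 𝟙 _
      simp
    · change 𝟙 _ = 𝟙 _ ≫ 𝟙 _ ≫ 𝟙 _ ≫ (CategoryTheory.Functor.map f.unop.toFunctor (𝟙 _)) ≫ 𝟙 _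
      simp
  map₂_left_unitor f := by
    refine congrArg op2 (Cat.Hom₂.ext (NatTrans.ext (funext fun x => ?_)))
    refine Prod.ext ?_ ?_
    · change 𝟙 _ = 𝟙 _ ≫ 𝟙 _ ≫ 𝟙 _ 
      simp
    · change 𝟙 _ = 𝟙 _ ≫ 𝟙 _ ≫ 𝟙 _
      simp
  map₂_right_unitor f := by
    refine congrArg op2 (Cat.Hom₂.ext (NatTrans.ext (funext fun x => ?_)))
    refine Prod.ext ?_ ?_
    · change 𝟙 _ = 𝟙 _ ≫ 𝟙 _ ≫ 𝟙 _ 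
      simp
    · change 𝟙 _ = 𝟙 _ ≫ CategoryTheory.Functor.map f.unop.toFunctor (𝟙 _) ≫ 𝟙 _
      simp


/-- The canonical identification `id ⋙ D ≅ D`. -/
def unitTrans {A : Type u₁} [Bicategory.{w₁, v₁} A] {C : Type u₂} [Bicategory.{w₂, v₂} C]
    (D : A ⥤ᵖ C) : (Pseudofunctor.id A).comp D ⟶ D where
  app a := 𝟙 _
  naturality f := ρ_ _ ≪≫ (λ_ _).symm
  naturality_naturality {a b f g} η := by
    change D.map₂ η ▷ 𝟙 _ ≫ ((ρ_ _).hom ≫ (λ_ _).inv) = ((ρ_ _).hom ≫ (λ_ _).inv) ≫ 𝟙 _ ◁ D.map₂ η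
    simp
  naturality_id a := by
    change ((ρ_ _).hom ≫ (λ_ _).inv) ≫ 𝟙 _ ◁ (D.mapId a).hom = (D.map₂ (𝟙 _) ≫ (D.mapId a).hom) ▷ 𝟙 _ ≫ (λ_ _).hom ≫ (ρ_ _).inv
    simp
  naturality_comp f g := by
    change ((ρ_ _).hom ≫ (λ_ _).inv) ≫ 𝟙 _ ◁ (D.mapComp f g).hom =
      (D.map₂ (𝟙 _) ≫ (D.mapComp f g).hom) ▷ 𝟙 _ ≫ (α_ _ _ _).hom ≫ D.map f ◁ ((ρ_ _).hom ≫ (λ_ _).inv) ≫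
        (α_ _ _ _).inv ≫ ((ρ_ _).hom ≫ (λ_ _).inv) ▷ D.map g ≫ (α_ _ _ _).hom
    simp

/-- The canonical identification of the two bracketings of a composite. -/
def assocTrans {A : Type u₁} [Bicategory.{w₁, v₁} A] {B : Type u₂} [Bicategory.{w₂, v₂} B]
    {C : Type u₃} [Bicategory.{w₃, v₃} C] {E : Type u₄} [Bicategory.{w₄, v₄} E]
    (F : A ⥤ᵖ B) (G : B ⥤ᵖ C) (H : C ⥤ᵖ E) : (F.comp G).comp H ⟶ F.comp (G.comp H) where
  app a := 𝟙 _
  naturality f := ρ_ _ ≪≫ (λ_ _).symm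
  naturality_naturality {a b f g} η := by
    change H.map₂ (G.map₂ (F.map₂ η)) ▷ 𝟙 _ ≫ ((ρ_ _).hom ≫ (λ_ _).inv) = ((ρ_ _).hom ≫ (λ_ _).inv) ≫ 𝟙 _ ◁ H.map₂ (G.map₂ (F.map₂ η))
    simp
  naturality_id a := by
    change ((ρ_ _).hom ≫ (λ_ _).inv) ≫ 𝟙 _ ◁ (H.map₂ (G.map₂ (F.mapId a).hom) ≫ (H.map₂ (G.mapId _).hom ≫ (H.mapId _).hom)) = (H.map₂ (G.map₂ (F.mapId a).hom ≫ (G.mapId _).hom) ≫ (H.mapId _).hom) ▷ 𝟙 _ ≫ (λ_ _).hom ≫ (ρ_ _).inv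
    simp
  naturality_comp f g := by
    change ((ρ_ _).hom ≫ (λ_ _).inv) ≫ 𝟙 _ ◁ (H.map₂ (G.map₂ (F.mapComp f g).hom) ≫ (H.map₂ (G.mapComp _ _).hom ≫ (H.mapComp _ _).hom)) =
      (H.map₂ (G.map₂ (F.mapComp f g).hom ≫ (G.mapComp _ _).hom) ≫ (H.mapComp _ _).hom) ▷ 𝟙 _ ≫ (α_ _ _ _).hom ≫ H.map (G.map (F.map f)) ◁ ((ρ_ _).hom ≫ (λ_ _).inv) ≫
        (α_ _ _ _).inv ≫ ((ρ_ _).hom ≫ (λ_ _).inv) ▷ H.map (G.map (F.map g)) ≫ (α_ _ _ _).hom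
    simp

/-- The same with the roles of the two bracketings exchanged. -/
def assocTrans' {A : Type u₁} [Bicategory.{w₁, v₁} A] {B : Type u₂} [Bicategory.{w₂, v₂} B]
    {C : Type u₃} [Bicategory.{w₃, v₃} C] {E : Type u₄} [Bicategory.{w₄, v₄} E]
    (F : A ⥤ᵖ B) (G : B ⥤ᵖ C) (H : C ⥤ᵖ E) : F.comp (G.comp H) ⟶ (F.comp G).comp H where
  app a := 𝟙 _
  naturality f := ρ_ _ ≪≫ (λ_ _).symm
  naturality_naturality {a b f g} η := by
    change H.map₂ (G.map₂ (F.map₂ η)) ▷ 𝟙 _ ≫ ((ρ_ _).hom ≫ (λ_ _).inv) = ((ρ_ _).hom ≫ (λ_ _).inv) ≫ 𝟙 _ ◁ H.map₂ (G.map₂ (F.map₂ η))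
    simp
  naturality_id a := by
    change ((ρ_ _).hom ≫ (λ_ _).inv) ≫ 𝟙 _ ◁ (H.map₂ (G.map₂ (F.mapId a).hom ≫ (G.mapId _).hom) ≫ (H.mapId _).hom) = (H.map₂ (G.map₂ (F.mapId a).hom) ≫ (H.map₂ (G.mapId _).hom ≫ (H.mapId _).hom)) ▷ 𝟙 _ ≫ (λ_ _).hom ≫ (ρ_ _).inv
    simp
  naturality_comp f g := by
    change ((ρ_ _).hom ≫ (λ_ _).inv) ≫ 𝟙 _ ◁ (H.map₂ (G.map₂ (F.mapComp f g).hom ≫ (G.mapComp _ _).hom) ≫ (H.mapComp _ _).hom) =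
      (H.map₂ (G.map₂ (F.mapComp f g).hom) ≫ (H.map₂ (G.mapComp _ _).hom ≫ (H.mapComp _ _).hom)) ▷ 𝟙 _ ≫ (α_ _ _ _).hom ≫ H.map (G.map (F.map f)) ◁ ((ρ_ _).hom ≫ (λ_ _).inv) ≫
        (α_ _ _ _).inv ≫ ((ρ_ _).hom ≫ (λ_ _).inv) ▷ H.map (G.map (F.map g)) ≫ (α_ _ _ _).hom
    simp


theorem map_comp_id_eq {C D : Type*} [Category* C] [Category* D] (F : C ⥤ D) {X Y : C} (f : X ⟶ Y) :
    F.map f ≫ 𝟙 _ = 𝟙 _ ≫ F.map f := (Category.comp_id _).trans (Category.id_comp _).symm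

/-- The transformation with components `u × id`. -/
def prodIdxMap {A B : Type} [SmallCategory A] [SmallCategory B] (u : A ⥤ B) :
    prodIdx B ⟶ prodIdx A where
  app K := (u.prod (𝟭 K.unop)).toCatHom.op
  naturality f := Iso.op2_unop (Cat.Hom.isoMk (NatIso.ofComponents (fun _ => Iso.refl _)
    (map_comp_id_eq (u.prod f.unop.toFunctor))))
  naturality_naturality η := by
    refine congrArg op2 (Cat.Hom₂.ext (NatTrans.ext (funext fun x => Prod.ext ?_ ?_)))
    · change 𝟙 _ ≫ 𝟙 _ = 𝟙 _ ≫ CategoryTheory.Functor.map u (𝟙 _)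
      simp
    · exact (Category.comp_id _).trans (Category.id_comp _).symm
  naturality_id a := by
    refine congrArg op2 (Cat.Hom₂.ext (NatTrans.ext (funext fun x => Prod.ext ?_ ?_)))
    · change 𝟙 _ ≫ CategoryTheory.Functor.map u (𝟙 _) = 𝟙 _ ≫ 𝟙 _ ≫ 𝟙 _
      simp
    · change 𝟙 _ ≫ 𝟙 _ = 𝟙 _ ≫ 𝟙 _ ≫ 𝟙 _
      simp
  naturality_comp f g := by
    refine congrArg op2 (Cat.Hom₂.ext (NatTrans.ext (funext fun x => Prod.ext ?_ ?_)))
    · change 𝟙 _ ≫ CategoryTheory.Functor.map u (𝟙 _) =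
        𝟙 _ ≫ 𝟙 _ ≫ 𝟙 _ ≫ 𝟙 _ ≫ 𝟙 _ ≫ 𝟙 _
      simp
    · change 𝟙 _ ≫ 𝟙 _ = 𝟙 _ ≫ 𝟙 _ ≫ CategoryTheory.Functor.map f.unop.toFunctor (𝟙 _) ≫ 𝟙 _ ≫ 𝟙 _ ≫ 𝟙 _
      simp

/-- The transformation with components `k ↦ (b, k)`. -/
def prodIdxPt {B : Type} [SmallCategory B] (b : B) :
    prodIdx B ⟶ Pseudofunctor.id Cat.{0, 0}ᵒᵖ where
  app K := (CategoryTheory.Prod.sectR b K.unop).toCatHom.op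
  naturality f := Iso.op2_unop (Cat.Hom.isoMk (NatIso.ofComponents (fun _ => Iso.refl _)
    (map_comp_id_eq (f.unop.toFunctor ⋙ CategoryTheory.Prod.sectR b _))))
  naturality_naturality η := by
    refine congrArg op2 (Cat.Hom₂.ext (NatTrans.ext (funext fun x => Prod.ext ?_ ?_)))
    · change 𝟙 _ ≫ 𝟙 _ = 𝟙 _ ≫ 𝟙 _
      simp
    · exact (Category.comp_id _).trans (Category.id_comp _).symm
  naturality_id a := by
    refine congrArg op2 (Cat.Hom₂.ext (NatTrans.ext (funext fun x => Prod.ext ?_ ?_)))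
    · change 𝟙 b ≫ 𝟙 b = 𝟙 b ≫ 𝟙 b ≫ 𝟙 b
      simp
    · change 𝟙 _ ≫ 𝟙 _ = 𝟙 _ ≫ 𝟙 _ ≫ 𝟙 _
      simp
  naturality_comp f g := by
    refine congrArg op2 (Cat.Hom₂.ext (NatTrans.ext (funext fun x => Prod.ext ?_ ?_)))
    · change 𝟙 b ≫ 𝟙 b = 𝟙 b ≫ 𝟙 b ≫ 𝟙 b ≫ 𝟙 b ≫ 𝟙 b ≫ 𝟙 b
      simp
    · change 𝟙 _ ≫ 𝟙 _ = 𝟙 _ ≫ 𝟙 _ ≫ CategoryTheory.Functor.map f.unop.toFunctor (𝟙 _) ≫ 𝟙 _ ≫ 𝟙 _ ≫ 𝟙 _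
      simp

/-- The category `[1] = (0 → 1)`. -/
abbrev Arr := Fin 2

/-- The square `□ = [1] × [1]`, as a poset; `(1, 0)` is one step in the first direction. -/
def Sq : Type := Fin 2 × Fin 2

instance : PartialOrder Sq := inferInstanceAs (PartialOrder (Fin 2 × Fin 2))

instance : DecidableEq Sq := inferInstanceAs (DecidableEq (Fin 2 × Fin 2))

instance : DecidableLE Sq := inferInstanceAs (DecidableLE (Fin 2 × Fin 2))

instance : Fintype Sq := inferInstanceAs (Fintype (Fin 2 × Fin 2))

/-- The functor between posets given by a monotone map. -/
def mono {A B : Type} [Preorder A] [Preorder B] (f : A → B) (hf : ∀ a b, a ≤ b → f a ≤ f b) :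
    A ⥤ B :=
  Monotone.functor (f := f) hf

/-- The vertex `(a, b)` of the square. -/
def Sq.mk (a b : Arr) : Sq := (a, b)

/-- `(s, (t, k)) ↦ ((p s t), k)` for a monotone pairing `p`. -/
def pairFun (p : Arr → Arr → Sq) (hp : ∀ {s s' t t' : Arr}, s ≤ s' → t ≤ t' → p s t ≤ p s' t')
    (K : Type) [SmallCategory K] : Arr × (Arr × K) ⥤ Sq × K where
  obj x := (p x.1 x.2.1, x.2.2)
  map f := (homOfLE (hp (leOfHom f.1) (leOfHom f.2.1)), f.2.2)
  map_id _ := rfl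
  map_comp _ _ := rfl

/-- The transformation with components `(s, (t, k)) ↦ (p s t, k)`. -/
def pairIdx (p : Arr → Arr → Sq) (hp : ∀ {s s' t t' : Arr}, s ≤ s' → t ≤ t' → p s t ≤ p s' t') :
    prodIdx Sq ⟶ (prodIdx Arr).comp (prodIdx Arr) where
  app K := (pairFun p hp K.unop).toCatHom.op
  naturality f := Iso.op2_unop (Cat.Hom.isoMk (NatIso.ofComponents (fun _ => Iso.refl _)
    (map_comp_id_eq (pairFun p hp _ ⋙ (𝟭 Sq).prod f.unop.toFunctor))))
  naturality_naturality η := by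
    refine congrArg op2 (Cat.Hom₂.ext (NatTrans.ext (funext fun x => Prod.ext rfl ?_)))
    exact (Category.comp_id _).trans (Category.id_comp _).symm
  naturality_id a := by
    refine congrArg op2 (Cat.Hom₂.ext (NatTrans.ext (funext fun x => Prod.ext rfl ?_)))
    change 𝟙 _ ≫ (𝟙 _ ≫ 𝟙 _) = 𝟙 _ ≫ 𝟙 _ ≫ 𝟙 _
    simp
  naturality_comp f g := by
    refine congrArg op2 (Cat.Hom₂.ext (NatTrans.ext (funext fun x => Prod.ext rfl ?_)))
    change 𝟙 _ ≫ (𝟙 _ ≫ 𝟙 _) = 𝟙 _ ≫ 𝟙 _ ≫ CategoryTheory.Functor.map f.unop.toFunctor (𝟙 _) ≫ 𝟙 _ ≫ 𝟙 _ ≫ 𝟙 _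
    simp

/-- `(s, k) ↦ (q₁ s, (q₂ s, k))`  -/
def unpairFun (q : Sq → Arr × Arr) (hq : ∀ {s s' : Sq}, s ≤ s' → q s ≤ q s')
    (K : Type) [SmallCategory K] : Sq × K ⥤ Arr × (Arr × K) where
  obj x := ((q x.1).1, ((q x.1).2, x.2))
  map f := (homOfLE (hq (leOfHom f.1)).1, (homOfLE (hq (leOfHom f.1)).2, f.2))
  map_id _ := rfl
  map_comp _ _ := rfl

/-- The transformation with components `(s, k) ↦ ((q s).1, ((q s).2, k))`. -/
def unpairIdx (q : Sq → Arr × Arr) (hq : ∀ {s s' : Sq}, s ≤ s' → q s ≤ q s') :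
    (prodIdx Arr).comp (prodIdx Arr) ⟶ prodIdx Sq where
  app K := (unpairFun q hq K.unop).toCatHom.op
  naturality f := Iso.op2_unop (Cat.Hom.isoMk (NatIso.ofComponents (fun _ => Iso.refl _)
    (map_comp_id_eq (unpairFun q hq _ ⋙ (𝟭 Arr).prod ((𝟭 Arr).prod f.unop.toFunctor)))))
  naturality_naturality η := by
    refine congrArg op2 (Cat.Hom₂.ext (NatTrans.ext (funext fun x =>
      Prod.ext rfl (Prod.ext rfl ?_))))
    exact (Category.comp_id _).trans (Category.id_comp _).symm
  naturality_id a := by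
    refine congrArg op2 (Cat.Hom₂.ext (NatTrans.ext (funext fun x =>
      Prod.ext rfl (Prod.ext rfl ?_))))
    change 𝟙 _ ≫ 𝟙 _ = (𝟙 _ ≫ 𝟙 _) ≫ 𝟙 _ ≫ 𝟙 _
    simp
  naturality_comp f g := by
    refine congrArg op2 (Cat.Hom₂.ext (NatTrans.ext (funext fun x =>
      Prod.ext rfl (Prod.ext rfl ?_))))
    change 𝟙 _ ≫ 𝟙 _ = (𝟙 _ ≫ 𝟙 _) ≫ 𝟙 _ ≫ CategoryTheory.Functor.map f.unop.toFunctor (𝟙 _) ≫ 𝟙 _ ≫ 𝟙 _ ≫ 𝟙 _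
    simp

/-- A prederivator: a 2-functor from small categories to categories, contravariant on functors and
covariant on natural transformations. -/
abbrev Prederivator : Type _ := Cat.{0, 0}ᵒᵖ ⥤ᵖ Cat.{v, u}

namespace Prederivator

variable (D E F G : Prederivator.{v, u})

/-- The functor `u^*`. -/
def res {A B : Type} [SmallCategory A] [SmallCategory B] (u : A ⥤ B) :
    D.obj (op (Cat.of B)) ⥤ D.obj (op (Cat.of A)) :=
  (D.map u.toCatHom.op).toFunctor

/-- The transformation `α^*`. -/
def resTrans {A B : Type} [SmallCategory A] [SmallCategory B] {u v : A ⥤ B} (α : u ⟶ v) :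
    D.res u ⟶ D.res v :=
  (D.map₂ (op2 α.toCatHom₂)).toNatTrans

/-- `(w u)^* ≅ u^* w^*`. -/
def resComp {A B C : Type} [SmallCategory A] [SmallCategory B] [SmallCategory C]
    (u : A ⥤ B) (w : B ⥤ C) : D.res (u ⋙ w) ≅ D.res w ⋙ D.res u :=
  Cat.Hom.toNatIso (D.mapComp w.toCatHom.op u.toCatHom.op)

/-- The product of two prederivators. -/
def prod : Prederivator.{v, u} where
  obj K := Cat.of (D.obj K × E.obj K)
  map f := ((D.map f).toFunctor.prod (E.map f).toFunctor).toCatHom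
  map₂ η := (NatTrans.prod (D.map₂ η).toNatTrans (E.map₂ η).toNatTrans).toCatHom₂
  mapId K := Cat.Hom.isoMk (NatIso.ofComponents
    (fun X => ((Cat.Hom.toNatIso (D.mapId K)).app X.1).prod ((Cat.Hom.toNatIso (E.mapId K)).app X.2))
    (fun f => Prod.ext ((Cat.Hom.toNatIso (D.mapId K)).hom.naturality f.1)
      ((Cat.Hom.toNatIso (E.mapId K)).hom.naturality f.2)))
  mapComp f g := Cat.Hom.isoMk (NatIso.ofComponents
    (fun X => ((Cat.Hom.toNatIso (D.mapComp f g)).app X.1).prod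
      ((Cat.Hom.toNatIso (E.mapComp f g)).app X.2))
    (fun h => Prod.ext ((Cat.Hom.toNatIso (D.mapComp f g)).hom.naturality h.1)
      ((Cat.Hom.toNatIso (E.mapComp f g)).hom.naturality h.2)))
  map₂_id f := Cat.Hom₂.ext (NatTrans.ext (funext fun X => Prod.ext
    (congrArg (fun t => t.toNatTrans.app X.1) (D.map₂_id f))
    (congrArg (fun t => t.toNatTrans.app X.2) (E.map₂_id f))))
  map₂_comp η θ := Cat.Hom₂.ext (NatTrans.ext (funext fun X => Prod.ext
    (congrArg (fun t => t.toNatTrans.app X.1) (D.map₂_comp η θ))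
    (congrArg (fun t => t.toNatTrans.app X.2) (E.map₂_comp η θ))))
  map₂_whisker_left f _ _ η := Cat.Hom₂.ext (NatTrans.ext (funext fun X => Prod.ext
    (congrArg (fun t => t.toNatTrans.app X.1) (D.map₂_whisker_left f η))
    (congrArg (fun t => t.toNatTrans.app X.2) (E.map₂_whisker_left f η))))
  map₂_whisker_right η h := Cat.Hom₂.ext (NatTrans.ext (funext fun X => Prod.ext
    (congrArg (fun t => t.toNatTrans.app X.1) (D.map₂_whisker_right η h))
    (congrArg (fun t => t.toNatTrans.app X.2) (E.map₂_whisker_right η h))))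
  map₂_associator f g h := Cat.Hom₂.ext (NatTrans.ext (funext fun X => Prod.ext
    (congrArg (fun t => t.toNatTrans.app X.1) (D.map₂_associator f g h))
    (congrArg (fun t => t.toNatTrans.app X.2) (E.map₂_associator f g h))))
  map₂_left_unitor f := Cat.Hom₂.ext (NatTrans.ext (funext fun X => Prod.ext
    (congrArg (fun t => t.toNatTrans.app X.1) (D.map₂_left_unitor f))
    (congrArg (fun t => t.toNatTrans.app X.2) (E.map₂_left_unitor f))))
  map₂_right_unitor f := Cat.Hom₂.ext (NatTrans.ext (funext fun X => Prod.ext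
    (congrArg (fun t => t.toNatTrans.app X.1) (D.map₂_right_unitor f))
    (congrArg (fun t => t.toNatTrans.app X.2) (E.map₂_right_unitor f))))

variable {D E F G} in
/-- The product of two morphisms. -/
def prodMap (φ : D ⟶ F) (ψ : E ⟶ G) : D.prod E ⟶ F.prod G where
  app K := ((φ.app K).toFunctor.prod (ψ.app K).toFunctor).toCatHom
  naturality f := Cat.Hom.isoMk (NatIso.ofComponents
    (fun X => ((Cat.Hom.toNatIso (φ.naturality f)).app X.1).prod
      ((Cat.Hom.toNatIso (ψ.naturality f)).app X.2))
    (fun h => Prod.ext ((Cat.Hom.toNatIso (φ.naturality f)).hom.naturality h.1)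
      ((Cat.Hom.toNatIso (ψ.naturality f)).hom.naturality h.2)))
  naturality_naturality η := Cat.Hom₂.ext (NatTrans.ext (funext fun X => Prod.ext
    (congrArg (fun t => t.toNatTrans.app X.1) (φ.naturality_naturality η))
    (congrArg (fun t => t.toNatTrans.app X.2) (ψ.naturality_naturality η))))
  naturality_id K := Cat.Hom₂.ext (NatTrans.ext (funext fun X => Prod.ext
    (congrArg (fun t => t.toNatTrans.app X.1) (φ.naturality_id K))
    (congrArg (fun t => t.toNatTrans.app X.2) (ψ.naturality_id K))))
  naturality_comp f g := Cat.Hom₂.ext (NatTrans.ext (funext fun X => Prod.ext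
    (congrArg (fun t => t.toNatTrans.app X.1) (φ.naturality_comp f g))
    (congrArg (fun t => t.toNatTrans.app X.2) (ψ.naturality_comp f g))))

variable {E F} in
/-- A morphism of prederivators, restricted to full subprederivators. -/
def liftSub (P : E.ObjectProperty) (Q : F.ObjectProperty) [P.IsClosedUnderMapObj]
    [Q.IsClosedUnderMapObj] (θ : E ⟶ F)
    (h : ∀ K X, P.prop K X → Q.prop K ((θ.app K).toFunctor.obj X)) :
    P.fullsubcategory ⟶ Q.fullsubcategory where
  app K := ((Q.prop K).lift ((P.prop K).ι ⋙ (θ.app K).toFunctor) (fun X => h K X.1 X.2)).toCatHom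
  naturality {K L} f := Cat.Hom.isoMk (((Q.prop L).fullyFaithfulι.whiskeringRight _).preimageIso
    (Functor.isoWhiskerLeft (P.prop K).ι (Cat.Hom.toNatIso (θ.naturality f))))
  naturality_naturality η := Cat.Hom₂.ext (NatTrans.ext (funext fun X =>
    InducedCategory.hom_ext (congrArg (fun t => t.toNatTrans.app X.1) (θ.naturality_naturality η))))
  naturality_id K := Cat.Hom₂.ext (NatTrans.ext (funext fun X =>
    InducedCategory.hom_ext (congrArg (fun t => t.toNatTrans.app X.1) (θ.naturality_id K))))
  naturality_comp f g := Cat.Hom₂.ext (NatTrans.ext (funext fun X =>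
    InducedCategory.hom_ext (congrArg (fun t => t.toNatTrans.app X.1) (θ.naturality_comp f g))))

variable {E} in
/-- The inclusion of a full subprederivator. -/
def subι (P : E.ObjectProperty) [P.IsClosedUnderMapObj] : P.fullsubcategory ⟶ E := P.ι
/-- A monoidal structure on a prederivator: a pseudomonoid structure, spelled out as monoidal
structures on all values such that restriction functors are strong monoidal, compatibly with
the 2-functoriality. -/
class MonoidalStr (D : Prederivator.{v, u}) where
  [mon : ∀ K, MonoidalCategory (D.obj K)]
  [strong : ∀ {K L} (f : K ⟶ L), (D.map f).toFunctor.Monoidal]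
  map₂ : ∀ {K L} {f g : K ⟶ L} (η : f ⟶ g), NatTrans.IsMonoidal (D.map₂ η).toNatTrans
  mapId : ∀ K, NatTrans.IsMonoidal
    (F₁ := (D.map (𝟙 K)).toFunctor) (F₂ := 𝟭 (D.obj K)) (D.mapId K).hom.toNatTrans
  mapComp : ∀ {K L M} (f : K ⟶ L) (g : L ⟶ M), NatTrans.IsMonoidal
    (F₁ := (D.map (f ≫ g)).toFunctor) (F₂ := (D.map f).toFunctor ⋙ (D.map g).toFunctor)
    (D.mapComp f g).hom.toNatTrans

attribute [instance] MonoidalStr.mon MonoidalStr.strong MonoidalStr.map₂ MonoidalStr.mapId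
  MonoidalStr.mapComp

/-- The induced (pointwise) structure on shifted prederivators. -/
instance MonoidalStr.reindex (D : Prederivator.{v, u}) [D.MonoidalStr]
    (Φ : Cat.{0, 0}ᵒᵖ ⥤ᵖ Cat.{0, 0}ᵒᵖ) : MonoidalStr (Φ.comp D) where
  mon K := mon (D := D) (Φ.obj K)
  strong f := strong (D := D) (Φ.map f)
  map₂ η := map₂ (D := D) (Φ.map₂ η)
  mapId K := NatTrans.IsMonoidal.comp (F₁ := (D.map (Φ.map (𝟙 K))).toFunctor)
    (F₂ := (D.map (𝟙 (Φ.obj K))).toFunctor) (F₃ := 𝟭 (D.obj (Φ.obj K)))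
    (D.map₂ (Φ.mapId K).hom).toNatTrans (D.mapId _).hom.toNatTrans
  mapComp f g := NatTrans.IsMonoidal.comp (F₁ := (D.map (Φ.map (f ≫ g))).toFunctor)
    (F₂ := (D.map (Φ.map f ≫ Φ.map g)).toFunctor)
    (F₃ := (D.map (Φ.map f)).toFunctor ⋙ (D.map (Φ.map g)).toFunctor)
    (D.map₂ (Φ.mapComp f g).hom).toNatTrans (D.mapComp _ _).hom.toNatTrans

open MonoidalCategory in
/-- The tensor product as a morphism `D × D ⟶ D`. -/
def tensor (D : Prederivator.{v, u}) [D.MonoidalStr] : D.prod D ⟶ D where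
  app K := (MonoidalCategory.tensor (D.obj K)).toCatHom
  naturality {K L} f :=
    Cat.Hom.isoMk (NatIso.ofComponents
      (fun X => Functor.Monoidal.μIso (D.map f).toFunctor X.1 X.2)
      (fun g => Functor.LaxMonoidal.μ_natural _ g.1 g.2))
  naturality_naturality {K L f g} η := by
    refine Cat.Hom₂.ext (NatTrans.ext (funext fun X => ?_))
    exact ((MonoidalStr.map₂ (D := D) η).tensor X.1 X.2).symm
  naturality_id K := by
    refine Cat.Hom₂.ext (NatTrans.ext (funext fun X => ?_))
    refine Eq.trans ((MonoidalStr.mapId (D := D) K).tensor X.1 X.2) ?_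
    change (_ ⊗ₘ _) ≫ 𝟙 _ = (_ ⊗ₘ _) ≫ 𝟙 _ ≫ 𝟙 _
    rw [Category.id_comp]
    rfl
  naturality_comp {K L N} f g := by
    refine Cat.Hom₂.ext (NatTrans.ext (funext fun X => ?_))
    refine Eq.trans ((MonoidalStr.mapComp (D := D) f g).tensor X.1 X.2) ?_
    change (_ ⊗ₘ _) ≫ (_ ≫ _) = (_ ⊗ₘ _) ≫ 𝟙 _ ≫ _ ≫ 𝟙 _ ≫ _ ≫ 𝟙 _
    simp only [Category.id_comp, Category.comp_id]
    rfl

/-! ### Derivators -/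


/-- `u^* ≅ v^*` for isomorphic functors `u` and `v`. -/
def resIso {A B : Type} [SmallCategory A] [SmallCategory B] {u v : A ⥤ B} (α : u ≅ v) :
    D.res u ≅ D.res v :=
  Cat.Hom.toNatIso (D.map₂Iso (Cat.Hom.isoMk α).op2)

/-- The category `D(A)`. -/
abbrev val (A : Type) [SmallCategory A] := D.obj (op (Cat.of A))

/-- The terminal category. -/
abbrev One : Type := Discrete PUnit.{1}

/-- Evaluation `a^* : D(A) ⥤ D(𝟙)`. -/
def evalAt {A : Type} [SmallCategory A] (a : A) : D.val A ⥤ D.val One :=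
  D.res (Functor.fromPUnit.{0} a)

/-- The canonical transformation `u p ⟶ b π` on `u/b`. -/
def toPt {A B : Type} [SmallCategory A] [SmallCategory B] (u : A ⥤ B) (b : B) :
    CostructuredArrow.proj u b ⋙ u ⟶
      (Functor.const (CostructuredArrow u b)).obj (⟨PUnit.unit⟩ : One) ⋙
        Functor.fromPUnit.{0} b where
  app f := f.hom
  naturality _ _ φ := (CostructuredArrow.w φ).trans (Category.comp_id _).symm

/-- The canonical transformation `b π ⟶ u q` on `b/u`. -/
def fromPt {A B : Type} [SmallCategory A] [SmallCategory B] (u : A ⥤ B) (b : B) :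
    (Functor.const (StructuredArrow b u)).obj (⟨PUnit.unit⟩ : One) ⋙ Functor.fromPUnit.{0} b ⟶
      StructuredArrow.proj b u ⋙ u where
  app f := f.hom
  naturality _ _ φ := (Category.id_comp _).trans (StructuredArrow.w φ).symm

/-- For the comma category `u/b`, the transformation `p^* u^* ⟶ π^* b^*` induced by `u p ⟶ b π`. -/
def overSquare {A B : Type} [SmallCategory A] [SmallCategory B] (u : A ⥤ B) (b : B) :
    TwoSquare (D.res u) (D.evalAt b) (D.res (CostructuredArrow.proj u b))
      (D.res ((Functor.const (CostructuredArrow u b)).obj (⟨PUnit.unit⟩ : One))) :=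
  .mk _ _ _ _ <| (D.resComp (CostructuredArrow.proj u b) u).inv ≫
    D.resTrans (toPt u b) ≫
    (D.resComp ((Functor.const (CostructuredArrow u b)).obj (⟨PUnit.unit⟩ : One))
      (Functor.fromPUnit.{0} b)).hom

/-- For the comma category `b/u`, the transformation `π^* b^* ⟶ q^* u^*` induced by `b π ⟶ u q`. -/
def underSquare {A B : Type} [SmallCategory A] [SmallCategory B] (u : A ⥤ B) (b : B) :
    TwoSquare (D.evalAt b) (D.res u)
      (D.res ((Functor.const (StructuredArrow b u)).obj (⟨PUnit.unit⟩ : One)))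
      (D.res (StructuredArrow.proj b u)) :=
  .mk _ _ _ _ <| (D.resComp ((Functor.const (StructuredArrow b u)).obj (⟨PUnit.unit⟩ : One))
      (Functor.fromPUnit.{0} b)).inv ≫
    D.resTrans (fromPt u b) ≫
    (D.resComp (StructuredArrow.proj b u) u).hom

/-- The axioms of a derivator. -/
structure IsDerivator : Prop where
  /-- Coproducts are sent to products. -/
  der1 : ∀ (ι : Type) (A : ι → Type) [∀ i, SmallCategory (A i)],
    (Functor.pi' fun i => D.res (CategoryTheory.Sigma.incl (C := A) i)).IsEquivalence
  /-- Isomorphisms are detected pointwise. -/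
  der2 : ∀ (A : Type) [SmallCategory A] {X Y : D.val A} (f : X ⟶ Y),
    (∀ a : A, IsIso ((D.evalAt a).map f)) → IsIso f
  /-- Existence of left Kan extensions. -/
  der3_left : ∀ {A B : Type} [SmallCategory A] [SmallCategory B] (u : A ⥤ B),
    (D.res u).IsRightAdjoint
  /-- Existence of right Kan extensions. -/
  der3_right : ∀ {A B : Type} [SmallCategory A] [SmallCategory B] (u : A ⥤ B),
    (D.res u).IsLeftAdjoint
  /-- Pointwise formula for left Kan extensions: the mate `π_! p^* ⟶ b^* u_!` is invertible. -/
  der4_left : ∀ {A B : Type} [SmallCategory A] [SmallCategory B] (u : A ⥤ B) (b : B)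
    (l : D.val A ⥤ D.val B) (adj : l ⊣ D.res u)
    (c : D.val (CostructuredArrow u b) ⥤ D.val One)
    (adj' : c ⊣ D.res ((Functor.const (CostructuredArrow u b)).obj (⟨PUnit.unit⟩ : One))),
    IsIso ((mateEquiv adj adj').symm (D.overSquare u b)).natTrans
  /-- Pointwise formula for right Kan extensions: the mate `b^* u_* ⟶ π_* q^*` is invertible. -/
  der4_right : ∀ {A B : Type} [SmallCategory A] [SmallCategory B] (u : A ⥤ B) (b : B)
    (r : D.val A ⥤ D.val B) (adj : D.res u ⊣ r)
    (c : D.val (StructuredArrow b u) ⥤ D.val One)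
    (adj' : D.res ((Functor.const (StructuredArrow b u)).obj (⟨PUnit.unit⟩ : One)) ⊣ c),
    IsIso (mateEquiv adj adj' (D.underSquare u b)).natTrans

/-- The poset `⌜`, the square without its final vertex. -/
abbrev Span : Type := {s : Sq // s ≠ Sq.mk 1 1}

/-- The poset `⌟`, the square without its initial vertex. -/
abbrev Cospan : Type := {s : Sq // s ≠ Sq.mk 0 0}

/-- The inclusion of `⌜` in the square. -/
def spanIncl : Span ⥤ Sq := mono (fun s => s.1) (fun _ _ h => h)

/-- The inclusion of `⌟` in the square. -/
def cospanIncl : Cospan ⥤ Sq := mono (fun s => s.1) (fun _ _ h => h)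

/-- A coherent square is cocartesian if it is in the essential image of left Kan extension
along `⌜ ⊂ □`. -/
def IsCocartesian (Q : D.val Sq) : Prop :=
  ∃ (l : D.val Span ⥤ D.val Sq) (_ : l ⊣ D.res spanIncl), l.essImage Q

/-- A coherent square is cartesian if it is in the essential image of right Kan extension
along `⌟ ⊂ □`. -/
def IsCartesian (Q : D.val Sq) : Prop :=
  ∃ (r : D.val Cospan ⥤ D.val Sq) (_ : D.res cospanIncl ⊣ r), r.essImage Q

/-- Bicartesian coherent squares. -/
def IsBicartesian (Q : D.val Sq) : Prop := D.IsCocartesian Q ∧ D.IsCartesian Q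

/-- Stable derivators: pointed derivators in which the cartesian and the cocartesian squares
coincide. -/
structure IsStable : Prop extends D.IsDerivator where
  pointed : Limits.HasZeroObject (D.val One)
  stable : ∀ Q : D.val Sq, D.IsCocartesian Q ↔ D.IsCartesian Q

/-! ### Shifted prederivators and Kan extensions between them -/

/-- The shifted prederivator `D^B`, `D^B(K) = D(B × K)`. -/
abbrev shift (B : Type) [SmallCategory B] : Prederivator.{v, u} := (prodIdx B).comp D

/-- The restriction morphism `u^* : D^B ⟶ D^A`. -/
def restr {A B : Type} [SmallCategory A] [SmallCategory B] (u : A ⥤ B) :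
    D.shift B ⟶ D.shift A :=
  whisk (prodIdxMap u) D

/-- The evaluation morphism `b^* : D^B ⟶ D`. -/
def ev {B : Type} [SmallCategory B] (b : B) : D.shift B ⟶ D :=
  whisk (prodIdxPt b) D ≫ unitTrans D

/-- Restriction and evaluation morphisms have left and right adjoints in the 2-category of
prederivators. -/
structure HasKan : Prop where
  left : ∀ {A B : Type} [SmallCategory A] [SmallCategory B] (u : A ⥤ B),
    Bicategory.IsRightAdjoint (D.restr u)
  right : ∀ {A B : Type} [SmallCategory A] [SmallCategory B] (u : A ⥤ B),
    Bicategory.IsLeftAdjoint (D.restr u)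
  left_pt : ∀ {B : Type} [SmallCategory B] (b : B), Bicategory.IsRightAdjoint (D.ev b)
  right_pt : ∀ {B : Type} [SmallCategory B] (b : B), Bicategory.IsLeftAdjoint (D.ev b)

section Kan

variable {D} (h : D.HasKan) {A B : Type} [SmallCategory A] [SmallCategory B]

/-- Left Kan extension `u_! : D^A ⟶ D^B`. -/
def lan (u : A ⥤ B) : D.shift A ⟶ D.shift B :=
  haveI := h.left u; Bicategory.leftAdjoint (D.restr u)

/-- Right Kan extension `u_* : D^A ⟶ D^B`. -/
def ran (u : A ⥤ B) : D.shift A ⟶ D.shift B :=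
  haveI := h.right u; Bicategory.rightAdjoint (D.restr u)

/-- Left Kan extension `b_! : D ⟶ D^B` along `b : 𝟙 ⥤ B`. -/
def lanPt (b : B) : D ⟶ D.shift B :=
  haveI := h.left_pt b; Bicategory.leftAdjoint (D.ev b)

/-- Right Kan extension `b_* : D ⟶ D^B` along `b : 𝟙 ⥤ B`. -/
def ranPt (b : B) : D ⟶ D.shift B :=
  haveI := h.right_pt b; Bicategory.rightAdjoint (D.ev b)

/-- Suspension: extend `X` by zero to the span `0 ← X → 0`, form the cocartesian square and
evaluate at its final vertex. -/
def susp : D ⟶ D :=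
  ranPt h (⟨Sq.mk 0 0, by decide⟩ : Span) ≫ lan h spanIncl ≫ D.ev (Sq.mk 1 1)

/-- Loop: extend `X` by zero to the cospan `0 → X ← 0`, form the cartesian square and
evaluate at its initial vertex. -/
def loop : D ⟶ D :=
  lanPt h (⟨Sq.mk 1 1, by decide⟩ : Cospan) ≫ ran h cospanIncl ≫ D.ev (Sq.mk 0 0)

/-- The arrow `00 → 10` of the span. -/
def arrSpan : Arr ⥤ Span :=
  mono (fun t => ⟨Sq.mk t 0, by revert t; decide⟩) (by decide)

/-- The arrow `10 → 11` of the cospan. -/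
def arrCospan : Arr ⥤ Cospan :=
  mono (fun t => ⟨Sq.mk 1 t, by revert t; decide⟩) (by decide)

/-- The arrow `10 → 11` of the square. -/
def arrFinal : Arr ⥤ Sq := mono (fun t => Sq.mk 1 t) (by decide)

/-- The arrow `00 → 10` of the square. -/
def arrInitial : Arr ⥤ Sq := mono (fun t => Sq.mk t 0) (by decide)

/-- The cofiber morphism: `x → y` is sent to the arrow `y → z` in the cocartesian square with
vertices `x`, `y`, `0`, `z` at `00`, `10`, `01`, `11`. -/
def cof : D.shift Arr ⟶ D.shift Arr :=
  ran h arrSpan ≫ lan h spanIncl ≫ D.restr arrFinal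

/-- The fiber morphism: `x → y` is sent to the arrow `w → x` in the cartesian square with
vertices `w`, `x`, `0`, `y` at `00`, `10`, `01`, `11`. -/
def fib : D.shift Arr ⟶ D.shift Arr :=
  lan h arrCospan ≫ ran h cospanIncl ≫ D.restr arrInitial

end Kan

variable {D}

/-! ### The poset `C` of reinforced cubes and `D^{C,ex}` -/

/-- The inclusion of subposets. -/
def incl {n : ℕ} {S T : Set (Fin n → ℤ)} (h : S ⊆ T) : ↥S ⥤ ↥T :=
  mono (Set.inclusion h) (fun _ _ h => h)

/-- The string of cubes `C₀ ⊂ ℤ³`. -/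
def cubes : Set (Fin 3 → ℤ) := {c | ∃ n : ℤ, ∀ i, n ≤ c i ∧ c i ≤ n + 1}

/-- The points of `ℤ³` which reinforce the links between the cubes. -/
def links : Set (Fin 3 → ℤ) :=
  {c | ∃ n : ℤ, c = ![n, n + 2, n + 1] ∨ c = ![n + 2, n + 1, n] ∨ c = ![n + 1, n, n + 2]}

/-- The poset `C ⊂ ℤ³`. -/
def C : Set (Fin 3 → ℤ) := cubes ∪ links

/-- The small squares in `C`: the squares in `C` whose sides are unit steps in two different
coordinate directions. -/
def IsSmallSquare (k : Sq ⥤ ↥C) : Prop :=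
  ∃ (x : Fin 3 → ℤ) (i j : Fin 3), i ≠ j ∧
    ∀ s : Sq, (k.obj s).1 = x + Pi.single i ((s.1 : ℕ) : ℤ) + Pi.single j ((s.2 : ℕ) : ℤ)

/-- `(n₁, n₂, n₃) ↦ (n₃, n₁, n₂)`. -/
def rotFun (c : Fin 3 → ℤ) : Fin 3 → ℤ := ![c 2, c 0, c 1]

/-- `(n₁, n₂, n₃) ↦ (n₁ + 1, n₂ + 1, n₃ + 1)`. -/
def shFun (c : Fin 3 → ℤ) : Fin 3 → ℤ := fun i => c i + 1

theorem rotFun_apply (c : Fin 3 → ℤ) (l : Fin 3) : rotFun c l = c (l + 2) := by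
  fin_cases l <;> rfl

theorem rot_links {c : Fin 3 → ℤ} (h : c ∈ links) : rotFun c ∈ links := by
  obtain ⟨n, rfl | rfl | rfl⟩ := h
  · exact ⟨n, Or.inr (Or.inr rfl)⟩
  · exact ⟨n, Or.inl rfl⟩
  · exact ⟨n, Or.inr (Or.inl rfl)⟩

theorem sh_links {c : Fin 3 → ℤ} (h : c ∈ links) : shFun c ∈ links := by
  obtain ⟨n, h⟩ := h
  refine ⟨n + 1, h.imp ?_ (Or.imp ?_ ?_)⟩ <;>
  · rintro rfl
    funext i
    fin_cases i <;> (simp [shFun]; try ring)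

theorem rot_mem {c : Fin 3 → ℤ} (h : c ∈ C) : rotFun c ∈ C := by
  rcases h with ⟨n, h⟩ | h
  · refine Or.inl ⟨n, fun i => ?_⟩
    fin_cases i
    exacts [h 2, h 0, h 1]
  · exact Or.inr (rot_links h)

theorem sh_mem {c : Fin 3 → ℤ} (h : c ∈ C) : shFun c ∈ C := by
  rcases h with ⟨n, h⟩ | h
  · exact Or.inl ⟨n + 1, fun i => ⟨by simpa [shFun] using (h i).1, by simpa [shFun] using (h i).2⟩⟩
  · exact Or.inr (sh_links h)

/-- The rotation `r : C ⥤ C`. -/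
def rot : ↥C ⥤ ↥C :=
  mono (fun c => ⟨rotFun c.1, rot_mem c.2⟩) (fun _ _ h i => by
    fin_cases i
    exacts [h 2, h 0, h 1])

/-- The shift `sh : C ⥤ C`. -/
def sh : ↥C ⥤ ↥C :=
  mono (fun c => ⟨shFun c.1, sh_mem c.2⟩) (fun _ _ h i => by simpa [shFun] using h i)

theorem IsSmallSquare.rot {k : Sq ⥤ ↥C} (hk : IsSmallSquare k) : IsSmallSquare (k ⋙ rot) := by
  obtain ⟨x, i, j, hij, h⟩ := hk
  refine ⟨rotFun x, i + 1, j + 1, by simpa using hij, fun s => ?_⟩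
  change rotFun (k.obj s).1 = _
  rw [h s]
  funext l
  have h₁ : ∀ i l : Fin 3, l + 2 = i ↔ l = i + 1 := by decide
  simp only [rotFun_apply, Pi.add_apply, Pi.single_apply, h₁]

theorem IsSmallSquare.sh {k : Sq ⥤ ↥C} (hk : IsSmallSquare k) : IsSmallSquare (k ⋙ sh) := by
  obtain ⟨x, i, j, hij, h⟩ := hk
  refine ⟨shFun x, i, j, hij, fun s => ?_⟩
  change shFun (k.obj s).1 = _
  rw [h s]
  funext l
  simp only [shFun, Pi.add_apply]
  ring

theorem IsCocartesian.of_iso {P Q : D.val Sq} (e : P ≅ Q) (h : D.IsCocartesian P) :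
    D.IsCocartesian Q := by
  obtain ⟨l, adj, hl⟩ := h
  exact ⟨l, adj, hl.ofIso e⟩

theorem IsCartesian.of_iso {P Q : D.val Sq} (e : P ≅ Q) (h : D.IsCartesian P) :
    D.IsCartesian Q := by
  obtain ⟨l, adj, hl⟩ := h
  exact ⟨l, adj, hl.ofIso e⟩

theorem IsBicartesian.of_iso {P Q : D.val Sq} (e : P ≅ Q) (h : D.IsBicartesian P) :
    D.IsBicartesian Q :=
  ⟨h.1.of_iso e, h.2.of_iso e⟩

/-- The functor `s ↦ (k s, a)`. -/
def atPt {S A B : Type} [SmallCategory S] [SmallCategory A] [SmallCategory B] (k : S ⥤ B) (a : A) :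
    S ⥤ B × A :=
  k.prod' ((Functor.const S).obj a)

variable (D) in
/-- The coherent diagrams in `D^C` in which all small squares are bicartesian and all objects
outside of `C₀` are zero. -/
noncomputable def exProp : (D.shift ↥C).ObjectProperty where
  prop A := fun Y : D.val (↥C × A.unop) =>
    (∀ (k : Sq ⥤ ↥C), IsSmallSquare k → ∀ a : A.unop, D.IsBicartesian ((D.res (atPt k a)).obj Y)) ∧
    ∀ (c : ↥C), c.1 ∈ links → ∀ a : A.unop, Limits.IsZero ((D.evalAt (c, a)).obj Y)

instance : (exProp D).IsClosedUnderMapObj where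
  map_obj {A A' Y} hY f := by
    refine ⟨fun k hk a => ?_, fun c hc a => ?_⟩
    · refine IsBicartesian.of_iso ?_ (hY.1 k hk (f.unop.toFunctor.obj a))
      refine (D.resIso (v := atPt k a ⋙ (𝟭 ↥C).prod f.unop.toFunctor) ?_ ≪≫ D.resComp _ _).app Y
      exact NatIso.ofComponents (fun _ => Iso.refl _) (fun g => Prod.ext (by simp [atPt]) (by simp [atPt]))
    · refine (hY.2 c hc (f.unop.toFunctor.obj a)).of_iso ?_
      refine (D.resIso (v := Functor.fromPUnit.{0} (c, a) ⋙ (𝟭 ↥C).prod f.unop.toFunctor) ?_ ≪≫ D.resComp _ _).symm.app Y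
      exact NatIso.ofComponents (fun _ => Iso.refl _) (fun g => Prod.ext (by simp) (by simp))

theorem exProp_restr (g : ↥C ⥤ ↥C) (hg : ∀ k, IsSmallSquare k → IsSmallSquare (k ⋙ g))
    (hl : ∀ c : ↥C, c.1 ∈ links → (g.obj c).1 ∈ links) (A) (Y : (D.shift ↥C).obj A)
    (hY : (exProp D).prop A Y) : (exProp D).prop A (((D.restr g).app A).toFunctor.obj Y) := by
  refine ⟨fun k hk a => ?_, fun c hc a => ?_⟩
  · refine IsBicartesian.of_iso ?_ (hY.1 (k ⋙ g) (hg k hk) a)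
    refine (D.resIso (v := atPt k a ⋙ g.prod (𝟭 A.unop)) ?_ ≪≫ D.resComp _ _).app Y
    exact NatIso.ofComponents (fun _ => Iso.refl _) (fun g => Prod.ext (by simp [atPt]) (by simp [atPt]))
  · refine (hY.2 (g.obj c) (hl c hc) a).of_iso ?_
    refine (D.resIso (v := Functor.fromPUnit.{0} (c, a) ⋙ g.prod (𝟭 A.unop)) ?_ ≪≫ D.resComp _ _).symm.app Y
    exact NatIso.ofComponents (fun _ => Iso.refl _) (fun g => Prod.ext (by simp) (by simp))

variable (D) in
/-- The full subprederivator `D^{C,ex}` of `D^C`. -/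
abbrev cex : Prederivator.{v, u} := (exProp D).fullsubcategory

variable (D) in
/-- Restriction `k^* : D^{C,ex} ⟶ D^A` along `k : A ⥤ C`. -/
def cexRestr {A : Type} [SmallCategory A] (k : A ⥤ ↥C) : cex D ⟶ D.shift A :=
  subι (exProp D) ≫ D.restr k

variable (D) in
/-- Evaluation at an object of `C`. -/
def cexEv (c : ↥C) : cex D ⟶ D := subι (exProp D) ≫ D.ev c

variable (D) in
/-- `r^* : D^{C,ex} ⟶ D^{C,ex}`. -/
def rotRes : cex D ⟶ cex D :=
  liftSub _ _ (D.restr rot) (exProp_restr rot (fun _ h => h.rot) (fun _ h => rot_links h))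

variable (D) in
/-- `sh^* : D^{C,ex} ⟶ D^{C,ex}`. -/
def shRes : cex D ⟶ cex D :=
  liftSub _ _ (D.restr sh) (exProp_restr sh (fun _ h => h.sh) (fun _ h => sh_links h))

/-- The poset `[1]³_{≤1}`. -/
def V : Set (Fin 3 → ℤ) := {![0, 0, 0], ![1, 0, 0], ![0, 1, 0], ![0, 0, 1]}

theorem V_sub : V ⊆ C := by
  rintro _ (rfl | rfl | rfl | rfl) <;>
  · refine Or.inl ⟨0, fun i => ?_⟩
    fin_cases i <;> simp

/-- The inclusion `i : [1]³_{≤1} ⥤ C`. -/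
def iV : ↥V ⥤ ↥C := incl V_sub

/-- The values of `j : □ ⥤ C`. -/
def jFun (s : Sq) : Fin 3 → ℤ :=
  if s = Sq.mk 0 0 then ![0, 1, 0] else if s = Sq.mk 0 1 then ![0, 1, 1] else
    if s = Sq.mk 1 0 then ![1, 1, 0] else ![1, 1, 2]

theorem jFun_mem (s : Sq) : jFun s ∈ C := by
  obtain ⟨a, b⟩ := s
  refine Or.inl ⟨if a = 1 ∧ b = 1 then 1 else 0, fun i => ?_⟩
  revert a b i
  decide

/-- The functor `j : □ ⥤ C` given by `00 ↦ 010`, `01 ↦ 011`, `10 ↦ 110`, `11 ↦ 112`. -/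
def jSq : Sq ⥤ ↥C := mono (fun s => ⟨jFun s, jFun_mem s⟩) (by
  intro a b h
  change ∀ i, jFun a i ≤ jFun b i
  revert a b
  decide)

/-! ### Equivalences -/

/-- Equivalences of prederivators. -/
def IsEquiv {E F : Prederivator.{v, u}} (f : E ⟶ F) : Prop :=
  ∃ g : F ⟶ E, Nonempty (f ≫ g ≅ 𝟙 E) ∧ Nonempty (g ≫ f ≅ 𝟙 F)

/-- The inverse of an equivalence (unique up to isomorphism). -/
def IsEquiv.inv {E F : Prederivator.{v, u}} {f : E ⟶ F} (h : IsEquiv f) : F ⟶ E :=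
  h.choose

/-! ### The endomorphism `T` -/

/-- The vertices of the hypercube `[1]⁴`. -/
def hyper : Set (Fin 4 → ℤ) := {e | ∀ i, e i = 0 ∨ e i = 1}

/-- The object `(-∞, 0)` is realized by the point `(-1, -1, -1, 0)`. -/
def E₁ : Set (Fin 4 → ℤ) :=
  {![-1, -1, -1, 0], ![1, 1, 0, 0], ![0, 1, 1, 0], ![1, 0, 1, 0], ![1, 1, 1, 0]}

/-- The upper cube is added. -/
def E₂ : Set (Fin 4 → ℤ) := E₁ ∪ {e | e ∈ hyper ∧ e 3 = 0}

/-- The object `(-∞, 1)`, realized by the point `(-1, -1, -1, 1)`, is added. -/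
def E₃ : Set (Fin 4 → ℤ) := E₂ ∪ {![-1, -1, -1, 1]}

/-- The lower cube is added. -/
def E₄ : Set (Fin 4 → ℤ) := E₃ ∪ {e | e ∈ hyper ∧ e 3 = 1}

/-- Three of the remaining objects are added. -/
def E₅ : Set (Fin 4 → ℤ) := E₄ ∪ {![0, 2, 1, 1], ![2, 1, 0, 1], ![1, 0, 2, 1]}

/-- The poset `E`. -/
def E₆ : Set (Fin 4 → ℤ) := E₅ ∪ {![2, 1, 1, 1], ![1, 2, 1, 1], ![1, 1, 2, 1]}

/-- The values of `v₁`: `000 ↦ (-∞, 0)`, `100 ↦ 1100`, `010 ↦ 0110`, `001 ↦ 1010`. -/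
def v₁Fun (c : Fin 3 → ℤ) : Fin 4 → ℤ :=
  if c = ![0, 0, 0] then ![-1, -1, -1, 0] else if c = ![1, 0, 0] then ![1, 1, 0, 0] else
    if c = ![0, 1, 0] then ![0, 1, 1, 0] else ![1, 0, 1, 0]

theorem v₁Fun_mem {c : Fin 3 → ℤ} (h : c ∈ V) : v₁Fun c ∈ E₁ := by
  rcases h with rfl | rfl | rfl | rfl <;> simp [v₁Fun, E₁]

theorem v₁Fun_mono {c d : Fin 3 → ℤ} (hc : c ∈ V) (hd : d ∈ V) (h : c ≤ d) :
    v₁Fun c ≤ v₁Fun d := by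
  change ∀ i, c i ≤ d i at h
  change ∀ i, v₁Fun c i ≤ v₁Fun d i
  rcases hc with rfl | rfl | rfl | rfl <;> rcases hd with rfl | rfl | rfl | rfl <;>
    revert h <;> decide

/-- The embedding `v₁ : [1]³_{≤1} ⥤ E₁`. -/
def v₁ : ↥V ⥤ ↥E₁ :=
  mono (fun c => ⟨v₁Fun c.1, v₁Fun_mem c.2⟩) (fun a b h => v₁Fun_mono a.2 b.2 h)

theorem w_mem {c : Fin 3 → ℤ} (h : c ∈ V) : ![c 0, c 1, c 2, 1] ∈ E₆ := by
  refine Or.inl (Or.inl (Or.inr ⟨fun i => ?_, rfl⟩))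
  rcases h with rfl | rfl | rfl | rfl <;> fin_cases i <;> simp

/-- The embedding `w : [1]³_{≤1} ⥤ E`, `(n₁, n₂, n₃) ↦ (n₁, n₂, n₃, 1)`. -/
def wE : ↥V ⥤ ↥E₆ :=
  mono (fun c => ⟨![c.1 0, c.1 1, c.1 2, 1], w_mem c.2⟩) (fun a b h i => by
    fin_cases i
    exacts [h 0, h 1, h 2, le_refl _])

section Kan

variable (h : D.HasKan)

/-- The morphism `H : D^{[1]³_{≤1}} ⟶ D^E`, a composition of six Kan extensions. -/
def bigH : D.shift ↥V ⟶ D.shift ↥E₆ :=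
  ran h v₁ ≫ ran h (incl (T := E₂) Set.subset_union_left) ≫
    ran h (incl (T := E₃) Set.subset_union_left) ≫ lan h (incl (T := E₄) Set.subset_union_left) ≫
      ran h (incl (T := E₅) Set.subset_union_left) ≫ lan h (incl (T := E₆) Set.subset_union_left)

/-- `T' = w^* H`. -/
def bigT' : D.shift ↥V ⟶ D.shift ↥V := bigH h ≫ D.restr wE

/-- `T = F T' i^*`, where `F` is the inverse of `i^*`. -/
def bigT (hi : IsEquiv (cexRestr D iV)) : cex D ⟶ cex D :=
  cexRestr D iV ≫ bigT' h ≫ hi.inv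

variable (D) in
/-- The Serre functor `S = r^* sh^*`. -/
def serre : cex D ⟶ cex D := shRes D ≫ rotRes D

end Kan

/-- The Auslander--Reiten translation `τ = r^* T⁻¹`. -/
def arTau {h : D.HasKan} {hi : IsEquiv (cexRestr D iV)} (hT : IsEquiv (bigT h hi)) :
    cex D ⟶ cex D :=
  hT.inv ≫ rotRes D

/-! ### The two cofiber morphisms on squares -/

section Cof

variable (D) in
/-- `D^□ ⟶ (D^[1])^[1]`, induced by `(s, (t, k)) ↦ (p s t, k)`; the variable `t` belongs to the
outer exponent. -/
def curry (p : Arr → Arr → Sq) (hp : ∀ {s s' t t' : Arr}, s ≤ s' → t ≤ t' → p s t ≤ p s' t') :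
    D.shift Sq ⟶ (D.shift Arr).shift Arr :=
  whisk (pairIdx p hp) D ≫ assocTrans _ _ D

variable (D) in
/-- `(D^[1])^[1] ⟶ D^□`, induced by `(x, k) ↦ ((q x).1, ((q x).2, k))`. -/
def uncurry (q : Sq → Arr × Arr) (hq : ∀ {s s' : Sq}, s ≤ s' → q s ≤ q s') :
    (D.shift Arr).shift Arr ⟶ D.shift Sq :=
  assocTrans' _ _ D ≫ whisk (unpairIdx q hq) D

variable (h : (D.shift Arr).HasKan)

/-- Cofibers in the first direction: `cof` of `D^[1]`, where the arrow is the first coordinate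
of the square. -/
def cof₁ : D.shift Sq ⟶ D.shift Sq :=
  curry D (fun s t => Sq.mk t s) (fun hs ht => ⟨ht, hs⟩) ≫ cof h ≫
    uncurry D (fun x => (x.2, x.1)) (fun hx => ⟨hx.2, hx.1⟩)

/-- Cofibers in the second direction. -/
def cof₂ : D.shift Sq ⟶ D.shift Sq :=
  curry D (fun s t => Sq.mk s t) (fun hs ht => ⟨hs, ht⟩) ≫ cof h ≫
    uncurry D (fun x => (x.1, x.2)) (fun hx => ⟨hx.1, hx.2⟩)

end Cof

/-! ### Monoidal derivators -/

section Monoidal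

open MonoidalCategory

variable {A A' B B' : Type} [SmallCategory A] [SmallCategory A'] [SmallCategory B]
  [SmallCategory B']

variable (D) in
/-- `(u pr₁)^* ≅ (u × w)^* pr₁^*`. -/
def fstIso (u : A ⥤ A') (w : B ⥤ B') :
    D.res (CategoryTheory.Prod.fst A B ⋙ u) ≅
      D.res (CategoryTheory.Prod.fst A' B') ⋙ D.res (u.prod w) :=
  D.resIso (NatIso.ofComponents (fun _ => Iso.refl _)) ≪≫
    D.resComp (u.prod w) (CategoryTheory.Prod.fst A' B')

variable (D) in
/-- `(w pr₂)^* ≅ (u × w)^* pr₂^*`. -/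
def sndIso (u : A ⥤ A') (w : B ⥤ B') :
    D.res (CategoryTheory.Prod.snd A B ⋙ w) ≅
      D.res (CategoryTheory.Prod.snd A' B') ⋙ D.res (u.prod w) :=
  D.resIso (NatIso.ofComponents (fun _ => Iso.refl _)) ≪≫
    D.resComp (u.prod w) (CategoryTheory.Prod.snd A' B')

variable (D) [D.MonoidalStr]

instance (u : A ⥤ A') : (D.res u).Monoidal :=
  inferInstanceAs (D.map u.toCatHom.op).toFunctor.Monoidal

/-- The functor `X ↦ X ⊠ Y = pr₁^* X ⊗ pr₂^* Y`. -/
def extRight (A : Type) [SmallCategory A] {B : Type} [SmallCategory B] (Y : D.val B) :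
    D.val A ⥤ D.val (A × B) :=
  D.res (CategoryTheory.Prod.fst A B) ⋙ tensorRight ((D.res (CategoryTheory.Prod.snd A B)).obj Y)

/-- The functor `Y ↦ X ⊠ Y = pr₁^* X ⊗ pr₂^* Y`. -/
def extLeft {A : Type} [SmallCategory A] (B : Type) [SmallCategory B] (X : D.val A) :
    D.val B ⥤ D.val (A × B) :=
  D.res (CategoryTheory.Prod.snd A B) ⋙ tensorLeft ((D.res (CategoryTheory.Prod.fst A B)).obj X)

section

variable {X M N : Type*} [Category* X] [Category* M] [MonoidalCategory M] [Category* N]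
  [MonoidalCategory N] {P : X ⥤ M} {Q : X ⥤ N} {K : N ⥤ M} [K.Monoidal]

/-- `P x ⊗ a ⟶ K (Q x) ⊗ K b ⟶ K (Q x ⊗ b)`. -/
def whiskerTensorRight (α : P ⟶ Q ⋙ K) {a : M} {b : N} (e : a ⟶ K.obj b) :
    P ⋙ tensorRight a ⟶ (Q ⋙ tensorRight b) ⋙ K where
  app x := (α.app x ⊗ₘ e) ≫ Functor.LaxMonoidal.μ K (Q.obj x) b
  naturality x y f := by
    have h : P.map f ≫ α.app y = α.app x ≫ K.map (Q.map f) := α.naturality f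
    change (P.map f ▷ a) ≫ (α.app y ⊗ₘ e) ≫ Functor.LaxMonoidal.μ K (Q.obj y) b =
      ((α.app x ⊗ₘ e) ≫ Functor.LaxMonoidal.μ K (Q.obj x) b) ≫ K.map (Q.map f ▷ b)
    rw [Category.assoc, ← Functor.LaxMonoidal.μ_natural_left, ← tensorHom_id, ← tensorHom_id,
      tensorHom_comp_tensorHom_assoc, tensorHom_comp_tensorHom_assoc, h, Category.id_comp,
      Category.comp_id]

/-- `a ⊗ P x ⟶ K b ⊗ K (Q x) ⟶ K (b ⊗ Q x)`. -/
def whiskerTensorLeft (α : P ⟶ Q ⋙ K) {a : M} {b : N} (e : a ⟶ K.obj b) :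
    P ⋙ tensorLeft a ⟶ (Q ⋙ tensorLeft b) ⋙ K where
  app x := (e ⊗ₘ α.app x) ≫ Functor.LaxMonoidal.μ K b (Q.obj x)
  naturality x y f := by
    have h : P.map f ≫ α.app y = α.app x ≫ K.map (Q.map f) := α.naturality f
    change (a ◁ P.map f) ≫ (e ⊗ₘ α.app y) ≫ Functor.LaxMonoidal.μ K b (Q.obj y) =
      ((e ⊗ₘ α.app x) ≫ Functor.LaxMonoidal.μ K b (Q.obj x)) ≫ K.map (b ◁ Q.map f)
    rw [Category.assoc, ← Functor.LaxMonoidal.μ_natural_right, ← id_tensorHom, ← id_tensorHom,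
      tensorHom_comp_tensorHom_assoc, tensorHom_comp_tensorHom_assoc, h, Category.id_comp,
      Category.comp_id]

end

/-- The canonical isomorphism `u^* Z ⊠ Y ≅ (u × id)^* (Z ⊠ Y)`. -/
def extRightSquare (u : A ⥤ A') (Y : D.val B) :
    TwoSquare (D.res u) (D.extRight A' Y) (D.extRight A Y) (D.res (u.prod (𝟭 B))) :=
  .mk _ _ _ _ <|
    whiskerTensorRight ((D.resComp (CategoryTheory.Prod.fst A B) u).symm ≪≫ D.fstIso u (𝟭 B)).hom
      ((D.resIso (Functor.rightUnitor (CategoryTheory.Prod.snd A B)).symm ≪≫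
        D.sndIso u (𝟭 B)).hom.app Y)

/-- The canonical isomorphism `X ⊠ w^* Z ≅ (id × w)^* (X ⊠ Z)`. -/
def extLeftSquare (w : B ⥤ B') (X : D.val A) :
    TwoSquare (D.res w) (D.extLeft B' X) (D.extLeft B X) (D.res ((𝟭 A).prod w)) :=
  .mk _ _ _ _ <|
    whiskerTensorLeft ((D.resComp (CategoryTheory.Prod.snd A B) w).symm ≪≫ D.sndIso (𝟭 A) w).hom
      ((D.resIso (Functor.rightUnitor (CategoryTheory.Prod.fst A B)).symm ≪≫
        D.fstIso (𝟭 A) w).hom.app X)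

/-- The tensor product preserves left Kan extensions in each variable separately: the canonical
maps `(u × id)_! (X ⊠ Y) ⟶ u_! X ⊠ Y` and `(id × w)_! (X ⊠ Y) ⟶ X ⊠ w_! Y` are invertible. -/
structure TensorCocontinuous : Prop where
  left : ∀ {A A' B : Type} [SmallCategory A] [SmallCategory A'] [SmallCategory B] (u : A ⥤ A')
    (Y : D.val B) (l : D.val A ⥤ D.val A') (adj : l ⊣ D.res u)
    (l' : D.val (A × B) ⥤ D.val (A' × B)) (adj' : l' ⊣ D.res (u.prod (𝟭 B))),
    IsIso ((mateEquiv adj adj').symm (D.extRightSquare u Y)).natTrans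
  right : ∀ {A B B' : Type} [SmallCategory A] [SmallCategory B] [SmallCategory B'] (w : B ⥤ B')
    (X : D.val A) (l : D.val B ⥤ D.val B') (adj : l ⊣ D.res w)
    (l' : D.val (A × B) ⥤ D.val (A × B')) (adj' : l' ⊣ D.res ((𝟭 A).prod w)),
    IsIso ((mateEquiv adj adj').symm (D.extLeftSquare w X)).natTrans

/-- The first projection `□ ⥤ [1]`. -/
def sqFst : Sq ⥤ Arr := mono (fun s => s.1) (fun _ _ h => h.1)

/-- The second projection `□ ⥤ [1]`. -/
def sqSnd : Sq ⥤ Arr := mono (fun s => s.2) (fun _ _ h => h.2)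

/-- The external tensor product `D^[1] × D^[1] ⟶ D^□`, `(X, Y) ↦ pr₁^* X ⊗ pr₂^* Y`. -/
def extTensor : (D.shift Arr).prod (D.shift Arr) ⟶ D.shift Sq :=
  prodMap (D.restr sqFst) (D.restr sqSnd) ≫ (D.shift Sq).tensor

end Monoidal

/-! ### The diagrams (TC3) and (TC3') -/

section TC

variable [D.MonoidalStr] (h : D.HasKan)

variable (D) in
/-- `(x → y) ↦ x`. -/
def arrX : D.shift Arr ⟶ D := D.ev (0 : Arr)

variable (D) in
/-- `(x → y) ↦ y`. -/
def arrY : D.shift Arr ⟶ D := D.ev (1 : Arr)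

/-- `(x → y) ↦ z`, where `x → y → z` is the cofiber sequence of `x → y`. -/
def arrZ : D.shift Arr ⟶ D := cof h ≫ D.ev (1 : Arr)

/-- `(X, X') ↦ p X ⊗ q X'`. -/
def tens (p q : D.shift Arr ⟶ D) : (D.shift Arr).prod (D.shift Arr) ⟶ D :=
  prodMap p q ≫ D.tensor

/-- The diagram `M (X, X')` has the value `p (X, X')` at `c`, naturally in `X` and `X'`. -/
def HasValue (M : (D.shift Arr).prod (D.shift Arr) ⟶ cex D) (c : Fin 3 → ℤ)
    (p : (D.shift Arr).prod (D.shift Arr) ⟶ D) : Prop :=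
  ∃ hc : c ∈ C, Nonempty (M ≫ cexEv D ⟨c, hc⟩ ≅ p)

/-- The diagram `M (X, X')`, for `X = (x → y)` and `X' = (x' → y')` with cofibers `z` and `z'`,
is objectwise the extended (TC3) diagram. The objects are listed on a fundamental domain of the
translation by `(3, 3, 3)`, which acts by `Σ²`; `loop` is `Σ⁻¹`. -/
structure IsTC3 (M : (D.shift Arr).prod (D.shift Arr) ⟶ cex D)
    (u v w : (D.shift Arr).prod (D.shift Arr) ⟶ D) : Prop where
  at000 : HasValue M ![0, 0, 0] (w ≫ loop h)
  at100 : HasValue M ![1, 0, 0] (tens (arrY D) (arrZ h) ≫ loop h)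
  at010 : HasValue M ![0, 1, 0] (tens (arrX D) (arrX D))
  at001 : HasValue M ![0, 0, 1] (tens (arrZ h) (arrY D) ≫ loop h)
  at110 : HasValue M ![1, 1, 0] (tens (arrY D) (arrX D))
  at101 : HasValue M ![1, 0, 1] (tens (arrZ h) (arrZ h) ≫ loop h)
  at011 : HasValue M ![0, 1, 1] (tens (arrX D) (arrY D))
  at111 : HasValue M ![1, 1, 1] v
  at211 : HasValue M ![2, 1, 1] (tens (arrX D) (arrZ h))
  at121 : HasValue M ![1, 2, 1] (tens (arrZ h) (arrX D))
  at112 : HasValue M ![1, 1, 2] (tens (arrY D) (arrY D))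
  at221 : HasValue M ![2, 2, 1] (tens (arrX D) (arrX D) ≫ susp h)
  at212 : HasValue M ![2, 1, 2] (tens (arrY D) (arrZ h))
  at122 : HasValue M ![1, 2, 2] (tens (arrZ h) (arrY D))
  at222 : HasValue M ![2, 2, 2] (u ≫ susp h)
  at322 : HasValue M ![3, 2, 2] (tens (arrZ h) (arrZ h))
  at232 : HasValue M ![2, 3, 2] (tens (arrY D) (arrX D) ≫ susp h)
  at223 : HasValue M ![2, 2, 3] (tens (arrX D) (arrY D) ≫ susp h)
  at332 : HasValue M ![3, 3, 2] (tens (arrZ h) (arrX D) ≫ susp h)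
  at323 : HasValue M ![3, 2, 3] (tens (arrX D) (arrZ h) ≫ susp h)
  at233 : HasValue M ![2, 3, 3] (tens (arrY D) (arrY D) ≫ susp h)
  period : ∀ (p : Fin 3 → ℤ) (hp : p ∈ C),
    HasValue M (fun i => p i + 3) (M ≫ cexEv D ⟨p, hp⟩ ≫ susp h ≫ susp h)

/-- The diagram `M (X, X')` is objectwise the extended (TC3') diagram. -/
structure IsTC3' (M : (D.shift Arr).prod (D.shift Arr) ⟶ cex D)
    (u v w : (D.shift Arr).prod (D.shift Arr) ⟶ D) : Prop where
  at000 : HasValue M ![0, 0, 0] u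
  at100 : HasValue M ![1, 0, 0] (tens (arrX D) (arrY D))
  at010 : HasValue M ![0, 1, 0] (tens (arrZ h) (arrZ h) ≫ loop h)
  at001 : HasValue M ![0, 0, 1] (tens (arrY D) (arrX D))
  at110 : HasValue M ![1, 1, 0] (tens (arrX D) (arrZ h))
  at101 : HasValue M ![1, 0, 1] (tens (arrY D) (arrY D))
  at011 : HasValue M ![0, 1, 1] (tens (arrZ h) (arrX D))
  at111 : HasValue M ![1, 1, 1] w
  at211 : HasValue M ![2, 1, 1] (tens (arrZ h) (arrY D))
  at121 : HasValue M ![1, 2, 1] (tens (arrY D) (arrZ h))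
  at112 : HasValue M ![1, 1, 2] (tens (arrX D) (arrX D) ≫ susp h)
  at221 : HasValue M ![2, 2, 1] (tens (arrZ h) (arrZ h))
  at212 : HasValue M ![2, 1, 2] (tens (arrX D) (arrY D) ≫ susp h)
  at122 : HasValue M ![1, 2, 2] (tens (arrY D) (arrX D) ≫ susp h)
  at222 : HasValue M ![2, 2, 2] (v ≫ susp h)
  at322 : HasValue M ![3, 2, 2] (tens (arrY D) (arrY D) ≫ susp h)
  at232 : HasValue M ![2, 3, 2] (tens (arrX D) (arrZ h) ≫ susp h)
  at223 : HasValue M ![2, 2, 3] (tens (arrZ h) (arrX D) ≫ susp h)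
  at332 : HasValue M ![3, 3, 2] (tens (arrY D) (arrZ h) ≫ susp h)
  at323 : HasValue M ![3, 2, 3] (tens (arrZ h) (arrY D) ≫ susp h)
  at233 : HasValue M ![2, 3, 3] (tens (arrX D) (arrX D) ≫ susp h ≫ susp h)
  period : ∀ (p : Fin 3 → ℤ) (hp : p ∈ C),
    HasValue M (fun i => p i + 3) (M ≫ cexEv D ⟨p, hp⟩ ≫ susp h ≫ susp h)

end TC

end Prederivator

end

end Der

open Der Der.Prederivator

/-!
Everything happens in the category `Ho` of prederivators and isomorphism classes `cls` of morphisms,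
in which pseudonatural isomorphisms become equations and equivalences become isomorphisms.

*Kan extensions.* A square of functors is exact as soon as the categories of factorizations in it
have initial (`InitCrit`) or terminal (`TermCrit`) objects; this follows from (Der2) and (Der4) and
passes to shifted prederivators. Applied to naturality squares it shows that restriction and
evaluation morphisms have both adjoints (`IsKan.hasKan`).

*Exact diagrams.* For a shape `T` fix a set of squares which are to be bicartesian and a set of points
at which diagrams are to be zero. If a full inclusion `S ⊆ T` satisfies the combinatorial conditions
`LCrit`, then left Kan extension identifies the exact diagrams on `S` and `T`: squares whose span is a
meet and covers the points of `S` below its end become cocartesian (`IsKan.isCocartesian_res`), and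
conversely the new values are determined by cocartesian squares (`LCrit.lExt`). Dually for right Kan
extensions and `RCrit`, by stability. The resulting equivalences are recorded as `Good p ρ L`; for
finite posets the conditions are decidable.

This gives the equivalence `i^*` (`good_lC`): extend by zero to the nonnegative links, then to the
right by cocartesian squares, then to the left by cartesian squares. Exact diagrams on the unit cube
with `102` and `112` are determined by their restriction to `V` and also by that along `j`, whence
`j^*` is an equivalence (`good_lSq`). The six Kan extensions in `H` are of the same kind
(`good_bigH`), and so are the constructions of cofibers, fibers and suspensions; in particular,
cofibers may be computed by any natural bicartesian squares (`cls_cof_eq`).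

*Relations.* Write `J = j^*`. The diagrams `T Y` are known by definition on `V` only. A poset `Om` of
18 points which maps to `C` and to an enlargement of `E`, and whose exact diagrams are determined by
their restriction to `V`, identifies the square `J T Y` with the square of `Y` at `110, 112, 121, 122`
(`cls_bigT_jSq`). Composites of small squares of `C` show that this square is the cofiber of `J Y` in
the first direction, and that further cofibers and the suspension of `J Y` are also squares of `Y`.
As `J` is an equivalence, it follows that
`cof₁ J = J T`, `cof₂ J = J T r^*`, `T² = sh^*`, `T r^* = r^* T` and `Σ J = J T sh^*`.
In particular `T` is invertible, `τ⁻¹ = T (r^*)²`, and `(r^*)³ = 1` gives the first part.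

*Tensor products.* Since `⊗` preserves left Kan extensions in each variable, the product of a
cofiber square with an arrow consists of cofiber squares (`TensorCocontinuous.exAt_cube`), whence
`cof X ⊗ Y = cof₁ (X ⊗ Y)` and `X ⊗ cof Y = cof₂ (X ⊗ Y)`. The product of the two relations with `J`
is `T r^* T = r^* sh^* = 𝕊`; since `fib` is inverse to `cof`, the product of fibers corresponds to
`𝕊⁻¹`, and its suspension to `T sh^* 𝕊⁻¹ = τ⁻¹`.

*Tables.* The vertices of `X ⊗ Y` are the values of `G (X ⊗ Y)` at `010, 011, 110, 112`. Taking
cofibers in one variable amounts to applying `T` and rotations, which permute the points of `C₀`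
outside the diagonal along the orbit of `010` and its rotations (`Orbits`). The square
`010, 210, 021, 221` with zeros at the links shows that the value at `221` is the suspension of that
at `010`; conjugation with `T` and rotation gives the other suspensions (`Susps`). On the diagonal,
the composite of the squares of `E` from `(-∞, 0)` to `1111` shows that `T` followed by evaluation at
`111` is the suspension of the value at `000` (`cls_bigT_ev111`). With `T² = sh^*` this determines the
values at `(n, n, n)` of both diagrams in terms of three morphisms `u`, `v`, `w`, and the period.
-/


namespace Der.Prederivator

noncomputable section

/-! ### Morphisms of prederivators up to isomorphism -/

variable {D E F G : Prederivator.{v, u}}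

/-- A 2-cell between morphisms of prederivators is invertible if its components are. -/
theorem isIso_of_app {φ ψ : E ⟶ F} (m : φ ⟶ ψ)
    (h : ∀ K (X : E.obj K), IsIso ((m.as.app K).toNatTrans.app X)) : IsIso m := by
  let e : φ ≅ ψ := Pseudofunctor.StrongTrans.isoMk
    (fun K => Cat.Hom.isoMk
      (@asIso _ _ _ _ (m.as.app K).toNatTrans (@NatIso.isIso_of_isIso_app _ _ _ _ _ _ _ (h K))))
    (fun f => m.as.naturality f)
  exact (inferInstance : IsIso e.hom)

/-- The category of prederivators and isomorphism classes of morphisms. -/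
structure Ho where
  /-- The underlying prederivator. -/
  of : Prederivator.{v, u}

instance : Category Ho.{v, u} where
  Hom E F := Quotient (isIsomorphicSetoid (E.of ⟶ F.of))
  id E := Quotient.mk _ (𝟙 E.of)
  comp f g := Quotient.map₂ (fun φ ψ => φ ≫ ψ)
    (fun _ _ (h : Nonempty _) _ _ (h' : Nonempty _) =>
      h.elim fun e => h'.elim fun e' => ⟨whiskerRightIso e _ ≪≫ whiskerLeftIso _ e'⟩) f g
  id_comp f := Quotient.inductionOn f fun φ => Quotient.sound ⟨λ_ φ⟩
  comp_id f := Quotient.inductionOn f fun φ => Quotient.sound ⟨ρ_ φ⟩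
  assoc f g h := Quotient.inductionOn₃ f g h fun φ ψ χ => Quotient.sound ⟨α_ φ ψ χ⟩

def cls (φ : E ⟶ F) : Ho.mk E ⟶ Ho.mk F := Quotient.mk _ φ

theorem cls_eq_iff {φ ψ : E ⟶ F} : cls φ = cls ψ ↔ Nonempty (φ ≅ ψ) :=
  Quotient.eq (r := isIsomorphicSetoid (E ⟶ F))

theorem cls_eq {φ ψ : E ⟶ F} (e : φ ≅ ψ) : cls φ = cls ψ := cls_eq_iff.2 ⟨e⟩

theorem cls_comp (φ : E ⟶ F) (ψ : F ⟶ G) : cls (φ ≫ ψ) = cls φ ≫ cls ψ := rfl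

theorem cls_id (E : Prederivator.{v, u}) : cls (𝟙 E) = 𝟙 (Ho.mk E) := rfl

theorem cls_surj (f : Ho.mk E ⟶ Ho.mk F) : ∃ φ : E ⟶ F, cls φ = f :=
  Quotient.exists_rep f

/-- Equivalences of prederivators are the morphisms whose classes are invertible, so that all
equations between inverses can be handled in `Ho`. -/
theorem isEquiv_iff {φ : E ⟶ F} : IsEquiv φ ↔ IsIso (cls φ) := by
  constructor
  · rintro ⟨g, ⟨e⟩, ⟨e'⟩⟩
    exact ⟨cls g, cls_eq e, cls_eq e'⟩
  · rintro ⟨g, h, h'⟩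
    obtain ⟨g, rfl⟩ := cls_surj g
    exact ⟨g, cls_eq_iff.1 h, cls_eq_iff.1 h'⟩

theorem cls_inv {φ : E ⟶ F} (h : IsEquiv φ) [IsIso (cls φ)] :
    cls h.inv = CategoryTheory.inv (cls φ) := by
  obtain ⟨⟨e⟩, -⟩ := h.choose_spec
  rw [← cancel_epi (cls φ), IsIso.hom_inv_id]
  exact cls_eq e

/-! ### Adjunctions between morphisms of prederivators -/

abbrev fn (φ : E ⟶ F) (K : Cat.{0, 0}ᵒᵖ) : E.obj K ⥤ F.obj K := (φ.app K).toFunctor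

abbrev rs (E : Prederivator.{v, u}) {K L : Cat.{0, 0}ᵒᵖ} (f : K ⟶ L) : E.obj K ⥤ E.obj L :=
  (E.map f).toFunctor

def nt (φ : E ⟶ F) {K L} (f : K ⟶ L) : rs E f ⋙ fn φ L ≅ fn φ K ⋙ rs F f :=
  Cat.Hom.toNatIso (φ.naturality f)

def rsId (E : Prederivator.{v, u}) (K) : rs E (𝟙 K) ≅ 𝟭 (E.obj K) :=
  Cat.Hom.toNatIso (E.mapId K)

def rsComp (E : Prederivator.{v, u}) {K L M : Cat.{0, 0}ᵒᵖ} (f : K ⟶ L) (g : L ⟶ M) :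
    rs E (f ≫ g) ≅ rs E f ⋙ rs E g :=
  Cat.Hom.toNatIso (E.mapComp f g)

/-- The action of a prederivator on 2-cells. -/
def rs₂ (E : Prederivator.{v, u}) {K L : Cat.{0, 0}ᵒᵖ} {f g : K ⟶ L} (η : f ⟶ g) :
    rs E f ⟶ rs E g :=
  (E.map₂ η).toNatTrans

def md {φ ψ : E ⟶ F} (m : φ ⟶ ψ) (K) : fn φ K ⟶ fn ψ K := (m.as.app K).toNatTrans

theorem nt_comp_app (φ : E ⟶ F) (ψ : F ⟶ G) {K L} (f : K ⟶ L) (X : E.obj K) :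
    (nt (φ ≫ ψ) f).hom.app X = (fn ψ L).map ((nt φ f).hom.app X) ≫
      (nt ψ f).hom.app ((fn φ K).obj X) := by
  change 𝟙 _ ≫ _ ≫ 𝟙 _ ≫ _ ≫ 𝟙 _ = _
  rw [Category.id_comp, Category.id_comp]
  exact congrArg _ (Category.comp_id _)

theorem nt_id_app {K L} (f : K ⟶ L) (X : E.obj K) :
    (nt (𝟙 E) f).hom.app X = 𝟙 _ :=
  Category.comp_id (𝟙 _)

theorem hom_ext_app {φ ψ : E ⟶ F} {m n : φ ⟶ ψ}
    (h : ∀ K (X : E.obj K), (md m K).app X = (md n K).app X) : m = n := by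
  exact Pseudofunctor.StrongTrans.homCategory.ext fun K =>
    Cat.Hom₂.ext (NatTrans.ext (funext fun X => h K X))

def homMk {φ ψ : E ⟶ F} (m : ∀ K, fn φ K ⟶ fn ψ K)
    (h : ∀ {K L} (f : K ⟶ L) (X : E.obj K), (m L).app ((rs E f).obj X) ≫ (nt ψ f).hom.app X =
        (nt φ f).hom.app X ≫ (rs F f).map ((m K).app X)) :
    φ ⟶ ψ where
  as :=
    { app := fun K => (m K).toCatHom₂
      naturality := fun f => Cat.Hom₂.ext (NatTrans.ext (funext fun X => h f X)) }

def isoMk {φ ψ : E ⟶ F} (m : ∀ K, fn φ K ≅ fn ψ K)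
    (h : ∀ {K L} (f : K ⟶ L) (X : E.obj K), (m L).hom.app ((rs E f).obj X) ≫ (nt ψ f).hom.app X =
        (nt φ f).hom.app X ≫ (rs F f).map ((m K).hom.app X)) :
    φ ≅ ψ :=
  Pseudofunctor.StrongTrans.isoMk (fun K => Cat.Hom.isoMk (m K))
    (fun f => Cat.Hom₂.ext (NatTrans.ext (funext fun X => h f X)))

theorem md_naturality {φ ψ : E ⟶ F} (m : φ ⟶ ψ) {K L} (f : K ⟶ L) (X : E.obj K) :
    (md m L).app ((rs E f).obj X) ≫ (nt ψ f).hom.app X =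
      (nt φ f).hom.app X ≫ (rs F f).map ((md m K).app X) :=
  congrArg (fun t => t.toNatTrans.app X) (m.as.naturality f)

theorem nt_rs₂ (φ : E ⟶ F) {K L} {f g : K ⟶ L} (η : f ⟶ g) (X : E.obj K) :
    (fn φ L).map ((rs₂ E η).app X) ≫ (nt φ g).hom.app X =
      (nt φ f).hom.app X ≫ (rs₂ F η).app ((fn φ K).obj X) :=
  congrArg (fun t => t.toNatTrans.app X) (φ.naturality_naturality η)

theorem nt_rsId (φ : E ⟶ F) (K) (X : E.obj K) :
    (nt φ (𝟙 K)).hom.app X ≫ (rsId F K).hom.app ((fn φ K).obj X) =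
      (fn φ K).map ((rsId E K).hom.app X) := by
  refine (congrArg (fun t => t.toNatTrans.app X) (φ.naturality_id K)).trans ?_
  change _ ≫ 𝟙 _ ≫ 𝟙 _ = _
  rw [Category.comp_id]
  exact Category.comp_id _

theorem nt_rsComp (φ : E ⟶ F) {K L M} (f : K ⟶ L) (g : L ⟶ M) (X : E.obj K) :
    (nt φ (f ≫ g)).hom.app X ≫ (rsComp F f g).hom.app ((fn φ K).obj X) =
      (fn φ M).map ((rsComp E f g).hom.app X) ≫ (nt φ g).hom.app ((rs E f).obj X) ≫
          (rs F g).map ((nt φ f).hom.app X) := by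
  refine (congrArg (fun t => t.toNatTrans.app X) (φ.naturality_comp f g)).trans ?_
  change _ ≫ 𝟙 _ ≫ _ ≫ 𝟙 _ ≫ _ ≫ 𝟙 _ = _
  rw [Category.id_comp, Category.id_comp]
  exact congrArg (fun t => _ ≫ _ ≫ t) (Category.comp_id _)

theorem leftZigzag_eq {B : Type u₁} [Bicategory.{w₁, v₁} B] {a b : B} {f : a ⟶ b} {g : b ⟶ a}
    (η : 𝟙 a ⟶ f ≫ g) (θ : g ≫ f ⟶ 𝟙 b) :
    leftZigzag η θ = η ▷ f ≫ (α_ f g f).hom ≫ f ◁ θ := by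
  simp [leftZigzag, bicategoricalComp]

theorem rightZigzag_eq {B : Type u₁} [Bicategory.{w₁, v₁} B] {a b : B} {f : a ⟶ b} {g : b ⟶ a}
    (η : 𝟙 a ⟶ f ≫ g) (θ : g ≫ f ⟶ 𝟙 b) :
    rightZigzag η θ = g ◁ η ≫ (α_ g f g).inv ≫ θ ▷ g := by
  simp [rightZigzag, bicategoricalComp]

section LeftAdjoint

variable (φ : E ⟶ F) (L : ∀ K, F.obj K ⥤ E.obj K) (adj : ∀ K, L K ⊣ fn φ K)

/-- The mate of the naturality isomorphism of `φ` at `f`, for left adjoints of the components. -/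
def leftMate {K K'} (f : K ⟶ K') : rs F f ⋙ L K' ⟶ L K ⋙ rs E f where
  app Y := ((adj K').homEquiv _ _).symm
    ((rs F f).map ((adj K).unit.app Y) ≫ (nt φ f).inv.app ((L K).obj Y))
  naturality Y Z g := by
    have h := (nt φ f).inv.naturality ((L K).map g)
    have h' := (adj K).unit.naturality g
    apply ((adj K').homEquiv _ _).injective
    dsimp only [Functor.comp_map, Functor.comp_obj, Functor.id_obj, Functor.id_map] at h h' ⊢
    rw [Adjunction.homEquiv_naturality_left, Adjunction.homEquiv_naturality_right,
      Equiv.apply_symm_apply, Equiv.apply_symm_apply, Category.assoc, ← h,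
      ← Functor.map_comp_assoc, ← Functor.map_comp_assoc, h']

theorem unit_leftMate {K K'} (f : K ⟶ K') (Y : F.obj K) :
    (adj K').unit.app ((rs F f).obj Y) ≫ (fn φ K').map ((leftMate φ L adj f).app Y) =
      (rs F f).map ((adj K).unit.app Y) ≫ (nt φ f).inv.app ((L K).obj Y) := by
  exact ((adj K').homEquiv_unit ..).symm.trans (Equiv.apply_symm_apply _ _)

theorem unit_leftMate_nt {K K'} (f : K ⟶ K') (Y : F.obj K) :
    (adj K').unit.app ((rs F f).obj Y) ≫ (fn φ K').map ((leftMate φ L adj f).app Y) ≫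
      (nt φ f).hom.app ((L K).obj Y) = (rs F f).map ((adj K).unit.app Y) := by
  rw [reassoc_of% (unit_leftMate φ L adj)]
  simp

variable (h : ∀ {K K'} (f : K ⟶ K'), IsIso (leftMate φ L adj f))

/-- The left adjoints of the components of a morphism form a morphism if the mates of the
naturality isomorphisms are invertible. -/
def leftAdj : F ⟶ E where
  app K := (L K).toCatHom
  naturality f := haveI := h f; Cat.Hom.isoMk (asIso (leftMate φ L adj f))
  naturality_naturality {K K' f g} η := by
    refine Cat.Hom₂.ext (NatTrans.ext (funext fun Y => ?_))
    change (L K').map ((rs₂ F η).app Y) ≫ (leftMate φ L adj g).app Y =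
      (leftMate φ L adj f).app Y ≫ (rs₂ E η).app ((L K).obj Y)
    apply ((adj K').homEquiv _ _).injective
    rw [← cancel_mono ((nt φ g).hom.app _), Adjunction.homEquiv_unit, Adjunction.homEquiv_unit]
    simp only [Functor.map_comp, Category.assoc, nt_rs₂]
    have h1 := (adj K').unit.naturality ((rs₂ F η).app Y)
    have h2 := (rs₂ F η).naturality ((adj K).unit.app Y)
    dsimp only [Functor.comp_map, Functor.comp_obj, Functor.id_obj, Functor.id_map] at h1 h2 ⊢
    rw [← reassoc_of% h1, unit_leftMate_nt, reassoc_of% (unit_leftMate_nt φ L adj)]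
    exact h2.symm
  naturality_id K := by
    refine Cat.Hom₂.ext (NatTrans.ext (funext fun Y => ?_))
    change (leftMate φ L adj (𝟙 K)).app Y ≫ (rsId E K).hom.app ((L K).obj Y) =
      (L K).map ((rsId F K).hom.app Y) ≫ 𝟙 _ ≫ 𝟙 _
    apply ((adj K).homEquiv _ _).injective
    rw [Adjunction.homEquiv_unit, Adjunction.homEquiv_unit]
    have h1 := (adj K).unit.naturality ((rsId F K).hom.app Y)
    have h2 := (rsId F K).hom.naturality ((adj K).unit.app Y)
    dsimp only [Functor.comp_map, Functor.comp_obj, Functor.id_obj, Functor.id_map] at h1 h2 ⊢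
    simp only [Functor.map_comp, Category.comp_id]
    rw [← nt_rsId, reassoc_of% (unit_leftMate_nt φ L adj)]
    exact h2.trans h1
  naturality_comp {K K' K''} f g := by
    refine Cat.Hom₂.ext (NatTrans.ext (funext fun Y => ?_))
    change (leftMate φ L adj (f ≫ g)).app Y ≫ (rsComp E f g).hom.app ((L K).obj Y) =
      (L K'').map ((rsComp F f g).hom.app Y) ≫ 𝟙 _ ≫ (leftMate φ L adj g).app ((rs F f).obj Y) ≫
        𝟙 _ ≫ (rs E g).map ((leftMate φ L adj f).app Y) ≫ 𝟙 _
    simp only [Category.id_comp]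
    apply ((adj K'').homEquiv _ _).injective
    rw [Adjunction.homEquiv_unit, Adjunction.homEquiv_unit,
      ← cancel_mono ((nt φ g).hom.app _), ← cancel_mono ((rs F g).map ((nt φ f).hom.app _))]
    have h1 := (adj K'').unit.naturality ((rsComp F f g).hom.app Y)
    have h2 := (rsComp F f g).hom.naturality ((adj K).unit.app Y)
    have h3 := (nt φ g).hom.naturality ((leftMate φ L adj f).app Y)
    have h4 := nt_rsComp φ f g ((L K).obj Y)
    dsimp only [Functor.comp_map, Functor.comp_obj, Functor.id_obj, Functor.id_map] at h1 h2 h3 h4 ⊢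
    simp only [Functor.map_comp, Category.assoc, Category.comp_id]
    rw [← h4, reassoc_of% (unit_leftMate_nt φ L adj), h2, ← reassoc_of% h1, reassoc_of% h3,
      reassoc_of% (unit_leftMate_nt φ L adj),
      ← Functor.map_comp, ← Functor.map_comp, unit_leftMate_nt]

theorem nt_leftAdj {K K'} (f : K ⟶ K') (Y : F.obj K) :
    (nt (leftAdj φ L adj h) f).hom.app Y = (leftMate φ L adj f).app Y := rfl

/-- A morphism is a right adjoint if its components are right adjoints and the mates of the
naturality isomorphisms are invertible. -/
theorem isRightAdjoint_of_mates (h : ∀ {K K'} (f : K ⟶ K'), IsIso (leftMate φ L adj f)) :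
    Bicategory.IsRightAdjoint φ := by
  let η : 𝟙 F ⟶ leftAdj φ L adj h ≫ φ := homMk (fun K => (adj K).unit) (by
    intro K K' f Y
    rw [nt_comp_app, nt_leftAdj, nt_id_app]
    refine (unit_leftMate_nt φ L adj f Y).trans ?_
    exact (Category.id_comp _).symm)
  let θ : φ ≫ leftAdj φ L adj h ⟶ 𝟙 E := homMk (fun K => (adj K).counit) (by
    intro K K' f X
    rw [nt_comp_app, nt_leftAdj, nt_id_app]
    refine (Category.comp_id _).trans ?_
    change (adj K').counit.app _ = ((L K').map ((nt φ f).hom.app X) ≫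
      (leftMate φ L adj f).app ((fn φ K).obj X)) ≫ (rs E f).map ((adj K).counit.app X)
    apply ((adj K').homEquiv _ _).injective
    have h1 := (adj K').unit.naturality ((nt φ f).hom.app X)
    have h3 := (nt φ f).hom.naturality ((adj K).counit.app X)
    rw [Adjunction.homEquiv_unit, Adjunction.homEquiv_unit, ← cancel_mono ((nt φ f).hom.app _)]
    dsimp only [Functor.comp_map, Functor.comp_obj, Functor.id_obj, Functor.id_map] at h1 h3 ⊢
    simp only [Functor.map_comp, Category.assoc]
    rw [h3, ← reassoc_of% h1, reassoc_of% (unit_leftMate_nt φ L adj), ← Functor.map_comp]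
    simp)
  refine Bicategory.IsRightAdjoint.mk (f := leftAdj φ L adj h)
    { unit := η, counit := θ, left_triangle := ?_, right_triangle := ?_ }
  · refine hom_ext_app fun K Y => ?_
    rw [leftZigzag_eq]
    change (L K).map ((adj K).unit.app Y) ≫ 𝟙 _ ≫ (adj K).counit.app ((L K).obj Y) = 𝟙 _ ≫ 𝟙 _
    rw [Category.id_comp, Category.id_comp]
    exact (adj K).left_triangle_components Y
  · refine hom_ext_app fun K X => ?_
    rw [rightZigzag_eq]
    change (adj K).unit.app ((fn φ K).obj X) ≫ 𝟙 _ ≫ (fn φ K).map ((adj K).counit.app X) = 𝟙 _ ≫ 𝟙 _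
    rw [Category.id_comp, Category.id_comp]
    exact (adj K).right_triangle_components X

end LeftAdjoint

section RightAdjoint

variable (φ : E ⟶ F) (R : ∀ K, F.obj K ⥤ E.obj K) (adj : ∀ K, fn φ K ⊣ R K)

/-- The mate of the naturality isomorphism of `φ` at `f`, for right adjoints of the components. -/
def rightMate {K K'} (f : K ⟶ K') : R K ⋙ rs E f ⟶ rs F f ⋙ R K' where
  app Y := (adj K').homEquiv _ _
    ((nt φ f).hom.app ((R K).obj Y) ≫ (rs F f).map ((adj K).counit.app Y))
  naturality Y Z g := by
    have h := (nt φ f).hom.naturality ((R K).map g)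
    have h' := (adj K).counit.naturality g
    apply ((adj K').homEquiv _ _).symm.injective
    dsimp only [Functor.comp_map, Functor.comp_obj, Functor.id_obj, Functor.id_map] at h h' ⊢
    rw [Adjunction.homEquiv_naturality_left_symm, Adjunction.homEquiv_naturality_right_symm,
      Equiv.symm_apply_apply, Equiv.symm_apply_apply, Category.assoc, reassoc_of% h,
      ← Functor.map_comp, ← Functor.map_comp, h']

theorem rightMate_counit {K K'} (f : K ⟶ K') (Y : F.obj K) :
    (fn φ K').map ((rightMate φ R adj f).app Y) ≫ (adj K').counit.app ((rs F f).obj Y) =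
      (nt φ f).hom.app ((R K).obj Y) ≫ (rs F f).map ((adj K).counit.app Y) := by
  exact ((adj K').homEquiv_counit ..).symm.trans (Equiv.symm_apply_apply _ _)

theorem rightMate_rs₂ {K K'} {f g : K ⟶ K'} (η : f ⟶ g) (Y : F.obj K) :
    (rightMate φ R adj f).app Y ≫ (R K').map ((rs₂ F η).app Y) =
      (rs₂ E η).app ((R K).obj Y) ≫ (rightMate φ R adj g).app Y := by
  apply ((adj K').homEquiv _ _).symm.injective
  rw [Adjunction.homEquiv_counit, Adjunction.homEquiv_counit]
  have h1 := (adj K').counit.naturality ((rs₂ F η).app Y)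
  have h2 := (rs₂ F η).naturality ((adj K).counit.app Y)
  dsimp only [Functor.comp_map, Functor.comp_obj, Functor.id_obj, Functor.id_map] at h1 h2 ⊢
  simp only [Functor.map_comp, Category.assoc]
  rw [h1, reassoc_of% (rightMate_counit φ R adj), rightMate_counit, reassoc_of% (nt_rs₂ φ η), h2]

theorem rightMate_rsId (K) (Y : F.obj K) :
    (rightMate φ R adj (𝟙 K)).app Y ≫ (R K).map ((rsId F K).hom.app Y) =
      (rsId E K).hom.app ((R K).obj Y) := by
  apply ((adj K).homEquiv _ _).symm.injective
  rw [Adjunction.homEquiv_counit, Adjunction.homEquiv_counit]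
  have h1 := (adj K).counit.naturality ((rsId F K).hom.app Y)
  have h2 := (rsId F K).hom.naturality ((adj K).counit.app Y)
  have h3 := nt_rsId φ K ((R K).obj Y)
  dsimp only [Functor.comp_map, Functor.comp_obj, Functor.id_obj, Functor.id_map] at h1 h2 h3 ⊢
  simp only [Functor.map_comp, Category.assoc]
  rw [h1, reassoc_of% (rightMate_counit φ R adj), h2, reassoc_of% h3]

theorem rightMate_rsComp {K K' K''} (f : K ⟶ K') (g : K' ⟶ K'') (Y : F.obj K) :
    (rightMate φ R adj (f ≫ g)).app Y ≫ (R K'').map ((rsComp F f g).hom.app Y) =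
      (rsComp E f g).hom.app ((R K).obj Y) ≫ (rs E g).map ((rightMate φ R adj f).app Y) ≫
        (rightMate φ R adj g).app ((rs F f).obj Y) := by
  apply ((adj K'').homEquiv _ _).symm.injective
  rw [Adjunction.homEquiv_counit, Adjunction.homEquiv_counit]
  have h1 := (adj K'').counit.naturality ((rsComp F f g).hom.app Y)
  have h2 := (rsComp F f g).hom.naturality ((adj K).counit.app Y)
  have h3 := (nt φ g).hom.naturality ((rightMate φ R adj f).app Y)
  have h4 := nt_rsComp φ f g ((R K).obj Y)
  dsimp only [Functor.comp_map, Functor.comp_obj, Functor.id_obj, Functor.id_map] at h1 h2 h3 h4 ⊢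
  simp only [Functor.map_comp, Category.assoc]
  rw [h1, reassoc_of% (rightMate_counit φ R adj), h2, reassoc_of% h4, rightMate_counit,
    reassoc_of% h3,
    ← Functor.map_comp, ← Functor.map_comp, rightMate_counit]

variable (h : ∀ {K K'} (f : K ⟶ K'), IsIso (rightMate φ R adj f))

def rightMateIso {K K'} (f : K ⟶ K') : R K ⋙ rs E f ≅ rs F f ⋙ R K' :=
  haveI := h f; asIso (rightMate φ R adj f)

theorem hom_rightMateIso {K K'} (f : K ⟶ K') (Y : F.obj K) :
    (rightMate φ R adj f).app Y ≫ (rightMateIso φ R adj h f).inv.app Y = 𝟙 _ :=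
  (rightMateIso φ R adj h f).hom_inv_id_app Y

/-- The right adjoints of the components of a morphism form a morphism if the mates of the
naturality isomorphisms are invertible. -/
def rightAdj : F ⟶ E where
  app K := (R K).toCatHom
  naturality f := Cat.Hom.isoMk (rightMateIso φ R adj h f).symm
  naturality_naturality {K K' f g} η := by
    refine Cat.Hom₂.ext (NatTrans.ext (funext fun Y => ?_))
    change (R K').map ((rs₂ F η).app Y) ≫ (rightMateIso φ R adj h g).inv.app Y =
      (rightMateIso φ R adj h f).inv.app Y ≫ (rs₂ E η).app ((R K).obj Y)
    rw [← cancel_epi ((rightMateIso φ R adj h f).hom.app Y), Iso.hom_inv_id_app_assoc]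
    refine ((reassoc_of% (rightMate_rs₂ φ R adj η Y)) _).trans ?_
    rw [hom_rightMateIso]
    exact Category.comp_id _
  naturality_id K := by
    refine Cat.Hom₂.ext (NatTrans.ext (funext fun Y => ?_))
    change (rightMateIso φ R adj h (𝟙 K)).inv.app Y ≫ (rsId E K).hom.app ((R K).obj Y) =
      (R K).map ((rsId F K).hom.app Y) ≫ 𝟙 _ ≫ 𝟙 _
    rw [Category.comp_id, ← cancel_epi ((rightMateIso φ R adj h (𝟙 K)).hom.app Y),
      Iso.hom_inv_id_app_assoc]
    refine (rightMate_rsId φ R adj K Y).symm.trans ?_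
    exact congrArg _ (Category.comp_id _).symm
  naturality_comp {K K' K''} f g := by
    refine Cat.Hom₂.ext (NatTrans.ext (funext fun Y => ?_))
    change (rightMateIso φ R adj h (f ≫ g)).inv.app Y ≫ (rsComp E f g).hom.app ((R K).obj Y) =
      (R K'').map ((rsComp F f g).hom.app Y) ≫ 𝟙 _ ≫
        (rightMateIso φ R adj h g).inv.app ((rs F f).obj Y) ≫
        𝟙 _ ≫ (rs E g).map ((rightMateIso φ R adj h f).inv.app Y) ≫ 𝟙 _
    have h2 := hom_rightMateIso φ R adj h g ((rs F f).obj Y)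
    have h3 := hom_rightMateIso φ R adj h f Y
    rw [← cancel_epi ((rightMateIso φ R adj h (f ≫ g)).hom.app Y), Iso.hom_inv_id_app_assoc]
    simp only [Category.id_comp]
    refine Eq.symm (((reassoc_of% (rightMate_rsComp φ R adj f g Y)) _).trans ?_)
    rw [reassoc_of% h2, ← Functor.map_comp_assoc, h3]
    simp

/-- A morphism is a left adjoint if its components are left adjoints and the mates of the
naturality isomorphisms are invertible. -/
theorem isLeftAdjoint_of_mates (h : ∀ {K K'} (f : K ⟶ K'), IsIso (rightMate φ R adj f)) :
    Bicategory.IsLeftAdjoint φ := by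
  let η : 𝟙 E ⟶ φ ≫ rightAdj φ R adj h := homMk (fun K => (adj K).unit) (by
    intro K K' f X
    rw [nt_comp_app, nt_id_app]
    refine Eq.trans ?_ (Category.id_comp _).symm
    change (adj K').unit.app ((rs E f).obj X) ≫ (R K').map ((nt φ f).hom.app X) ≫
      (rightMateIso φ R adj h f).inv.app ((fn φ K).obj X) = (rs E f).map ((adj K).unit.app X)
    rw [← cancel_mono ((rightMateIso φ R adj h f).hom.app ((fn φ K).obj X)), Category.assoc,
      Category.assoc, Iso.inv_hom_id_app]
    refine (congrArg (_ ≫ ·) (Category.comp_id _)).trans ?_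
    change _ = _ ≫ (rightMate φ R adj f).app ((fn φ K).obj X)
    apply ((adj K').homEquiv _ _).symm.injective
    have h1 := (adj K').counit.naturality ((nt φ f).hom.app X)
    have h3 := (nt φ f).hom.naturality ((adj K).unit.app X)
    have h4 := rightMate_counit φ R adj f ((fn φ K).obj X)
    rw [Adjunction.homEquiv_counit, Adjunction.homEquiv_counit]
    dsimp only [Functor.comp_map, Functor.comp_obj, Functor.id_obj, Functor.id_map] at h1 h3 h4 ⊢
    simp only [Functor.map_comp, Category.assoc]
    rw [h1, h4, reassoc_of% h3, ← Functor.map_comp]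
    simp)
  let θ : rightAdj φ R adj h ≫ φ ⟶ 𝟙 F := homMk (fun K => (adj K).counit) (by
    intro K K' f Y
    rw [nt_comp_app, nt_id_app]
    refine (Category.comp_id _).trans ?_
    change (adj K').counit.app ((rs F f).obj Y) =
      ((fn φ K').map ((rightMateIso φ R adj h f).inv.app Y) ≫
      (nt φ f).hom.app ((R K).obj Y)) ≫ (rs F f).map ((adj K).counit.app Y)
    rw [Category.assoc, ← rightMate_counit φ R adj f Y]
    refine Eq.symm ((Functor.map_comp_assoc ..).symm.trans ?_)
    refine (congrArg (fun t => (fn φ K').map t ≫ _)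
      ((rightMateIso φ R adj h f).inv_hom_id_app Y)).trans ?_
    rw [CategoryTheory.Functor.map_id]
    exact Category.id_comp _)
  refine Bicategory.IsLeftAdjoint.mk (g := rightAdj φ R adj h)
    { unit := η, counit := θ, left_triangle := ?_, right_triangle := ?_ }
  · refine hom_ext_app fun K Y => ?_
    rw [leftZigzag_eq]
    change (fn φ K).map ((adj K).unit.app Y) ≫ 𝟙 _ ≫ (adj K).counit.app ((fn φ K).obj Y) = 𝟙 _ ≫ 𝟙 _
    rw [Category.id_comp, Category.id_comp]
    exact (adj K).left_triangle_components Y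
  · refine hom_ext_app fun K X => ?_
    rw [rightZigzag_eq]
    change (adj K).unit.app ((R K).obj X) ≫ 𝟙 _ ≫ (R K).map ((adj K).counit.app X) = 𝟙 _ ≫ 𝟙 _
    rw [Category.id_comp, Category.id_comp]
    exact (adj K).right_triangle_components X

end RightAdjoint

end

end Der.Prederivator

namespace Der

/-! ### Universal arrows and exact squares of functors -/

section Universal

universe a₁ b₁ a₂ b₂ a₃ b₃ a₄ b₄ a₅ b₅ a₆ b₆

variable {𝓐 : Type b₁} [Category.{a₁} 𝓐] {𝓑 : Type b₂} [Category.{a₂} 𝓑]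
  {𝓙 : Type b₃} [Category.{a₃} 𝓙] {𝓚 : Type b₄} [Category.{a₄} 𝓚]

/-- `η : X ⟶ G Y` is a universal arrow from `X` to `G`. -/
def UnivL (G : 𝓑 ⥤ 𝓐) {X : 𝓐} {Y : 𝓑} (η : X ⟶ G.obj Y) : Prop :=
  ∀ Z, Function.Bijective fun g : Y ⟶ Z => η ≫ G.map g

/-- `θ : G Y ⟶ X` is a universal arrow from `G` to `X`. -/
def UnivR (G : 𝓑 ⥤ 𝓐) {X : 𝓐} {Y : 𝓑} (θ : G.obj Y ⟶ X) : Prop :=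
  ∀ Z, Function.Bijective fun g : Z ⟶ Y => G.map g ≫ θ

theorem UnivL.of_adj {G : 𝓑 ⥤ 𝓐} {L : 𝓐 ⥤ 𝓑} (adj : L ⊣ G) (X : 𝓐) :
    UnivL G (X := X) (adj.unit.app X) := fun Z => by
  have : (fun g : L.obj X ⟶ Z => adj.unit.app X ≫ G.map g) = adj.homEquiv X Z :=
    funext fun g => (adj.homEquiv_unit ..).symm
  rw [this]
  exact (adj.homEquiv X Z).bijective

theorem UnivR.of_adj {G : 𝓑 ⥤ 𝓐} {R : 𝓐 ⥤ 𝓑} (adj : G ⊣ R) (X : 𝓐) :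
    UnivR G (X := X) (adj.counit.app X) := fun Z => by
  have : (fun g : Z ⟶ R.obj X => G.map g ≫ adj.counit.app X) = (adj.homEquiv Z X).symm :=
    funext fun g => (adj.homEquiv_counit ..).symm
  rw [this]
  exact (adj.homEquiv Z X).symm.bijective

theorem exists_univL (G : 𝓑 ⥤ 𝓐) [G.IsRightAdjoint] (X : 𝓐) :
    ∃ (Y : 𝓑) (η : X ⟶ G.obj Y), UnivL G η :=
  ⟨_, _, UnivL.of_adj (Adjunction.ofIsRightAdjoint G) X⟩

theorem exists_univR (G : 𝓑 ⥤ 𝓐) [G.IsLeftAdjoint] (X : 𝓐) :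
    ∃ (Y : 𝓑) (θ : G.obj Y ⟶ X), UnivR G θ :=
  ⟨_, _, UnivR.of_adj (Adjunction.ofIsLeftAdjoint G) X⟩

theorem UnivL.isIso {G : 𝓑 ⥤ 𝓐} {X : 𝓐} {Y Y' : 𝓑} {η : X ⟶ G.obj Y} (h : UnivL G η)
    {g : Y ⟶ Y'} (h' : UnivL G (η ≫ G.map g)) : IsIso g := by
  obtain ⟨k, hk⟩ := (h' Y).2 η
  have h1 : g ≫ k = 𝟙 _ := (h Y).1 (by simpa using hk)
  refine ⟨k, h1, (h' Y').1 ?_⟩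
  have : (η ≫ G.map g) ≫ G.map k = η := hk
  simp [← Functor.map_comp, reassoc_of% h1]

theorem UnivR.isIso {G : 𝓑 ⥤ 𝓐} {X : 𝓐} {Y Y' : 𝓑} {θ : G.obj Y ⟶ X} (h : UnivR G θ)
    {g : Y' ⟶ Y} (h' : UnivR G (G.map g ≫ θ)) : IsIso g := by
  obtain ⟨k, hk⟩ := (h' Y).2 θ
  have h1 : k ≫ g = 𝟙 _ := (h Y).1 (by simpa using hk)
  refine ⟨k, (h' Y').1 ?_, h1⟩
  have : G.map k ≫ G.map g ≫ θ = θ := hk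
  simp [this]

theorem UnivL.comp_iso {G : 𝓑 ⥤ 𝓐} {X : 𝓐} {Y Y' : 𝓑} {η : X ⟶ G.obj Y} (h : UnivL G η)
    (g : Y ⟶ Y') [IsIso g] : UnivL G (η ≫ G.map g) := fun Z => by
  have : (fun k : Y' ⟶ Z => (η ≫ G.map g) ≫ G.map k) =
      (fun k : Y ⟶ Z => η ≫ G.map k) ∘ fun k => g ≫ k := by
    funext k; simp
  rw [this]
  exact (h Z).comp (asIso g).homFromEquiv.symm.bijective

theorem UnivR.iso_comp {G : 𝓑 ⥤ 𝓐} {X : 𝓐} {Y Y' : 𝓑} {θ : G.obj Y ⟶ X} (h : UnivR G θ)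
    (g : Y' ⟶ Y) [IsIso g] : UnivR G (G.map g ≫ θ) := fun Z => by
  have : (fun k : Z ⟶ Y' => G.map k ≫ G.map g ≫ θ) =
      (fun k : Z ⟶ Y => G.map k ≫ θ) ∘ fun k => k ≫ g := by
    funext k; simp
  rw [this]
  exact (h Z).comp (asIso g).homToEquiv.bijective

theorem UnivL.iso_comp {G : 𝓑 ⥤ 𝓐} {X X' : 𝓐} {Y : 𝓑} {η : X ⟶ G.obj Y} (h : UnivL G η)
    (g : X' ⟶ X) [IsIso g] : UnivL G (g ≫ η) := fun Z => by
  simp only [Category.assoc]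
  exact (asIso g).homFromEquiv.symm.bijective.comp (h Z)

theorem UnivR.comp_iso {G : 𝓑 ⥤ 𝓐} {X X' : 𝓐} {Y : 𝓑} {θ : G.obj Y ⟶ X} (h : UnivR G θ)
    (g : X ⟶ X') [IsIso g] : UnivR G (θ ≫ g) := fun Z => by
  simp only [← Category.assoc]
  exact (asIso g).homToEquiv.bijective.comp (h Z)

theorem UnivL.congr {G G' : 𝓑 ⥤ 𝓐} (e : G ≅ G') {X : 𝓐} {Y : 𝓑} {η : X ⟶ G.obj Y}
    (h : UnivL G η) : UnivL G' (η ≫ e.hom.app Y) := fun Z => by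
  have : (fun k : Y ⟶ Z => (η ≫ e.hom.app Y) ≫ G'.map k) = fun k => (η ≫ G.map k) ≫ e.hom.app Z :=
    by
    funext k; simp
  rw [this]
  exact (e.app Z).homToEquiv.bijective.comp (h Z)

theorem UnivR.congr {G G' : 𝓑 ⥤ 𝓐} (e : G ≅ G') {X : 𝓐} {Y : 𝓑} {θ : G.obj Y ⟶ X}
    (h : UnivR G θ) : UnivR G' (e.inv.app Y ≫ θ) := fun Z => by
  have : (fun k : Z ⟶ Y => G'.map k ≫ e.inv.app Y ≫ θ) = fun k => e.inv.app Z ≫ (G.map k ≫ θ) := by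
    funext k; simp
  rw [this]
  exact (e.app Z).homFromEquiv.bijective.comp (h Z)

variable {Gu : 𝓑 ⥤ 𝓐} {P : 𝓐 ⥤ 𝓙} {Gv : 𝓑 ⥤ 𝓚} {Q : 𝓚 ⥤ 𝓙}

/-- The square `s` preserves universal arrows to `Gu` and `Q`: its left mate is invertible. -/
def ExL (s : Gu ⋙ P ⟶ Gv ⋙ Q) : Prop :=
  ∀ ⦃X Y⦄ (η : X ⟶ Gu.obj Y), UnivL Gu η → UnivL Q (P.map η ≫ s.app Y)

/-- The square `s` preserves universal arrows from `Gv` and `P`: its right mate is invertible. -/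
def ExR (s : Gu ⋙ P ⟶ Gv ⋙ Q) : Prop :=
  ∀ ⦃W Y⦄ (θ : Gv.obj Y ⟶ W), UnivR Gv θ → UnivR P (s.app Y ≫ Q.map θ)

/-- Exactness can be tested on one universal arrow for each object. -/
theorem ExL.of_exists {s : Gu ⋙ P ⟶ Gv ⋙ Q}
    (h : ∀ X, ∃ (Y : 𝓑) (η : X ⟶ Gu.obj Y), UnivL Gu η ∧ UnivL Q (P.map η ≫ s.app Y)) : ExL s := by
  intro X Y η hη
  obtain ⟨Y', η', h1, h2⟩ := h X
  obtain ⟨g, rfl⟩ := (h1 Y).2 η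
  have := h1.isIso hη
  have h3 := s.naturality g
  dsimp at h3 ⊢
  rw [Functor.map_comp, Category.assoc, h3, ← Category.assoc]
  exact h2.comp_iso (Gv.map g)

theorem ExR.of_exists {s : Gu ⋙ P ⟶ Gv ⋙ Q}
    (h : ∀ W, ∃ (Y : 𝓑) (θ : Gv.obj Y ⟶ W), UnivR Gv θ ∧ UnivR P (s.app Y ≫ Q.map θ)) : ExR s := by
  intro X Y θ hθ
  obtain ⟨Y', θ', h1, h2⟩ := h X
  obtain ⟨g, rfl⟩ := (h1 Y).2 θ
  have := h1.isIso hθ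
  have h3 := s.naturality g
  dsimp at h3 ⊢
  rw [Functor.map_comp, ← reassoc_of% h3]
  exact h2.iso_comp (Gu.map g)

/-- Invariance of exactness under isomorphisms of functors. -/
theorem ExL.congr {s : Gu ⋙ P ⟶ Gv ⋙ Q} (h : ExL s) {Gu' : 𝓑 ⥤ 𝓐} {P' : 𝓐 ⥤ 𝓙}
    {Gv' : 𝓑 ⥤ 𝓚} {Q' : 𝓚 ⥤ 𝓙} (eu : Gu ≅ Gu') (ep : P ≅ P') (ev : Gv ≅ Gv') (eq : Q ≅ Q')
    (s' : Gu' ⋙ P' ⟶ Gv' ⋙ Q')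
    (hs : ∀ Y, ep.hom.app (Gu.obj Y) ≫ P'.map (eu.hom.app Y) ≫ s'.app Y =
      s.app Y ≫ eq.hom.app (Gv.obj Y) ≫ Q'.map (ev.hom.app Y)) : ExL s' := by
  intro X Y η hη
  have h1 := h (η ≫ eu.inv.app Y) (by simpa using hη.congr eu.symm)
  have h2 := ((h1.congr eq).comp_iso (ev.hom.app Y)).iso_comp (ep.inv.app X)
  convert h2 using 1
  simp only [Category.assoc]
  rw [← hs]
  simp [← Functor.map_comp_assoc]

theorem ExR.congr {s : Gu ⋙ P ⟶ Gv ⋙ Q} (h : ExR s) {Gu' : 𝓑 ⥤ 𝓐} {P' : 𝓐 ⥤ 𝓙}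
    {Gv' : 𝓑 ⥤ 𝓚} {Q' : 𝓚 ⥤ 𝓙} (eu : Gu ≅ Gu') (ep : P ≅ P') (ev : Gv ≅ Gv') (eq : Q ≅ Q')
    (s' : Gu' ⋙ P' ⟶ Gv' ⋙ Q')
    (hs : ∀ Y, ep.hom.app (Gu.obj Y) ≫ P'.map (eu.hom.app Y) ≫ s'.app Y =
      s.app Y ≫ eq.hom.app (Gv.obj Y) ≫ Q'.map (ev.hom.app Y)) : ExR s' := by
  intro W Y θ hθ
  have h1 := h (ev.hom.app Y ≫ θ) (by simpa using hθ.congr ev.symm)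
  have h2 := ((h1.congr ep).iso_comp (eu.inv.app Y)).comp_iso (eq.hom.app W)
  convert h2 using 1
  have h3 : s'.app Y = P'.map (eu.inv.app Y) ≫ ep.inv.app _ ≫ s.app Y ≫ eq.hom.app (Gv.obj Y) ≫
      Q'.map (ev.hom.app Y) := by
    rw [← hs]
    simp [← Functor.map_comp_assoc]
  rw [h3]
  simp

variable {𝓙' : Type b₅} [Category.{a₅} 𝓙'] {𝓚' : Type b₆} [Category.{a₆} 𝓚']

def pasteSq (s : Gu ⋙ P ⟶ Gv ⋙ Q) {P' : 𝓙 ⥤ 𝓙'} {V' : 𝓚 ⥤ 𝓚'} {Q' : 𝓚' ⥤ 𝓙'}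
    (t : Q ⋙ P' ⟶ V' ⋙ Q') : Gu ⋙ P ⋙ P' ⟶ (Gv ⋙ V') ⋙ Q' :=
  Functor.whiskerRight s P' ≫ Functor.whiskerLeft Gv t

@[simp] theorem pasteSq_app (s : Gu ⋙ P ⟶ Gv ⋙ Q) {P' : 𝓙 ⥤ 𝓙'} {V' : 𝓚 ⥤ 𝓚'} {Q' : 𝓚' ⥤ 𝓙'}
    (t : Q ⋙ P' ⟶ V' ⋙ Q') (Y) :
    (pasteSq s t).app Y = P'.map (s.app Y) ≫ t.app (Gv.obj Y) := rfl

/-- If `s` becomes exact after pasting with an exact square, then the left mate of `s` is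
inverted by the functor along which `s` is pasted. -/
theorem ExL.isIso_of_paste {s : Gu ⋙ P ⟶ Gv ⋙ Q} {P' : 𝓙 ⥤ 𝓙'} {V' : 𝓚 ⥤ 𝓚'} {Q' : 𝓚' ⥤ 𝓙'}
    {t : Q ⋙ P' ⟶ V' ⋙ Q'} (ht : ExL t) (h : ExL (pasteSq s t)) {X Y} {η : X ⟶ Gu.obj Y}
    (hη : UnivL Gu η) {W} {θ : P.obj X ⟶ Q.obj W} (hθ : UnivL Q θ) {g : W ⟶ Gv.obj Y}
    (hg : θ ≫ Q.map g = P.map η ≫ s.app Y) : IsIso (V'.map g) := by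
  refine (ht θ hθ).isIso (g := V'.map g) ?_
  have h1 := t.naturality g
  dsimp at h1 hg
  have h2 := h η hη
  rw [pasteSq_app, Functor.comp_map, ← Functor.map_comp_assoc, ← hg, Functor.map_comp_assoc,
    h1, ← Category.assoc] at h2
  exact h2

/-- A square is exact if its mate, computed with any universal arrows, is invertible. -/
theorem ExL.of_isIso [Q.IsRightAdjoint] {s : Gu ⋙ P ⟶ Gv ⋙ Q}
    (h : ∀ ⦃X Y⦄ (η : X ⟶ Gu.obj Y), UnivL Gu η → ∀ ⦃W⦄ (θ : P.obj X ⟶ Q.obj W), UnivL Q θ →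
      ∀ g : W ⟶ Gv.obj Y, θ ≫ Q.map g = P.map η ≫ s.app Y → IsIso g) : ExL s := by
  intro X Y η hη
  obtain ⟨W, θ, hθ⟩ := exists_univL Q (P.obj X)
  obtain ⟨g, hg⟩ := (hθ _).2 (P.map η ≫ s.app Y)
  have := h η hη θ hθ g hg
  dsimp at hg
  rw [← hg]
  exact hθ.comp_iso g

def vpasteSq (s : Gu ⋙ P ⟶ Gv ⋙ Q) {Q' : 𝓙 ⥤ 𝓙'} {U' : 𝓐 ⥤ 𝓚'} {P' : 𝓚' ⥤ 𝓙'}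
    (t : U' ⋙ P' ⟶ P ⋙ Q') : (Gu ⋙ U') ⋙ P' ⟶ Gv ⋙ Q ⋙ Q' :=
  Functor.whiskerLeft Gu t ≫ Functor.whiskerRight s Q'

@[simp] theorem vpasteSq_app (s : Gu ⋙ P ⟶ Gv ⋙ Q) {Q' : 𝓙 ⥤ 𝓙'} {U' : 𝓐 ⥤ 𝓚'} {P' : 𝓚' ⥤ 𝓙'}
    (t : U' ⋙ P' ⟶ P ⋙ Q') (Y) :
    (vpasteSq s t).app Y = t.app (Gu.obj Y) ≫ Q'.map (s.app Y) := rfl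

theorem ExR.isIso_of_vpaste {s : Gu ⋙ P ⟶ Gv ⋙ Q} {Q' : 𝓙 ⥤ 𝓙'} {U' : 𝓐 ⥤ 𝓚'} {P' : 𝓚' ⥤ 𝓙'}
    {t : U' ⋙ P' ⟶ P ⋙ Q'} (ht : ExR t) (h : ExR (vpasteSq s t)) {W Y} {θ : Gv.obj Y ⟶ W}
    (hθ : UnivR Gv θ) {X} {η : P.obj X ⟶ Q.obj W} (hη : UnivR P η) {g : Gu.obj Y ⟶ X}
    (hg : P.map g ≫ η = s.app Y ≫ Q.map θ) : IsIso (U'.map g) := by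
  refine (ht η hη).isIso (g := U'.map g) ?_
  have h1 := t.naturality g
  dsimp at h1 hg
  have h2 := h θ hθ
  rw [vpasteSq_app, Functor.comp_map, Category.assoc, ← Functor.map_comp, ← hg, Functor.map_comp,
    ← reassoc_of% h1] at h2
  exact h2

theorem ExR.of_isIso [P.IsLeftAdjoint] {s : Gu ⋙ P ⟶ Gv ⋙ Q}
    (h : ∀ ⦃W Y⦄ (θ : Gv.obj Y ⟶ W), UnivR Gv θ → ∀ ⦃X⦄ (η : P.obj X ⟶ Q.obj W), UnivR P η →
      ∀ g : Gu.obj Y ⟶ X, P.map g ≫ η = s.app Y ≫ Q.map θ → IsIso g) : ExR s := by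
  intro W Y θ hθ
  obtain ⟨X, η, hη⟩ := exists_univR P (Q.obj W)
  obtain ⟨g, hg⟩ := (hη _).2 (s.app Y ≫ Q.map θ)
  have := h θ hθ η hη g hg
  dsimp at hg
  rw [← hg]
  exact hη.iso_comp g

/-- A left adjoint `F` preserves universal arrows to `G` if its unit is invertible on the image
of `G`. -/
theorem UnivL.map_of_adj {G : 𝓑 ⥤ 𝓐} {F : 𝓐 ⥤ 𝓙} {L : 𝓙 ⥤ 𝓐} (adj : F ⊣ L)
    (h : ∀ Z, IsIso (adj.unit.app (G.obj Z))) {X Y} {η : X ⟶ G.obj Y} (hη : UnivL G η) :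
    UnivL (G ⋙ F) (F.map η) := fun Z => by
  have : (adj.homEquiv X (F.obj (G.obj Z))) ∘ (fun g : Y ⟶ Z => F.map η ≫ (G ⋙ F).map g) =
      (fun f => f ≫ adj.unit.app (G.obj Z)) ∘ fun g : Y ⟶ Z => η ≫ G.map g := by
    funext g
    have h1 := adj.unit.naturality (η ≫ G.map g)
    simp only [Function.comp_apply, Functor.comp_map, ← Functor.map_comp, adj.homEquiv_unit]
    exact h1.symm
  have h2 := Function.Bijective.comp (g := fun f : X ⟶ G.obj Z => f ≫ adj.unit.app (G.obj Z))
    (Iso.homToEquiv (@asIso _ _ _ _ (adj.unit.app (G.obj Z)) (h Z)) (Z := X)).bijective (hη Z)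
  rw [← Function.Bijective.of_comp_iff' (adj.homEquiv X (F.obj (G.obj Z))).bijective, this]
  exact h2

theorem UnivR.map_of_adj {G : 𝓑 ⥤ 𝓐} {F : 𝓐 ⥤ 𝓙} {L : 𝓙 ⥤ 𝓐} (adj : L ⊣ F)
    (h : ∀ Z, IsIso (adj.counit.app (G.obj Z))) {X Y} {θ : G.obj Y ⟶ X} (hθ : UnivR G θ) :
    UnivR (G ⋙ F) (F.map θ) := fun Z => by
  have : (adj.homEquiv (F.obj (G.obj Z)) X).symm ∘ (fun g : Z ⟶ Y => (G ⋙ F).map g ≫ F.map θ) =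
      (fun f => adj.counit.app (G.obj Z) ≫ f) ∘ fun g : Z ⟶ Y => G.map g ≫ θ := by
    funext g
    have h1 := adj.counit.naturality (G.map g ≫ θ)
    simp only [Function.comp_apply, Functor.comp_map, ← Functor.map_comp, adj.homEquiv_counit]
    exact h1
  have h2 := Function.Bijective.comp (g := fun f : G.obj Z ⟶ X => adj.counit.app (G.obj Z) ≫ f)
    (Iso.homFromEquiv (@asIso _ _ _ _ (adj.counit.app (G.obj Z)) (h Z)) (Z := X)).symm.bijective
      (hθ Z)
  rw [← Function.Bijective.of_comp_iff' (adj.homEquiv (F.obj (G.obj Z)) X).symm.bijective, this]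
  exact h2

end Universal

end Der

namespace Der.Prederivator

noncomputable section

/-! ### Exact squares of restriction functors -/

section Squares

variable (D : Prederivator.{v, u}) {A B C' J K L : Type} [SmallCategory A] [SmallCategory B]
  [SmallCategory C'] [SmallCategory J] [SmallCategory K] [SmallCategory L]

theorem resTrans_id_app (p : A ⥤ B) (X : D.val B) : (D.resTrans (𝟙 p)).app X = 𝟙 _ :=
  congrArg (fun t => t.toNatTrans.app X) (D.map₂_id p.toCatHom.op)

theorem resTrans_comp_app {p q r : A ⥤ B} (α : p ⟶ q) (β : q ⟶ r) (X : D.val B) :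
    (D.resTrans (α ≫ β)).app X = (D.resTrans α).app X ≫ (D.resTrans β).app X :=
  congrArg (fun t => t.toNatTrans.app X) (D.map₂_comp (op2 α.toCatHom₂) (op2 β.toCatHom₂))

theorem resTrans_whiskerRight_app {p q : A ⥤ B} (α : p ⟶ q) (w : B ⥤ C') (X : D.val C') :
    (D.resTrans (Functor.whiskerRight α w)).app X ≫ (D.resComp q w).hom.app X =
      (D.resComp p w).hom.app X ≫ (D.resTrans α).app ((D.res w).obj X) := by
  have h := congrArg (fun t => t.toNatTrans.app X)
    (Pseudofunctor.map₂_whisker_left D w.toCatHom.op (op2 α.toCatHom₂))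
  refine (congrArg (· ≫ (D.resComp q w).hom.app X) h).trans ?_
  change ((D.resComp p w).hom.app X ≫ (D.resTrans α).app _ ≫ (D.resComp q w).inv.app X) ≫ _ = _
  simp

theorem resTrans_whiskerLeft_app (w : A ⥤ B) {p q : B ⥤ C'} (α : p ⟶ q) (X : D.val C') :
    (D.resTrans (Functor.whiskerLeft w α)).app X ≫ (D.resComp w q).hom.app X =
      (D.resComp w p).hom.app X ≫ (D.res w).map ((D.resTrans α).app X) := by
  have h := congrArg (fun t => t.toNatTrans.app X)
    (Pseudofunctor.map₂_whisker_right D (op2 α.toCatHom₂) w.toCatHom.op)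
  refine (congrArg (· ≫ (D.resComp w q).hom.app X) h).trans ?_
  change ((D.resComp w p).hom.app X ≫ (D.res w).map ((D.resTrans α).app _) ≫
    (D.resComp w q).inv.app X) ≫ _ = _
  simp

theorem resComp_assoc_app (p : A ⥤ B) (q : B ⥤ C') (r : C' ⥤ L) (X : D.val L) :
    (D.resComp p (q ⋙ r)).hom.app X ≫ (D.res p).map ((D.resComp q r).hom.app X) =
      (D.resComp (p ⋙ q) r).hom.app X ≫ (D.resComp p q).hom.app ((D.res r).obj X) := by
  have h := congrArg (fun t => t.toNatTrans.app X)
    (Pseudofunctor.map₂_associator D r.toCatHom.op q.toCatHom.op p.toCatHom.op)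
  have h0 : (α_ r.toCatHom.op q.toCatHom.op p.toCatHom.op).hom =
      𝟙 ((p ⋙ q ⋙ r).toCatHom.op) := rfl
  rw [h0] at h
  have h' := (D.resTrans_id_app (p ⋙ q ⋙ r) X).symm.trans h
  change _ = (D.resComp p (q ⋙ r)).hom.app X ≫ (D.res p).map ((D.resComp q r).hom.app X) ≫ 𝟙 _ ≫
    (D.resComp p q).inv.app ((D.res r).obj X) ≫ (D.resComp (p ⋙ q) r).inv.app X at h'
  rw [← cancel_mono ((D.resComp p q).inv.app ((D.res r).obj X)),
    ← cancel_mono ((D.resComp (p ⋙ q) r).inv.app X)]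
  simp only [Category.assoc, Iso.hom_inv_id_app_assoc]
  rw [Category.id_comp] at h'
  rw [← h']
  simp
  rfl

def resId (A : Type) [SmallCategory A] : D.res (𝟭 A) ≅ 𝟭 (D.val A) := D.rsId (op (Cat.of A))

/-- The square of restriction functors induced by a square of functors. -/
def sqm {p : J ⥤ A} {u : A ⥤ B} {q : J ⥤ K} {v : K ⥤ B} (α : p ⋙ u ⟶ q ⋙ v) :
    D.res u ⋙ D.res p ⟶ D.res v ⋙ D.res q :=
  (D.resComp p u).inv ≫ D.resTrans α ≫ (D.resComp q v).hom

theorem sqm_app {p : J ⥤ A} {u : A ⥤ B} {q : J ⥤ K} {v : K ⥤ B} (α : p ⋙ u ⟶ q ⋙ v)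
    (X : D.val B) : (D.sqm α).app X =
      (D.resComp p u).inv.app X ≫ (D.resTrans α).app X ≫ (D.resComp q v).hom.app X := rfl

def hpaste {p : J ⥤ A} {u : A ⥤ B} {q : J ⥤ K} {v : K ⥤ B} (α : p ⋙ u ⟶ q ⋙ v)
    {J' K' : Type} [SmallCategory J'] [SmallCategory K'] {p' : J' ⥤ J} {q' : J' ⥤ K'} {v' : K' ⥤ K}
    (β : p' ⋙ q ⟶ q' ⋙ v') : (p' ⋙ p) ⋙ u ⟶ q' ⋙ v' ⋙ v :=
  Functor.whiskerLeft p' α ≫ Functor.whiskerRight β v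

def vpaste {p : J ⥤ A} {u : A ⥤ B} {q : J ⥤ K} {v : K ⥤ B} (α : p ⋙ u ⟶ q ⋙ v)
    {J' K' : Type} [SmallCategory J'] [SmallCategory K'] {q' : J' ⥤ J} {p' : J' ⥤ K'} {u' : K' ⥤ A}
    (β : p' ⋙ u' ⟶ q' ⋙ p) : p' ⋙ u' ⋙ u ⟶ (q' ⋙ q) ⋙ v :=
  Functor.whiskerRight β u ≫ Functor.whiskerLeft q' α

/-- Pasting of squares of functors corresponds to pasting of squares of restriction functors, up to
the composition isomorphisms of the prederivator. -/
theorem sqm_hpaste {p : J ⥤ A} {u : A ⥤ B} {q : J ⥤ K} {v : K ⥤ B} (α : p ⋙ u ⟶ q ⋙ v)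
    {J' K' : Type} [SmallCategory J'] [SmallCategory K'] {p' : J' ⥤ J} {q' : J' ⥤ K'} {v' : K' ⥤ K}
    (β : p' ⋙ q ⟶ q' ⋙ v') (X : D.val B) :
    (D.resComp p' p).hom.app _ ≫ (D.res p').map ((D.sqm α).app X) ≫ (D.sqm β).app _ =
      (D.sqm (hpaste α β)).app X ≫ (D.res q').map ((D.resComp v' v).hom.app X) := by
  simp only [sqm_app, hpaste, Functor.map_comp, Category.assoc, resTrans_comp_app]
  have h1 := D.resComp_assoc_app p' p u X
  have h2 := D.resComp_assoc_app p' q v X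
  have h3 := D.resComp_assoc_app q' v' v X
  have h4 := D.resTrans_whiskerLeft_app p' α X
  have h5 := D.resTrans_whiskerRight_app β v X
  rw [← cancel_epi ((D.resComp (p' ⋙ p) u).hom.app X)]
  simp only [Functor.comp_obj] at *
  rw [← reassoc_of% h1, ← Functor.map_comp_assoc, Iso.hom_inv_id_app]
  simp only [CategoryTheory.Functor.map_id, Category.id_comp,
    Iso.hom_inv_id_app_assoc]
  erw [h3, reassoc_of% h5]
  rw [← reassoc_of% h4, reassoc_of% h2, Iso.hom_inv_id_app_assoc]

theorem sqm_vpaste {p : J ⥤ A} {u : A ⥤ B} {q : J ⥤ K} {v : K ⥤ B} (α : p ⋙ u ⟶ q ⋙ v)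
    {J' K' : Type} [SmallCategory J'] [SmallCategory K'] {q' : J' ⥤ J} {p' : J' ⥤ K'} {u' : K' ⥤ A}
    (β : p' ⋙ u' ⟶ q' ⋙ p) (X : D.val B) :
    (D.res p').map ((D.resComp u' u).hom.app X) ≫ (D.sqm β).app _ ≫ (D.res q').map ((D.sqm α).app X)
      = (D.sqm (vpaste α β)).app X ≫ (D.resComp q' q).hom.app _ := by
  simp only [sqm_app, vpaste, Functor.map_comp, Category.assoc, resTrans_comp_app]
  have h1 := D.resComp_assoc_app p' u' u X
  have h2 := D.resComp_assoc_app q' p u X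
  have h3 := D.resComp_assoc_app q' q v X
  have h4 := D.resTrans_whiskerLeft_app q' α X
  have h5 := D.resTrans_whiskerRight_app β u X
  rw [← cancel_epi ((D.resComp p' (u' ⋙ u)).hom.app X)]
  simp only [Functor.comp_obj] at *
  rw [reassoc_of% h1, Iso.hom_inv_id_app_assoc, ← reassoc_of% h5, ← reassoc_of% h2,
    ← Functor.map_comp_assoc, Iso.hom_inv_id_app]
  simp only [CategoryTheory.Functor.map_id, Category.id_comp]
  rw [← reassoc_of% h4]
  erw [h3]
  rw [Iso.hom_inv_id_app_assoc]

/-- The factorizations `a ⟶ p j`, `q j ⟶ k` of any `φ : u a ⟶ v k` have an initial object. -/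
def InitCrit {p : J ⥤ A} {u : A ⥤ B} {q : J ⥤ K} {v : K ⥤ B} (α : p ⋙ u ⟶ q ⋙ v) : Prop :=
  ∀ (a : A) (k : K) (φ : u.obj a ⟶ v.obj k), ∃ (j : J) (f : a ⟶ p.obj j) (g : q.obj j ⟶ k),
    u.map f ≫ α.app j ≫ v.map g = φ ∧
    ∀ (j' : J) (f' : a ⟶ p.obj j') (g' : q.obj j' ⟶ k), u.map f' ≫ α.app j' ≫ v.map g' = φ →
      ∃! m : j ⟶ j', f ≫ p.map m = f' ∧ q.map m ≫ g' = g

/-- The factorizations `a ⟶ p j`, `q j ⟶ k` of any `φ : u a ⟶ v k` have a terminal object. -/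
def TermCrit {p : J ⥤ A} {u : A ⥤ B} {q : J ⥤ K} {v : K ⥤ B} (α : p ⋙ u ⟶ q ⋙ v) : Prop :=
  ∀ (a : A) (k : K) (φ : u.obj a ⟶ v.obj k), ∃ (j : J) (f : a ⟶ p.obj j) (g : q.obj j ⟶ k),
    u.map f ≫ α.app j ≫ v.map g = φ ∧
    ∀ (j' : J) (f' : a ⟶ p.obj j') (g' : q.obj j' ⟶ k), u.map f' ≫ α.app j' ≫ v.map g' = φ →
      ∃! m : j' ⟶ j, f' ≫ p.map m = f ∧ q.map m ≫ g = g'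

/-- The properties of derivators which are inherited by shifted derivators. -/
structure IsKan : Prop where
  isIso : ∀ {A : Type} [SmallCategory A] {X Y : D.val A} (f : X ⟶ Y),
    (∀ a : A, IsIso ((D.evalAt a).map f)) → IsIso f
  left : ∀ {A B : Type} [SmallCategory A] [SmallCategory B] (u : A ⥤ B),
    (D.res u).IsRightAdjoint
  right : ∀ {A B : Type} [SmallCategory A] [SmallCategory B] (u : A ⥤ B),
    (D.res u).IsLeftAdjoint
  init : ∀ {A B J K : Type} [SmallCategory A] [SmallCategory B] [SmallCategory J] [SmallCategory K]
    {p : J ⥤ A} {u : A ⥤ B} {q : J ⥤ K} {v : K ⥤ B} (α : p ⋙ u ⟶ q ⋙ v), InitCrit α →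
    ExL (D.sqm α)
  term : ∀ {A B J K : Type} [SmallCategory A] [SmallCategory B] [SmallCategory J] [SmallCategory K]
    {p : J ⥤ A} {u : A ⥤ B} {q : J ⥤ K} {v : K ⥤ B} (α : p ⋙ u ⟶ q ⋙ v), TermCrit α →
    ExR (D.sqm α)
  empty : ∀ {A : Type} [SmallCategory A] [IsEmpty A] (X Y : D.val A), Nonempty (Unique (X ⟶ Y))

/-- The axiom (Der4) for left Kan extensions. -/
theorem sqm_toPt_exL (hD : D.IsDerivator) (u : A ⥤ B) (b : B) : ExL (D.sqm (toPt u b)) := by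
  have := hD.der3_left u
  have := hD.der3_left ((Functor.const (CostructuredArrow u b)).obj (⟨PUnit.unit⟩ : One))
  let adj := Adjunction.ofIsRightAdjoint (D.res u)
  let adj' := Adjunction.ofIsRightAdjoint
    (D.res ((Functor.const (CostructuredArrow u b)).obj (⟨PUnit.unit⟩ : One)))
  have h := hD.der4_left u b _ adj _ adj'
  refine ExL.of_exists fun X => ⟨_, _, UnivL.of_adj adj X, ?_⟩
  have h1 := unit_mateEquiv_symm adj adj' (D.overSquare u b) X
  have h2 := (UnivL.of_adj adj' ((D.res (CostructuredArrow.proj u b)).obj X)).comp_iso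
    (((mateEquiv adj adj').symm (D.overSquare u b)).natTrans.app X)
  exact cast (congrArg (UnivL _) h1.symm) h2

/-- The axiom (Der4) for right Kan extensions. -/
theorem sqm_fromPt_exR (hD : D.IsDerivator) (u : A ⥤ B) (b : B) : ExR (D.sqm (fromPt u b)) := by
  have := hD.der3_right u
  have := hD.der3_right ((Functor.const (StructuredArrow b u)).obj (⟨PUnit.unit⟩ : One))
  let adj := Adjunction.ofIsLeftAdjoint (D.res u)
  let adj' := Adjunction.ofIsLeftAdjoint
    (D.res ((Functor.const (StructuredArrow b u)).obj (⟨PUnit.unit⟩ : One)))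
  have h := hD.der4_right u b _ adj _ adj'
  refine ExR.of_exists fun X => ⟨_, _, UnivR.of_adj adj X, ?_⟩
  have h1 := mateEquiv_counit adj adj' (D.underSquare u b) X
  have h2 := (UnivR.of_adj adj' ((D.res (StructuredArrow.proj b u)).obj X)).iso_comp
    ((mateEquiv adj adj' (D.underSquare u b)).natTrans.app X)
  exact cast (congrArg (UnivR _) h1) h2

/-- Restriction turns an adjunction of functors into an adjunction. -/
def resAdj {f : A ⥤ B} {g : B ⥤ A} (adj : f ⊣ g) : D.res g ⊣ D.res f :=
  Adjunction.ofCat (Pseudofunctor.mapAdjunction D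
    (f := g.toCatHom.op) (g := f.toCatHom.op)
    { unit := op2 adj.unit.toCatHom₂
      counit := op2 adj.counit.toCatHom₂
      left_triangle := by
        rw [leftZigzag_eq]
        refine congrArg op2 (Cat.Hom₂.ext (NatTrans.ext (funext fun X => ?_)))
        change adj.unit.app (g.obj X) ≫ 𝟙 _ ≫ g.map (adj.counit.app X) = 𝟙 (g.obj X) ≫ 𝟙 _
        rw [Category.id_comp, Category.id_comp]
        exact adj.right_triangle_components X
      right_triangle := by
        rw [rightZigzag_eq]
        refine congrArg op2 (Cat.Hom₂.ext (NatTrans.ext (funext fun X => ?_)))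
        change f.map (adj.unit.app X) ≫ 𝟙 _ ≫ adj.counit.app (f.obj X) = 𝟙 (f.obj X) ≫ 𝟙 _
        rw [Category.id_comp, Category.id_comp]
        exact adj.left_triangle_components X })

theorem resAdj_unit_app {f : A ⥤ B} {g : B ⥤ A} (adj : f ⊣ g) (X : D.val A) :
    (D.resAdj adj).unit.app X = (D.resId A).inv.app X ≫ (D.resTrans adj.unit).app X ≫
      (D.resComp f g).hom.app X := by
  rfl

theorem resAdj_counit_app {f : A ⥤ B} {g : B ⥤ A} (adj : f ⊣ g) (X : D.val B) :
    (D.resAdj adj).counit.app X = (D.resComp g f).inv.app X ≫ (D.resTrans adj.counit).app X ≫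
      (D.resId B).hom.app X := by
  rfl

instance (p q : A ⥤ One) (α : p ⟶ q) : IsIso α :=
  @NatIso.isIso_of_isIso_app _ _ _ _ _ _ α fun _ =>
    ⟨⟨⟨Subsingleton.elim _ _⟩⟩, Subsingleton.elim _ _, Subsingleton.elim _ _⟩

instance {p q : A ⥤ B} (α : p ⟶ q) [IsIso α] (X : D.val B) : IsIso ((D.resTrans α).app X) :=
  (inferInstance : IsIso ((D.resIso (asIso α)).hom.app X))

theorem isIso_resTrans_app {p q : A ⥤ B} (α : p ⟶ q) (w : B ⥤ C')
    [IsIso (Functor.whiskerRight α w)] (X : D.val C') :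
    IsIso ((D.resTrans α).app ((D.res w).obj X)) := by
  have h := D.resTrans_whiskerRight_app α w X
  rw [← Iso.inv_hom_id_app_assoc (D.resComp p w) X ((D.resTrans α).app ((D.res w).obj X)), ← h]
  infer_instance

theorem sqm_whiskerLeft {p : J ⥤ A} {u : A ⥤ B} {q : J ⥤ K} {v : K ⥤ B} (α : p ⋙ u ⟶ q ⋙ v)
    (F : L ⥤ J) (Y : D.val B) :
    (D.resComp F p).hom.app _ ≫ (D.res F).map ((D.sqm α).app Y) =
      (D.sqm (p := F ⋙ p) (q := F ⋙ q) (Functor.whiskerLeft F α)).app Y ≫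
        (D.resComp F q).hom.app _ := by
  have h1 := D.resComp_assoc_app F p u Y
  have h2 := D.resComp_assoc_app F q v Y
  have h3 := D.resTrans_whiskerLeft_app F α Y
  simp only [sqm_app, Functor.map_comp, Category.assoc]
  rw [← cancel_epi ((D.resComp (F ⋙ p) u).hom.app Y), Iso.hom_inv_id_app_assoc, ← reassoc_of% h1,
    ← Functor.map_comp_assoc, Iso.hom_inv_id_app, CategoryTheory.Functor.map_id, Category.id_comp,
    ← reassoc_of% h3]
  erw [h2]

/-- Transport of a square of restriction functors along natural transformations of all four
functors. -/
theorem sqm_congr_app {p p' : J ⥤ A} {u u' : A ⥤ B} {q q' : J ⥤ K} {v v' : K ⥤ B}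
    (α : p ⋙ u ⟶ q ⋙ v) (α' : p' ⋙ u' ⟶ q' ⋙ v') (ep : p ⟶ p') (eu : u ⟶ u') (eq : q ⟶ q')
    (ev : v ⟶ v')
    (h : Functor.whiskerRight ep u ≫ Functor.whiskerLeft p' eu ≫ α' =
      α ≫ Functor.whiskerRight eq v ≫ Functor.whiskerLeft q' ev) (Y : D.val B) :
    (D.resTrans ep).app _ ≫ (D.res p').map ((D.resTrans eu).app Y) ≫ (D.sqm α').app Y =
      (D.sqm α).app Y ≫ (D.resTrans eq).app _ ≫ (D.res q').map ((D.resTrans ev).app Y) := by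
  have h0 := congrArg (fun t => (D.resTrans t).app Y) h
  simp only [resTrans_comp_app] at h0
  have h1 := D.resTrans_whiskerRight_app ep u Y
  have h2 := D.resTrans_whiskerLeft_app p' eu Y
  have h3 := D.resTrans_whiskerRight_app eq v Y
  have h4 := D.resTrans_whiskerLeft_app q' ev Y
  simp only [sqm_app, Category.assoc]
  rw [← reassoc_of% h3, ← h4, ← cancel_epi ((D.resComp p u).hom.app Y), ← reassoc_of% h1,
    ← reassoc_of% h2, Iso.hom_inv_id_app_assoc, Iso.hom_inv_id_app_assoc, reassoc_of% h0]

variable {D} in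
theorem exL_sqm_congr {p p' : J ⥤ A} {u u' : A ⥤ B} {q q' : J ⥤ K} {v v' : K ⥤ B}
    {α : p ⋙ u ⟶ q ⋙ v} (hα : ExL (D.sqm α)) (α' : p' ⋙ u' ⟶ q' ⋙ v') (ep : p ≅ p')
    (eu : u ≅ u') (eq : q ≅ q') (ev : v ≅ v')
    (h : Functor.whiskerRight ep.hom u ≫ Functor.whiskerLeft p' eu.hom ≫ α' =
      α ≫ Functor.whiskerRight eq.hom v ≫ Functor.whiskerLeft q' ev.hom) : ExL (D.sqm α') :=
  hα.congr (D.resIso eu) (D.resIso ep) (D.resIso ev) (D.resIso eq) _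
    (D.sqm_congr_app α α' ep.hom eu.hom eq.hom ev.hom h)

variable {D} in
theorem exR_sqm_congr {p p' : J ⥤ A} {u u' : A ⥤ B} {q q' : J ⥤ K} {v v' : K ⥤ B}
    {α : p ⋙ u ⟶ q ⋙ v} (hα : ExR (D.sqm α)) (α' : p' ⋙ u' ⟶ q' ⋙ v') (ep : p ≅ p')
    (eu : u ≅ u') (eq : q ≅ q') (ev : v ≅ v')
    (h : Functor.whiskerRight ep.hom u ≫ Functor.whiskerLeft p' eu.hom ≫ α' =
      α ≫ Functor.whiskerRight eq.hom v ≫ Functor.whiskerLeft q' ev.hom) : ExR (D.sqm α') :=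
  hα.congr (D.resIso eu) (D.resIso ep) (D.resIso ev) (D.resIso eq) _
    (D.sqm_congr_app α α' ep.hom eu.hom eq.hom ev.hom h)

/-- Restriction along a right adjoint preserves exactness over the terminal category. -/
theorem exL_whiskerLeft {p : J ⥤ A} {u : A ⥤ B} {q : J ⥤ One} {v : One ⥤ B} (α : p ⋙ u ⟶ q ⋙ v)
    (hα : ExL (D.sqm α)) (F : L ⥤ J) [F.IsRightAdjoint] :
    ExL (D.sqm (p := F ⋙ p) (q := F ⋙ q) (Functor.whiskerLeft F α)) := by
  have adj := Adjunction.ofIsRightAdjoint F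
  intro X Y η hη
  have h1 := (hα η hη).map_of_adj (D.resAdj adj) (fun Z => by
    rw [resAdj_unit_app]
    have := D.isIso_resTrans_app adj.unit q Z
    infer_instance)
  have h2 := (h1.congr (D.resComp F q).symm).iso_comp ((D.resComp F p).hom.app X)
  refine cast (congrArg (UnivL _) ?_) h2
  have h3 := D.sqm_whiskerLeft α F Y
  have h4 := (D.resComp F p).hom.naturality η
  rw [Functor.map_comp, Category.assoc]
  dsimp at h4 ⊢
  rw [← reassoc_of% h4, reassoc_of% h3, Iso.hom_inv_id_app]
  exact congrArg _ (Category.comp_id _)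

theorem exR_whiskerLeft {p : J ⥤ One} {u : One ⥤ B} {q : J ⥤ K} {v : K ⥤ B} (α : p ⋙ u ⟶ q ⋙ v)
    (hα : ExR (D.sqm α)) (F : L ⥤ J) [F.IsLeftAdjoint] :
    ExR (D.sqm (p := F ⋙ p) (q := F ⋙ q) (Functor.whiskerLeft F α)) := by
  have adj := Adjunction.ofIsLeftAdjoint F
  intro X Y η hη
  have h1 := (hα η hη).map_of_adj (D.resAdj adj) (fun Z => by
    rw [resAdj_counit_app]
    have := D.isIso_resTrans_app adj.counit p Z
    infer_instance)
  have h2 := (h1.congr (D.resComp F p).symm).comp_iso ((D.resComp F q).inv.app X)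
  refine cast (congrArg (UnivR _) ?_) h2
  have h3 := D.sqm_whiskerLeft α F Y
  have h4 := (D.resComp F q).inv.naturality η
  rw [Functor.map_comp, Category.assoc]
  dsimp at h4 ⊢
  rw [Category.assoc, h4, reassoc_of% h3, Iso.hom_inv_id_app_assoc]

/-- Exactness of a square of functors with vertex the terminal category. -/
theorem exL_of_init_one (hD : D.IsDerivator) {p : J ⥤ A} {u : A ⥤ B} {q : J ⥤ One} {v : One ⥤ B}
    (α : p ⋙ u ⟶ q ⋙ v) (h : InitCrit α) : ExL (D.sqm α) := by
  let b : B := v.obj ⟨PUnit.unit⟩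
  have hv : ∀ {x y : One} (f : x ⟶ y), v.map f = 𝟙 b := fun f =>
    (congrArg (fun g : (⟨PUnit.unit⟩ : One) ⟶ ⟨PUnit.unit⟩ => v.map g)
      (Subsingleton.elim f (𝟙 (⟨PUnit.unit⟩ : One)))).trans (CategoryTheory.Functor.map_id v _)
  -- The criterion says that the comparison functor to the comma category is a right adjoint, and
  -- restriction along right adjoints preserves the exactness of the comma square.
  let F : J ⥤ CostructuredArrow u b :=
    { obj := fun j => CostructuredArrow.mk (Y := p.obj j) (α.app j)
      map := fun f => CostructuredArrow.homMk (p.map f) (by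
        refine (α.naturality f).trans ?_
        exact (congrArg (α.app _ ≫ ·) (hv (q.map f))).trans (Category.comp_id (Y := b) (α.app _)))
      map_id := fun _ => by ext; simp
      map_comp := fun _ _ => by ext; simp }
  have hF : F.IsRightAdjoint := by
    refine @isRightAdjointOfStructuredArrowInitials _ _ _ _ F fun c => ?_
    obtain ⟨j, f, g, h1, h2⟩ := h c.left ⟨PUnit.unit⟩ c.hom
    rw [hv] at h1
    have h1' : u.map f ≫ α.app j = c.hom := (congrArg _ (Category.comp_id _)).symm.trans h1
    refine (Limits.IsInitial.ofUniqueHom (X := StructuredArrow.mk (Y := j)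
      (CostructuredArrow.homMk f h1' : c ⟶ F.obj j)) ?_ ?_).hasInitial
    · intro x
      have h3 : u.map x.hom.left ≫ α.app x.right ≫ v.map (𝟙 _) = c.hom := by
        rw [hv]
        exact (congrArg _ (Category.comp_id _)).trans (CostructuredArrow.w x.hom)
      have h4 := (h2 x.right x.hom.left (𝟙 _) h3)
      exact StructuredArrow.homMk h4.choose
        (CostructuredArrow.hom_ext _ _ h4.choose_spec.1.1)
    · intro x m
      have h3 : u.map x.hom.left ≫ α.app x.right ≫ v.map (𝟙 _) = c.hom := by
        rw [hv]
        exact (congrArg _ (Category.comp_id _)).trans (CostructuredArrow.w x.hom)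
      have h4 := (h2 x.right x.hom.left (𝟙 _) h3)
      refine StructuredArrow.hom_ext _ _ (h4.choose_spec.2 _ ⟨?_, Subsingleton.elim _ _⟩)
      exact congrArg CommaMorphism.left (StructuredArrow.w m)
  have h1 := D.exL_whiskerLeft (toPt u b) (D.sqm_toPt_exL hD u b) F
  refine exL_sqm_congr h1 α (NatIso.ofComponents (fun _ => Iso.refl _) (map_comp_id_eq p))
    (Iso.refl _) (NatIso.ofComponents (fun _ => Iso.refl _))
    (NatIso.ofComponents (fun _ => Iso.refl _) (fun f => by rw [hv]; rfl)) ?_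
  ext j
  change u.map (𝟙 _) ≫ 𝟙 _ ≫ α.app j = α.app j ≫ 𝟙 b ≫ 𝟙 b
  rw [CategoryTheory.Functor.map_id]
  exact (Category.id_comp _).trans ((Category.id_comp _).trans
    ((Category.comp_id _).symm.trans (congrArg _ (Category.comp_id _).symm)))

theorem exR_of_term_one (hD : D.IsDerivator) {p : J ⥤ One} {u : One ⥤ B} {q : J ⥤ K} {v : K ⥤ B}
    (α : p ⋙ u ⟶ q ⋙ v) (h : TermCrit α) : ExR (D.sqm α) := by
  let b : B := u.obj ⟨PUnit.unit⟩
  have hu : ∀ {x y : One} (f : x ⟶ y), u.map f = 𝟙 b := fun f =>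
    (congrArg (fun g : (⟨PUnit.unit⟩ : One) ⟶ ⟨PUnit.unit⟩ => u.map g)
      (Subsingleton.elim f (𝟙 (⟨PUnit.unit⟩ : One)))).trans (CategoryTheory.Functor.map_id u _)
  let F : J ⥤ StructuredArrow b v :=
    { obj := fun j => StructuredArrow.mk (Y := q.obj j) (α.app j)
      map := fun f => StructuredArrow.homMk (q.map f) (by
        refine (α.naturality f).symm.trans ?_
        exact (congrArg (· ≫ α.app _) (hu (p.map f))).trans (Category.id_comp (X := b) (α.app _)))
      map_id := fun _ => by ext; simp
      map_comp := fun _ _ => by ext; simp }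
  have hF : F.IsLeftAdjoint := by
    refine @isLeftAdjoint_of_costructuredArrowTerminals _ _ _ _ F fun c => ?_
    obtain ⟨j, f, g, h1, h2⟩ := h ⟨PUnit.unit⟩ c.right c.hom
    rw [hu] at h1
    have h1' : α.app j ≫ v.map g = c.hom := (Category.id_comp _).symm.trans h1
    refine (Limits.IsTerminal.ofUniqueHom (Y := CostructuredArrow.mk (Y := j)
      (StructuredArrow.homMk g h1' : F.obj j ⟶ c)) ?_ ?_).hasTerminal
    · intro x
      have h3 : u.map (𝟙 _) ≫ α.app x.left ≫ v.map x.hom.right = c.hom := by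
        rw [hu]
        exact (Category.id_comp _).trans (StructuredArrow.w x.hom)
      have h4 := (h2 x.left (𝟙 _) x.hom.right h3)
      exact CostructuredArrow.homMk h4.choose
        (StructuredArrow.hom_ext _ _ h4.choose_spec.1.2)
    · intro x m
      have h3 : u.map (𝟙 _) ≫ α.app x.left ≫ v.map x.hom.right = c.hom := by
        rw [hu]
        exact (Category.id_comp _).trans (StructuredArrow.w x.hom)
      have h4 := (h2 x.left (𝟙 _) x.hom.right h3)
      refine CostructuredArrow.hom_ext _ _ (h4.choose_spec.2 _ ⟨Subsingleton.elim _ _, ?_⟩)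
      exact congrArg CommaMorphism.right (CostructuredArrow.w m)
  have h1 := D.exR_whiskerLeft (fromPt v b) (D.sqm_fromPt_exR hD v b) F
  refine exR_sqm_congr h1 α (NatIso.ofComponents (fun _ => Iso.refl _))
    (NatIso.ofComponents (fun _ => Iso.refl _) (fun f => by rw [hu]; rfl))
    (NatIso.ofComponents (fun _ => Iso.refl _) (map_comp_id_eq q)) (Iso.refl _) ?_
  ext j
  change 𝟙 b ≫ 𝟙 b ≫ α.app j = α.app j ≫ v.map (𝟙 _) ≫ 𝟙 _
  rw [CategoryTheory.Functor.map_id]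
  exact (Category.id_comp _).trans ((Category.id_comp _).trans
    ((Category.comp_id _).symm.trans (congrArg _ (Category.comp_id _).symm)))

/-- The criterion is inherited by pasting with a comma square, which reduces general squares to
those with vertex the terminal category. -/
theorem InitCrit.hpaste_toPt {p : J ⥤ A} {u : A ⥤ B} {q : J ⥤ K} {v : K ⥤ B}
    {α : p ⋙ u ⟶ q ⋙ v} (h : InitCrit α) (k : K) : InitCrit (hpaste α (toPt q k)) := by
  intro a z φ
  obtain ⟨j, f, g, h1, h2⟩ := h a k φ
  refine ⟨CostructuredArrow.mk g, f, 𝟙 _, ?_, fun x f' g' h' => ?_⟩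
  · refine Eq.trans ?_ h1
    change u.map f ≫ (α.app j ≫ v.map g) ≫ v.map (𝟙 k) = _
    simp
  · have h3 : u.map f' ≫ α.app x.left ≫ v.map x.hom = φ := by
      refine Eq.trans ?_ h'
      change _ = u.map f' ≫ (α.app x.left ≫ v.map x.hom) ≫ v.map (𝟙 k)
      simp
    obtain ⟨m, ⟨hm1, hm2⟩, hm⟩ := h2 x.left f' x.hom h3
    exact ⟨CostructuredArrow.homMk m hm2, ⟨hm1, Subsingleton.elim _ _⟩, fun m' hm' =>
      CostructuredArrow.hom_ext _ _ (hm m'.left ⟨hm'.1, CostructuredArrow.w m'⟩)⟩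

theorem TermCrit.vpaste_fromPt {p : J ⥤ A} {u : A ⥤ B} {q : J ⥤ K} {v : K ⥤ B}
    {α : p ⋙ u ⟶ q ⋙ v} (h : TermCrit α) (a : A) : TermCrit (vpaste α (fromPt p a)) := by
  intro z k φ
  obtain ⟨j, f, g, h1, h2⟩ := h a k φ
  refine ⟨StructuredArrow.mk f, 𝟙 _, g, ?_, fun x f' g' h' => ?_⟩
  · refine Eq.trans ?_ h1
    change u.map (𝟙 a) ≫ (u.map f ≫ α.app j) ≫ v.map g = _
    simp
  · have h3 : u.map x.hom ≫ α.app x.right ≫ v.map g' = φ := by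
      refine Eq.trans ?_ h'
      change _ = u.map (𝟙 a) ≫ (u.map x.hom ≫ α.app x.right) ≫ v.map g'
      simp
    obtain ⟨m, ⟨hm1, hm2⟩, hm⟩ := h2 x.right x.hom g' h3
    exact ⟨StructuredArrow.homMk m hm1, ⟨Subsingleton.elim _ _, hm2⟩, fun m' hm' =>
      StructuredArrow.hom_ext _ _ (hm m'.right ⟨StructuredArrow.w m', hm'.2⟩)⟩

/-- The pasting of squares corresponds to the pasting of squares of restriction functors. -/
theorem exL_pasteSq_iff {p : J ⥤ A} {u : A ⥤ B} {q : J ⥤ K} {v : K ⥤ B} (α : p ⋙ u ⟶ q ⋙ v)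
    {J' K' : Type} [SmallCategory J'] [SmallCategory K'] {p' : J' ⥤ J} {q' : J' ⥤ K'} {v' : K' ⥤ K}
    (β : p' ⋙ q ⟶ q' ⋙ v') (h : ExL (D.sqm (hpaste α β))) : ExL (pasteSq (D.sqm α) (D.sqm β)) := by
  refine h.congr (Iso.refl _) (D.resComp p' p) (D.resComp v' v) (Iso.refl _) _ fun Y => ?_
  have h1 := D.sqm_hpaste α β Y
  change (D.resComp p' p).hom.app _ ≫ (D.res p' ).map ((D.res p).map (𝟙 _)) ≫ (D.res p').map
    ((D.sqm α).app Y) ≫ (D.sqm β).app _ = (D.sqm (hpaste α β)).app Y ≫ 𝟙 _ ≫ (D.res q').map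
      ((D.resComp v' v).hom.app Y)
  rw [Category.id_comp, ← h1, CategoryTheory.Functor.map_id, CategoryTheory.Functor.map_id]
  exact congrArg _ (Category.id_comp _)

theorem exR_vpasteSq_iff {p : J ⥤ A} {u : A ⥤ B} {q : J ⥤ K} {v : K ⥤ B} (α : p ⋙ u ⟶ q ⋙ v)
    {J' K' : Type} [SmallCategory J'] [SmallCategory K'] {q' : J' ⥤ J} {p' : J' ⥤ K'} {u' : K' ⥤ A}
    (β : p' ⋙ u' ⟶ q' ⋙ p) (h : ExR (D.sqm (vpaste α β))) :
    ExR (vpasteSq (D.sqm α) (D.sqm β)) := by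
  refine h.congr (D.resComp u' u) (Iso.refl _) (Iso.refl _) (D.resComp q' q) _ fun Y => ?_
  have h1 := D.sqm_vpaste α β Y
  change 𝟙 _ ≫ (D.res p').map ((D.resComp u' u).hom.app Y) ≫ (D.sqm β).app _ ≫
    (D.res q').map ((D.sqm α).app Y) = (D.sqm (vpaste α β)).app Y ≫ (D.resComp q' q).hom.app _ ≫
      (D.res q').map ((D.res q).map (𝟙 _))
  rw [Category.id_comp, h1, CategoryTheory.Functor.map_id, CategoryTheory.Functor.map_id]
  exact congrArg _ (Category.comp_id _).symm

/-- A square satisfying `InitCrit` is exact, by (Der2) and (Der4) for the squares pasted with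
points. -/
theorem IsDerivator.exL (hD : D.IsDerivator) {p : J ⥤ A} {u : A ⥤ B} {q : J ⥤ K} {v : K ⥤ B}
    (α : p ⋙ u ⟶ q ⋙ v) (h : InitCrit α) : ExL (D.sqm α) := by
  have := hD.der3_left q
  refine ExL.of_isIso fun X Y η hη W θ hθ g hg => hD.der2 _ g fun k => ?_
  exact (D.sqm_toPt_exL hD q k).isIso_of_paste
    (D.exL_pasteSq_iff α (toPt q k) (D.exL_of_init_one hD _ (h.hpaste_toPt k))) hη hθ hg

theorem IsDerivator.exR (hD : D.IsDerivator) {p : J ⥤ A} {u : A ⥤ B} {q : J ⥤ K} {v : K ⥤ B}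
    (α : p ⋙ u ⟶ q ⋙ v) (h : TermCrit α) : ExR (D.sqm α) := by
  have := hD.der3_right p
  refine ExR.of_isIso fun X Y η hη W θ hθ g hg => hD.der2 _ g fun a => ?_
  exact (D.sqm_fromPt_exR hD p a).isIso_of_vpaste
    (D.exR_vpasteSq_iff α (fromPt p a) (D.exR_of_term_one hD _ (h.vpaste_fromPt a))) hη hθ hg

/-- There is exactly one morphism between any two diagrams of empty shape, by (Der1). -/
theorem IsDerivator.empty (hD : D.IsDerivator) [IsEmpty A] (X Y : D.val A) :
    Nonempty (Unique (X ⟶ Y)) := by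
  have h := hD.der1 Empty (fun _ => One)
  let S := Σ _ : Empty, One
  let w : S ⥤ A :=
    { obj := fun x => x.1.elim
      map := fun {x} => x.1.elim
      map_id := fun x => x.1.elim
      map_comp := fun {x} => x.1.elim }
  let w' : A ⥤ S :=
    { obj := fun x => isEmptyElim x
      map := fun {x} => isEmptyElim x
      map_id := fun x => isEmptyElim x
      map_comp := fun {x} => isEmptyElim x }
  let e : D.res w' ⋙ D.res w ≅ 𝟭 _ := (D.resComp w w').symm ≪≫
    D.resIso (NatIso.ofComponents (fun x => x.1.elim) (fun {x} => x.1.elim)) ≪≫ D.resId _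
  let e' : D.res w ⋙ D.res w' ≅ 𝟭 _ := (D.resComp w' w).symm ≪≫
    D.resIso (NatIso.ofComponents (fun x => isEmptyElim x) (fun {x} => isEmptyElim x)) ≪≫ D.resId _
  let E := CategoryTheory.Equivalence.mk (D.res w) (D.res w') e'.symm e
  let F := Functor.pi' fun i => D.res (CategoryTheory.Sigma.incl (C := fun _ : Empty => One) i)
  let G := E.functor ⋙ F
  have hG : G.IsEquivalence := inferInstance
  have e₀ := (Functor.FullyFaithful.ofFullyFaithful G).homEquiv (X := X) (Y := Y)
  have : Unique (G.obj X ⟶ G.obj Y) := ⟨⟨fun i => i.elim⟩, fun f => funext fun i => i.elim⟩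
  exact ⟨e₀.unique⟩

theorem IsDerivator.isKan (hD : D.IsDerivator) : D.IsKan where
  isIso := fun f h => hD.der2 _ f h
  left := hD.der3_left
  right := hD.der3_right
  init := fun α h => hD.exL D α h
  term := fun α h => hD.exR D α h
  empty := fun X Y => hD.empty D X Y

end Squares

end

end Der.Prederivator

namespace Der.Prederivator

noncomputable section

/-! ### Shifted prederivators -/

section Shift

variable {D : Prederivator.{v, u}} {A B J K L : Type} [SmallCategory A] [SmallCategory B]
  [SmallCategory J] [SmallCategory K] [SmallCategory L]

def prodComp (B : Type) [SmallCategory B] (p : J ⥤ A) (q : A ⥤ K) :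
    (𝟭 B).prod (p ⋙ q) ≅ (𝟭 B).prod p ⋙ (𝟭 B).prod q :=
  NatIso.ofComponents (fun _ => Iso.refl _) (map_comp_id_eq ((𝟭 B).prod (p ⋙ q)))

/-- The product of a square of functors with an identity functor. -/
def prodSq (B : Type) [SmallCategory B] {A' : Type} [SmallCategory A'] {p : J ⥤ A} {u : A ⥤ A'}
    {q : J ⥤ K} {v : K ⥤ A'} (α : p ⋙ u ⟶ q ⋙ v) :
    (𝟭 B).prod p ⋙ (𝟭 B).prod u ⟶ (𝟭 B).prod q ⋙ (𝟭 B).prod v :=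
  (prodComp B p u).inv ≫ NatTrans.prod (𝟙 (𝟭 B)) α ≫ (prodComp B q v).hom

theorem prodSq_app {A' : Type} [SmallCategory A'] {p : J ⥤ A} {u : A ⥤ A'}
    {q : J ⥤ K} {v : K ⥤ A'} (α : p ⋙ u ⟶ q ⋙ v) (x : B × J) :
    (prodSq B α).app x = (𝟙 x.1, α.app x.2) := by
  change 𝟙 _ ≫ _ ≫ 𝟙 _ = _
  rw [Category.id_comp, Category.comp_id]
  rfl

theorem sqm_prodSq_app {A' : Type} [SmallCategory A'] {p : J ⥤ A} {u : A ⥤ A'}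
    {q : J ⥤ K} {v : K ⥤ A'} (α : p ⋙ u ⟶ q ⋙ v) (X : D.val (B × A')) :
    (D.sqm (prodSq B α)).app X =
      ((D.resComp _ _).inv.app X ≫ (D.resTrans (prodComp B p u).inv).app X) ≫
      (D.resTrans (NatTrans.prod (𝟙 (𝟭 B)) α)).app X ≫ (D.resTrans (prodComp B q v).hom).app X ≫
      (D.resComp _ _).hom.app X := by
  rw [sqm_app, prodSq, resTrans_comp_app, resTrans_comp_app]
  simp only [Category.assoc]

/-- The squares of a shifted prederivator are squares of the original one, which makes exactness
pass to the shift. -/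
theorem shift_sqm {A' : Type} [SmallCategory A'] {p : J ⥤ A} {u : A ⥤ A'}
    {q : J ⥤ K} {v : K ⥤ A'} (α : p ⋙ u ⟶ q ⋙ v) :
    (D.shift B).sqm α = D.sqm (prodSq B α) :=
  NatTrans.ext (funext fun X => (sqm_prodSq_app α X).symm)

theorem InitCrit.prodSq {A' : Type} [SmallCategory A'] {p : J ⥤ A} {u : A ⥤ A'}
    {q : J ⥤ K} {v : K ⥤ A'} {α : p ⋙ u ⟶ q ⋙ v} (h : InitCrit α) :
    InitCrit (Prederivator.prodSq B α) := by
  intro a k φ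
  obtain ⟨j, f, g, h1, h2⟩ := h a.2 k.2 φ.2
  refine ⟨(a.1, j), (𝟙 _, f), (φ.1, g), ?_, ?_⟩
  · rw [prodSq_app]
    refine Prod.ext ?_ h1
    change 𝟙 _ ≫ 𝟙 _ ≫ φ.1 = φ.1
    simp
  · intro j' f' g' h'
    rw [prodSq_app] at h'
    obtain ⟨m, ⟨hm1, hm2⟩, hm⟩ := h2 j'.2 f'.2 g'.2 (congrArg Prod.snd h')
    have h3 : f'.1 ≫ 𝟙 _ ≫ g'.1 = φ.1 := congrArg Prod.fst h'
    rw [Category.id_comp] at h3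
    refine ⟨(f'.1, m), ⟨Prod.ext (Category.id_comp _) hm1, Prod.ext h3 hm2⟩, ?_⟩
    rintro ⟨m₁, m₂⟩ ⟨h4, h5⟩
    exact Prod.ext ((Category.id_comp _).symm.trans (congrArg Prod.fst h4))
      (hm m₂ ⟨congrArg Prod.snd h4, congrArg Prod.snd h5⟩)

theorem TermCrit.prodSq {A' : Type} [SmallCategory A'] {p : J ⥤ A} {u : A ⥤ A'}
    {q : J ⥤ K} {v : K ⥤ A'} {α : p ⋙ u ⟶ q ⋙ v} (h : TermCrit α) :
    TermCrit (Prederivator.prodSq B α) := by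
  intro a k φ
  obtain ⟨j, f, g, h1, h2⟩ := h a.2 k.2 φ.2
  refine ⟨(k.1, j), (φ.1, f), (𝟙 _, g), ?_, ?_⟩
  · rw [prodSq_app]
    refine Prod.ext ?_ h1
    change φ.1 ≫ 𝟙 _ ≫ 𝟙 _ = φ.1
    simp
  · intro j' f' g' h'
    rw [prodSq_app] at h'
    obtain ⟨m, ⟨hm1, hm2⟩, hm⟩ := h2 j'.2 f'.2 g'.2 (congrArg Prod.snd h')
    have h3 : f'.1 ≫ 𝟙 _ ≫ g'.1 = φ.1 := congrArg Prod.fst h'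
    rw [Category.id_comp] at h3
    refine ⟨(g'.1, m), ⟨Prod.ext h3 hm1, Prod.ext (Category.comp_id _) hm2⟩, ?_⟩
    rintro ⟨m₁, m₂⟩ ⟨h4, h5⟩
    exact Prod.ext ((Category.comp_id _).symm.trans (congrArg Prod.fst h5))
      (hm m₂ ⟨congrArg Prod.snd h4, congrArg Prod.snd h5⟩)

theorem isIso_map_of_iso {𝓐 𝓑 : Type*} [Category* 𝓐] [Category* 𝓑] {F G : 𝓐 ⥤ 𝓑} (e : F ≅ G)
    {X Y : 𝓐} (f : X ⟶ Y) (h : IsIso (F.map f)) : IsIso (G.map f) := by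
  rw [← NatIso.naturality_1 e f]
  infer_instance

/-- Isomorphisms are detected by a family of functors which is surjective on points. -/
theorem IsKan.isIso_of_cover (hD : D.IsKan) {ι : Type*} {C' : ι → Type} [∀ i, SmallCategory (C' i)]
    (w : ∀ i, C' i ⥤ A) (hw : ∀ a, ∃ i c, (w i).obj c = a) {X Y : D.val A} (f : X ⟶ Y)
    (h : ∀ i, IsIso ((D.res (w i)).map f)) : IsIso f := by
  refine hD.isIso f fun a => ?_
  obtain ⟨i, c, rfl⟩ := hw a
  have h1 := h i
  have h2 : IsIso ((D.evalAt c).map ((D.res (w i)).map f)) := inferInstance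
  let e : Functor.fromPUnit.{0} c ⋙ w i ≅ Functor.fromPUnit.{0} ((w i).obj c) :=
    NatIso.ofComponents (fun _ => Iso.refl _) (fun _ => by simp)
  exact isIso_map_of_iso ((D.resComp _ _).symm ≪≫ D.resIso e) f h2

theorem IsKan.shift (hD : D.IsKan) (B : Type) [SmallCategory B] : (D.shift B).IsKan where
  isIso {A _ X Y} f h := by
    refine hD.isIso_of_cover (fun a : A => (𝟭 B).prod (Functor.fromPUnit.{0} a))
      (fun x => ⟨x.2, (x.1, ⟨PUnit.unit⟩), rfl⟩) f h
  left u := hD.left ((𝟭 B).prod u)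
  right u := hD.right ((𝟭 B).prod u)
  init α h := by
    rw [shift_sqm]
    exact hD.init _ h.prodSq
  term α h := by
    rw [shift_sqm]
    exact hD.term _ h.prodSq
  empty {A _ _} X Y := hD.empty (A := B × A) X Y

theorem isIso_leftMate {E F : Prederivator.{v, u}} (φ : E ⟶ F) (L : ∀ K, F.obj K ⥤ E.obj K)
    (adj : ∀ K, L K ⊣ fn φ K) {K K'} (f : K ⟶ K') (h : ExL (nt φ f).inv) :
    IsIso (leftMate φ L adj f) := by
  refine @NatIso.isIso_of_isIso_app _ _ _ _ _ _ _ fun Y => ?_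
  refine (UnivL.of_adj (adj K') _).isIso ?_
  exact cast (congrArg (UnivL _) (unit_leftMate φ L adj f Y).symm) (h _ (UnivL.of_adj (adj K) Y))

theorem isIso_rightMate {E F : Prederivator.{v, u}} (φ : E ⟶ F) (R : ∀ K, F.obj K ⥤ E.obj K)
    (adj : ∀ K, fn φ K ⊣ R K) {K K'} (f : K ⟶ K') (h : ExR (nt φ f).hom) :
    IsIso (rightMate φ R adj f) := by
  refine @NatIso.isIso_of_isIso_app _ _ _ _ _ _ _ fun Y => ?_
  refine (UnivR.of_adj (adj K') _).isIso ?_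
  exact cast (congrArg (UnivR _) (rightMate_counit φ R adj f Y).symm) (h _ (UnivR.of_adj (adj K) Y))

/-- A componentwise right adjoint is a right adjoint if its naturality squares are exact. -/
theorem isRightAdjoint_of_exL {E F : Prederivator.{v, u}} (φ : E ⟶ F)
    (h : ∀ K, (fn φ K).IsRightAdjoint) (h' : ∀ {K K'} (f : K ⟶ K'), ExL (nt φ f).inv) :
    Bicategory.IsRightAdjoint φ :=
  isRightAdjoint_of_mates φ _ (fun K => Adjunction.ofIsRightAdjoint (fn φ K))
    (fun f => isIso_leftMate φ _ _ f (h' f))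

theorem isLeftAdjoint_of_exR {E F : Prederivator.{v, u}} (φ : E ⟶ F)
    (h : ∀ K, (fn φ K).IsLeftAdjoint) (h' : ∀ {K K'} (f : K ⟶ K'), ExR (nt φ f).hom) :
    Bicategory.IsLeftAdjoint φ :=
  isLeftAdjoint_of_mates φ _ (fun K => Adjunction.ofIsLeftAdjoint (fn φ K))
    (fun f => isIso_rightMate φ _ _ f (h' f))

/-- A square is exact if it is so after pasting with a family of exact squares which covers the
vertex `K`. -/
theorem IsKan.exL_of_cover (hD : D.IsKan) {p : J ⥤ A} {u : A ⥤ B}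
    {q : J ⥤ K} {v : K ⥤ B} (α : p ⋙ u ⟶ q ⋙ v) {ι : Type*} {J' K' : ι → Type}
    [∀ i, SmallCategory (J' i)] [∀ i, SmallCategory (K' i)]
    {p' : ∀ i, J' i ⥤ J} {q' : ∀ i, J' i ⥤ K' i} {v' : ∀ i, K' i ⥤ K}
    (β : ∀ i, p' i ⋙ q ⟶ q' i ⋙ v' i) (hv : ∀ k, ∃ i c, (v' i).obj c = k)
    (h : ∀ i, InitCrit (β i)) (h' : ∀ i, InitCrit (hpaste α (β i))) : ExL (D.sqm α) := by
  have := hD.left q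
  refine ExL.of_isIso fun X Y η hη W θ hθ g hg => hD.isIso_of_cover v' hv g fun i => ?_
  exact (hD.init _ (h i)).isIso_of_paste
    (D.exL_pasteSq_iff α (β i) (hD.init _ (h' i))) hη hθ hg

theorem IsKan.exR_of_cover (hD : D.IsKan) {p : J ⥤ A} {u : A ⥤ B}
    {q : J ⥤ K} {v : K ⥤ B} (α : p ⋙ u ⟶ q ⋙ v) {ι : Type*} {J' K' : ι → Type}
    [∀ i, SmallCategory (J' i)] [∀ i, SmallCategory (K' i)]
    {q' : ∀ i, J' i ⥤ J} {p' : ∀ i, J' i ⥤ K' i} {u' : ∀ i, K' i ⥤ A}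
    (β : ∀ i, p' i ⋙ u' i ⟶ q' i ⋙ p) (hu : ∀ k, ∃ i c, (u' i).obj c = k)
    (h : ∀ i, TermCrit (β i)) (h' : ∀ i, TermCrit (vpaste α (β i))) : ExR (D.sqm α) := by
  have := hD.right p
  refine ExR.of_isIso fun X Y η hη W θ hθ g hg => hD.isIso_of_cover u' hu g fun i => ?_
  exact (hD.term _ (h i)).isIso_of_vpaste
    (D.exR_vpasteSq_iff α (β i) (hD.term _ (h' i))) hη hθ hg

/-- The naturality square of the product with a functor. -/
def restrSq (u : A ⥤ B) (f : L ⥤ K) :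
    (𝟭 A).prod f ⋙ u.prod (𝟭 K) ≅ u.prod (𝟭 L) ⋙ (𝟭 B).prod f :=
  NatIso.ofComponents (fun _ => Iso.refl _) (map_comp_id_eq (u.prod f))

theorem nt_restr_inv (u : A ⥤ B) (f : L ⥤ K) :
    (nt (D.restr u) f.toCatHom.op).inv = D.sqm (restrSq u f).hom :=
  NatTrans.ext (funext fun _ => Category.assoc _ _ _)

/-- The square of sections of a product with a functor. -/
def sectSq (u : A ⥤ B) (l : L) :
    CategoryTheory.Prod.sectL A l ⋙ u.prod (𝟭 L) ≅ u ⋙ CategoryTheory.Prod.sectL B l :=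
  NatIso.ofComponents (fun _ => Iso.refl _) (fun _ => map_comp_id_eq
    (u ⋙ CategoryTheory.Prod.sectL B l) _)

theorem initCrit_sectSq (u : A ⥤ B) (l : L) : InitCrit (sectSq u l).hom := by
  rintro ⟨a, l'⟩ k ⟨φ₁, φ₂⟩
  change u.obj a ⟶ k at φ₁
  change l' ⟶ l at φ₂
  refine ⟨a, (𝟙 a, φ₂), φ₁, ?_, ?_⟩
  · refine Prod.ext ?_ ?_
    · change u.map (𝟙 a) ≫ 𝟙 (u.obj a) ≫ φ₁ = φ₁
      simp
    · change φ₂ ≫ 𝟙 l ≫ 𝟙 l = φ₂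
      simp
  · rintro j ⟨f₁, f₂⟩ g h'
    change a ⟶ j at f₁
    change l' ⟶ l at f₂
    have h1 : u.map f₁ ≫ 𝟙 (u.obj j) ≫ g = φ₁ := congrArg Prod.fst h'
    have h2 : f₂ ≫ 𝟙 l ≫ 𝟙 l = φ₂ := congrArg Prod.snd h'
    simp only [Category.id_comp, Category.comp_id] at h1 h2
    refine ⟨f₁, ⟨Prod.ext (Category.id_comp f₁) ?_, h1⟩, fun m hm => ?_⟩
    · exact (Category.comp_id φ₂).trans h2.symm
    · exact (Category.id_comp m).symm.trans (congrArg Prod.fst hm.1)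

theorem termCrit_sectSq (u : A ⥤ B) (l : L) : TermCrit (sectSq u l).inv := by
  rintro b ⟨a, l'⟩ ⟨φ₁, φ₂⟩
  change b ⟶ u.obj a at φ₁
  change l ⟶ l' at φ₂
  refine ⟨a, φ₁, (𝟙 a, φ₂), ?_, ?_⟩
  · refine Prod.ext ?_ ?_
    · change φ₁ ≫ 𝟙 (u.obj a) ≫ u.map (𝟙 a) = φ₁
      simp
    · change 𝟙 l ≫ 𝟙 l ≫ φ₂ = φ₂
      simp
  · rintro j g ⟨f₁, f₂⟩ h'
    change j ⟶ a at f₁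
    change l ⟶ l' at f₂
    have h1 : g ≫ 𝟙 (u.obj j) ≫ u.map f₁ = φ₁ := congrArg Prod.fst h'
    have h2 : 𝟙 l ≫ 𝟙 l ≫ f₂ = φ₂ := congrArg Prod.snd h'
    simp only [Category.id_comp] at h1 h2
    refine ⟨f₁, ⟨h1, Prod.ext (Category.comp_id f₁) ?_⟩, fun m hm => ?_⟩
    · exact (Category.id_comp φ₂).trans h2.symm
    · exact (Category.comp_id m).symm.trans (congrArg Prod.fst hm.2)

/-- The Kan extensions of diagrams with parameters are compatible with change of parameters; this
makes the left adjoint of a restriction morphism a morphism of prederivators. -/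
theorem IsKan.exL_restrSq (hD : D.IsKan) (u : A ⥤ B) (f : L ⥤ K) :
    ExL (D.sqm (restrSq u f).hom) := by
  refine hD.exL_of_cover (restrSq u f).hom (p' := fun l : L => CategoryTheory.Prod.sectL A l)
    (q' := fun _ => u) (v' := fun l => CategoryTheory.Prod.sectL B l)
    (fun l => (sectSq u l).hom)
    (fun x => ⟨x.2, x.1, rfl⟩) (fun l => initCrit_sectSq u l) ?_
  · rintro l ⟨a, l'⟩ k ⟨φ₁, φ₂⟩
    change u.obj a ⟶ k at φ₁
    change l' ⟶ f.obj l at φ₂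
    refine ⟨a, (𝟙 a, φ₂), φ₁, ?_, ?_⟩
    · refine Prod.ext ?_ ?_
      · change u.map (𝟙 a) ≫ (𝟙 (u.obj a) ≫ 𝟙 (u.obj a)) ≫ φ₁ = φ₁
        simp
      · change φ₂ ≫ (𝟙 (f.obj l) ≫ f.map (𝟙 l)) ≫ f.map (𝟙 l) = φ₂
        simp
    · rintro j ⟨f₁, f₂⟩ g h'
      change a ⟶ j at f₁
      change l' ⟶ f.obj l at f₂
      have h1 : u.map f₁ ≫ (𝟙 (u.obj j) ≫ 𝟙 (u.obj j)) ≫ g = φ₁ := congrArg Prod.fst h'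
      have h2 : f₂ ≫ (𝟙 (f.obj l) ≫ f.map (𝟙 l)) ≫ f.map (𝟙 l) = φ₂ := congrArg Prod.snd h'
      simp only [CategoryTheory.Functor.map_id, Category.id_comp, Category.comp_id] at h1 h2
      refine ⟨f₁, ⟨Prod.ext (Category.id_comp f₁) ?_, h1⟩, fun m hm => ?_⟩
      · change φ₂ ≫ f.map (𝟙 l) = f₂
        rw [CategoryTheory.Functor.map_id, Category.comp_id, h2]
      · exact (Category.id_comp m).symm.trans (congrArg Prod.fst hm.1)

theorem IsKan.exR_restrSq (hD : D.IsKan) (u : A ⥤ B) (f : L ⥤ K) :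
    ExR (D.sqm (restrSq u f).inv) := by
  refine hD.exR_of_cover (restrSq u f).inv (q' := fun l : L => CategoryTheory.Prod.sectL A l)
    (p' := fun _ => u) (u' := fun l => CategoryTheory.Prod.sectL B l)
    (fun l => (sectSq u l).inv)
    (fun x => ⟨x.2, x.1, rfl⟩) (fun l => termCrit_sectSq u l) ?_
  · rintro l b ⟨a, l'⟩ ⟨φ₁, φ₂⟩
    change b ⟶ u.obj a at φ₁
    change f.obj l ⟶ l' at φ₂
    refine ⟨a, φ₁, (𝟙 a, φ₂), ?_, ?_⟩
    · refine Prod.ext ?_ ?_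
      · change φ₁ ≫ (𝟙 (u.obj a) ≫ 𝟙 (u.obj a)) ≫ u.map (𝟙 a) = φ₁
        simp
      · change f.map (𝟙 l) ≫ (f.map (𝟙 l) ≫ 𝟙 (f.obj l)) ≫ φ₂ = φ₂
        simp
    · rintro j g ⟨f₁, f₂⟩ h'
      change j ⟶ a at f₁
      change f.obj l ⟶ l' at f₂
      have h1 : g ≫ (𝟙 (u.obj j) ≫ 𝟙 (u.obj j)) ≫ u.map f₁ = φ₁ := congrArg Prod.fst h'
      have h2 : f.map (𝟙 l) ≫ (f.map (𝟙 l) ≫ 𝟙 (f.obj l)) ≫ f₂ = φ₂ := congrArg Prod.snd h'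
      simp only [CategoryTheory.Functor.map_id, Category.id_comp] at h1 h2
      refine ⟨f₁, ⟨h1, Prod.ext (Category.comp_id f₁) ?_⟩, fun m hm => ?_⟩
      · change f.map (𝟙 l) ≫ φ₂ = f₂
        rw [CategoryTheory.Functor.map_id, Category.id_comp, h2]
      · exact (Category.comp_id m).symm.trans (congrArg Prod.fst hm.2)

/-- The naturality square of a section of a product. -/
def ptSq (b : B) (f : L ⥤ K) :
    f ⋙ CategoryTheory.Prod.sectR b K ≅ CategoryTheory.Prod.sectR b L ⋙ (𝟭 B).prod f :=
  NatIso.ofComponents (fun _ => Iso.refl _)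
    (map_comp_id_eq (f ⋙ CategoryTheory.Prod.sectR b _))

theorem nt_pt_inv (b : B) (f : L ⥤ K) :
    (nt (whisk (prodIdxPt b) D) f.toCatHom.op).inv = D.sqm (ptSq b f).hom :=
  NatTrans.ext (funext fun _ => Category.assoc _ _ _)

/-- The square of sections of a product over points of both factors. -/
def ptSectSq (b : B) (l : L) :
    Functor.fromPUnit.{0} l ⋙ CategoryTheory.Prod.sectR b L ≅
      Functor.fromPUnit.{0} b ⋙ CategoryTheory.Prod.sectL B l :=
  NatIso.ofComponents (fun _ => Iso.refl _) (fun _ => map_comp_id_eq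
    (Functor.fromPUnit.{0} (b, l)) _)

theorem initCrit_ptSectSq (b : B) (l : L) : InitCrit (ptSectSq b l).hom := by
  rintro l' k ⟨φ₁, φ₂⟩
  change b ⟶ k at φ₁
  change l' ⟶ l at φ₂
  refine ⟨⟨⟨⟩⟩, φ₂, φ₁, Prod.ext ?_ ?_, fun j f' g' h' =>
    ⟨𝟙 _, ⟨?_, ?_⟩, fun m hm => Subsingleton.elim _ _⟩⟩
  · change 𝟙 b ≫ 𝟙 b ≫ φ₁ = φ₁
    simp
  · change φ₂ ≫ 𝟙 l ≫ 𝟙 l = φ₂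
    simp
  · change l' ⟶ l at f'
    have h2 : f' ≫ 𝟙 l ≫ 𝟙 l = φ₂ := congrArg Prod.snd h'
    simp only [Category.comp_id] at h2
    exact (Category.comp_id φ₂).trans h2.symm
  · change b ⟶ k at g'
    have h2 : 𝟙 b ≫ 𝟙 b ≫ g' = φ₁ := congrArg Prod.fst h'
    simp only [Category.id_comp] at h2
    exact (Category.id_comp g').trans h2

theorem termCrit_ptSectSq (b : B) (l : L) : TermCrit (ptSectSq b l).inv := by
  rintro k l' ⟨φ₁, φ₂⟩
  change k ⟶ b at φ₁
  change l ⟶ l' at φ₂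
  refine ⟨⟨⟨⟩⟩, φ₁, φ₂, Prod.ext ?_ ?_, fun j f' g' h' =>
    ⟨𝟙 _, ⟨?_, ?_⟩, fun m hm => Subsingleton.elim _ _⟩⟩
  · change φ₁ ≫ 𝟙 b ≫ 𝟙 b = φ₁
    simp
  · change 𝟙 l ≫ 𝟙 l ≫ φ₂ = φ₂
    simp
  · change k ⟶ b at f'
    have h2 : f' ≫ 𝟙 b ≫ 𝟙 b = φ₁ := congrArg Prod.fst h'
    simp only [Category.comp_id] at h2
    exact (Category.comp_id f').trans h2
  · change l ⟶ l' at g'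
    have h2 : 𝟙 l ≫ 𝟙 l ≫ g' = φ₂ := congrArg Prod.snd h'
    simp only [Category.id_comp] at h2
    exact (Category.id_comp φ₂).trans h2.symm

/-- The analogue of `exL_restrSq` for evaluation at an object. -/
theorem IsKan.exL_ptSq (hD : D.IsKan) (b : B) (f : L ⥤ K) : ExL (D.sqm (ptSq b f).hom) := by
  refine hD.exL_of_cover (ptSq b f).hom (p' := fun l : L => Functor.fromPUnit.{0} l)
    (q' := fun _ => Functor.fromPUnit.{0} b) (v' := fun l => CategoryTheory.Prod.sectL B l)
    (fun l => (ptSectSq b l).hom)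
    (fun x => ⟨x.2, x.1, rfl⟩) (fun l => initCrit_ptSectSq b l) ?_
  · rintro l l' k ⟨φ₁, φ₂⟩
    change b ⟶ k at φ₁
    change l' ⟶ f.obj l at φ₂
    refine ⟨⟨⟨⟩⟩, φ₂, φ₁, Prod.ext ?_ ?_, fun j f' g' h' =>
      ⟨𝟙 _, ⟨?_, ?_⟩, fun m hm => Subsingleton.elim _ _⟩⟩
    · change 𝟙 b ≫ (𝟙 b ≫ 𝟙 b) ≫ φ₁ = φ₁
      simp
    · change φ₂ ≫ (𝟙 (f.obj l) ≫ f.map (𝟙 l)) ≫ f.map (𝟙 l) = φ₂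
      simp
    · change l' ⟶ f.obj l at f'
      have h2 : f' ≫ (𝟙 (f.obj l) ≫ f.map (𝟙 l)) ≫ f.map (𝟙 l) = φ₂ := congrArg Prod.snd h'
      simp only [CategoryTheory.Functor.map_id, Category.comp_id] at h2
      change φ₂ ≫ f.map (𝟙 l) = f'
      rw [CategoryTheory.Functor.map_id, Category.comp_id, h2]
    · change b ⟶ k at g'
      have h2 : 𝟙 b ≫ (𝟙 b ≫ 𝟙 b) ≫ g' = φ₁ := congrArg Prod.fst h'
      simp only [Category.id_comp] at h2
      exact (Category.id_comp g').trans h2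

theorem IsKan.exR_ptSq (hD : D.IsKan) (b : B) (f : L ⥤ K) : ExR (D.sqm (ptSq b f).inv) := by
  refine hD.exR_of_cover (ptSq b f).inv (q' := fun l : L => Functor.fromPUnit.{0} l)
    (p' := fun _ => Functor.fromPUnit.{0} b) (u' := fun l => CategoryTheory.Prod.sectL B l)
    (fun l => (ptSectSq b l).inv)
    (fun x => ⟨x.2, x.1, rfl⟩) (fun l => termCrit_ptSectSq b l) ?_
  · rintro l k l' ⟨φ₁, φ₂⟩
    change k ⟶ b at φ₁
    change f.obj l ⟶ l' at φ₂
    refine ⟨⟨⟨⟩⟩, φ₁, φ₂, Prod.ext ?_ ?_, fun j f' g' h' =>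
      ⟨𝟙 _, ⟨?_, ?_⟩, fun m hm => Subsingleton.elim _ _⟩⟩
    · change φ₁ ≫ (𝟙 b ≫ 𝟙 b) ≫ 𝟙 b = φ₁
      simp
    · change f.map (𝟙 l) ≫ (f.map (𝟙 l) ≫ 𝟙 (f.obj l)) ≫ φ₂ = φ₂
      simp
    · change k ⟶ b at f'
      have h2 : f' ≫ (𝟙 b ≫ 𝟙 b) ≫ 𝟙 b = φ₁ := congrArg Prod.fst h'
      simp only [Category.comp_id] at h2
      exact (Category.comp_id f').trans h2
    · change f.obj l ⟶ l' at g'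
      have h2 : f.map (𝟙 l) ≫ (f.map (𝟙 l) ≫ 𝟙 (f.obj l)) ≫ g' = φ₂ := congrArg Prod.snd h'
      simp only [CategoryTheory.Functor.map_id, Category.id_comp] at h2
      change f.map (𝟙 l) ≫ φ₂ = g'
      rw [CategoryTheory.Functor.map_id, Category.id_comp, h2]

theorem exL_of_isIso {𝓐 𝓑 : Type*} [Category* 𝓐] [Category* 𝓑] {G : 𝓑 ⥤ 𝓐}
    (s : 𝟭 𝓑 ⋙ G ⟶ G ⋙ 𝟭 𝓐) [IsIso s] : ExL s := by
  refine ExL.of_exists fun X => ⟨X, 𝟙 _, fun Z => ?_, fun Z => ?_⟩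
  · have h : (fun g : X ⟶ Z => 𝟙 X ≫ (𝟭 𝓑).map g) = id := funext fun g => Category.id_comp g
    exact cast (congrArg _ h.symm) Function.bijective_id
  · have h : (fun g : G.obj X ⟶ Z => (G.map (𝟙 X) ≫ s.app X) ≫ (𝟭 𝓐).map g) =
        (Iso.homFromEquiv (asIso (s.app X)) (Z := Z)).symm := by
      funext g
      simp
    exact cast (congrArg _ h.symm) (Iso.homFromEquiv (asIso (s.app X)) (Z := Z)).symm.bijective

theorem exR_of_isIso {𝓐 𝓑 : Type*} [Category* 𝓐] [Category* 𝓑] {G : 𝓑 ⥤ 𝓐}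
    (s : G ⋙ 𝟭 𝓐 ⟶ 𝟭 𝓑 ⋙ G) [IsIso s] : ExR s := by
  refine ExR.of_exists fun X => ⟨X, 𝟙 _, fun Z => ?_, fun Z => ?_⟩
  · have h : (fun g : Z ⟶ X => (𝟭 𝓑).map g ≫ 𝟙 X) = id := funext fun g => Category.comp_id g
    exact cast (congrArg _ h.symm) Function.bijective_id
  · have h : (fun g : Z ⟶ G.obj X => (𝟭 𝓐).map g ≫ s.app X ≫ G.map (𝟙 X)) =
        (Iso.homToEquiv (asIso (s.app X)) (Z := Z)) := by
      funext g
      simp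
    exact cast (congrArg _ h.symm) (Iso.homToEquiv (asIso (s.app X)) (Z := Z)).bijective

theorem isRightAdjoint_unitTrans (D : Prederivator.{v, u}) :
    Bicategory.IsRightAdjoint (unitTrans D) :=
  isRightAdjoint_of_exL _ (fun K => (inferInstance : (𝟭 (D.obj K)).IsRightAdjoint))
    (fun f => @exL_of_isIso _ _ _ _ (rs D f) _ (nt (unitTrans D) f).isIso_inv)

theorem isLeftAdjoint_unitTrans (D : Prederivator.{v, u}) :
    Bicategory.IsLeftAdjoint (unitTrans D) :=
  isLeftAdjoint_of_exR _ (fun K => (inferInstance : (𝟭 (D.obj K)).IsLeftAdjoint))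
    (fun f => @exR_of_isIso _ _ _ _ (rs D f) _ (nt (unitTrans D) f).isIso_hom)

/-- Restriction and evaluation morphisms have both adjoints. -/
theorem IsKan.hasKan (hD : D.IsKan) : D.HasKan where
  left u := isRightAdjoint_of_exL _ (fun K => hD.left (u.prod (𝟭 K.unop))) fun f =>
    cast (congrArg ExL (nt_restr_inv u f.unop.toFunctor).symm) (hD.exL_restrSq u f.unop.toFunctor)
  right u := isLeftAdjoint_of_exR _ (fun K => hD.right (u.prod (𝟭 K.unop))) fun f =>
    hD.exR_restrSq u f.unop.toFunctor
  left_pt b := by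
    have h1 : Bicategory.IsRightAdjoint (whisk (prodIdxPt b) D) :=
      isRightAdjoint_of_exL _ (fun K => hD.left (CategoryTheory.Prod.sectR b K.unop)) fun f =>
        cast (congrArg ExL (nt_pt_inv b f.unop.toFunctor).symm) (hD.exL_ptSq b f.unop.toFunctor)
    have h2 := isRightAdjoint_unitTrans D
    exact Bicategory.IsRightAdjoint.mk
      ((Bicategory.Adjunction.ofIsRightAdjoint (unitTrans D)).comp
        (Bicategory.Adjunction.ofIsRightAdjoint (whisk (prodIdxPt b) D)))
  right_pt b := by
    have h1 : Bicategory.IsLeftAdjoint (whisk (prodIdxPt b) D) :=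
      isLeftAdjoint_of_exR _ (fun K => hD.right (CategoryTheory.Prod.sectR b K.unop)) fun f =>
        hD.exR_ptSq b f.unop.toFunctor
    have h2 := isLeftAdjoint_unitTrans D
    exact Bicategory.IsLeftAdjoint.mk
      ((Bicategory.Adjunction.ofIsLeftAdjoint (whisk (prodIdxPt b) D)).comp
        (Bicategory.Adjunction.ofIsLeftAdjoint (unitTrans D)))

end Shift

end

end Der.Prederivator

namespace Der.Prederivator

noncomputable section

/-! ### Kan extended diagrams -/

section Ext

variable {D : Prederivator.{v, u}} {S S' T J K : Type} [SmallCategory S] [SmallCategory S']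
  [SmallCategory T] [SmallCategory J] [SmallCategory K]

variable (D) in
/-- The diagram `Y` is a left Kan extension of its restriction along `u`. -/
def LExt (u : S ⥤ T) (Y : D.val T) : Prop := UnivL (D.res u) (𝟙 ((D.res u).obj Y))

variable (D) in
/-- The diagram `Y` is a right Kan extension of its restriction along `u`. -/
def RExt (u : S ⥤ T) (Y : D.val T) : Prop := UnivR (D.res u) (𝟙 ((D.res u).obj Y))

instance {p : J ⥤ S} {u : S ⥤ T} {q : J ⥤ K} {v : K ⥤ T} (α : p ⋙ u ⟶ q ⋙ v) [IsIso α]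
    (Y : D.val T) : IsIso ((D.sqm α).app Y) := by
  rw [sqm_app]
  infer_instance

/-- Restriction along an exact square preserves left Kan extended diagrams. -/
theorem IsKan.lExt_res (hD : D.IsKan) {p : J ⥤ S} {u : S ⥤ T} {q : J ⥤ K} {v : K ⥤ T}
    (α : p ⋙ u ⟶ q ⋙ v) [IsIso α] (h : InitCrit α) {Y : D.val T} (hY : D.LExt u Y) :
    D.LExt q ((D.res v).obj Y) := by
  refine cast (congrArg (UnivL _) ?_)
    ((hD.init α h _ hY).iso_comp (CategoryTheory.inv ((D.sqm α).app Y)))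
  rw [CategoryTheory.Functor.map_id]
  refine (congrArg _ (Category.id_comp _)).trans (IsIso.inv_hom_id _)

theorem IsKan.rExt_res (hD : D.IsKan) {p : J ⥤ S} {u : S ⥤ T} {q : J ⥤ K} {v : K ⥤ T}
    (α : p ⋙ u ⟶ q ⋙ v) [IsIso α] (h : TermCrit α) {Y : D.val T} (hY : D.RExt v Y) :
    D.RExt p ((D.res u).obj Y) := by
  refine cast (congrArg (UnivR _) ?_)
    ((hD.term α h _ hY).comp_iso (CategoryTheory.inv ((D.sqm α).app Y)))
  rw [CategoryTheory.Functor.map_id]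
  refine (congrArg (· ≫ _) (Category.comp_id _)).trans (IsIso.hom_inv_id _)

theorem _root_.Der.UnivL.lExt {u : S ⥤ T} {X : D.val S} {Y : D.val T} {η : X ⟶ (D.res u).obj Y}
    (h : UnivL (D.res u) η) [IsIso η] : D.LExt u Y := by
  exact cast (congrArg (UnivL _) (IsIso.inv_hom_id η)) (h.iso_comp (CategoryTheory.inv η))

theorem _root_.Der.UnivR.rExt {u : S ⥤ T} {X : D.val S} {Y : D.val T} {η : (D.res u).obj Y ⟶ X}
    (h : UnivR (D.res u) η) [IsIso η] : D.RExt u Y := by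
  exact cast (congrArg (UnivR _) (IsIso.hom_inv_id η)) (h.comp_iso (CategoryTheory.inv η))

theorem LExt.univL {u : S ⥤ T} {X : D.val S} {Y : D.val T} (h : D.LExt u Y)
    (η : X ⟶ (D.res u).obj Y) [IsIso η] : UnivL (D.res u) η := by
  simpa using UnivL.iso_comp h η

theorem RExt.univR {u : S ⥤ T} {X : D.val S} {Y : D.val T} (h : D.RExt u Y)
    (η : (D.res u).obj Y ⟶ X) [IsIso η] : UnivR (D.res u) η := by
  simpa using UnivR.comp_iso h η

/-- A diagram is left Kan extended if it is so locally, on a family of exact squares covering `T`.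
-/
theorem IsKan.lExt_of_cover (hD : D.IsKan) {u : S ⥤ T} {Y : D.val T} {ι : Type*} {J K : ι → Type}
    [∀ i, SmallCategory (J i)] [∀ i, SmallCategory (K i)] {p : ∀ i, J i ⥤ S}
    {q : ∀ i, J i ⥤ K i} {v : ∀ i, K i ⥤ T} (α : ∀ i, p i ⋙ u ⟶ q i ⋙ v i) [∀ i, IsIso (α i)]
    (h : ∀ i, InitCrit (α i)) (hv : ∀ t, ∃ i c, (v i).obj c = t)
    (hY : ∀ i, D.LExt (q i) ((D.res (v i)).obj Y)) : D.LExt u Y := by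
  have := hD.left u
  obtain ⟨W, η, hη⟩ := exists_univL (D.res u) ((D.res u).obj Y)
  obtain ⟨g, hg⟩ := (hη Y).2 (𝟙 _)
  have : IsIso g := hD.isIso_of_cover v hv g fun i => by
    refine (hD.init (α i) (h i) η hη).isIso ?_
    refine cast (congrArg (UnivL _) ?_) ((hY i).univL ((D.sqm (α i)).app Y))
    have h1 := (D.sqm (α i)).naturality g
    dsimp at h1 hg ⊢
    rw [Category.assoc, ← h1, ← Functor.map_comp_assoc, hg]
    simp
  exact cast (congrArg (UnivL _) hg) (hη.comp_iso g)

theorem IsKan.rExt_of_cover (hD : D.IsKan) {v : K ⥤ T} {Y : D.val T} {ι : Type*} {J S : ι → Type}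
    [∀ i, SmallCategory (J i)] [∀ i, SmallCategory (S i)] {p : ∀ i, J i ⥤ S i}
    {q : ∀ i, J i ⥤ K} {u : ∀ i, S i ⥤ T} (α : ∀ i, p i ⋙ u i ⟶ q i ⋙ v) [∀ i, IsIso (α i)]
    (h : ∀ i, TermCrit (α i)) (hv : ∀ t, ∃ i c, (u i).obj c = t)
    (hY : ∀ i, D.RExt (p i) ((D.res (u i)).obj Y)) : D.RExt v Y := by
  have := hD.right v
  obtain ⟨W, η, hη⟩ := exists_univR (D.res v) ((D.res v).obj Y)
  obtain ⟨g, hg⟩ := (hη Y).2 (𝟙 _)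
  have : IsIso g := hD.isIso_of_cover u hv g fun i => by
    refine (hD.term (α i) (h i) η hη).isIso ?_
    refine cast (congrArg (UnivR _) ?_) ((hY i).univR ((D.sqm (α i)).app Y))
    have h1 := (D.sqm (α i)).naturality g
    dsimp at h1 hg ⊢
    rw [reassoc_of% h1, ← Functor.map_comp, hg]
    simp
  exact cast (congrArg (UnivR _) hg) (hη.iso_comp g)

theorem _root_.Der.UnivL.isIso_of_iso {𝓐 : Type*} [Category* 𝓐] {G : 𝓐 ⥤ 𝓐} (e : G ≅ 𝟭 𝓐) {X Y : 𝓐}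
    {η : X ⟶ G.obj Y} (h : UnivL G η) : IsIso η := by
  have h1 := h.congr e
  have h2 : UnivL (𝟭 𝓐) (X := X) (Y := X) (𝟙 X) := fun Z => by
    have : (fun g : X ⟶ Z => 𝟙 X ≫ (𝟭 𝓐).map g) = id := funext fun g => Category.id_comp g
    exact cast (congrArg _ this.symm) Function.bijective_id
  have h3 : IsIso (η ≫ e.hom.app Y) :=
    h2.isIso (cast (congrArg (UnivL (𝟭 𝓐)) (Category.id_comp _).symm) h1)
  exact IsIso.of_isIso_comp_right η (e.hom.app Y)

theorem _root_.Der.UnivR.isIso_of_iso {𝓐 : Type*} [Category* 𝓐] {G : 𝓐 ⥤ 𝓐} (e : G ≅ 𝟭 𝓐) {X Y : 𝓐}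
    {η : G.obj Y ⟶ X} (h : UnivR G η) : IsIso η := by
  have h1 := h.congr e
  have h2 : UnivR (𝟭 𝓐) (X := X) (Y := X) (𝟙 X) := fun Z => by
    have : (fun g : Z ⟶ X => (𝟭 𝓐).map g ≫ 𝟙 X) = id := funext fun g => Category.comp_id g
    exact cast (congrArg _ this.symm) Function.bijective_id
  have h3 : IsIso (e.inv.app Y ≫ η) :=
    h2.isIso (cast (congrArg (UnivR (𝟭 𝓐)) (Category.comp_id _).symm) h1)
  exact IsIso.of_isIso_comp_left (e.inv.app Y) η

/-- Left Kan extension along a fully faithful functor is fully faithful. -/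
theorem IsKan.isIso_of_univL (hD : D.IsKan) {u : S ⥤ T} [u.Full] [u.Faithful] {X : D.val S}
    {Y : D.val T} {η : X ⟶ (D.res u).obj Y} (h : UnivL (D.res u) η) : IsIso η := by
  let α : 𝟭 S ⋙ u ⟶ 𝟭 S ⋙ u := 𝟙 _
  have h1 : InitCrit α := fun a k φ => by
    refine ⟨a, 𝟙 a, u.preimage φ, ?_, fun j f g h' => ⟨f, ⟨Category.id_comp f, ?_⟩, fun m hm => ?_⟩⟩
    · change u.map (𝟙 a) ≫ 𝟙 (u.obj a) ≫ u.map (u.preimage φ) = φ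
      simp
    · have h2 : u.map f ≫ 𝟙 (u.obj j) ≫ u.map g = φ := h'
      refine u.map_injective ?_
      refine (u.map_comp _ _).trans ?_
      rw [u.map_preimage, ← h2]
      exact congrArg (u.map f ≫ ·) (Category.id_comp (u.map g)).symm
    · exact (Category.id_comp _).symm.trans hm.1
  have h2 := (hD.init α h1 η h).isIso_of_iso (D.resId S)
  have h3 : IsIso ((D.res (𝟭 S)).map η) := IsIso.of_isIso_comp_right _ ((D.sqm α).app Y)
  exact isIso_map_of_iso (D.resId S) η h3

/-- Right Kan extension along a fully faithful functor is fully faithful. -/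
theorem IsKan.isIso_of_univR (hD : D.IsKan) {u : S ⥤ T} [u.Full] [u.Faithful] {X : D.val S}
    {Y : D.val T} {η : (D.res u).obj Y ⟶ X} (h : UnivR (D.res u) η) : IsIso η := by
  let α : 𝟭 S ⋙ u ⟶ 𝟭 S ⋙ u := 𝟙 _
  have h1 : TermCrit α := fun a k φ => by
    refine ⟨k, u.preimage φ, 𝟙 k, ?_, fun j f g h' => ⟨g, ⟨?_, Category.comp_id g⟩, fun m hm => ?_⟩⟩
    · change u.map (u.preimage φ) ≫ 𝟙 (u.obj k) ≫ u.map (𝟙 k) = φ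
      simp
    · have h2 : u.map f ≫ 𝟙 (u.obj j) ≫ u.map g = φ := h'
      refine u.map_injective ?_
      refine (u.map_comp _ _).trans ?_
      rw [u.map_preimage, ← h2]
      exact congrArg (u.map f ≫ ·) (Category.id_comp (u.map g)).symm
    · exact (Category.comp_id _).symm.trans hm.2
  have h2 := (hD.term α h1 η h).isIso_of_iso (D.resId S)
  have h3 : IsIso ((D.res (𝟭 S)).map η) := IsIso.of_isIso_comp_left ((D.sqm α).app Y) _
  exact isIso_map_of_iso (D.resId S) η h3

theorem LExt.of_iso {u : S ⥤ T} {Y Z : D.val T} (h : D.LExt u Y) (g : Y ⟶ Z) [IsIso g] :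
    D.LExt u Z := by
  have := UnivL.comp_iso h g
  rw [Category.id_comp] at this
  exact this.lExt

theorem RExt.of_iso {u : S ⥤ T} {Y Z : D.val T} (h : D.RExt u Y) (g : Z ⟶ Y) [IsIso g] :
    D.RExt u Z := by
  have := UnivR.iso_comp h g
  rw [Category.comp_id] at this
  exact this.rExt

/-- A morphism of left Kan extended diagrams is invertible if it is so on the source of the
extension. -/
theorem LExt.isIso {u : S ⥤ T} {Y Z : D.val T} (hY : D.LExt u Y) (hZ : D.LExt u Z) (g : Y ⟶ Z)
    (hg : IsIso ((D.res u).map g)) : IsIso g :=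
  UnivL.isIso hY (cast (congrArg (UnivL _) (Category.id_comp _).symm)
    (hZ.univL ((D.res u).map g)))

theorem RExt.isIso {u : S ⥤ T} {Y Z : D.val T} (hY : D.RExt u Y) (hZ : D.RExt u Z) (g : Y ⟶ Z)
    (hg : IsIso ((D.res u).map g)) : IsIso g :=
  UnivR.isIso hZ (cast (congrArg (UnivR _) (Category.comp_id _).symm)
    (hY.univR ((D.res u).map g)))

theorem LExt.comp {u : S ⥤ S'} {i : S' ⥤ T} {Y : D.val T} (h : D.LExt u ((D.res i).obj Y))
    (h' : D.LExt i Y) : D.LExt (u ⋙ i) Y := by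
  have h1 : UnivL (D.res i ⋙ D.res u) (𝟙 ((D.res i ⋙ D.res u).obj Y)) := fun Z => by
    have h2 := (h ((D.res i).obj Z)).comp (h' Z)
    have h3 : (fun g : Y ⟶ Z => 𝟙 _ ≫ (D.res i ⋙ D.res u).map g) =
        (fun g => 𝟙 _ ≫ (D.res u).map g) ∘ fun g : Y ⟶ Z => 𝟙 _ ≫ (D.res i).map g := by
      funext g
      simp
    exact cast (congrArg _ h3.symm) h2
  have h2 := (h1.congr (D.resComp u i).symm)
  rw [Category.id_comp] at h2
  exact h2.lExt

theorem RExt.comp {u : S ⥤ S'} {i : S' ⥤ T} {Y : D.val T} (h : D.RExt u ((D.res i).obj Y))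
    (h' : D.RExt i Y) : D.RExt (u ⋙ i) Y := by
  have h1 : UnivR (D.res i ⋙ D.res u) (𝟙 ((D.res i ⋙ D.res u).obj Y)) := fun Z => by
    have h2 := (h ((D.res i).obj Z)).comp (h' Z)
    have h3 : (fun g : Z ⟶ Y => (D.res i ⋙ D.res u).map g ≫ 𝟙 _) =
        (fun g => (D.res u).map g ≫ 𝟙 _) ∘ fun g : Z ⟶ Y => (D.res i).map g ≫ 𝟙 _ := by
      funext g
      simp
    exact cast (congrArg _ h3.symm) h2
  have h2 := (h1.congr (D.resComp u i).symm)
  rw [Category.comp_id] at h2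
  exact h2.rExt

/-- A diagram which is left Kan extended from `S` is left Kan extended from every full subcategory
through which `S ⥤ T` factors. -/
theorem IsKan.lExt_of_comp (hD : D.IsKan) {u : S ⥤ S'} {i : S' ⥤ T} [i.Full] [i.Faithful]
    {Y : D.val T} (h : D.LExt (u ⋙ i) Y) : D.LExt i Y := by
  have := hD.left i
  obtain ⟨W, η, hη⟩ := exists_univL (D.res i) ((D.res i).obj Y)
  have h1 := hD.isIso_of_univL hη
  obtain ⟨g, hg⟩ := (hη Y).2 (𝟙 _)
  have hg' : η ≫ (D.res i).map g = 𝟙 _ := hg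
  have h2 : IsIso ((D.res i).map g) := by
    rw [← IsIso.inv_eq_of_hom_inv_id hg']
    infer_instance
  let α : 𝟭 S ⋙ (u ⋙ i) ⟶ u ⋙ i := 𝟙 (u ⋙ i)
  have hα : IsIso α := inferInstanceAs (IsIso (𝟙 (u ⋙ i)))
  have h3 : InitCrit α := fun a k φ => by
    change i.obj (u.obj a) ⟶ i.obj k at φ
    refine ⟨a, 𝟙 a, i.preimage φ, ?_, fun j f g h' => ⟨f, ⟨Category.id_comp f, ?_⟩, fun m hm => ?_⟩⟩
    · change i.map (u.map (𝟙 a)) ≫ 𝟙 (i.obj (u.obj a)) ≫ i.map (i.preimage φ) = φ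
      simp
    · have h2 : i.map (u.map f) ≫ 𝟙 (i.obj (u.obj j)) ≫ i.map g = φ := h'
      refine i.map_injective ?_
      refine (i.map_comp _ _).trans ?_
      rw [i.map_preimage, ← h2]
      exact congrArg (i.map (u.map f) ≫ ·) (Category.id_comp (i.map g)).symm
    · exact (Category.id_comp _).symm.trans hm.1
  have h4 := hD.lExt_res α h3 h
  have h5 := LExt.comp (h4.of_iso (CategoryTheory.inv ((D.res i).map g))) hη.lExt
  have h6 : IsIso ((D.res (u ⋙ i)).map g) :=
    isIso_map_of_iso (D.resComp u i).symm g (inferInstanceAs (IsIso ((D.res u).map _)))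
  have := h5.isIso h g h6
  exact hη.lExt.of_iso g

theorem IsKan.rExt_of_comp (hD : D.IsKan) {u : S ⥤ S'} {i : S' ⥤ T} [i.Full] [i.Faithful]
    {Y : D.val T} (h : D.RExt (u ⋙ i) Y) : D.RExt i Y := by
  have := hD.right i
  obtain ⟨W, η, hη⟩ := exists_univR (D.res i) ((D.res i).obj Y)
  have h1 := hD.isIso_of_univR hη
  obtain ⟨g, hg⟩ := (hη Y).2 (𝟙 _)
  have hg' : (D.res i).map g ≫ η = 𝟙 _ := hg
  have h2 : IsIso ((D.res i).map g) := by
    rw [← IsIso.inv_eq_of_inv_hom_id hg']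
    infer_instance
  let α : u ⋙ i ⟶ 𝟭 S ⋙ (u ⋙ i) := 𝟙 (u ⋙ i)
  have hα : IsIso α := inferInstanceAs (IsIso (𝟙 (u ⋙ i)))
  have h3 : TermCrit α := fun k a φ => by
    change i.obj k ⟶ i.obj (u.obj a) at φ
    refine ⟨a, i.preimage φ, 𝟙 a, ?_, fun j g f h' => ⟨f, ⟨?_, Category.comp_id f⟩, fun m hm => ?_⟩⟩
    · change i.map (i.preimage φ) ≫ 𝟙 (i.obj (u.obj a)) ≫ i.map (u.map (𝟙 a)) = φ
      simp
    · have h2 : i.map g ≫ 𝟙 (i.obj (u.obj j)) ≫ i.map (u.map f) = φ := h'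
      refine i.map_injective ?_
      refine (i.map_comp _ _).trans ?_
      rw [i.map_preimage, ← h2]
      exact congrArg (i.map g ≫ ·) (Category.id_comp (i.map (u.map f))).symm
    · exact (Category.comp_id _).symm.trans hm.2
  have h4 := hD.rExt_res α h3 h
  have h5 := RExt.comp (h4.of_iso (CategoryTheory.inv ((D.res i).map g))) hη.rExt
  have h6 : IsIso ((D.res (u ⋙ i)).map g) :=
    isIso_map_of_iso (D.resComp u i).symm g (inferInstanceAs (IsIso ((D.res u).map _)))
  have := h.isIso h5 g h6
  exact hη.rExt.of_iso g

theorem LExt.congr {u u' : S ⥤ T} (e : u ≅ u') {Y : D.val T} (h : D.LExt u Y) : D.LExt u' Y := by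
  have h1 := UnivL.congr (D.resIso e) h
  rw [Category.id_comp] at h1
  exact h1.lExt

theorem RExt.congr {u u' : S ⥤ T} (e : u ≅ u') {Y : D.val T} (h : D.RExt u Y) : D.RExt u' Y := by
  have h1 := UnivR.congr (D.resIso e) h
  rw [Category.comp_id] at h1
  exact h1.rExt

/-- Left Kan extensions from the empty category are initial objects. -/
theorem IsKan.lExt_empty_iff (hD : D.IsKan) [IsEmpty S] {u : S ⥤ T} {Y : D.val T} :
    D.LExt u Y ↔ ∀ Z, Nonempty (Unique (Y ⟶ Z)) := by
  refine ⟨fun h Z => ?_, fun h Z => ?_⟩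
  · obtain ⟨h1⟩ := hD.empty ((D.res u).obj Y) ((D.res u).obj Z)
    exact ⟨(Equiv.ofBijective _ (h Z)).unique⟩
  · obtain ⟨h1⟩ := hD.empty ((D.res u).obj Y) ((D.res u).obj Z)
    obtain ⟨h2⟩ := h Z
    exact ⟨fun _ _ _ => Subsingleton.elim _ _, fun f => ⟨default, Subsingleton.elim _ _⟩⟩

theorem IsKan.rExt_empty_iff (hD : D.IsKan) [IsEmpty S] {u : S ⥤ T} {Y : D.val T} :
    D.RExt u Y ↔ ∀ Z, Nonempty (Unique (Z ⟶ Y)) := by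
  refine ⟨fun h Z => ?_, fun h Z => ?_⟩
  · obtain ⟨h1⟩ := hD.empty ((D.res u).obj Z) ((D.res u).obj Y)
    exact ⟨(Equiv.ofBijective _ (h Z)).unique⟩
  · obtain ⟨h1⟩ := hD.empty ((D.res u).obj Z) ((D.res u).obj Y)
    obtain ⟨h2⟩ := h Z
    exact ⟨fun _ _ _ => Subsingleton.elim _ _, fun f => ⟨default, Subsingleton.elim _ _⟩⟩

end Ext

/-! ### Diagrams on thin categories -/

section Thin

variable {D : Prederivator.{v, u}} {S T J K : Type} [SmallCategory S]
  [SmallCategory T] [SmallCategory J] [SmallCategory K]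

/-- For preorders, `InitCrit` asks for a least element of a set. -/
theorem initCrit_of_thin [Quiver.IsThin S] [Quiver.IsThin T] [Quiver.IsThin J] [Quiver.IsThin K]
    {p : J ⥤ S} {u : S ⥤ T} {q : J ⥤ K} {v : K ⥤ T} (α : p ⋙ u ⟶ q ⋙ v)
    (h : ∀ a k, Nonempty (u.obj a ⟶ v.obj k) → ∃ j, Nonempty (a ⟶ p.obj j) ∧
      Nonempty (q.obj j ⟶ k) ∧ ∀ j', Nonempty (a ⟶ p.obj j') → Nonempty (q.obj j' ⟶ k) →
        Nonempty (j ⟶ j')) : InitCrit α := by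
  intro a k φ
  obtain ⟨j, ⟨f⟩, ⟨g⟩, h'⟩ := h a k ⟨φ⟩
  refine ⟨j, f, g, Subsingleton.elim _ _, fun j' f' g' _ => ?_⟩
  obtain ⟨m⟩ := h' j' ⟨f'⟩ ⟨g'⟩
  exact ⟨m, ⟨Subsingleton.elim _ _, Subsingleton.elim _ _⟩, fun _ _ => Subsingleton.elim _ _⟩

theorem termCrit_of_thin [Quiver.IsThin S] [Quiver.IsThin T] [Quiver.IsThin J] [Quiver.IsThin K]
    {p : J ⥤ S} {u : S ⥤ T} {q : J ⥤ K} {v : K ⥤ T} (α : p ⋙ u ⟶ q ⋙ v)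
    (h : ∀ a k, Nonempty (u.obj a ⟶ v.obj k) → ∃ j, Nonempty (a ⟶ p.obj j) ∧
      Nonempty (q.obj j ⟶ k) ∧ ∀ j', Nonempty (a ⟶ p.obj j') → Nonempty (q.obj j' ⟶ k) →
        Nonempty (j' ⟶ j)) : TermCrit α := by
  intro a k φ
  obtain ⟨j, ⟨f⟩, ⟨g⟩, h'⟩ := h a k ⟨φ⟩
  refine ⟨j, f, g, Subsingleton.elim _ _, fun j' f' g' _ => ?_⟩
  obtain ⟨m⟩ := h' j' ⟨f'⟩ ⟨g'⟩
  exact ⟨m, ⟨Subsingleton.elim _ _, Subsingleton.elim _ _⟩, fun _ _ => Subsingleton.elim _ _⟩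

def thinIso [Quiver.IsThin T] {u v : S ⥤ T} (h : ∀ s, u.obj s = v.obj s) : u ≅ v :=
  NatIso.ofComponents (fun s => eqToIso (h s)) (fun _ => Subsingleton.elim _ _)

theorem full_of_thin [Quiver.IsThin T] {u : S ⥤ T}
    (h : ∀ a b, Nonempty (u.obj a ⟶ u.obj b) → Nonempty (a ⟶ b)) : u.Full :=
  ⟨fun {a b} f => ⟨(h a b ⟨f⟩).some, Subsingleton.elim _ _⟩⟩

theorem faithful_of_thin [Quiver.IsThin S] (u : S ⥤ T) : u.Faithful :=
  ⟨fun _ => Subsingleton.elim _ _⟩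

theorem sq_cases (s : Sq) : s = Sq.mk 0 0 ∨ s = Sq.mk 1 0 ∨ s = Sq.mk 0 1 ∨ s = Sq.mk 1 1 := by
  revert s; decide

theorem sq_bot_le (s : Sq) : Sq.mk 0 0 ≤ s := by
  revert s; decide

theorem sq_le_top (s : Sq) : s ≤ Sq.mk 1 1 := by
  revert s; decide

theorem span_cases (s : Span) : s = ⟨Sq.mk 0 0, by decide⟩ ∨ s = ⟨Sq.mk 1 0, by decide⟩ ∨
    s = ⟨Sq.mk 0 1, by decide⟩ := by
  revert s; decide

theorem cospan_cases (s : Cospan) : s = ⟨Sq.mk 1 1, by decide⟩ ∨ s = ⟨Sq.mk 1 0, by decide⟩ ∨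
    s = ⟨Sq.mk 0 1, by decide⟩ := by
  revert s; decide

instance : spanIncl.Full := full_of_thin fun _ _ ⟨f⟩ => ⟨homOfLE (leOfHom f)⟩
instance : cospanIncl.Full := full_of_thin fun _ _ ⟨f⟩ => ⟨homOfLE (leOfHom f)⟩
instance : spanIncl.Faithful := faithful_of_thin _
instance : cospanIncl.Faithful := faithful_of_thin _

theorem IsKan.isCocartesian_iff (hD : D.IsKan) (Q : D.val Sq) :
    D.IsCocartesian Q ↔ D.LExt spanIncl Q := by
  constructor
  · rintro ⟨l, adj, X, ⟨e⟩⟩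
    have h := UnivL.of_adj adj X
    have := hD.isIso_of_univL h
    exact h.lExt.of_iso e.hom
  · intro h
    have := hD.left spanIncl
    let adj := Adjunction.ofIsRightAdjoint (D.res spanIncl)
    have h1 := UnivL.of_adj adj ((D.res spanIncl).obj Q)
    obtain ⟨g, hg⟩ := (h1 Q).2 (𝟙 _)
    have : IsIso g := h1.isIso (cast (congrArg (UnivL _) hg.symm) h)
    exact ⟨_, adj, _, ⟨asIso g⟩⟩

theorem IsKan.isCartesian_iff (hD : D.IsKan) (Q : D.val Sq) :
    D.IsCartesian Q ↔ D.RExt cospanIncl Q := by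
  constructor
  · rintro ⟨l, adj, X, ⟨e⟩⟩
    have h := UnivR.of_adj adj X
    have := hD.isIso_of_univR h
    exact h.rExt.of_iso e.inv
  · intro h
    have := hD.right cospanIncl
    let adj := Adjunction.ofIsLeftAdjoint (D.res cospanIncl)
    have h1 := UnivR.of_adj adj ((D.res cospanIncl).obj Q)
    obtain ⟨g, hg⟩ := (h1 Q).2 (𝟙 _)
    have : IsIso g := h1.isIso (cast (congrArg (UnivR _) hg.symm) h)
    exact ⟨_, adj, _, ⟨(asIso g).symm⟩⟩

end Thin

section Detect

variable {D : Prederivator.{v, u}} {S T : Type} [SmallCategory S] [Preorder T]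

/-- Squares in a left Kan extended diagram are cocartesian if the span of the square is a meet and
contains what lies below the final vertex in the source of the Kan extension. -/
theorem IsKan.isCocartesian_res (hD : D.IsKan) {u : S ⥤ T} {Y : D.val T} (hY : D.LExt u Y)
    (k : Sq ⥤ T)
    (h₁ : ∀ x, x ≤ k.obj (Sq.mk 1 0) → x ≤ k.obj (Sq.mk 0 1) → x ≤ k.obj (Sq.mk 0 0))
    (h₂ : ∀ s, u.obj s ≤ k.obj (Sq.mk 1 1) →
      u.obj s ≤ k.obj (Sq.mk 1 0) ∨ u.obj s ≤ k.obj (Sq.mk 0 1)) :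
    D.IsCocartesian ((D.res k).obj Y) := by
  -- `Y` is left Kan extended from the union `S'` of the image of `u` with the points below the
  -- span, and the square formed by `Span ⥤ S'` and `Sq ⥤ T` is exact.
  let S' := {x : T // (∃ s, u.obj s = x) ∨ x ≤ k.obj (Sq.mk 1 0) ∨ x ≤ k.obj (Sq.mk 0 1)}
  let i : S' ⥤ T := mono (fun x => x.1) (fun _ _ h => h)
  let u' : S ⥤ S' :=
    { obj := fun s => ⟨u.obj s, Or.inl ⟨s, rfl⟩⟩
      map := fun f => homOfLE (leOfHom (u.map f)) }
  have : i.Full := full_of_thin fun _ _ ⟨f⟩ => ⟨homOfLE (leOfHom f)⟩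
  have : i.Faithful := faithful_of_thin _
  have h3 : D.LExt i Y := hD.lExt_of_comp (u := u') (hY.congr (thinIso fun _ => rfl))
  have hk : ∀ s : Span, k.obj s.1 ≤ k.obj (Sq.mk 1 0) ∨ k.obj s.1 ≤ k.obj (Sq.mk 0 1) := fun s =>
    (show s.1 ≤ Sq.mk 1 0 ∨ s.1 ≤ Sq.mk 0 1 by revert s; decide).imp
      (fun h => leOfHom (k.map (homOfLE h))) (fun h => leOfHom (k.map (homOfLE h)))
  let p : Span ⥤ S' := mono (fun s => ⟨k.obj s.1, Or.inr (hk s)⟩)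
    (fun _ _ h => leOfHom (k.map (homOfLE h)))
  rw [hD.isCocartesian_iff]
  refine hD.lExt_res (p := p) (u := i) (q := spanIncl) (v := k)
    (thinIso (u := p ⋙ i) (v := spanIncl ⋙ k) fun _ => rfl).hom (initCrit_of_thin _ ?_) h3
  rintro ⟨a, ha⟩ s ⟨f⟩
  have f : a ≤ k.obj s := leOfHom f
  suffices h : ∃ j : Span, a ≤ k.obj j.1 ∧ j.1 ≤ s ∧ ∀ j' : Span, a ≤ k.obj j'.1 → j'.1 ≤ s →
      j.1 ≤ j'.1 by
    obtain ⟨j, h1, h2, h3⟩ := h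
    exact ⟨j, ⟨homOfLE h1⟩, ⟨homOfLE h2⟩, fun j' h4 h5 =>
      ⟨homOfLE (h3 j' (leOfHom h4.some) (leOfHom h5.some))⟩⟩
  by_cases h00 : a ≤ k.obj (Sq.mk 0 0)
  · exact ⟨⟨Sq.mk 0 0, by decide⟩, h00, sq_bot_le s, fun j' _ _ => sq_bot_le j'.1⟩
  by_cases h10 : a ≤ k.obj (Sq.mk 1 0)
  · have h01 : ¬ a ≤ k.obj (Sq.mk 0 1) := fun h => h00 (h₁ a h10 h)
    refine ⟨⟨Sq.mk 1 0, by decide⟩, h10, ?_, fun j' h h' => ?_⟩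
    · rcases sq_cases s with rfl | rfl | rfl | rfl
      exacts [absurd f h00, le_refl _, absurd f h01, by decide]
    · rcases span_cases j' with rfl | rfl | rfl
      exacts [absurd h h00, le_refl _, absurd h h01]
  by_cases h01 : a ≤ k.obj (Sq.mk 0 1)
  · refine ⟨⟨Sq.mk 0 1, by decide⟩, h01, ?_, fun j' h h' => ?_⟩
    · rcases sq_cases s with rfl | rfl | rfl | rfl
      exacts [absurd f h00, absurd f h10, le_refl _, by decide]
    · rcases span_cases j' with rfl | rfl | rfl
      exacts [absurd h h00, absurd h h10, le_refl _]
  exfalso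
  rcases sq_cases s with rfl | rfl | rfl | rfl
  · exact h00 f
  · exact h10 f
  · exact h01 f
  · rcases ha with ⟨s, rfl⟩ | h | h
    exacts [(h₂ s (leOfHom f)).elim h10 h01, h10 h, h01 h]

theorem IsKan.isCartesian_res (hD : D.IsKan) {u : S ⥤ T} {Y : D.val T} (hY : D.RExt u Y)
    (k : Sq ⥤ T)
    (h₁ : ∀ x, k.obj (Sq.mk 1 0) ≤ x → k.obj (Sq.mk 0 1) ≤ x → k.obj (Sq.mk 1 1) ≤ x)
    (h₂ : ∀ s, k.obj (Sq.mk 0 0) ≤ u.obj s →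
      k.obj (Sq.mk 1 0) ≤ u.obj s ∨ k.obj (Sq.mk 0 1) ≤ u.obj s) :
    D.IsCartesian ((D.res k).obj Y) := by
  let S' := {x : T // (∃ s, u.obj s = x) ∨ k.obj (Sq.mk 1 0) ≤ x ∨ k.obj (Sq.mk 0 1) ≤ x}
  let i : S' ⥤ T := mono (fun x => x.1) (fun _ _ h => h)
  let u' : S ⥤ S' :=
    { obj := fun s => ⟨u.obj s, Or.inl ⟨s, rfl⟩⟩
      map := fun f => homOfLE (leOfHom (u.map f)) }
  have : i.Full := full_of_thin fun _ _ ⟨f⟩ => ⟨homOfLE (leOfHom f)⟩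
  have : i.Faithful := faithful_of_thin _
  have h3 : D.RExt i Y := hD.rExt_of_comp (u := u') (hY.congr (thinIso fun _ => rfl))
  have hk : ∀ s : Cospan, k.obj (Sq.mk 1 0) ≤ k.obj s.1 ∨ k.obj (Sq.mk 0 1) ≤ k.obj s.1 := fun s =>
    (show Sq.mk 1 0 ≤ s.1 ∨ Sq.mk 0 1 ≤ s.1 by revert s; decide).imp
      (fun h => leOfHom (k.map (homOfLE h))) (fun h => leOfHom (k.map (homOfLE h)))
  let p : Cospan ⥤ S' := mono (fun s => ⟨k.obj s.1, Or.inr (hk s)⟩)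
    (fun _ _ h => leOfHom (k.map (homOfLE h)))
  rw [hD.isCartesian_iff]
  refine hD.rExt_res (p := cospanIncl) (u := k) (q := p) (v := i)
    (thinIso (u := cospanIncl ⋙ k) (v := p ⋙ i) fun _ => rfl).hom (termCrit_of_thin _ ?_) h3
  rintro s ⟨a, ha⟩ ⟨f⟩
  have f : k.obj s ≤ a := leOfHom f
  suffices h : ∃ j : Cospan, k.obj j.1 ≤ a ∧ s ≤ j.1 ∧ ∀ j' : Cospan, k.obj j'.1 ≤ a → s ≤ j'.1 →
      j'.1 ≤ j.1 by
    obtain ⟨j, h1, h2, h3⟩ := h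
    exact ⟨j, ⟨homOfLE h2⟩, ⟨homOfLE h1⟩, fun j' h4 h5 =>
      ⟨homOfLE (h3 j' (leOfHom h5.some) (leOfHom h4.some))⟩⟩
  by_cases h00 : k.obj (Sq.mk 1 1) ≤ a
  · exact ⟨⟨Sq.mk 1 1, by decide⟩, h00, sq_le_top s, fun j' _ _ => sq_le_top j'.1⟩
  by_cases h10 : k.obj (Sq.mk 1 0) ≤ a
  · have h01 : ¬ k.obj (Sq.mk 0 1) ≤ a := fun h => h00 (h₁ a h10 h)
    refine ⟨⟨Sq.mk 1 0, by decide⟩, h10, ?_, fun j' h h' => ?_⟩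
    · rcases sq_cases s with rfl | rfl | rfl | rfl
      exacts [by decide, le_refl _, absurd f h01, absurd f h00]
    · rcases cospan_cases j' with rfl | rfl | rfl
      exacts [absurd h h00, le_refl _, absurd h h01]
  by_cases h01 : k.obj (Sq.mk 0 1) ≤ a
  · refine ⟨⟨Sq.mk 0 1, by decide⟩, h01, ?_, fun j' h h' => ?_⟩
    · rcases sq_cases s with rfl | rfl | rfl | rfl
      exacts [by decide, absurd f h10, le_refl _, absurd f h00]
    · rcases cospan_cases j' with rfl | rfl | rfl
      exacts [absurd h h00, absurd h h10, le_refl _]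
  exfalso
  rcases sq_cases s with rfl | rfl | rfl | rfl
  · rcases ha with ⟨s, rfl⟩ | h | h
    exacts [(h₂ s (leOfHom f)).elim h10 h01, h10 h, h01 h]
  · exact h10 f
  · exact h01 f
  · exact h00 f

end Detect

end

end Der.Prederivator

namespace Der.Prederivator

noncomputable section

/-! ### Exact squares and zero objects in diagrams -/

section Evaluation

variable {D : Prederivator.{v, u}} {S T K : Type} [SmallCategory S] [SmallCategory T]
  [SmallCategory K]

def evalRes (D : Prederivator.{v, u}) (F : S ⥤ T) (s : S) :
    D.res F ⋙ D.evalAt s ≅ D.evalAt (F.obj s) :=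
  (D.resComp (Functor.fromPUnit.{0} s) F).symm ≪≫
    D.resIso (NatIso.ofComponents (fun _ => Iso.refl _) (fun _ => by simp))

theorem isIso_evalAt_res (F : S ⥤ T) (s : S) {X Y : D.val T} (g : X ⟶ Y) :
    IsIso ((D.evalAt s).map ((D.res F).map g)) ↔ IsIso ((D.evalAt (F.obj s)).map g) :=
  ⟨isIso_map_of_iso (evalRes D F s) g, isIso_map_of_iso (evalRes D F s).symm g⟩

theorem isZero_evalAt_res (F : S ⥤ T) (s : S) {X : D.val T} :
    Limits.IsZero ((D.evalAt s).obj ((D.res F).obj X)) ↔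
      Limits.IsZero ((D.evalAt (F.obj s)).obj X) :=
  ⟨fun h => h.of_iso ((evalRes D F s).app X).symm, fun h => h.of_iso ((evalRes D F s).app X)⟩

theorem isIso_of_isZero {𝓐 : Type*} [Category* 𝓐] {X Y : 𝓐} (hX : Limits.IsZero X)
    (hY : Limits.IsZero Y) (f : X ⟶ Y) : IsIso f :=
  ⟨hY.to_ X, hX.eq_of_src _ _, hY.eq_of_src _ _⟩

theorem isZero_of_initial {𝓐 : Type*} [Category* 𝓐] (h : Limits.HasZeroObject 𝓐) {X : 𝓐}
    (hX : ∀ Z, Nonempty (Unique (X ⟶ Z))) : Limits.IsZero X := by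
  obtain ⟨Z, hZ⟩ := h
  obtain ⟨h1⟩ := hX Z
  obtain ⟨h2⟩ := hX X
  exact hZ.of_iso ⟨default, hZ.to_ X, Subsingleton.elim _ _, hZ.eq_of_src _ _⟩

theorem isZero_of_terminal {𝓐 : Type*} [Category* 𝓐] (h : Limits.HasZeroObject 𝓐) {X : 𝓐}
    (hX : ∀ Z, Nonempty (Unique (Z ⟶ X))) : Limits.IsZero X := by
  obtain ⟨Z, hZ⟩ := h
  obtain ⟨h1⟩ := hX Z
  obtain ⟨h2⟩ := hX X
  exact hZ.of_iso ⟨hZ.from_ X, default, Subsingleton.elim _ _, hZ.eq_of_src _ _⟩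

/-- The square of an empty category and a point. -/
def emptySq (u : S ⥤ T) (t : T) : Functor.empty.{0} S ⋙ u ≅
    (Functor.empty.{0} One) ⋙ Functor.fromPUnit.{0} t :=
  Functor.emptyExt _ _

/-- A left Kan extended diagram vanishes at the points above which there is nothing to extend from.
-/
theorem IsKan.isZero_of_lExt (hD : D.IsKan) (hz : Limits.HasZeroObject (D.val One)) {u : S ⥤ T}
    {Y : D.val T} (hY : D.LExt u Y) (t : T) (ht : ∀ s, IsEmpty (u.obj s ⟶ t)) :
    Limits.IsZero ((D.evalAt t).obj Y) :=
  isZero_of_initial hz (hD.lExt_empty_iff.1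
    (hD.lExt_res (emptySq u t).hom (fun a _ φ => (ht a).elim φ) hY))

theorem IsKan.isZero_of_rExt (hD : D.IsKan) (hz : Limits.HasZeroObject (D.val One)) {u : S ⥤ T}
    {Y : D.val T} (hY : D.RExt u Y) (t : T) (ht : ∀ s, IsEmpty (t ⟶ u.obj s)) :
    Limits.IsZero ((D.evalAt t).obj Y) :=
  isZero_of_terminal hz (hD.rExt_empty_iff.1
    (hD.rExt_res (emptySq u t).inv (fun _ a φ => (ht a).elim φ) hY))

/-- Zero objects are detected pointwise. -/
theorem IsKan.isZero_of_evalAt (hD : D.IsKan) {Y : D.val T}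
    (h : ∀ t, Limits.IsZero ((D.evalAt t).obj Y)) : Limits.IsZero Y := by
  have h1 : D.LExt (Functor.empty.{0} T) Y := by
    refine hD.lExt_of_cover (ι := T) (K := fun _ => One) (p := fun _ => 𝟭 _)
      (v := fun t => Functor.fromPUnit.{0} t) (fun t => (Functor.emptyExt _ _ :
        𝟭 _ ⋙ Functor.empty.{0} T ≅ Functor.empty.{0} One ⋙ Functor.fromPUnit.{0} t).hom)
      (fun t a => a.as.elim) (fun t => ⟨t, ⟨PUnit.unit⟩, rfl⟩) fun t => ?_
    exact hD.lExt_empty_iff.2 fun Z => (h t).unique_to Z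
  have h2 : D.RExt (Functor.empty.{0} T) Y := by
    refine hD.rExt_of_cover (ι := T) (S := fun _ => One) (q := fun _ => 𝟭 _)
      (u := fun t => Functor.fromPUnit.{0} t) (fun t => (Functor.emptyExt _ _ :
        Functor.empty.{0} One ⋙ Functor.fromPUnit.{0} t ≅ 𝟭 _ ⋙ Functor.empty.{0} T).hom)
      (fun t k a => a.as.elim) (fun t => ⟨t, ⟨PUnit.unit⟩, rfl⟩) fun t => ?_
    exact hD.rExt_empty_iff.2 fun Z => (h t).unique_from Z
  exact ⟨hD.lExt_empty_iff.1 h1, hD.rExt_empty_iff.1 h2⟩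

theorem IsKan.hasZeroObject_shift (hD : D.IsKan) (hz : Limits.HasZeroObject (D.val One))
    (B : Type) [SmallCategory B] : Limits.HasZeroObject ((D.shift B).val One) := by
  obtain ⟨Z, hZ⟩ := hz
  let F : B × One ⥤ One := CategoryTheory.Prod.snd B One
  exact ⟨(D.res F).obj Z, hD.isZero_of_evalAt fun t =>
    (isZero_evalAt_res F t).2 (hZ.of_iso
      (((D.resIso (thinIso fun s => Subsingleton.elim _ _)) ≪≫ D.resId One).app Z))⟩

variable (D) in
/-- The square of `Y` with the vertices `a`, `b`, `c`, `d` at `00`, `10`, `01`, `11` is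
cocartesian. -/
def CoSq (Y : D.val T) (a b c d : T) : Prop :=
  ∃ k : Sq ⥤ T, (k.obj (Sq.mk 0 0) = a ∧ k.obj (Sq.mk 1 0) = b ∧ k.obj (Sq.mk 0 1) = c ∧
    k.obj (Sq.mk 1 1) = d) ∧ D.IsCocartesian ((D.res k).obj Y)

theorem CoSq.of_res {F : S ⥤ T} {Y : D.val T} {a b c d : S}
    (h : D.CoSq ((D.res F).obj Y) a b c d) :
    D.CoSq Y (F.obj a) (F.obj b) (F.obj c) (F.obj d) := by
  obtain ⟨k, ⟨rfl, rfl, rfl, rfl⟩, h⟩ := h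
  exact ⟨k ⋙ F, ⟨rfl, rfl, rfl, rfl⟩, h.of_iso ((D.resComp k F).symm.app Y)⟩

theorem CoSq.of_iso {Y Z : D.val T} (e : Y ≅ Z) {a b c d : T} (h : D.CoSq Y a b c d) :
    D.CoSq Z a b c d := by
  obtain ⟨k, hk, h⟩ := h
  exact ⟨k, hk, h.of_iso ((D.res k).mapIso e)⟩

def thinSq [Quiver.IsThin T] {a b c d : T} (f : Nonempty (a ⟶ b)) (g : Nonempty (a ⟶ c))
    (f' : Nonempty (c ⟶ d)) (g' : Nonempty (b ⟶ d)) : Sq ⥤ T where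
  obj s := if s.1 = 0 then if s.2 = 0 then a else c else if s.2 = 0 then b else d
  map {s s'} h := Nonempty.some (by
    have h := leOfHom h
    revert h
    rcases sq_cases s with rfl | rfl | rfl | rfl <;> rcases sq_cases s' with rfl | rfl | rfl | rfl <;>
    first
    | exact fun h => absurd h (by decide)
    | exact fun _ => ⟨𝟙 _⟩
    | exact fun _ => f
    | exact fun _ => g
    | exact fun _ => f'
    | exact fun _ => g'
    | exact fun _ => ⟨f.some ≫ g'.some⟩)
  map_id _ := Subsingleton.elim _ _
  map_comp _ _ := Subsingleton.elim _ _

/-- Functors on the square with values in a thin category are determined by the vertices. -/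
def sqIso [Quiver.IsThin T] {k k' : Sq ⥤ T} (h₁ : k.obj (Sq.mk 0 0) = k'.obj (Sq.mk 0 0))
    (h₂ : k.obj (Sq.mk 1 0) = k'.obj (Sq.mk 1 0)) (h₃ : k.obj (Sq.mk 0 1) = k'.obj (Sq.mk 0 1))
    (h₄ : k.obj (Sq.mk 1 1) = k'.obj (Sq.mk 1 1)) : k ≅ k' :=
  thinIso fun s => by rcases sq_cases s with rfl | rfl | rfl | rfl <;> assumption

theorem CoSq.isCocartesian [Quiver.IsThin T] {Y : D.val T} {k : Sq ⥤ T}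
    (h : D.CoSq Y (k.obj (Sq.mk 0 0)) (k.obj (Sq.mk 1 0)) (k.obj (Sq.mk 0 1)) (k.obj (Sq.mk 1 1))) :
    D.IsCocartesian ((D.res k).obj Y) := by
  obtain ⟨k', ⟨h1, h2, h3, h4⟩, h⟩ := h
  exact h.of_iso ((D.resIso (sqIso h1 h2 h3 h4)).app Y)

theorem CoSq.res [Quiver.IsThin T] [Quiver.IsThin S] {F : S ⥤ T} [F.Full] {Y : D.val T}
    {a b c d : S} (h : D.CoSq Y (F.obj a) (F.obj b) (F.obj c) (F.obj d)) :
    D.CoSq ((D.res F).obj Y) a b c d := by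
  obtain ⟨k, ⟨h1, h2, h3, h4⟩, h⟩ := h
  have H : ∀ {s s' : Sq} {x y : S}, k.obj s = F.obj x → k.obj s' = F.obj y → s ≤ s' →
      Nonempty (x ⟶ y) := fun {s s' x y} hx hy hs =>
    ⟨F.preimage (eqToHom hx.symm ≫ k.map (homOfLE hs) ≫ eqToHom hy)⟩
  let k' : Sq ⥤ S := thinSq (H h1 h2 (by decide)) (H h1 h3 (by decide)) (H h3 h4 (by decide))
    (H h2 h4 (by decide))
  refine ⟨k', ⟨rfl, rfl, rfl, rfl⟩, ?_⟩
  exact h.of_iso ((D.resIso (sqIso (k' := k' ⋙ F) h1 h2 h3 h4) ≪≫ D.resComp k' F).app Y)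

/-- A morphism between cocartesian squares is invertible at the final vertex if it is so at the
other vertices. -/
theorem IsKan.isIso_of_coSq (hD : D.IsKan) [Quiver.IsThin T] {W Y : D.val T} {a b c d : T}
    (hW : D.CoSq W a b c d) (hY : D.CoSq Y a b c d) (g : W ⟶ Y) (ha : IsIso ((D.evalAt a).map g))
    (hb : IsIso ((D.evalAt b).map g)) (hc : IsIso ((D.evalAt c).map g)) :
    IsIso ((D.evalAt d).map g) := by
  obtain ⟨k, ⟨rfl, rfl, rfl, rfl⟩, h⟩ := hW
  have h1 := (hD.isCocartesian_iff _).1 h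
  have h2 := (hD.isCocartesian_iff _).1 hY.isCocartesian
  have h3 : IsIso ((D.res k).map g) := h1.isIso h2 _ (hD.isIso _ fun j => by
    rw [isIso_evalAt_res, isIso_evalAt_res]
    rcases span_cases j with rfl | rfl | rfl
    exacts [ha, hb, hc])
  rw [← isIso_evalAt_res]
  infer_instance

theorem IsKan.isIso_of_coSq' (hD : D.IsKan) (hst : ∀ Q, D.IsCocartesian Q → D.IsCartesian Q)
    [Quiver.IsThin T] {W Y : D.val T} {a b c d : T}
    (hW : D.CoSq W a b c d) (hY : D.CoSq Y a b c d) (g : W ⟶ Y) (hd : IsIso ((D.evalAt d).map g))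
    (hb : IsIso ((D.evalAt b).map g)) (hc : IsIso ((D.evalAt c).map g)) :
    IsIso ((D.evalAt a).map g) := by
  obtain ⟨k, ⟨rfl, rfl, rfl, rfl⟩, h⟩ := hW
  have h1 := (hD.isCartesian_iff _).1 (hst _ h)
  have h2 := (hD.isCartesian_iff _).1 (hst _ hY.isCocartesian)
  have h3 : IsIso ((D.res k).map g) := h1.isIso h2 _ (hD.isIso _ fun j => by
    rw [isIso_evalAt_res, isIso_evalAt_res]
    rcases cospan_cases j with rfl | rfl | rfl
    exacts [hd, hb, hc])
  rw [← isIso_evalAt_res]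
  infer_instance

end Evaluation

/-! ### Diagrams with exactness conditions -/

/-- Exactness conditions on diagrams of shape `T`: a set of squares, given by the vertices `00`,
`10`, `01`, `11`, which are to be cocartesian, and a set of points at which the values are to be
zero. -/
structure ExData (T : Type*) where
  /-- The squares which are to be cocartesian. -/
  sq : T → T → T → T → Prop
  /-- The points at which the values are to be zero. -/
  zero : T → Prop

/-- The restriction of exactness conditions along a map. -/
def ExData.pull {S T : Type*} (e : ExData T) (f : S → T) : ExData S :=
  ⟨fun a b c d => e.sq (f a) (f b) (f c) (f d), fun s => e.zero (f s)⟩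

section Steps

variable {D : Prederivator.{v, u}} {S T : Type} [SmallCategory S]

variable (D) in
/-- The diagram `Y` satisfies the exactness conditions `e`. -/
structure ExAt [SmallCategory T] (e : ExData T) (Y : D.val T) : Prop where
  sq : ∀ a b c d, e.sq a b c d → D.CoSq Y a b c d
  zero : ∀ t, e.zero t → Limits.IsZero ((D.evalAt t).obj Y)

theorem ExAt.of_iso [SmallCategory T] {e : ExData T} {Y Z : D.val T} (i : Y ≅ Z)
    (h : D.ExAt e Y) : D.ExAt e Z :=
  ⟨fun a b c d hs => (h.sq a b c d hs).of_iso i, fun t ht =>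
    (h.zero t ht).of_iso ((D.evalAt t).mapIso i.symm)⟩

theorem ExAt.res [SmallCategory T] [Quiver.IsThin T] [Quiver.IsThin S] {e : ExData T}
    {u : S ⥤ T} [u.Full] {Y : D.val T} (h : D.ExAt e Y) :
    D.ExAt (e.pull u.obj) ((D.res u).obj Y) :=
  ⟨fun _ _ _ _ hs => (h.sq _ _ _ _ hs).res, fun s hs => (isZero_evalAt_res u s).2 (h.zero _ hs)⟩

variable [Preorder T]

/-- Combinatorial conditions under which left Kan extension along `u` identifies the diagrams
satisfying the exactness conditions on source and target: every new point is the final vertex of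
one of the squares, or the value there is zero for lack of points below it, and left Kan
extension makes all the squares cocartesian. -/
structure LCrit (u : S ⥤ T) (e : ExData T) : Prop where
  emb : ∀ a b, u.obj a ≤ u.obj b → Nonempty (a ⟶ b)
  new : ∃ r : T → ℕ, ∀ p, (∃ s, u.obj s = p) ∨ (e.zero p ∧ ∀ s, ¬ u.obj s ≤ p) ∨
    ∃ a b c, e.sq a b c p ∧ r a < r p ∧ r b < r p ∧ r c < r p
  sq : ∀ a b c d, e.sq a b c d → ((∃ s, u.obj s = a) ∧ (∃ s, u.obj s = b) ∧
    (∃ s, u.obj s = c) ∧ ∃ s, u.obj s = d) ∨ (a ≤ b ∧ a ≤ c ∧ c ≤ d ∧ b ≤ d) ∧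
      (∀ x, x ≤ b → x ≤ c → x ≤ a) ∧
      ∀ s, u.obj s ≤ d → u.obj s ≤ b ∨ u.obj s ≤ c
  zero : ∀ t, e.zero t → (∃ s, u.obj s = t) ∨ ∀ s, ¬ u.obj s ≤ t

/-- The dual of `LCrit`. -/
structure RCrit (u : S ⥤ T) (e : ExData T) : Prop where
  emb : ∀ a b, u.obj a ≤ u.obj b → Nonempty (a ⟶ b)
  new : ∃ r : T → ℕ, ∀ p, (∃ s, u.obj s = p) ∨ (e.zero p ∧ ∀ s, ¬ p ≤ u.obj s) ∨
    ∃ b c d, e.sq p b c d ∧ r b < r p ∧ r c < r p ∧ r d < r p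
  sq : ∀ a b c d, e.sq a b c d → ((∃ s, u.obj s = a) ∧ (∃ s, u.obj s = b) ∧
    (∃ s, u.obj s = c) ∧ ∃ s, u.obj s = d) ∨ (a ≤ b ∧ a ≤ c ∧ c ≤ d ∧ b ≤ d) ∧
      (∀ x, b ≤ x → c ≤ x → d ≤ x) ∧
      ∀ s, a ≤ u.obj s → b ≤ u.obj s ∨ c ≤ u.obj s
  zero : ∀ t, e.zero t → (∃ s, u.obj s = t) ∨ ∀ s, ¬ t ≤ u.obj s

theorem CoSq.of_res_iso {u : S ⥤ T} {X : D.val S} {Y : D.val T} (i : X ≅ (D.res u).obj Y)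
    {a b c d : S} (h : D.CoSq X a b c d) : D.CoSq Y (u.obj a) (u.obj b) (u.obj c) (u.obj d) :=
  (h.of_iso i).of_res

/-- Left Kan extensions of diagrams satisfying the exactness conditions satisfy them as well. -/
theorem LCrit.ext (hD : D.IsKan) (hz : Limits.HasZeroObject (D.val One)) [Quiver.IsThin S]
    {u : S ⥤ T} {e : ExData T} (h : LCrit u e) {X : D.val S} {Y : D.val T}
    {η : X ⟶ (D.res u).obj Y} (hη : UnivL (D.res u) η) (hX : D.ExAt (e.pull u.obj) X) :
    IsIso η ∧ D.ExAt e Y := by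
  have := full_of_thin (u := u) fun a b ⟨f⟩ => h.emb a b (leOfHom f)
  have := faithful_of_thin u
  have h1 := hD.isIso_of_univL hη
  have h2 := hη.lExt
  refine ⟨h1, fun a b c d hs => ?_, fun t ht => ?_⟩
  · obtain ⟨⟨a, rfl⟩, ⟨b, rfl⟩, ⟨c, rfl⟩, ⟨d, rfl⟩⟩ | ⟨⟨h3, h4, h5, h6⟩, h7, h8⟩ := h.sq a b c d hs
    · exact (hX.sq a b c d hs).of_res_iso (asIso η)
    · let k : Sq ⥤ T := thinSq ⟨homOfLE h3⟩ ⟨homOfLE h4⟩ ⟨homOfLE h5⟩ ⟨homOfLE h6⟩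
      exact ⟨k, ⟨rfl, rfl, rfl, rfl⟩, hD.isCocartesian_res h2 k h7 h8⟩
  · obtain ⟨s, rfl⟩ | h3 := h.zero t ht
    · rw [← isZero_evalAt_res]
      exact (hX.zero s ht).of_iso ((D.evalAt s).mapIso (asIso η).symm)
    · exact hD.isZero_of_lExt hz h2 t fun s => ⟨fun f => h3 s (leOfHom f)⟩

theorem RCrit.ext (hD : D.IsKan) (hz : Limits.HasZeroObject (D.val One))
    (hst : ∀ Q, D.IsCartesian Q → D.IsCocartesian Q) [Quiver.IsThin S]
    {u : S ⥤ T} {e : ExData T} (h : RCrit u e) {X : D.val S} {Y : D.val T}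
    {η : (D.res u).obj Y ⟶ X} (hη : UnivR (D.res u) η) (hX : D.ExAt (e.pull u.obj) X) :
    IsIso η ∧ D.ExAt e Y := by
  have := full_of_thin (u := u) fun a b ⟨f⟩ => h.emb a b (leOfHom f)
  have := faithful_of_thin u
  have h1 := hD.isIso_of_univR hη
  have h2 := hη.rExt
  refine ⟨h1, fun a b c d hs => ?_, fun t ht => ?_⟩
  · obtain ⟨⟨a, rfl⟩, ⟨b, rfl⟩, ⟨c, rfl⟩, ⟨d, rfl⟩⟩ | ⟨⟨h3, h4, h5, h6⟩, h7, h8⟩ := h.sq a b c d hs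
    · exact (hX.sq a b c d hs).of_res_iso (asIso η).symm
    · let k : Sq ⥤ T := thinSq ⟨homOfLE h3⟩ ⟨homOfLE h4⟩ ⟨homOfLE h5⟩ ⟨homOfLE h6⟩
      exact ⟨k, ⟨rfl, rfl, rfl, rfl⟩, hst _ (hD.isCartesian_res h2 k h7 h8)⟩
  · obtain ⟨s, rfl⟩ | h3 := h.zero t ht
    · rw [← isZero_evalAt_res]
      exact (hX.zero s ht).of_iso ((D.evalAt s).mapIso (asIso η))
    · exact hD.isZero_of_rExt hz h2 t fun s => ⟨fun f => h3 s (leOfHom f)⟩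

/-- Conversely, a diagram satisfying the exactness conditions is a left Kan extension of its
restriction: the comparison morphism is invertible at the new points by induction on their rank,
because every new value is zero or determined by a cocartesian square. -/
theorem LCrit.lExt (hD : D.IsKan) (hz : Limits.HasZeroObject (D.val One)) [Quiver.IsThin S]
    {u : S ⥤ T} {e : ExData T} (h : LCrit u e) {Y : D.val T} (hY : D.ExAt e Y) : D.LExt u Y := by
  have := full_of_thin (u := u) fun a b ⟨f⟩ => h.emb a b (leOfHom f)
  have := hD.left u
  obtain ⟨W, η, hη⟩ := exists_univL (D.res u) ((D.res u).obj Y)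
  obtain ⟨h1, hW⟩ := h.ext hD hz hη hY.res
  obtain ⟨g, hg⟩ := (hη Y).2 (𝟙 _)
  have hg' : η ≫ (D.res u).map g = 𝟙 _ := hg
  have h2 : IsIso ((D.res u).map g) := by
    rw [← IsIso.inv_eq_of_hom_inv_id hg']
    infer_instance
  obtain ⟨r, hr⟩ := h.new
  have h3 : ∀ n p, r p < n → IsIso ((D.evalAt p).map g) := by
    intro n
    induction n with
    | zero => exact fun p hp => absurd hp (Nat.not_lt_zero _)
    | succ n ih =>
      intro p hp
      obtain ⟨s, rfl⟩ | ⟨h4, -⟩ | ⟨a, b, c, h4, ha, hb, hc⟩ := hr p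
      · rw [← isIso_evalAt_res]
        infer_instance
      · exact isIso_of_isZero (hW.zero p h4) (hY.zero p h4) _
      · exact hD.isIso_of_coSq (hW.sq _ _ _ _ h4) (hY.sq _ _ _ _ h4) g (ih a (by omega))
          (ih b (by omega)) (ih c (by omega))
  have : IsIso g := hD.isIso g fun p => h3 _ p (Nat.lt_succ_self _)
  exact hη.lExt.of_iso g

theorem RCrit.rExt (hD : D.IsKan) (hz : Limits.HasZeroObject (D.val One))
    (hst : ∀ Q, D.IsCocartesian Q ↔ D.IsCartesian Q) [Quiver.IsThin S]
    {u : S ⥤ T} {e : ExData T} (h : RCrit u e) {Y : D.val T} (hY : D.ExAt e Y) : D.RExt u Y := by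
  have := full_of_thin (u := u) fun a b ⟨f⟩ => h.emb a b (leOfHom f)
  have := hD.right u
  obtain ⟨W, η, hη⟩ := exists_univR (D.res u) ((D.res u).obj Y)
  obtain ⟨h1, hW⟩ := h.ext hD hz (fun Q => (hst Q).2) hη hY.res
  obtain ⟨g, hg⟩ := (hη Y).2 (𝟙 _)
  have hg' : (D.res u).map g ≫ η = 𝟙 _ := hg
  have h2 : IsIso ((D.res u).map g) := by
    rw [← IsIso.inv_eq_of_inv_hom_id hg']
    infer_instance
  obtain ⟨r, hr⟩ := h.new
  have h3 : ∀ n p, r p < n → IsIso ((D.evalAt p).map g) := by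
    intro n
    induction n with
    | zero => exact fun p hp => absurd hp (Nat.not_lt_zero _)
    | succ n ih =>
      intro p hp
      obtain ⟨s, rfl⟩ | ⟨h4, -⟩ | ⟨b, c, d, h4, hb, hc, hd⟩ := hr p
      · rw [← isIso_evalAt_res]
        infer_instance
      · exact isIso_of_isZero (hY.zero p h4) (hW.zero p h4) _
      · exact hD.isIso_of_coSq' (fun Q => (hst Q).1) (hY.sq _ _ _ _ h4) (hW.sq _ _ _ _ h4) g
          (ih d (by omega)) (ih b (by omega)) (ih c (by omega))
  have : IsIso g := hD.isIso g fun p => h3 _ p (Nat.lt_succ_self _)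
  exact hη.rExt.of_iso g

end Steps

end

end Der.Prederivator

namespace Der.Prederivator

noncomputable section

section Parametrized

variable {D : Prederivator.{v, u}} {S T S' K : Type} [SmallCategory S] [SmallCategory S']
  [SmallCategory K] [Preorder T]

/-- Version of `LCrit.ext` for diagrams with a parameter in `K`. -/
theorem LCrit.ext_of_cover (hD : D.IsKan) (hz : Limits.HasZeroObject (D.val One)) [Quiver.IsThin S]
    {u : S ⥤ T} {e : ExData T} (h : LCrit u e) {U : S' ⥤ T × K} {G : K → S ⥤ S'}
    (α : ∀ a, G a ⋙ U ≅ u ⋙ CategoryTheory.Prod.sectL T a) (hα : ∀ a, InitCrit (α a).hom)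
    (hG : ∀ s', ∃ a s, (G a).obj s = s') {X : D.val S'} {Y : D.val (T × K)}
    {η : X ⟶ (D.res U).obj Y} (hη : UnivL (D.res U) η)
    (hX : ∀ a, D.ExAt (e.pull u.obj) ((D.res (G a)).obj X)) :
    IsIso η ∧ ∀ a, D.ExAt e ((D.res (CategoryTheory.Prod.sectL T a)).obj Y) := by
  have h1 := fun a => h.ext hD hz (hD.init (α a).hom (hα a) η hη) (hX a)
  refine ⟨hD.isIso_of_cover G hG η fun a => ?_, fun a => (h1 a).2⟩
  have := (h1 a).1
  exact IsIso.of_isIso_comp_right _ ((D.sqm (α a).hom).app Y)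

theorem RCrit.ext_of_cover (hD : D.IsKan) (hz : Limits.HasZeroObject (D.val One))
    (hst : ∀ Q, D.IsCartesian Q → D.IsCocartesian Q) [Quiver.IsThin S]
    {u : S ⥤ T} {e : ExData T} (h : RCrit u e) {U : S' ⥤ T × K} {G : K → S ⥤ S'}
    (α : ∀ a, G a ⋙ U ≅ u ⋙ CategoryTheory.Prod.sectL T a) (hα : ∀ a, TermCrit (α a).inv)
    (hG : ∀ s', ∃ a s, (G a).obj s = s') {X : D.val S'} {Y : D.val (T × K)}
    {η : (D.res U).obj Y ⟶ X} (hη : UnivR (D.res U) η)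
    (hX : ∀ a, D.ExAt (e.pull u.obj) ((D.res (G a)).obj X)) :
    IsIso η ∧ ∀ a, D.ExAt e ((D.res (CategoryTheory.Prod.sectL T a)).obj Y) := by
  have h1 := fun a => h.ext hD hz hst (hD.term (α a).inv (hα a) η hη) (hX a)
  refine ⟨hD.isIso_of_cover G hG η fun a => ?_, fun a => (h1 a).2⟩
  have := (h1 a).1
  exact IsIso.of_isIso_comp_left ((D.sqm (α a).inv).app Y) _

/-- Version of `LCrit.lExt` for diagrams with a parameter in `K`. -/
theorem LCrit.lExt_of_cover (hD : D.IsKan) (hz : Limits.HasZeroObject (D.val One)) [Quiver.IsThin S]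
    {u : S ⥤ T} {e : ExData T} (h : LCrit u e) {U : S' ⥤ T × K} {G : K → S ⥤ S'}
    (α : ∀ a, G a ⋙ U ≅ u ⋙ CategoryTheory.Prod.sectL T a) (hα : ∀ a, InitCrit (α a).hom)
    {Y : D.val (T × K)} (hY : ∀ a, D.ExAt e ((D.res (CategoryTheory.Prod.sectL T a)).obj Y)) :
    D.LExt U Y :=
  hD.lExt_of_cover (fun a => (α a).hom) hα (fun t => ⟨t.2, t.1, rfl⟩)
    fun a => h.lExt hD hz (hY a)

theorem RCrit.rExt_of_cover (hD : D.IsKan) (hz : Limits.HasZeroObject (D.val One))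
    (hst : ∀ Q, D.IsCocartesian Q ↔ D.IsCartesian Q) [Quiver.IsThin S]
    {u : S ⥤ T} {e : ExData T} (h : RCrit u e) {U : S' ⥤ T × K} {G : K → S ⥤ S'}
    (α : ∀ a, G a ⋙ U ≅ u ⋙ CategoryTheory.Prod.sectL T a) (hα : ∀ a, TermCrit (α a).inv)
    {Y : D.val (T × K)} (hY : ∀ a, D.ExAt e ((D.res (CategoryTheory.Prod.sectL T a)).obj Y)) :
    D.RExt U Y :=
  hD.rExt_of_cover (fun a => (α a).inv) hα (fun t => ⟨t.2, t.1, rfl⟩)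
    fun a => h.rExt hD hz hst (hY a)

theorem exAt_sectL_res {S : Type} [Preorder S] {g : S ⥤ T} {e : ExData T} {e' : ExData S}
    (hg : ∀ Y : D.val T, D.ExAt e Y → D.ExAt e' ((D.res g).obj Y)) {Y : D.val (T × K)} (a : K)
    (hY : D.ExAt e ((D.res (CategoryTheory.Prod.sectL T a)).obj Y)) :
    D.ExAt e' ((D.res (CategoryTheory.Prod.sectL S a)).obj ((D.res (g.prod (𝟭 K))).obj Y)) :=
  (hg _ hY).of_iso (((D.resComp _ _).symm ≪≫ D.resIso (sectSq g a).symm ≪≫ D.resComp _ _).app Y)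

end Parametrized

/-! ### Kan extensions of morphisms of prederivators with exactness conditions -/

section Good

variable {D E F P Q : Prederivator.{v, u}}

/-- The morphism `ρ` restricts to an equivalence from the full subprederivator of `P` on the
objects with the property `p` to `F`, with inverse `L`. -/
structure Good (p : ∀ K, P.obj K → Prop) (ρ : P ⟶ F) (L : F ⟶ P) : Prop where
  sec : cls L ≫ cls ρ = 𝟙 _
  mem : ∀ K X, p K ((fn L K).obj X)
  uniq : ∀ {E : Prederivator.{v, u}} (M : E ⟶ P), (∀ K X, p K ((fn M K).obj X)) →
    cls M ≫ cls ρ ≫ cls L = cls M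

/-- The components of an adjunction between morphisms of prederivators. -/
def fnAdj {φ : E ⟶ F} {ψ : F ⟶ E} (adj : Bicategory.Adjunction φ ψ) (K) : fn φ K ⊣ fn ψ K :=
  Adjunction.mkOfUnitCounit
    { unit := (md adj.unit K : fn (𝟙 E) K ⟶ fn (φ ≫ ψ) K)
      counit := (md adj.counit K : fn (ψ ≫ φ) K ⟶ fn (𝟙 F) K)
      left_triangle := by
        ext X
        have h := congrArg (fun t => (md t K).app X)
          ((leftZigzag_eq _ _).symm.trans adj.left_triangle)
        exact h.trans (Category.comp_id _)
      right_triangle := by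
        ext X
        have h := congrArg (fun t => (md t K).app X)
          ((rightZigzag_eq _ _).symm.trans adj.right_triangle)
        exact h.trans (Category.comp_id _) }

/-- The components of an isomorphism of morphisms of prederivators. -/
def appIso {φ ψ : E ⟶ F} (i : φ ≅ ψ) (K) : fn φ K ≅ fn ψ K where
  hom := md i.hom K
  inv := md i.inv K
  hom_inv_id := congrArg (fun t => md t K) i.hom_inv_id
  inv_hom_id := congrArg (fun t => md t K) i.inv_hom_id

/-- Composition of `Good` with a left adjoint: if the left adjoint `l` of `φ` carries `p`-objects to
`q`-objects and all `q`-objects are of this form, a `Good` pair for `p` gives one for `q`. -/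
theorem Good.of_leftAdjoint {p : ∀ K, P.obj K → Prop} {q : ∀ K, Q.obj K → Prop} {ρ : P ⟶ F}
    {L : F ⟶ P} (h : Good p ρ L) {φ : Q ⟶ P} {l : P ⟶ Q} (adj : Bicategory.Adjunction l φ)
    (hext : ∀ K (X : P.obj K) (Y : Q.obj K) (η : X ⟶ (fn φ K).obj Y), UnivL (fn φ K) η → p K X →
      IsIso η ∧ q K Y)
    (hfull : ∀ K (Y : Q.obj K), q K Y → p K ((fn φ K).obj Y) ∧
      UnivL (fn φ K) (𝟙 ((fn φ K).obj Y))) :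
    Good q (φ ≫ ρ) (L ≫ l) where
  sec := by
    have h1 : IsIso (L ◁ adj.unit) := isIso_of_app _ fun K X =>
      (hext K _ _ _ (UnivL.of_adj (fnAdj adj K) ((fn L K).obj X)) (h.mem K X)).1
    have h2 : cls L = cls (L ≫ l) ≫ cls φ :=
      cls_eq ((ρ_ L).symm ≪≫ asIso (L ◁ adj.unit) ≪≫ (α_ _ _ _).symm)
    rw [cls_comp φ ρ, ← Category.assoc, ← h2, h.sec]
  mem K X := (hext K _ _ _ (UnivL.of_adj (fnAdj adj K) ((fn L K).obj X)) (h.mem K X)).2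
  uniq M hM := by
    have h1 : IsIso (M ◁ adj.counit) := isIso_of_app _ fun K X => by
      have h3 := (hfull K _ (hM K X)).2
      rw [← (fnAdj adj K).right_triangle_components] at h3
      exact (UnivL.of_adj (fnAdj adj K) _).isIso h3
    have h2 : cls (M ≫ φ) ≫ cls l = cls M :=
      cls_eq ((α_ _ _ _) ≪≫ asIso (M ◁ adj.counit) ≪≫ ρ_ M)
    calc _ = (cls (M ≫ φ) ≫ cls ρ ≫ cls L) ≫ cls l := by
          rw [cls_comp φ ρ, cls_comp L l, cls_comp M φ]; simp only [Category.assoc]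
      _ = _ := by rw [h.uniq (M ≫ φ) fun K X => (hfull K _ (hM K X)).1, h2]

theorem Good.of_rightAdjoint {p : ∀ K, P.obj K → Prop} {q : ∀ K, Q.obj K → Prop} {ρ : P ⟶ F}
    {L : F ⟶ P} (h : Good p ρ L) {φ : Q ⟶ P} {r : P ⟶ Q} (adj : Bicategory.Adjunction φ r)
    (hext : ∀ K (X : P.obj K) (Y : Q.obj K) (η : (fn φ K).obj Y ⟶ X), UnivR (fn φ K) η → p K X →
      IsIso η ∧ q K Y)
    (hfull : ∀ K (Y : Q.obj K), q K Y → p K ((fn φ K).obj Y) ∧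
      UnivR (fn φ K) (𝟙 ((fn φ K).obj Y))) :
    Good q (φ ≫ ρ) (L ≫ r) where
  sec := by
    have h1 : IsIso (L ◁ adj.counit) := isIso_of_app _ fun K X =>
      (hext K _ _ _ (UnivR.of_adj (fnAdj adj K) ((fn L K).obj X)) (h.mem K X)).1
    have h2 : cls (L ≫ r) ≫ cls φ = cls L :=
      cls_eq ((α_ _ _ _) ≪≫ asIso (L ◁ adj.counit) ≪≫ ρ_ L)
    rw [cls_comp φ ρ, ← Category.assoc, h2, h.sec]
  mem K X := (hext K _ _ _ (UnivR.of_adj (fnAdj adj K) ((fn L K).obj X)) (h.mem K X)).2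
  uniq M hM := by
    have h1 : IsIso (M ◁ adj.unit) := isIso_of_app _ fun K X => by
      have h3 := (hfull K _ (hM K X)).2
      rw [← (fnAdj adj K).left_triangle_components] at h3
      exact (UnivR.of_adj (fnAdj adj K) _).isIso h3
    have h2 : cls M = cls (M ≫ φ) ≫ cls r :=
      cls_eq ((ρ_ M).symm ≪≫ asIso (M ◁ adj.unit) ≪≫ (α_ _ _ _).symm)
    calc _ = (cls (M ≫ φ) ≫ cls ρ ≫ cls L) ≫ cls r := by
          rw [cls_comp φ ρ, cls_comp L r, cls_comp M φ]; simp only [Category.assoc]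
      _ = _ := by rw [h.uniq (M ≫ φ) fun K X => (hfull K _ (hM K X)).1, ← h2]

theorem Good.base {p : ∀ K, P.obj K → Prop} (h : ∀ K X, p K X) : Good p (𝟙 P) (𝟙 P) where
  sec := Category.comp_id _
  mem K X := h K X
  uniq M _ := by rw [cls_id, Category.comp_id, Category.comp_id]

theorem Good.congr {p : ∀ K, P.obj K → Prop} {ρ ρ' : P ⟶ F} {L L' : F ⟶ P} (h : Good p ρ L)
    (hp : ∀ K (X Y : P.obj K), (X ≅ Y) → p K X → p K Y) (hρ : cls ρ = cls ρ') (hL : L ≅ L') :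
    Good p ρ' L' where
  sec := by rw [← hρ, ← cls_eq hL, h.sec]
  mem K X := hp K _ _ ((appIso hL K).app X) (h.mem K X)
  uniq M hM := by rw [← hρ, ← cls_eq hL, h.uniq M hM]

/-- Comparison of the extensions belonging to different exactness conditions. -/
theorem Good.comp_eq {p : ∀ K, P.obj K → Prop} {q : ∀ K, Q.obj K → Prop} {ρ : P ⟶ F}
    {L : F ⟶ P} (h : Good p ρ L) {ρ' : Q ⟶ F} {L' : F ⟶ Q} (h' : Good q ρ' L') {φ : P ⟶ Q}
    (hφ : cls φ ≫ cls ρ' = cls ρ) (hm : ∀ K X, p K X → q K ((fn φ K).obj X)) :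
    cls L ≫ cls φ = cls L' := by
  have h1 := h'.uniq (L ≫ φ) fun K X => hm K _ (h.mem K X)
  rw [← cls_comp, ← h1, cls_comp, Category.assoc, reassoc_of% hφ, reassoc_of% h.sec]

end Good

section ExK

variable {D F : Prederivator.{v, u}} {S T : Type} [SmallCategory S]

variable (D) in
/-- The parametrized diagrams of shape `T` all of whose members satisfy the exactness
conditions. -/
def ExK [SmallCategory T] (e : ExData T) (K : Cat.{0, 0}ᵒᵖ) (Y : (D.shift T).obj K) : Prop :=
  ∀ a : K.unop, D.ExAt e ((D.res (CategoryTheory.Prod.sectL T a)).obj Y)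

theorem ExK.res_sectL [SmallCategory T] [Quiver.IsThin S] [Quiver.IsThin T] {e : ExData T}
    {u : S ⥤ T} [u.Full] {K} {Y : (D.shift T).obj K} (h : D.ExK e K Y) :
    D.ExK (e.pull u.obj) K ((fn (D.restr u) K).obj Y) := fun a =>
  ((h a).res (u := u)).of_iso
    (((D.resComp _ _).symm ≪≫ D.resIso (sectSq u a).symm ≪≫ D.resComp _ _).app Y)

variable [Preorder T]

/-- A left Kan extension satisfying `LCrit` extends `Good` from the shape `S` to the shape `T`. -/
theorem Good.lan (hD : D.IsKan) (hz : Limits.HasZeroObject (D.val One)) (hK : D.HasKan)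
    [Quiver.IsThin S] {u : S ⥤ T} {e : ExData T} (hu : LCrit u e) {e' : ExData S}
    (he : e' = e.pull u.obj)
    {ρ : D.shift S ⟶ F} {L : F ⟶ D.shift S} (h : Good (D.ExK e') ρ L) :
    Good (D.ExK e) (D.restr u ≫ ρ) (L ≫ Der.Prederivator.lan hK u) := by
  subst he
  have := full_of_thin (u := u) fun a b ⟨f⟩ => hu.emb a b (leOfHom f)
  have := hK.left u
  refine h.of_leftAdjoint (Bicategory.Adjunction.ofIsRightAdjoint (D.restr u))
    (fun K X Y η hη hX => ?_) fun K Y hY => ⟨hY.res_sectL, ?_⟩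
  · exact hu.ext_of_cover hD hz (U := u.prod (𝟭 K.unop))
      (G := fun a => CategoryTheory.Prod.sectL S a) (fun a => sectSq u a)
      (fun a => initCrit_sectSq u a) (fun s => ⟨s.2, s.1, rfl⟩) hη hX
  · exact hu.lExt_of_cover hD hz (U := u.prod (𝟭 K.unop))
      (G := fun a => CategoryTheory.Prod.sectL S a) (fun a => sectSq u a)
      (fun a => initCrit_sectSq u a) hY

theorem Good.ran (hD : D.IsKan) (hz : Limits.HasZeroObject (D.val One))
    (hst : ∀ Q, D.IsCocartesian Q ↔ D.IsCartesian Q) (hK : D.HasKan)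
    [Quiver.IsThin S] {u : S ⥤ T} {e : ExData T} (hu : RCrit u e) {e' : ExData S}
    (he : e' = e.pull u.obj)
    {ρ : D.shift S ⟶ F} {L : F ⟶ D.shift S} (h : Good (D.ExK e') ρ L) :
    Good (D.ExK e) (D.restr u ≫ ρ) (L ≫ Der.Prederivator.ran hK u) := by
  subst he
  have := full_of_thin (u := u) fun a b ⟨f⟩ => hu.emb a b (leOfHom f)
  have := hK.right u
  refine h.of_rightAdjoint (Bicategory.Adjunction.ofIsLeftAdjoint (D.restr u))
    (fun K X Y η hη hX => ?_) fun K Y hY => ⟨hY.res_sectL, ?_⟩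
  · exact hu.ext_of_cover hD hz (fun Q => (hst Q).2) (U := u.prod (𝟭 K.unop))
      (G := fun a => CategoryTheory.Prod.sectL S a) (fun a => sectSq u a)
      (fun a => termCrit_sectSq u a) (fun s => ⟨s.2, s.1, rfl⟩) hη hX
  · exact hu.rExt_of_cover hD hz hst (U := u.prod (𝟭 K.unop))
      (G := fun a => CategoryTheory.Prod.sectL S a) (fun a => sectSq u a)
      (fun a => termCrit_sectSq u a) hY

theorem ExK.of_iso {e : ExData S} {K} {X Y : (D.shift S).obj K} (i : X ≅ Y)
    (h : D.ExK e K X) : D.ExK e K Y :=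
  fun a => (h a).of_iso ((D.res (CategoryTheory.Prod.sectL S a)).mapIso i)

/-- A right Kan extension from a point satisfying `RCrit`. -/
theorem Good.ranPt (hD : D.IsKan) (hz : Limits.HasZeroObject (D.val One))
    (hst : ∀ Q, D.IsCocartesian Q ↔ D.IsCartesian Q) (hK : D.HasKan)
    {b : T} {e : ExData T} (hu : RCrit (Functor.fromPUnit.{0} b) e)
    (he : ∀ Y, D.ExAt (e.pull (Functor.fromPUnit.{0} b).obj) Y) :
    Good (D.ExK e) (D.ev b) (Der.Prederivator.ranPt hK b) := by
  have := hK.right_pt b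
  have h0 : Good (fun (_ : Cat.{0, 0}ᵒᵖ) _ => True) (𝟙 D) (𝟙 D) := Good.base fun _ _ => trivial
  have h1 := h0.of_rightAdjoint (q := D.ExK e) (Bicategory.Adjunction.ofIsLeftAdjoint (D.ev b))
    (fun K X Y η hη _ => hu.ext_of_cover hD hz (fun Q => (hst Q).2)
      (U := CategoryTheory.Prod.sectR b K.unop)
      (G := fun a => Functor.fromPUnit.{0} a) (fun a => ptSectSq b a)
      (fun a => termCrit_ptSectSq b a) (fun s => ⟨s, ⟨PUnit.unit⟩, rfl⟩) hη fun a => he _)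
    fun K Y hY => ⟨trivial, hu.rExt_of_cover hD hz hst (U := CategoryTheory.Prod.sectR b K.unop)
      (G := fun a => Functor.fromPUnit.{0} a) (fun a => ptSectSq b a)
      (fun a => termCrit_ptSectSq b a) hY⟩
  exact h1.congr (fun _ _ _ => ExK.of_iso) (cls_eq (ρ_ _)) (λ_ _)

/-- A left Kan extension from a point satisfying `LCrit`. -/
theorem Good.lanPt (hD : D.IsKan) (hz : Limits.HasZeroObject (D.val One)) (hK : D.HasKan)
    {b : T} {e : ExData T} (hu : LCrit (Functor.fromPUnit.{0} b) e)
    (he : ∀ Y, D.ExAt (e.pull (Functor.fromPUnit.{0} b).obj) Y) :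
    Good (D.ExK e) (D.ev b) (Der.Prederivator.lanPt hK b) := by
  have := hK.left_pt b
  have h0 : Good (fun (_ : Cat.{0, 0}ᵒᵖ) _ => True) (𝟙 D) (𝟙 D) := Good.base fun _ _ => trivial
  have h1 := h0.of_leftAdjoint (q := D.ExK e) (Bicategory.Adjunction.ofIsRightAdjoint (D.ev b))
    (fun K X Y η hη _ => hu.ext_of_cover hD hz
      (U := CategoryTheory.Prod.sectR b K.unop)
      (G := fun a => Functor.fromPUnit.{0} a) (fun a => ptSectSq b a)
      (fun a => initCrit_ptSectSq b a) (fun s => ⟨s, ⟨PUnit.unit⟩, rfl⟩) hη fun a => he _)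
    fun K Y hY => ⟨trivial, hu.lExt_of_cover hD hz (U := CategoryTheory.Prod.sectR b K.unop)
      (G := fun a => Functor.fromPUnit.{0} a) (fun a => ptSectSq b a)
      (fun a => initCrit_ptSectSq b a) hY⟩
  exact h1.congr (fun _ _ _ => ExK.of_iso) (cls_eq (ρ_ _)) (λ_ _)

/-- Restriction along a functor which preserves exactness conditions on unparametrized diagrams. -/
theorem exK_restr {S : Type} [Preorder S] {g : S ⥤ T} {e : ExData T} {e' : ExData S}
    (hg : ∀ Y : D.val T, D.ExAt e Y → D.ExAt e' ((D.res g).obj Y)) (K)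
    (Y : (D.shift T).obj K) (hY : D.ExK e K Y) : D.ExK e' K ((fn (D.restr g) K).obj Y) :=
  fun a => exAt_sectL_res hg a (hY a)

end ExK

end

end Der.Prederivator

namespace Der.Prederivator

noncomputable section

/-! ### Full subprederivators -/

section Sub

variable {E F : Prederivator.{v, u}}

/-- A morphism of prederivators whose values have a property, as a morphism to the full
subprederivator. -/
def liftTo (P : F.ObjectProperty) [P.IsClosedUnderMapObj] (θ : E ⟶ F)
    (h : ∀ K X, P.prop K ((fn θ K).obj X)) : E ⟶ P.fullsubcategory where
  app K := ((P.prop K).lift (θ.app K).toFunctor (fun X => h K X)).toCatHom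
  naturality {_ L} f := Cat.Hom.isoMk (((P.prop L).fullyFaithfulι.whiskeringRight _).preimageIso
    (Cat.Hom.toNatIso (θ.naturality f)))
  naturality_naturality η := Cat.Hom₂.ext (NatTrans.ext (funext fun X =>
    InducedCategory.hom_ext (congrArg (fun t => t.toNatTrans.app X) (θ.naturality_naturality η))))
  naturality_id K := Cat.Hom₂.ext (NatTrans.ext (funext fun X =>
    InducedCategory.hom_ext (congrArg (fun t => t.toNatTrans.app X) (θ.naturality_id K))))
  naturality_comp f g := Cat.Hom₂.ext (NatTrans.ext (funext fun X =>
    InducedCategory.hom_ext (congrArg (fun t => t.toNatTrans.app X) (θ.naturality_comp f g))))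

theorem cls_liftTo (P : F.ObjectProperty) [P.IsClosedUnderMapObj] (θ : E ⟶ F)
    (h : ∀ K X, P.prop K ((fn θ K).obj X)) : cls (liftTo P θ h) ≫ cls (subι P) = cls θ := by
  refine cls_eq (φ := liftTo P θ h ≫ subι P) (isoMk (fun K => Iso.refl _) fun f X => ?_)
  rw [nt_comp_app]
  refine (Category.id_comp _).trans (Eq.trans ?_ ((congrArg (_ ≫ ·)
    (CategoryTheory.Functor.map_id (F.map f).toFunctor _)).trans (Category.comp_id _)).symm)
  exact (Category.comp_id _).symm

theorem cls_liftSub (P : E.ObjectProperty) (Q : F.ObjectProperty) [P.IsClosedUnderMapObj]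
    [Q.IsClosedUnderMapObj] (θ : E ⟶ F)
    (h : ∀ K X, P.prop K X → Q.prop K ((θ.app K).toFunctor.obj X)) :
    cls (liftSub P Q θ h) ≫ cls (subι Q) = cls (subι P) ≫ cls θ := by
  refine cls_eq (φ := liftSub P Q θ h ≫ subι Q) (ψ := subι P ≫ θ)
    (isoMk (fun K => Iso.refl _) fun f X => ?_)
  rw [nt_comp_app, nt_comp_app]
  refine (Category.id_comp _).trans (Eq.trans ?_ ((congrArg (_ ≫ ·)
    (CategoryTheory.Functor.map_id (F.map f).toFunctor _)).trans (Category.comp_id _)).symm)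
  refine Eq.trans ?_ (Category.comp_id _).symm
  exact (congrArg (· ≫ _) (CategoryTheory.Functor.map_id _ _)).trans (Category.id_comp _)

/-- Isomorphisms between morphisms into a full subprederivator can be computed in the ambient one.
-/
theorem cls_subι_mono (P : F.ObjectProperty) [P.IsClosedUnderMapObj] : Mono (cls (subι P)) := by
  refine ⟨fun {E} f g h => ?_⟩
  obtain ⟨φ, rfl⟩ := cls_surj f
  obtain ⟨ψ, rfl⟩ := cls_surj g
  obtain ⟨i⟩ := cls_eq_iff.1 h
  let m : ∀ K, fn φ K ≅ fn ψ K := fun K =>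
    ((P.prop K).fullyFaithfulι.whiskeringRight _).preimageIso (appIso i K)
  refine cls_eq (isoMk m fun f X => ?_)
  refine InducedCategory.hom_ext ?_
  have h1 := md_naturality i.hom f X
  rw [nt_comp_app, nt_comp_app] at h1
  exact ((congrArg (_ ≫ ·) (Category.comp_id _)).symm.trans h1).trans
    (congrArg (· ≫ _) (Category.comp_id _))

/-- `Good` expresses an equivalence from the full subprederivator of the `p`-objects. -/
theorem Good.isIso_sub {p : ∀ K, F.obj K → Prop} {G : Prederivator.{v, u}} {ρ : F ⟶ G} {L : G ⟶ F}
    (h : Good p ρ L) (P : F.ObjectProperty) [P.IsClosedUnderMapObj]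
    (hP : ∀ K X, P.prop K X ↔ p K X) : IsIso (cls (subι P) ≫ cls ρ) := by
  have := cls_subι_mono P
  refine ⟨cls (liftTo P L fun K X => (hP _ _).2 (h.mem K X)), ?_, ?_⟩
  · rw [← cancel_mono (cls (subι P)), Category.assoc, Category.assoc, cls_liftTo, Category.id_comp]
    exact h.uniq (subι P) fun K X => (hP _ _).1 X.2
  · rw [← Category.assoc, cls_liftTo, h.sec]

end Sub

end

end Der.Prederivator

namespace Der.Prederivator

noncomputable section

/-! ### Finite posets -/

section Lists

instance {n : ℕ} : DecidableLE (Fin n → ℤ) := fun a b =>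
  inferInstanceAs (Decidable (∀ i, a i ≤ b i))

/-- Exactness conditions given by lists. -/
def ExData.ofList {A : Type*} (sqs : List (A × A × A × A)) (zs : List A) : ExData A :=
  ⟨fun a b c d => (a, b, c, d) ∈ sqs, fun t => t ∈ zs⟩

variable {A : Type*} [Preorder A] [DecidableEq A]

/-- The criterion `LCrit` for a poset with list of points `lT`, a subposet with list of points `lS`
and exactness conditions given by the lists `sqs` and `zs`; the order of `lT` is the one in which
the new points are constructed. -/
def LOk (lS lT : List A) (sqs : List (A × A × A × A)) (zs : List A) : Prop :=
  (∀ p ∈ lT, p ∈ lS ∨ (p ∈ zs ∧ ∀ s ∈ lS, ¬ s ≤ p) ∨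
    ∃ q ∈ sqs, q.2.2.2 = p ∧ (q.1 ∈ lT ∧ q.2.1 ∈ lT ∧ q.2.2.1 ∈ lT) ∧
      lT.idxOf q.1 < lT.idxOf p ∧ lT.idxOf q.2.1 < lT.idxOf p ∧ lT.idxOf q.2.2.1 < lT.idxOf p) ∧
  (∀ q ∈ sqs, (q.1 ∈ lT ∧ q.2.1 ∈ lT ∧ q.2.2.1 ∈ lT ∧ q.2.2.2 ∈ lT) →
    (q.1 ∈ lS ∧ q.2.1 ∈ lS ∧ q.2.2.1 ∈ lS ∧ q.2.2.2 ∈ lS) ∨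
    (q.1 ≤ q.2.1 ∧ q.1 ≤ q.2.2.1 ∧ q.2.2.1 ≤ q.2.2.2 ∧ q.2.1 ≤ q.2.2.2) ∧
    (∀ x ∈ lT, x ≤ q.2.1 → x ≤ q.2.2.1 → x ≤ q.1) ∧
    ∀ s ∈ lS, s ≤ q.2.2.2 → s ≤ q.2.1 ∨ s ≤ q.2.2.1) ∧
  ∀ t ∈ zs, t ∈ lT → t ∈ lS ∨ ∀ s ∈ lS, ¬ s ≤ t

/-- The dual of `LOk`. -/
def ROk (lS lT : List A) (sqs : List (A × A × A × A)) (zs : List A) : Prop :=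
  (∀ p ∈ lT, p ∈ lS ∨ (p ∈ zs ∧ ∀ s ∈ lS, ¬ p ≤ s) ∨
    ∃ q ∈ sqs, q.1 = p ∧ (q.2.1 ∈ lT ∧ q.2.2.1 ∈ lT ∧ q.2.2.2 ∈ lT) ∧
      lT.idxOf q.2.1 < lT.idxOf p ∧ lT.idxOf q.2.2.1 < lT.idxOf p ∧
      lT.idxOf q.2.2.2 < lT.idxOf p) ∧
  (∀ q ∈ sqs, (q.1 ∈ lT ∧ q.2.1 ∈ lT ∧ q.2.2.1 ∈ lT ∧ q.2.2.2 ∈ lT) →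
    (q.1 ∈ lS ∧ q.2.1 ∈ lS ∧ q.2.2.1 ∈ lS ∧ q.2.2.2 ∈ lS) ∨
    (q.1 ≤ q.2.1 ∧ q.1 ≤ q.2.2.1 ∧ q.2.2.1 ≤ q.2.2.2 ∧ q.2.1 ≤ q.2.2.2) ∧
    (∀ x ∈ lT, q.2.1 ≤ x → q.2.2.1 ≤ x → q.2.2.2 ≤ x) ∧
    ∀ s ∈ lS, q.1 ≤ s → q.2.1 ≤ s ∨ q.2.2.1 ≤ s) ∧
  ∀ t ∈ zs, t ∈ lT → t ∈ lS ∨ ∀ s ∈ lS, ¬ t ≤ s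

set_option synthInstance.maxHeartbeats 400000 in
set_option synthInstance.maxSize 2000 in
instance [DecidableLE A] (lS lT : List A) (sqs : List (A × A × A × A)) (zs : List A) :
    Decidable (LOk lS lT sqs zs) := by unfold LOk; infer_instance

set_option synthInstance.maxHeartbeats 400000 in
set_option synthInstance.maxSize 2000 in
instance [DecidableLE A] (lS lT : List A) (sqs : List (A × A × A × A)) (zs : List A) :
    Decidable (ROk lS lT sqs zs) := by unfold ROk; infer_instance

end Lists

section Lists

variable {A : Type*} [Preorder A] {S T : Type} [SmallCategory S] [Preorder T] {u : S ⥤ T}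

/-- The points of the poset `T` are listed by `lT`, by means of an order embedding `f` into `A`,
and the image of `u : S ⥤ T` is listed by `lS`. -/
structure Listed (u : S ⥤ T) (f : T → A) (lS lT : List A) : Prop where
  le : ∀ a b, f a ≤ f b → a ≤ b
  mono : ∀ a b, a ≤ b → f a ≤ f b
  inj : ∀ a b, f a = f b → a = b
  mem : ∀ t, f t ∈ lT
  surj : ∀ p ∈ lT, ∃ t, f t = p
  memS : ∀ s, f (u.obj s) ∈ lS
  surjS : ∀ p ∈ lS, ∃ s, f (u.obj s) = p
  emb : ∀ a b, u.obj a ≤ u.obj b → Nonempty (a ⟶ b)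

theorem Listed.exists_obj {f : T → A} {lS lT : List A} (h : Listed u f lS lT) {t : T}
    (ht : f t ∈ lS) : ∃ s, u.obj s = t :=
  (h.surjS _ ht).imp fun _ hs => h.inj _ _ hs

/-- The decidable criterion on lists implies `LCrit`. -/
theorem Listed.lCrit [DecidableEq A] {f : T → A} {lS lT : List A} (h : Listed u f lS lT)
    {sqs : List (A × A × A × A)} {zs : List A} (hl : LOk lS lT sqs zs) :
    LCrit u ((ExData.ofList sqs zs).pull f) where
  emb := h.emb
  new := by
    refine ⟨fun t => lT.idxOf (f t), fun p => ?_⟩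
    obtain h1 | ⟨h1, h2⟩ | ⟨⟨a, b, c, d⟩, h1, h2, ⟨h3, h4, h5⟩, h6, h7, h8⟩ := hl.1 _ (h.mem p)
    · exact Or.inl (h.exists_obj h1)
    · exact Or.inr (Or.inl ⟨h1, fun s hs => h2 _ (h.memS s) (h.mono _ _ hs)⟩)
    · obtain ⟨a, rfl⟩ := h.surj _ h3
      obtain ⟨b, rfl⟩ := h.surj _ h4
      obtain ⟨c, rfl⟩ := h.surj _ h5
      change d = f p at h2
      subst h2
      exact Or.inr (Or.inr ⟨a, b, c, h1, h6, h7, h8⟩)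
  sq a b c d hs := by
    obtain ⟨h1, h2, h3, h4⟩ | ⟨⟨h1, h2, h3, h4⟩, h5, h6⟩ :=
      hl.2.1 _ hs ⟨h.mem a, h.mem b, h.mem c, h.mem d⟩
    · exact Or.inl ⟨h.exists_obj h1, h.exists_obj h2, h.exists_obj h3, h.exists_obj h4⟩
    · exact Or.inr ⟨⟨h.le _ _ h1, h.le _ _ h2, h.le _ _ h3, h.le _ _ h4⟩,
        fun x hb hc => h.le _ _ (h5 _ (h.mem x) (h.mono _ _ hb) (h.mono _ _ hc)),
        fun s hs => (h6 _ (h.memS s) (h.mono _ _ hs)).imp (h.le _ _) (h.le _ _)⟩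
  zero t ht := (hl.2.2 _ ht (h.mem t)).imp h.exists_obj
    fun h1 s hs => h1 _ (h.memS s) (h.mono _ _ hs)

theorem Listed.rCrit [DecidableEq A] {f : T → A} {lS lT : List A} (h : Listed u f lS lT)
    {sqs : List (A × A × A × A)} {zs : List A} (hl : ROk lS lT sqs zs) :
    RCrit u ((ExData.ofList sqs zs).pull f) where
  emb := h.emb
  new := by
    refine ⟨fun t => lT.idxOf (f t), fun p => ?_⟩
    obtain h1 | ⟨h1, h2⟩ | ⟨⟨a, b, c, d⟩, h1, h2, ⟨h3, h4, h5⟩, h6, h7, h8⟩ := hl.1 _ (h.mem p)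
    · exact Or.inl (h.exists_obj h1)
    · exact Or.inr (Or.inl ⟨h1, fun s hs => h2 _ (h.memS s) (h.mono _ _ hs)⟩)
    · obtain ⟨b, rfl⟩ := h.surj _ h3
      obtain ⟨c, rfl⟩ := h.surj _ h4
      obtain ⟨d, rfl⟩ := h.surj _ h5
      change a = f p at h2
      subst h2
      exact Or.inr (Or.inr ⟨b, c, d, h1, h6, h7, h8⟩)
  sq a b c d hs := by
    obtain ⟨h1, h2, h3, h4⟩ | ⟨⟨h1, h2, h3, h4⟩, h5, h6⟩ :=
      hl.2.1 _ hs ⟨h.mem a, h.mem b, h.mem c, h.mem d⟩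
    · exact Or.inl ⟨h.exists_obj h1, h.exists_obj h2, h.exists_obj h3, h.exists_obj h4⟩
    · exact Or.inr ⟨⟨h.le _ _ h1, h.le _ _ h2, h.le _ _ h3, h.le _ _ h4⟩,
        fun x hb hc => h.le _ _ (h5 _ (h.mem x) (h.mono _ _ hb) (h.mono _ _ hc)),
        fun s hs => (h6 _ (h.memS s) (h.mono _ _ hs)).imp (h.le _ _) (h.le _ _)⟩
  zero t ht := (hl.2.2 _ ht (h.mem t)).imp h.exists_obj
    fun h1 s hs => h1 _ (h.memS s) (h.mono _ _ hs)

end Lists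

/-! ### Pasting of cocartesian squares -/

section Paste

variable {D : Prederivator.{v, u}} {T : Type} [Preorder T]

/-- The shape of two adjacent squares. -/
def Rect : Type := Fin 3 × Fin 2

instance : PartialOrder Rect := inferInstanceAs (PartialOrder (Fin 3 × Fin 2))

instance : DecidableEq Rect := inferInstanceAs (DecidableEq (Fin 3 × Fin 2))

instance : DecidableLE Rect := inferInstanceAs (DecidableLE (Fin 3 × Fin 2))

instance : Fintype Rect := inferInstanceAs (Fintype (Fin 3 × Fin 2))

/-- The points of `Rect`. -/
def Rect.mk (i : Fin 3) (j : Fin 2) : Rect := (i, j)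

/-- The complement of the final row. -/
abbrev RectL : Type := {x : Rect // x.2 = 0 ∨ x.1 = 0}

/-- The complement of the initial row. -/
abbrev RectR : Type := {x : Rect // x.2 = 1 ∨ x.1 = 2}

/-- The inclusion of `RectL`. -/
def rectL : RectL ⥤ Rect := mono (fun x => x.1) fun _ _ h => h

/-- The inclusion of `RectR`. -/
def rectR : RectR ⥤ Rect := mono (fun x => x.1) fun _ _ h => h

/-- The points of `Rect`, constructed from those of `RectL`. -/
abbrev rectPts : List Rect := [.mk 0 0, .mk 1 0, .mk 2 0, .mk 0 1, .mk 1 1, .mk 2 1]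

theorem listed_rectL : Listed rectL id [.mk 0 0, .mk 1 0, .mk 2 0, .mk 0 1] rectPts where
  le _ _ h := h
  mono _ _ h := h
  inj _ _ h := h
  mem := by decide
  surj p _ := ⟨p, rfl⟩
  memS := by decide
  surjS := by decide
  emb _ _ h := ⟨homOfLE h⟩

theorem listed_rectR : Listed rectR id [.mk 2 1, .mk 1 1, .mk 0 1, .mk 2 0] rectPts.reverse where
  le _ _ h := h
  mono _ _ h := h
  inj _ _ h := h
  mem := by decide
  surj p _ := ⟨p, rfl⟩
  memS := by decide
  surjS := by decide
  emb _ _ h := ⟨homOfLE h⟩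

theorem CoSq.le {Y : D.val T} {a b c d : T} (h : D.CoSq Y a b c d) :
    a ≤ b ∧ a ≤ c ∧ b ≤ d ∧ c ≤ d := by
  obtain ⟨k, ⟨rfl, rfl, rfl, rfl⟩, -⟩ := h
  exact ⟨leOfHom (k.map (homOfLE (by decide))), leOfHom (k.map (homOfLE (by decide))),
    leOfHom (k.map (homOfLE (by decide))), leOfHom (k.map (homOfLE (by decide)))⟩

theorem rect_cases (x : Rect) : x = .mk 0 0 ∨ x = .mk 1 0 ∨ x = .mk 2 0 ∨ x = .mk 0 1 ∨
    x = .mk 1 1 ∨ x = .mk 2 1 := by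
  revert x; decide

/-- The functor on `Rect` given by two adjacent squares. -/
def rectFun {a b c d e f : T} (h₁ : a ≤ b) (h₂ : b ≤ e) (h₃ : a ≤ c) (h₄ : b ≤ d) (h₅ : e ≤ f)
    (h₆ : c ≤ d) (h₇ : d ≤ f) : Rect ⥤ T :=
  mono (fun x => if x.2 = 0 then (if x.1 = 0 then a else if x.1 = 1 then b else e) else
    if x.1 = 0 then c else if x.1 = 1 then d else f) (by
    intro x y hxy
    revert hxy
    rcases rect_cases x with rfl | rfl | rfl | rfl | rfl | rfl <;>
    rcases rect_cases y with rfl | rfl | rfl | rfl | rfl | rfl <;>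
    first
    | exact fun h => absurd h (by decide)
    | exact fun _ => le_refl _
    | exact fun _ => h₁
    | exact fun _ => h₂
    | exact fun _ => h₃
    | exact fun _ => h₄
    | exact fun _ => h₅
    | exact fun _ => h₆
    | exact fun _ => h₇
    | exact fun _ => h₁.trans h₂
    | exact fun _ => h₆.trans h₇
    | exact fun _ => h₃.trans h₆
    | exact fun _ => h₂.trans h₅
    | exact fun _ => h₁.trans (h₂.trans h₅))

theorem CoSq.res_of_le {S : Type} [Preorder S] {F : S ⥤ T} {Y : D.val T} {a b c d : T}
    (h : D.CoSq Y a b c d)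
    {x y z w : S} (hx : F.obj x = a) (hy : F.obj y = b) (hz : F.obj z = c) (hw : F.obj w = d)
    (hl : x ≤ y ∧ x ≤ z ∧ z ≤ w ∧ y ≤ w) : D.CoSq ((D.res F).obj Y) x y z w := by
  subst hx hy hz hw
  obtain ⟨k, ⟨h1, h2, h3, h4⟩, h⟩ := h
  let k' : Sq ⥤ S := thinSq ⟨homOfLE hl.1⟩ ⟨homOfLE hl.2.1⟩ ⟨homOfLE hl.2.2.1⟩ ⟨homOfLE hl.2.2.2⟩
  exact ⟨k', ⟨rfl, rfl, rfl, rfl⟩, h.of_iso ((D.resIso (sqIso (k' := k' ⋙ F) h1 h2 h3 h4) ≪≫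
    D.resComp k' F).app Y)⟩

theorem IsKan.coSq_rect (hD : D.IsKan) {Y : D.val Rect} (hY : D.LExt rectL Y) {a b c d : Rect}
    (h : (a ≤ b ∧ a ≤ c ∧ c ≤ d ∧ b ≤ d) ∧ (∀ x, x ≤ b → x ≤ c → x ≤ a) ∧
      ∀ s : Rect, (s.2 = 0 ∨ s.1 = 0) → s ≤ d → s ≤ b ∨ s ≤ c) : D.CoSq Y a b c d :=
  ⟨thinSq ⟨homOfLE h.1.1⟩ ⟨homOfLE h.1.2.1⟩ ⟨homOfLE h.1.2.2.1⟩ ⟨homOfLE h.1.2.2.2⟩,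
    ⟨rfl, rfl, rfl, rfl⟩, hD.isCocartesian_res hY _ h.2.1 fun s => h.2.2 s.1 s.2⟩

/-- The composite of two adjacent cocartesian squares is cocartesian. -/
theorem CoSq.paste (hD : D.IsKan) (hz : Limits.HasZeroObject (D.val One)) {Y : D.val T}
    {a b c d e f : T} (h₁ : D.CoSq Y a b c d) (h₂ : D.CoSq Y b e d f) : D.CoSq Y a e c f := by
  let F : Rect ⥤ T := rectFun h₁.le.1 h₂.le.1 h₁.le.2.1 h₁.le.2.2.1 h₂.le.2.2.1 h₁.le.2.2.2
    h₂.le.2.2.2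
  have h3 : D.LExt rectL ((D.res F).obj Y) := (listed_rectL.lCrit (f := id)
    (sqs := [(.mk 0 0, .mk 1 0, .mk 0 1, .mk 1 1), (.mk 1 0, .mk 2 0, .mk 1 1, .mk 2 1)])
    (zs := []) (by decide)).lExt hD hz ⟨fun x y z w h => ?_, fun _ h => absurd h List.not_mem_nil⟩
  · exact (hD.coSq_rect h3 (a := .mk 0 0) (b := .mk 2 0) (c := .mk 0 1) (d := .mk 2 1)
      (by decide)).of_res
  · simp only [ExData.pull, ExData.ofList, id, List.mem_cons, Prod.mk.injEq, List.not_mem_nil,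
      or_false] at h
    obtain ⟨rfl, rfl, rfl, rfl⟩ | ⟨rfl, rfl, rfl, rfl⟩ := h
    exacts [CoSq.res_of_le h₁ rfl rfl rfl rfl (by decide), CoSq.res_of_le h₂ rfl rfl rfl rfl
      (by decide)]

/-- If the first of two adjacent squares and their composite are cocartesian, so is the second. -/
theorem CoSq.cancel (hD : D.IsKan) (hz : Limits.HasZeroObject (D.val One)) {Y : D.val T}
    {a b c d e f : T} (h₁ : D.CoSq Y a b c d) (h₂ : D.CoSq Y a e c f) (hb : b ≤ e) (hd : d ≤ f) :
    D.CoSq Y b e d f := by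
  let F : Rect ⥤ T := rectFun h₁.le.1 hb h₁.le.2.1 h₁.le.2.2.1 h₂.le.2.2.1 h₁.le.2.2.2 hd
  have h3 : D.LExt rectL ((D.res F).obj Y) := (listed_rectL.lCrit (f := id)
    (sqs := [(.mk 0 0, .mk 1 0, .mk 0 1, .mk 1 1), (.mk 0 0, .mk 2 0, .mk 0 1, .mk 2 1)])
    (zs := []) (by decide)).lExt hD hz ⟨fun x y z w h => ?_, fun _ h => absurd h List.not_mem_nil⟩
  · exact (hD.coSq_rect h3 (a := .mk 1 0) (b := .mk 2 0) (c := .mk 1 1) (d := .mk 2 1)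
      (by decide)).of_res
  · simp only [ExData.pull, ExData.ofList, id, List.mem_cons, Prod.mk.injEq, List.not_mem_nil,
      or_false] at h
    obtain ⟨rfl, rfl, rfl, rfl⟩ | ⟨rfl, rfl, rfl, rfl⟩ := h
    exacts [CoSq.res_of_le h₁ rfl rfl rfl rfl (by decide), CoSq.res_of_le h₂ rfl rfl rfl rfl
      (by decide)]

/-- If the second of two adjacent squares and their composite are bicartesian, so is the first. -/
theorem CoSq.cancel' (hD : D.IsKan) (hz : Limits.HasZeroObject (D.val One))
    (hst : ∀ Q, D.IsCocartesian Q ↔ D.IsCartesian Q) {Y : D.val T}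
    {a b c d e f : T} (h₁ : D.CoSq Y b e d f) (h₂ : D.CoSq Y a e c f) (hb : a ≤ b) (hd : c ≤ d) :
    D.CoSq Y a b c d := by
  let F : Rect ⥤ T := rectFun hb h₁.le.1 h₂.le.2.1 h₁.le.2.1 h₁.le.2.2.1 hd h₁.le.2.2.2
  have h3 : D.RExt rectR ((D.res F).obj Y) := (listed_rectR.rCrit (f := id)
    (sqs := [(.mk 1 0, .mk 2 0, .mk 1 1, .mk 2 1), (.mk 0 0, .mk 2 0, .mk 0 1, .mk 2 1)])
    (zs := []) (by decide)).rExt hD hz hst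
      ⟨fun x y z w h => ?_, fun _ h => absurd h List.not_mem_nil⟩
  · let k : Sq ⥤ Rect := mono (fun s => .mk s.1.castSucc s.2) (by decide)
    refine CoSq.of_res (F := F) (a := .mk 0 0) (b := .mk 1 0) (c := .mk 0 1) (d := .mk 1 1)
      ⟨k, ⟨rfl, rfl, rfl, rfl⟩, (hst _).2 (hD.isCartesian_res h3 _ ?_ ?_)⟩
    all_goals decide
  · simp only [ExData.pull, ExData.ofList, id, List.mem_cons, Prod.mk.injEq, List.not_mem_nil,
      or_false] at h
    obtain ⟨rfl, rfl, rfl, rfl⟩ | ⟨rfl, rfl, rfl, rfl⟩ := h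
    exacts [CoSq.res_of_le h₁ rfl rfl rfl rfl (by decide), CoSq.res_of_le h₂ rfl rfl rfl rfl
      (by decide)]

theorem CoSq.symm (hD : D.IsKan) {Y : D.val T} {a b c d : T} (h : D.CoSq Y a b c d) :
    D.CoSq Y a c b d := by
  obtain ⟨k, ⟨rfl, rfl, rfl, rfl⟩, h⟩ := h
  let t : Sq ⥤ Sq := mono (fun s => .mk s.2 s.1) (by decide)
  refine CoSq.of_res (F := k) (a := .mk 0 0) (b := .mk 0 1) (c := .mk 1 0) (d := .mk 1 1)
    ⟨t, ⟨rfl, rfl, rfl, rfl⟩, hD.isCocartesian_res ((hD.isCocartesian_iff _).1 h) t ?_ ?_⟩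
  all_goals decide

/-- Squares with two identities are cocartesian. -/
theorem IsKan.coSq_refl (hD : D.IsKan) {Y : D.val T} {a c : T} (h : a ≤ c) : D.CoSq Y a a c c := by
  let F : Arr ⥤ T := mono (fun t => if t = 0 then a else c) (by
    intro x y
    fin_cases x <;> fin_cases y <;>
    first
    | exact fun h => absurd h (by decide)
    | exact fun _ => le_refl _
    | exact fun _ => h)
  have h1 : D.LExt (𝟭 Arr) ((D.res F).obj Y) := by
    have h2 := Functor.Full.of_iso (D.resId Arr).symm
    have h3 := Functor.Faithful.of_iso (D.resId Arr).symm
    intro Z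
    refine ⟨fun f g hfg => ?_, fun f => ?_⟩
    · exact (D.res (𝟭 Arr)).map_injective (by simpa using hfg)
    · obtain ⟨g, hg⟩ := (D.res (𝟭 Arr)).map_surjective f
      exact ⟨g, by simp [hg]⟩
  refine CoSq.of_res (F := F) (a := 0) (b := 0) (c := 1) (d := 1)
    ⟨sqSnd, ⟨rfl, rfl, rfl, rfl⟩, hD.isCocartesian_res h1 _ ?_ ?_⟩
  all_goals decide

end Paste

end

end Der.Prederivator

namespace Der.Prederivator

noncomputable section

/-! ### Whiskering -/

section Whisk

universe w₅ v₅ u₅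

variable {A : Type u₁} [Bicategory.{w₁, v₁} A] {B : Type u₂} [Bicategory.{w₂, v₂} B]
  {C : Type u₃} [Bicategory.{w₃, v₃} C] {C' : Type u₄} [Bicategory.{w₄, v₄} C']

def whiskIso {Φ Ψ : A ⥤ᵖ B} {α β : Φ ⟶ Ψ} (e : α ≅ β) (D : B ⥤ᵖ C) : whisk α D ≅ whisk β D :=
  Pseudofunctor.StrongTrans.isoMk
    (fun a => D.map₂Iso ⟨e.hom.as.app a, e.inv.as.app a,
      congrArg (fun t => t.as.app a) e.hom_inv_id, congrArg (fun t => t.as.app a) e.inv_hom_id⟩)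
    fun {a b} f => by
      have h := congrArg D.map₂ (e.hom.as.naturality f)
      simp only [PrelaxFunctor.map₂_comp, Pseudofunctor.map₂_whisker_left,
        Pseudofunctor.map₂_whisker_right, Category.assoc] at h
      change D.map (Φ.map f) ◁ D.map₂ (e.hom.as.app b) ≫ ((D.mapComp _ _).inv ≫
          D.map₂ (β.naturality f).hom ≫ (D.mapComp _ _).hom) =
        ((D.mapComp _ _).inv ≫ D.map₂ (α.naturality f).hom ≫ (D.mapComp _ _).hom) ≫
          D.map₂ (e.hom.as.app a) ▷ D.map (Ψ.map f)
      rw [← cancel_epi (D.mapComp _ _).hom, ← cancel_mono (D.mapComp _ _).inv]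
      simpa using h

def whiskComp {Φ Ψ Ω : A ⥤ᵖ B} (α : Φ ⟶ Ψ) (β : Ψ ⟶ Ω) (D : B ⥤ᵖ C) :
    whisk (α ≫ β) D ≅ whisk α D ≫ whisk β D :=
  Pseudofunctor.StrongTrans.isoMk (fun a => D.mapComp (α.app a) (β.app a)) fun {a b} f => by
    change D.map (Φ.map f) ◁ (D.mapComp (α.app b) (β.app b)).hom ≫
        ((α_ _ _ _).inv ≫ ((D.mapComp _ _).inv ≫ D.map₂ (α.naturality f).hom ≫
          (D.mapComp _ _).hom) ▷ D.map (β.app b) ≫ (α_ _ _ _).hom ≫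
            D.map (α.app a) ◁ ((D.mapComp _ _).inv ≫ D.map₂ (β.naturality f).hom ≫
              (D.mapComp _ _).hom) ≫ (α_ _ _ _).inv) =
      ((D.mapComp _ _).inv ≫ D.map₂ ((α_ _ _ _).inv ≫ (α.naturality f).hom ▷ β.app b ≫
        (α_ _ _ _).hom ≫ α.app a ◁ (β.naturality f).hom ≫ (α_ _ _ _).inv) ≫ (D.mapComp _ _).hom) ≫
          (D.mapComp (α.app a) (β.app a)).hom ▷ D.map (Ω.map f)
    simp only [PrelaxFunctor.map₂_comp, Pseudofunctor.map₂_whisker_left,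
      Pseudofunctor.map₂_whisker_right, Category.assoc, map₂_α_inv, Pseudofunctor.map₂_associator]
    simp

/-- Compatibility of whiskering with composition of pseudofunctors. -/
def assocWhisk {Φ Ψ : A ⥤ᵖ B} (α : Φ ⟶ Ψ) (G : B ⥤ᵖ C) (D : C ⥤ᵖ C') :
    assocTrans Φ G D ≫ whisk α (G.comp D) ≅ whisk (whisk α G) D ≫ assocTrans Ψ G D :=
  Pseudofunctor.StrongTrans.isoMk (fun a => λ_ _ ≪≫ (ρ_ (D.map (G.map (α.app a)))).symm)
    fun {a b} f => by
    change D.map (G.map (Φ.map f)) ◁ ((λ_ _).hom ≫ (ρ_ _).inv) ≫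
        ((α_ _ _ _).inv ≫ ((D.mapComp _ _).inv ≫ D.map₂ ((G.mapComp _ _).inv ≫
          G.map₂ (α.naturality f).hom ≫ (G.mapComp _ _).hom) ≫ (D.mapComp _ _).hom) ▷ 𝟙 _ ≫
            (α_ _ _ _).hom ≫ _ ◁ ((ρ_ _).hom ≫ (λ_ _).inv) ≫ (α_ _ _ _).inv) =
      ((α_ _ _ _).inv ≫ ((ρ_ _).hom ≫ (λ_ _).inv) ▷ D.map (G.map (α.app b)) ≫ (α_ _ _ _).hom ≫
        𝟙 _ ◁ (((D.mapComp _ _).inv ≫ D.map₂ (G.mapComp _ _).inv) ≫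
          D.map₂ (G.map₂ (α.naturality f).hom) ≫ D.map₂ (G.mapComp _ _).hom ≫ (D.mapComp _ _).hom)
            ≫ (α_ _ _ _).inv) ≫ ((λ_ _).hom ≫ (ρ_ _).inv) ▷ D.map (G.map (Ψ.map f))
    simp

def whiskId (Φ : A ⥤ᵖ B) (D : B ⥤ᵖ C) : whisk (𝟙 Φ) D ≅ 𝟙 (Φ.comp D) :=
  Pseudofunctor.StrongTrans.isoMk (fun a => D.mapId (Φ.obj a)) fun {a b} f => by
    change D.map (Φ.map f) ◁ (D.mapId _).hom ≫ ((ρ_ _).hom ≫ (λ_ _).inv) =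
      ((D.mapComp _ _).inv ≫ D.map₂ ((ρ_ _).hom ≫ (λ_ _).inv) ≫ (D.mapComp _ _).hom) ≫
        (D.mapId _).hom ▷ D.map (Φ.map f)
    have h : D.map₂ (λ_ (Φ.map f)).inv = (λ_ (D.map (Φ.map f))).inv ≫
        (D.mapId _).inv ▷ D.map (Φ.map f) ≫ (D.mapComp _ _).inv := by
      rw [← cancel_mono (D.map₂ (λ_ (Φ.map f)).hom), ← PrelaxFunctor.map₂_comp, Iso.inv_hom_id,
        PrelaxFunctor.map₂_id, Pseudofunctor.map₂_left_unitor]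
      simp
    simp [h, Pseudofunctor.map₂_right_unitor]

/-- The two identifications of bracketings are inverse to each other. -/
def assocInv (F : A ⥤ᵖ B) (G : B ⥤ᵖ C) (H : C ⥤ᵖ C') :
    assocTrans F G H ≫ assocTrans' F G H ≅ 𝟙 ((F.comp G).comp H) :=
  Pseudofunctor.StrongTrans.isoMk (fun a => λ_ (𝟙 (H.obj (G.obj (F.obj a))))) fun {a b} f => by
    change H.map (G.map (F.map f)) ◁ (λ_ _).hom ≫ ((ρ_ _).hom ≫ (λ_ _).inv) =
      ((α_ _ _ _).inv ≫ ((ρ_ _).hom ≫ (λ_ _).inv) ▷ 𝟙 _ ≫ (α_ _ _ _).hom ≫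
        𝟙 _ ◁ ((ρ_ _).hom ≫ (λ_ _).inv) ≫ (α_ _ _ _).inv) ≫ (λ_ _).hom ▷ H.map (G.map (F.map f))
    simp

/-- Compatibility of the identifications `id ⋙ D ≅ D`. -/
def assocUnit (G : A ⥤ᵖ B) (H : B ⥤ᵖ C) :
    assocTrans (Pseudofunctor.id A) G H ≫ unitTrans (G.comp H) ≅ whisk (unitTrans G) H :=
  Pseudofunctor.StrongTrans.isoMk
    (fun a => λ_ (𝟙 (H.obj (G.obj a))) ≪≫ (H.mapId (G.obj a)).symm) fun {a b} f => by
    change H.map (G.map f) ◁ ((λ_ _).hom ≫ (H.mapId _).inv) ≫ ((H.mapComp _ _).inv ≫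
        H.map₂ ((ρ_ _).hom ≫ (λ_ _).inv) ≫ (H.mapComp _ _).hom) =
      ((α_ _ _ _).inv ≫ ((ρ_ _).hom ≫ (λ_ _).inv) ▷ 𝟙 _ ≫ (α_ _ _ _).hom ≫
        𝟙 _ ◁ ((ρ_ _).hom ≫ (λ_ _).inv) ≫ (α_ _ _ _).inv) ≫
          ((λ_ _).hom ≫ (H.mapId _).inv) ▷ H.map (G.map f)
    have h : H.map₂ (λ_ (G.map f)).inv = (λ_ (H.map (G.map f))).inv ≫
        (H.mapId _).inv ▷ H.map (G.map f) ≫ (H.mapComp _ _).inv := by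
      rw [← cancel_mono (H.map₂ (λ_ (G.map f)).hom), ← PrelaxFunctor.map₂_comp, Iso.inv_hom_id,
        PrelaxFunctor.map₂_id, Pseudofunctor.map₂_left_unitor]
      simp
    simp [h, Pseudofunctor.map₂_right_unitor]

end Whisk

section Index

variable {Φ Ψ Ω : Cat.{0, 0}ᵒᵖ ⥤ᵖ Cat.{0, 0}ᵒᵖ} (D : Prederivator.{v, u})

theorem cls_whisk_comp (α : Φ ⟶ Ψ) (β : Ψ ⟶ Ω) :
    cls (whisk α D) ≫ cls (whisk β D) = cls (whisk (α ≫ β) D) :=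
  (cls_eq (whiskComp α β D)).symm

/-- Index transformations with isomorphic components induce isomorphic morphisms. -/
theorem cls_whisk_eq {α β : Φ ⟶ Ψ}
    (e : ∀ K, (α.app K).unop.toFunctor ≅ (β.app K).unop.toFunctor)
    (h : ∀ {K L} (f : K ⟶ L) (x : (Ψ.obj L).unop),
      (Φ.map f).unop.toFunctor.map ((e L).hom.app x) ≫
          (β.naturality f).hom.unop2.toNatTrans.app x =
        (α.naturality f).hom.unop2.toNatTrans.app x ≫
          (e K).hom.app ((Ψ.map f).unop.toFunctor.obj x)) :
    cls (whisk α D) = cls (whisk β D) :=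
  cls_eq (whiskIso (Pseudofunctor.StrongTrans.isoMk
    (fun K => Iso.op2_unop (Cat.Hom.isoMk (e K)))
    fun f => congrArg op2 (Cat.Hom₂.ext (NatTrans.ext (funext fun x => h f x)))) D)

variable {A B T P : Type} [SmallCategory A] [SmallCategory B] [SmallCategory T] [SmallCategory P]

theorem cls_restr_comp (u : A ⥤ B) (w : B ⥤ T) :
    cls (D.restr w) ≫ cls (D.restr u) = cls (D.restr (u ⋙ w)) := by
  refine (cls_whisk_comp D _ _).trans (cls_whisk_eq D (fun K => NatIso.ofComponents
    (fun x => Iso.refl _) (map_comp_id_eq ((u ⋙ w).prod (𝟭 K.unop)))) fun {K L} f x => ?_)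
  refine Prod.ext ?_ ?_
  · change 𝟙 _ ≫ 𝟙 _ = (𝟙 _ ≫ 𝟙 _ ≫ 𝟙 _ ≫ w.map (𝟙 (u.obj x.1)) ≫ 𝟙 _) ≫ 𝟙 _
    simp
  · change f.unop.toFunctor.map (𝟙 _) ≫ 𝟙 _ = (𝟙 _ ≫ 𝟙 _ ≫ 𝟙 _ ≫ 𝟙 _ ≫ 𝟙 _) ≫ 𝟙 _
    simp

theorem cls_restr_ev (u : A ⥤ B) (a : A) :
    cls (D.restr u) ≫ cls (D.ev a) = cls (D.ev (u.obj a)) := by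
  change cls (D.restr u) ≫ cls (whisk (prodIdxPt a) D) ≫ cls (unitTrans D) =
    cls (whisk (prodIdxPt (u.obj a)) D) ≫ cls (unitTrans D)
  rw [← Category.assoc]
  refine congrArg (· ≫ cls (unitTrans D)) ((cls_whisk_comp D _ _).trans
    (cls_whisk_eq D (fun K => NatIso.ofComponents
    (fun x => Iso.refl _) fun {k l} g => ?_) fun {K L} f x => ?_))
  · refine Prod.ext ?_ ?_
    · change u.map (𝟙 a) ≫ 𝟙 _ = 𝟙 _ ≫ 𝟙 _
      simp
    · change g ≫ 𝟙 _ = 𝟙 _ ≫ g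
      simp
  · refine Prod.ext ?_ ?_
    · change 𝟙 _ ≫ 𝟙 _ = (𝟙 _ ≫ 𝟙 _ ≫ 𝟙 _ ≫ u.map (𝟙 a) ≫ 𝟙 _) ≫ 𝟙 _
      simp
    · change f.unop.toFunctor.map (𝟙 _) ≫ 𝟙 _ = (𝟙 _ ≫ 𝟙 _ ≫ 𝟙 _ ≫ 𝟙 _ ≫ 𝟙 _) ≫ 𝟙 _
      simp

theorem cls_restr_congr {u w : A ⥤ B} (e : u ≅ w) : cls (D.restr u) = cls (D.restr w) := by
  refine cls_whisk_eq D (fun K => NatIso.prod e (Iso.refl _)) fun {K L} f x => ?_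
  refine Prod.ext ?_ ?_
  · change e.hom.app x.1 ≫ 𝟙 _ = 𝟙 _ ≫ e.hom.app x.1
    simp
  · change f.unop.toFunctor.map (𝟙 _) ≫ 𝟙 _ = 𝟙 _ ≫ 𝟙 _
    simp

theorem cls_restr_id : cls (D.restr (𝟭 A)) = 𝟙 _ := by
  refine Eq.trans ?_ (cls_eq (whiskId (prodIdx A) D))
  refine cls_whisk_eq D (fun K => NatIso.ofComponents
    (fun x => Iso.refl _) fun {k l} g => ?_) fun {K L} f x => ?_
  · exact (Category.comp_id _).trans (Category.id_comp _).symm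
  · refine Prod.ext ?_ ?_
    · change 𝟙 _ ≫ 𝟙 _ ≫ 𝟙 _ = 𝟙 _ ≫ 𝟙 _
      simp
    · change f.unop.toFunctor.map (𝟙 _) ≫ 𝟙 _ ≫ 𝟙 _ = 𝟙 _ ≫ 𝟙 _
      simp

def curFun (κ : B × T ⥤ P) (K : Type) [SmallCategory K] : B × (T × K) ⥤ P × K :=
  CategoryTheory.prod.inverseAssociator B T K ⋙ κ.prod (𝟭 K)

/-- The transformation with components `(b, (t, k)) ↦ (κ (b, t), k)`. -/
def curIdx (κ : B × T ⥤ P) : prodIdx P ⟶ (prodIdx T).comp (prodIdx B) where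
  app K := (curFun κ K.unop).toCatHom.op
  naturality f := Iso.op2_unop (Cat.Hom.isoMk (NatIso.ofComponents (fun _ => Iso.refl _)
    (map_comp_id_eq (curFun κ _ ⋙ (𝟭 P).prod f.unop.toFunctor))))
  naturality_naturality η := by
    refine congrArg op2 (Cat.Hom₂.ext (NatTrans.ext (funext fun x => Prod.ext ?_ ?_)))
    · change 𝟙 _ ≫ 𝟙 _ = 𝟙 _ ≫ κ.map (𝟙 (x.1, x.2.1))
      simp
    · exact (Category.comp_id _).trans (Category.id_comp _).symm
  naturality_id a := by
    refine congrArg op2 (Cat.Hom₂.ext (NatTrans.ext (funext fun x => Prod.ext ?_ ?_)))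
    · change 𝟙 _ ≫ κ.map (𝟙 (x.1, x.2.1) ≫ 𝟙 (x.1, x.2.1)) = 𝟙 _ ≫ 𝟙 _ ≫ 𝟙 _
      simp
    · change 𝟙 _ ≫ (𝟙 _ ≫ 𝟙 _) = 𝟙 _ ≫ 𝟙 _ ≫ 𝟙 _
      simp
  naturality_comp f g := by
    refine congrArg op2 (Cat.Hom₂.ext (NatTrans.ext (funext fun x => Prod.ext ?_ ?_)))
    · change 𝟙 _ ≫ κ.map (𝟙 (x.1, x.2.1) ≫ 𝟙 (x.1, x.2.1)) = 𝟙 _ ≫ 𝟙 _ ≫ 𝟙 _ ≫ 𝟙 _ ≫ 𝟙 _ ≫ 𝟙 _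
      simp
    · change 𝟙 _ ≫ (𝟙 _ ≫ 𝟙 _) = 𝟙 _ ≫ 𝟙 _ ≫ CategoryTheory.Functor.map f.unop.toFunctor (𝟙 _) ≫
      𝟙 _ ≫ 𝟙 _ ≫ 𝟙 _
      simp

/-- The morphism sending a diagram of shape `P` to a diagram of shape `T` of diagrams of
shape `B`. -/
def cur (κ : B × T ⥤ P) : D.shift P ⟶ (D.shift B).shift T :=
  whisk (curIdx κ) D ≫ assocTrans _ _ D

end Index

section Curry

variable (D : Prederivator.{v, u}) {B T T' P P' : Type} [SmallCategory B] [SmallCategory T]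
  [SmallCategory T'] [Preorder P] [SmallCategory P']

theorem cls_restr_curry (g : Sq ⥤ P) (p : Arr → Arr → Sq)
    (hp : ∀ {s s' t t' : Arr}, s ≤ s' → t ≤ t' → p s t ≤ p s' t') (κ : Arr × Arr ⥤ P)
    (h : ∀ s t, g.obj (p s t) = κ.obj (s, t)) :
    cls (D.restr g) ≫ cls (curry D p hp) = cls (D.cur κ) := by
  change cls (whisk (prodIdxMap g) D) ≫ cls (whisk (pairIdx p hp) D) ≫ cls (assocTrans _ _ D) =
    cls (whisk (curIdx κ) D) ≫ cls (assocTrans _ _ D)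
  rw [← Category.assoc]
  refine congrArg (· ≫ _) ((cls_whisk_comp D _ _).trans
    (cls_whisk_eq D (fun K => NatIso.ofComponents
    (fun x => (eqToIso (h x.1 x.2.1)).prod (Iso.refl _)) fun {k l} g => ?_) fun {K L} f x => ?_))
  · exact Prod.ext (Subsingleton.elim _ _) ((Category.comp_id _).trans (Category.id_comp _).symm)
  · refine Prod.ext (Subsingleton.elim _ _) ?_
    change f.unop.toFunctor.map (𝟙 _) ≫ 𝟙 _ = (𝟙 _ ≫ 𝟙 _ ≫ 𝟙 _ ≫ 𝟙 _ ≫ 𝟙 _) ≫ 𝟙 _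
    simp

theorem cls_cur_restr (κ : B × T ⥤ P) (w : T' ⥤ T) (κ' : B × T' ⥤ P)
    (h : ∀ b t, κ.obj (b, w.obj t) = κ'.obj (b, t)) :
    cls (D.cur κ) ≫ cls ((D.shift B).restr w) = cls (D.cur κ') := by
  change (cls (whisk (curIdx κ) D) ≫ cls (assocTrans _ _ D)) ≫
    cls (whisk (prodIdxMap w) ((prodIdx B).comp D)) =
    cls (whisk (curIdx κ') D) ≫ cls (assocTrans _ _ D)
  have h1 : cls (assocTrans _ _ D) ≫ cls (whisk (prodIdxMap w) ((prodIdx B).comp D)) =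
      cls (whisk (whisk (prodIdxMap w) (prodIdx B)) D) ≫ cls (assocTrans _ _ D) :=
    cls_eq (assocWhisk (prodIdxMap w) (prodIdx B) D)
  rw [Category.assoc, h1, ← Category.assoc]
  refine congrArg (· ≫ _) ((cls_whisk_comp D _ _).trans
    (cls_whisk_eq D (fun K => NatIso.ofComponents
    (fun x => (eqToIso (h x.1 x.2.1)).prod (Iso.refl _)) fun {k l} g => ?_) fun {K L} f x => ?_))
  · exact Prod.ext (Subsingleton.elim _ _) ((Category.comp_id _).trans (Category.id_comp _).symm)
  · refine Prod.ext (Subsingleton.elim _ _) ?_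
    change f.unop.toFunctor.map (𝟙 _) ≫ 𝟙 _ = (𝟙 _ ≫ 𝟙 _ ≫ 𝟙 _ ≫ (𝟙 _ ≫ 𝟙 _ ≫ 𝟙 _) ≫ 𝟙 _) ≫ 𝟙 _
    simp

/-- Restriction along `κ` in two variables, read as a diagram of squares. -/
theorem cls_cur_uncurry (κ : Arr × Arr ⥤ P) (q : Sq → Arr × Arr)
    (hq : ∀ {s s' : Sq}, s ≤ s' → q s ≤ q s') (g : Sq ⥤ P)
    (h : ∀ x, κ.obj (q x) = g.obj x) :
    cls (D.cur κ) ≫ cls (uncurry D q hq) = cls (D.restr g) := by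
  change (cls (whisk (curIdx κ) D) ≫ cls (assocTrans _ _ D)) ≫ cls (assocTrans' _ _ D) ≫
    cls (whisk (unpairIdx q hq) D) = cls (whisk (prodIdxMap g) D)
  have h1 : cls (assocTrans (prodIdx Arr) (prodIdx Arr) D) ≫ cls (assocTrans' _ _ D) = 𝟙 _ :=
    cls_eq (assocInv (prodIdx Arr) (prodIdx Arr) D)
  rw [Category.assoc, reassoc_of% h1]
  refine (cls_whisk_comp D _ _).trans
    (cls_whisk_eq D (fun K => NatIso.ofComponents
    (fun x => (eqToIso (h x.1)).prod (Iso.refl _)) fun {k l} g => ?_) fun {K L} f x => ?_)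
  · exact Prod.ext (Subsingleton.elim _ _) ((Category.comp_id _).trans (Category.id_comp _).symm)
  · refine Prod.ext (Subsingleton.elim _ _) ?_
    change f.unop.toFunctor.map (𝟙 _) ≫ 𝟙 _ = (𝟙 _ ≫ 𝟙 _ ≫ 𝟙 _ ≫ 𝟙 _ ≫ 𝟙 _) ≫ 𝟙 _
    simp

/-- The members of the diagram of diagrams `cur κ` are restrictions along the sections of `κ`. -/
theorem cls_cur_ev (κ : B × T ⥤ P) (t : T) (g : B ⥤ P) (h : ∀ b, κ.obj (b, t) = g.obj b) :
    cls (D.cur κ) ≫ cls ((D.shift B).ev t) = cls (D.restr g) := by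
  change (cls (whisk (curIdx κ) D) ≫ cls (assocTrans _ _ D)) ≫
    cls (whisk (prodIdxPt t) ((prodIdx B).comp D)) ≫ cls (unitTrans ((prodIdx B).comp D)) =
    cls (whisk (prodIdxMap g) D)
  have h1 : cls (assocTrans _ _ D) ≫ cls (whisk (prodIdxPt t) ((prodIdx B).comp D)) =
      cls (whisk (whisk (prodIdxPt t) (prodIdx B)) D) ≫ cls (assocTrans _ _ D) :=
    cls_eq (assocWhisk (prodIdxPt t) (prodIdx B) D)
  have h2 : cls (assocTrans _ _ D) ≫ cls (unitTrans ((prodIdx B).comp D)) =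
      cls (whisk (unitTrans (prodIdx B)) D) := cls_eq (assocUnit (prodIdx B) D)
  rw [Category.assoc, reassoc_of% h1, h2]
  refine (congrArg (_ ≫ ·) (cls_whisk_comp D _ _)).trans ((cls_whisk_comp D _ _).trans
    (cls_whisk_eq D (fun K => NatIso.ofComponents
    (fun x => (eqToIso (h x.1)).prod (Iso.refl _)) fun {k l} g => ?_) fun {K L} f x => ?_))
  · exact Prod.ext (Subsingleton.elim _ _) ((Category.comp_id _).trans (Category.id_comp _).symm)
  · refine Prod.ext (Subsingleton.elim _ _) ?_
    change f.unop.toFunctor.map (𝟙 _) ≫ 𝟙 _ = (𝟙 _ ≫ 𝟙 _ ≫ 𝟙 _ ≫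
      (𝟙 _ ≫ (𝟙 _ ≫ 𝟙 _ ≫ 𝟙 _) ≫ 𝟙 _ ≫ (𝟙 _ ≫ 𝟙 _) ≫ 𝟙 _) ≫ 𝟙 _) ≫ 𝟙 _
    simp

end Curry

end

end Der.Prederivator

namespace Der.Prederivator

noncomputable section

/-! ### Shifted stable derivators -/

section Shift

variable {D : Prederivator.{v, u}} {B S T : Type} [Preorder B] [SmallCategory S]

instance {A : Type} [SmallCategory A] [Quiver.IsThin S] [Quiver.IsThin A] :
    Quiver.IsThin (S × A) :=
  fun x y => inferInstanceAs (Subsingleton ((x.1 ⟶ y.1) × (x.2 ⟶ y.2)))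

/-- The square of sections of a product over points of the first factor. -/
def sectRSq {T : Type} [SmallCategory T] (u : S ⥤ T) (b : B) :
    u ⋙ CategoryTheory.Prod.sectR b T ≅ CategoryTheory.Prod.sectR b S ⋙ (𝟭 B).prod u :=
  NatIso.ofComponents (fun _ => Iso.refl _)
    (map_comp_id_eq (u ⋙ CategoryTheory.Prod.sectR b T))

theorem initCrit_sectRSq {T : Type} [SmallCategory T] [Quiver.IsThin S] [Quiver.IsThin T]
    (u : S ⥤ T) (b : B) : InitCrit (sectRSq u b).inv := by
  refine initCrit_of_thin _ fun a k ⟨f⟩ => ⟨a.2, ⟨(f.1, 𝟙 _)⟩, ⟨f.2⟩, fun j' ⟨g⟩ _ => ⟨g.2⟩⟩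

theorem termCrit_sectRSq {T : Type} [SmallCategory T] [Quiver.IsThin S] [Quiver.IsThin T]
    (u : S ⥤ T) (b : B) : TermCrit (sectRSq u b).hom := by
  refine termCrit_of_thin _ fun a k ⟨f⟩ => ⟨k.2, ⟨f.2⟩, ⟨(f.1, 𝟙 _)⟩, fun j' _ ⟨g⟩ => ⟨g.2⟩⟩

theorem IsKan.isCocartesian_shift (hD : D.IsKan) {Q : (D.shift B).val Sq} :
    (D.shift B).IsCocartesian Q ↔
      ∀ b, D.IsCocartesian ((D.res (CategoryTheory.Prod.sectR b Sq)).obj Q) := by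
  have h0 : (D.shift B).LExt spanIncl Q ↔ D.LExt ((𝟭 B).prod spanIncl) Q := Iff.rfl
  rw [(hD.shift B).isCocartesian_iff, h0]
  refine ⟨fun h b => (hD.isCocartesian_iff _).2 ?_, fun h => ?_⟩
  · exact hD.lExt_res (sectRSq spanIncl b).inv (initCrit_sectRSq _ b) h
  · exact hD.lExt_of_cover (fun b => (sectRSq spanIncl b).inv) (fun b => initCrit_sectRSq _ b)
      (fun t => ⟨t.1, t.2, rfl⟩) fun b => (hD.isCocartesian_iff _).1 (h b)

theorem IsKan.isCartesian_shift (hD : D.IsKan) {Q : (D.shift B).val Sq} :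
    (D.shift B).IsCartesian Q ↔
      ∀ b, D.IsCartesian ((D.res (CategoryTheory.Prod.sectR b Sq)).obj Q) := by
  have h0 : (D.shift B).RExt cospanIncl Q ↔ D.RExt ((𝟭 B).prod cospanIncl) Q := Iff.rfl
  rw [(hD.shift B).isCartesian_iff, h0]
  refine ⟨fun h b => (hD.isCartesian_iff _).2 ?_, fun h => ?_⟩
  · exact hD.rExt_res (sectRSq cospanIncl b).hom (termCrit_sectRSq _ b) h
  · exact hD.rExt_of_cover (fun b => (sectRSq cospanIncl b).hom) (fun b => termCrit_sectRSq _ b)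
      (fun t => ⟨t.1, t.2, rfl⟩) fun b => (hD.isCartesian_iff _).1 (h b)

theorem IsKan.exAt_shift [Nonempty B] [Preorder T] (hD : D.IsKan) {e : ExData T}
    {W : (D.shift B).val T}
    (h : ∀ b, D.ExAt e ((D.res (CategoryTheory.Prod.sectR b T)).obj W)) :
    (D.shift B).ExAt e W where
  sq a b c d hs := by
    obtain ⟨k, hk, -⟩ := (h (Classical.arbitrary B)).sq a b c d hs
    refine ⟨k, hk, hD.isCocartesian_shift.2 fun x => ?_⟩
    obtain ⟨rfl, rfl, rfl, rfl⟩ := hk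
    refine ((h x).sq _ _ _ _ hs).isCocartesian.of_iso (((D.resComp _ _).symm ≪≫
      D.resIso (?_ : _ ≅ CategoryTheory.Prod.sectR x Sq ⋙ (𝟭 B).prod k) ≪≫ D.resComp _ _).app W)
    exact thinIso fun _ => rfl
  zero t ht := hD.isZero_of_evalAt fun x => by
    refine (isZero_evalAt_res (D := D) ((𝟭 B).prod (Functor.fromPUnit.{0} t)) x).2 ?_
    exact (isZero_evalAt_res (D := D) (CategoryTheory.Prod.sectR x.1 T) t).1 ((h x.1).zero t ht)

/-- Exactness of a diagram of diagrams `cur κ` is tested on the restrictions along the sections of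
`κ`. -/
theorem IsKan.exK_cur [Nonempty B] [Preorder T] {P : Type} [Preorder P] (hD : D.IsKan)
    {e : ExData T} {e' : ExData P} (κ : B × T ⥤ P)
    (h : ∀ b (Y : D.val P), D.ExAt e' Y → D.ExAt e ((D.res
      (CategoryTheory.Prod.sectR b T ⋙ κ)).obj Y)) (K) (Y : (D.shift P).obj K)
    (hY : D.ExK e' K Y) : (D.shift B).ExK e K ((fn (D.cur κ) K).obj Y) := fun a =>
  hD.exAt_shift fun b => (h b _ (hY a)).of_iso (((D.resComp _ _).symm ≪≫
    D.resIso (NatIso.ofComponents (fun _ => Iso.refl _) (map_comp_id_eq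
      ((CategoryTheory.Prod.sectR b T ⋙ κ) ⋙ CategoryTheory.Prod.sectL P a)) :
      (CategoryTheory.Prod.sectR b T ⋙ κ) ⋙ CategoryTheory.Prod.sectL P a ≅
      CategoryTheory.Prod.sectR b T ⋙
        ((𝟭 B).prod (CategoryTheory.Prod.sectL T a) ⋙ curFun κ K.unop))
      ≪≫ D.resComp _ _ ≪≫ Functor.isoWhiskerRight (D.resComp _ _) _).app Y)

end Shift

/-- The part of the axioms of a stable derivator which is used below: Kan extensions along functors
of posets, a zero object, and the coincidence of the two kinds of bicartesian squares. -/
structure IsStableKan (D : Prederivator.{v, u}) : Prop where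
  kan : D.IsKan
  zero : Limits.HasZeroObject (D.val One)
  stable : ∀ Q, D.IsCocartesian Q ↔ D.IsCartesian Q

theorem IsStable.isStableKan {D : Prederivator.{v, u}} (hD : D.IsStable) : D.IsStableKan :=
  ⟨IsDerivator.isKan D hD.toIsDerivator, hD.pointed, hD.stable⟩

theorem IsStableKan.shift {D : Prederivator.{v, u}} (hs : D.IsStableKan) (B : Type) [Preorder B] :
    (D.shift B).IsStableKan :=
  ⟨hs.kan.shift B, hs.kan.hasZeroObject_shift hs.zero B, fun Q => by
    simp only [hs.kan.isCocartesian_shift, hs.kan.isCartesian_shift, hs.stable]⟩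

/-! ### Cofibers, fibers, suspensions and loops -/

section Cof

variable {D E : Prederivator.{v, u}}

/-- A cocartesian square with a zero object at `01`. -/
def cofEx : ExData Sq := .ofList [(.mk 0 0, .mk 1 0, .mk 0 1, .mk 1 1)] [.mk 0 1]

/-- A cocartesian square with zero objects at `10` and `01`. -/
def suspEx : ExData Sq := .ofList [(.mk 0 0, .mk 1 0, .mk 0 1, .mk 1 1)] [.mk 1 0, .mk 0 1]

/-- Exactness conditions none of which concerns points of `T` hold for all diagrams. -/
theorem exAt_of_disjoint {T P : Type} [SmallCategory T] {sqs : List (P × P × P × P)} {zs : List P}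
    {f : T → P} {l : List P} (hl : ∀ t, f t ∈ l)
    (h : ∀ q ∈ sqs, ¬ (q.1 ∈ l ∧ q.2.1 ∈ l ∧ q.2.2.1 ∈ l ∧ q.2.2.2 ∈ l)) (h' : ∀ z ∈ zs, z ∉ l)
    (Y : D.val T) : D.ExAt ((ExData.ofList sqs zs).pull f) Y :=
  ⟨fun _ _ _ _ hs => (h _ hs ⟨hl _, hl _, hl _, hl _⟩).elim, fun _ ht => (h' _ ht (hl _)).elim⟩

theorem Good.disjoint {T P : Type} [SmallCategory T] {sqs : List (P × P × P × P)} {zs : List P}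
    {f : T → P} {l : List P} (hl : ∀ t, f t ∈ l)
    (h : ∀ q ∈ sqs, ¬ (q.1 ∈ l ∧ q.2.1 ∈ l ∧ q.2.2.1 ∈ l ∧ q.2.2.2 ∈ l)) (h' : ∀ z ∈ zs, z ∉ l) :
    Good (D.ExK ((ExData.ofList sqs zs).pull f)) (𝟙 (D.shift T)) (𝟙 (D.shift T)) :=
  Good.base fun _ _ _ => exAt_of_disjoint hl h h' _

instance : DecidableRel (fun a b : Sq => a ≤ b) := inferInstanceAs (DecidableLE Sq)

theorem listed_arrSpan : Listed arrSpan (fun s : Span => s.1) [.mk 0 0, .mk 1 0]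
    [.mk 0 0, .mk 1 0, .mk 0 1] where
  le _ _ h := h
  mono _ _ h := h
  inj _ _ h := Subtype.ext h
  mem := by decide
  surj := by decide
  memS := by decide
  surjS := by decide
  emb a b h := ⟨homOfLE (by revert a b; decide)⟩

theorem listed_arrCospan : Listed arrCospan (fun s : Cospan => s.1) [.mk 1 0, .mk 1 1]
    [.mk 1 0, .mk 1 1, .mk 0 1] where
  le _ _ h := h
  mono _ _ h := h
  inj _ _ h := Subtype.ext h
  mem := by decide
  surj := by decide
  memS := by decide
  surjS := by decide
  emb a b h := ⟨homOfLE (by revert a b; decide)⟩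

theorem listed_spanPt : Listed (Functor.fromPUnit.{0} (⟨Sq.mk 0 0, by decide⟩ : Span))
    (fun s : Span => s.1) [.mk 0 0] [.mk 0 0, .mk 1 0, .mk 0 1] where
  le _ _ h := h
  mono _ _ h := h
  inj _ _ h := Subtype.ext h
  mem := by decide
  surj := by decide
  memS _ := List.mem_singleton.2 rfl
  surjS p hp := ⟨⟨⟨⟩⟩, (List.mem_singleton.1 hp).symm⟩
  emb a b h := ⟨eqToHom (Subsingleton.elim _ _)⟩

theorem listed_cospanPt : Listed (Functor.fromPUnit.{0} (⟨Sq.mk 1 1, by decide⟩ : Cospan))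
    (fun s : Cospan => s.1) [.mk 1 1] [.mk 1 1, .mk 1 0, .mk 0 1] where
  le _ _ h := h
  mono _ _ h := h
  inj _ _ h := Subtype.ext h
  mem := by decide
  surj := by decide
  memS _ := List.mem_singleton.2 rfl
  surjS p hp := ⟨⟨⟨⟩⟩, (List.mem_singleton.1 hp).symm⟩
  emb a b h := ⟨eqToHom (Subsingleton.elim _ _)⟩

theorem listed_spanIncl : Listed spanIncl id [.mk 0 0, .mk 1 0, .mk 0 1]
    [.mk 0 0, .mk 1 0, .mk 0 1, .mk 1 1] where
  le _ _ h := h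
  mono _ _ h := h
  inj _ _ h := h
  mem := by decide
  surj p _ := ⟨p, rfl⟩
  memS := by decide
  surjS := by decide
  emb _ _ h := ⟨homOfLE h⟩

theorem listed_cospanIncl : Listed cospanIncl id [.mk 1 1, .mk 1 0, .mk 0 1]
    [.mk 1 1, .mk 1 0, .mk 0 1, .mk 0 0] where
  le _ _ h := h
  mono _ _ h := h
  inj _ _ h := h
  mem := by decide
  surj p _ := ⟨p, rfl⟩
  memS := by decide
  surjS := by decide
  emb _ _ h := ⟨homOfLE h⟩

/-- A square exact in the sense of `cofEx` is determined by its edge `00 → 10`. -/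
theorem cofEx_good (hs : D.IsStableKan) (hK : D.HasKan) :
    Good (D.ExK cofEx) (D.restr spanIncl ≫ D.restr arrSpan ≫ 𝟙 _)
      ((𝟙 _ ≫ ran hK arrSpan) ≫ lan hK spanIncl) :=
  Good.lan hs.kan hs.zero hK (listed_spanIncl.lCrit (f := id) (by decide)) rfl
    (Good.ran hs.kan hs.zero hs.stable hK
      (listed_arrSpan.rCrit (sqs := [(.mk 0 0, .mk 1 0, .mk 0 1, .mk 1 1)])
      (zs := [.mk 0 1]) (by decide)) rfl
      (Good.disjoint listed_arrSpan.memS (by decide +kernel) (by decide)))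

/-- A square exact in the sense of `cofEx` is determined by its edge `10 → 11`. -/
theorem cofEx_good' (hs : D.IsStableKan) (hK : D.HasKan) :
    Good (D.ExK cofEx) (D.restr cospanIncl ≫ D.restr arrCospan ≫ 𝟙 _)
      ((𝟙 _ ≫ lan hK arrCospan) ≫ ran hK cospanIncl) :=
  Good.ran hs.kan hs.zero hs.stable hK (listed_cospanIncl.rCrit (f := id) (by decide)) rfl
    (Good.lan hs.kan hs.zero hK (listed_arrCospan.lCrit
      (sqs := [(.mk 0 0, .mk 1 0, .mk 0 1, .mk 1 1)])
      (zs := [.mk 0 1]) (by decide)) rfl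
      (Good.disjoint listed_arrCospan.memS (by decide +kernel) (by decide)))

/-- A square exact in the sense of `suspEx` is determined by its initial vertex. -/
theorem suspEx_good (hs : D.IsStableKan) (hK : D.HasKan) :
    Good (D.ExK suspEx) (D.restr spanIncl ≫ D.ev (⟨Sq.mk 0 0, by decide⟩ : Span))
      (ranPt hK (⟨Sq.mk 0 0, by decide⟩ : Span) ≫ lan hK spanIncl) :=
  Good.lan hs.kan hs.zero hK (listed_spanIncl.lCrit (f := id) (by decide)) rfl
    (Good.ranPt hs.kan hs.zero hs.stable hK (listed_spanPt.rCrit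
      (sqs := [(.mk 0 0, .mk 1 0, .mk 0 1, .mk 1 1)])
      (zs := [.mk 1 0, .mk 0 1]) (by decide))
      (exAt_of_disjoint listed_spanPt.memS (by decide +kernel) (by decide)))

/-- A square exact in the sense of `suspEx` is determined by its final vertex. -/
theorem suspEx_good' (hs : D.IsStableKan) (hK : D.HasKan) :
    Good (D.ExK suspEx) (D.restr cospanIncl ≫ D.ev (⟨Sq.mk 1 1, by decide⟩ : Cospan))
      (lanPt hK (⟨Sq.mk 1 1, by decide⟩ : Cospan) ≫ ran hK cospanIncl) :=
  Good.ran hs.kan hs.zero hs.stable hK (listed_cospanIncl.rCrit (f := id) (by decide)) rfl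
    (Good.lanPt hs.kan hs.zero hK (listed_cospanPt.lCrit
      (sqs := [(.mk 0 0, .mk 1 0, .mk 0 1, .mk 1 1)])
      (zs := [.mk 1 0, .mk 0 1]) (by decide))
      (exAt_of_disjoint listed_cospanPt.memS (by decide +kernel) (by decide)))

section

variable (hK : D.HasKan)

theorem cls_arrSpan : cls (D.restr spanIncl ≫ D.restr arrSpan ≫ 𝟙 _) =
    cls (D.restr arrInitial) := by
  rw [cls_comp, cls_comp, cls_id, Category.comp_id]
  exact (cls_restr_comp D _ _).trans (cls_restr_congr D (thinIso fun _ => rfl))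

theorem cls_arrCospan : cls (D.restr cospanIncl ≫ D.restr arrCospan ≫ 𝟙 _) =
    cls (D.restr arrFinal) := by
  rw [cls_comp, cls_comp, cls_id, Category.comp_id]
  exact (cls_restr_comp D _ _).trans (cls_restr_congr D (thinIso fun _ => rfl))

/-- The cofiber morphism is computed by any natural cocartesian square with a zero object. -/
theorem cls_cof_eq (hs : D.IsStableKan) {M : E ⟶ D.shift Sq}
    (hM : ∀ K X, D.ExK cofEx K ((fn M K).obj X)) :
    cls M ≫ cls (D.restr arrInitial) ≫ cls (cof hK) = cls M ≫ cls (D.restr arrFinal) := by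
  have h := (cofEx_good hs hK).uniq M hM
  rw [cls_arrSpan, cls_comp, cls_comp, cls_id, Category.id_comp] at h
  conv_rhs => rw [← h]
  simp only [Category.assoc, cof, cls_comp]

/-- The suspension is computed by any natural cocartesian square with two zero objects. -/
theorem cls_susp_eq (hs : D.IsStableKan) {M : E ⟶ D.shift Sq}
    (hM : ∀ K X, D.ExK suspEx K ((fn M K).obj X)) :
    cls M ≫ cls (D.ev (Sq.mk 0 0)) ≫ cls (susp hK) = cls M ≫ cls (D.ev (Sq.mk 1 1)) := by
  have h := (suspEx_good hs hK).uniq M hM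
  rw [cls_comp, cls_restr_ev, cls_comp] at h
  conv_rhs => rw [← h]
  simp only [Category.assoc, susp, cls_comp]
  rfl

theorem cls_loop_eq (hs : D.IsStableKan) {M : E ⟶ D.shift Sq}
    (hM : ∀ K X, D.ExK suspEx K ((fn M K).obj X)) :
    cls M ≫ cls (D.ev (Sq.mk 1 1)) ≫ cls (loop hK) = cls M ≫ cls (D.ev (Sq.mk 0 0)) := by
  have h := (suspEx_good' hs hK).uniq M hM
  rw [cls_comp, cls_restr_ev, cls_comp] at h
  conv_rhs => rw [← h]
  simp only [Category.assoc, loop, cls_comp]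
  rfl

/-- The fiber and then the cofiber of a morphism recover it: both are read off the same bicartesian
square. -/
theorem cls_fib_cof (hs : D.IsStableKan) : cls (fib hK) ≫ cls (cof hK) = 𝟙 _ := by
  have h := cofEx_good' hs hK
  have h1 := cls_cof_eq hK hs h.mem
  have h2 := h.sec
  rw [cls_arrCospan] at h2
  rw [h2] at h1
  rw [← h1]
  simp only [fib, cls_comp, cls_id, Category.id_comp, Category.assoc]

theorem cls_susp_loop (hs : D.IsStableKan) : cls (susp hK) ≫ cls (loop hK) = 𝟙 _ := by
  have h := suspEx_good hs hK
  have h1 := cls_loop_eq hK hs h.mem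
  have h2 := h.sec
  rw [cls_comp, cls_comp, cls_restr_ev, Category.assoc] at h2
  rw [cls_comp, Category.assoc, Category.assoc] at h1
  refine Eq.trans ?_ (h1.trans h2)
  simp only [susp, cls_comp, Category.assoc]

theorem cls_loop_susp (hs : D.IsStableKan) : cls (loop hK) ≫ cls (susp hK) = 𝟙 _ := by
  have h := suspEx_good' hs hK
  have h1 := cls_susp_eq hK hs h.mem
  have h2 := h.sec
  rw [cls_comp, cls_comp, cls_restr_ev, Category.assoc] at h2
  rw [cls_comp, Category.assoc, Category.assoc] at h1
  refine Eq.trans ?_ (h1.trans h2)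
  simp only [loop, cls_comp, Category.assoc]

end

end Cof

end

end Der.Prederivator

namespace Der.Prederivator

noncomputable section

/-! ### The exact diagrams of shape `C` -/

section ShapeC

theorem mem_cubes {c : Fin 3 → ℤ} : c ∈ cubes ↔ (c 0 ≤ c 1 + 1 ∧ c 1 ≤ c 0 + 1) ∧
    (c 0 ≤ c 2 + 1 ∧ c 2 ≤ c 0 + 1) ∧ c 1 ≤ c 2 + 1 ∧ c 2 ≤ c 1 + 1 := by
  constructor
  · rintro ⟨n, h⟩
    have h0 := h 0
    have h1 := h 1
    have h2 := h 2
    omega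
  · intro h
    refine ⟨min (c 0) (min (c 1) (c 2)), fun i => ?_⟩
    fin_cases i
    · change min (c 0) (min (c 1) (c 2)) ≤ c 0 ∧ c 0 ≤ min (c 0) (min (c 1) (c 2)) + 1
      omega
    · change min (c 0) (min (c 1) (c 2)) ≤ c 1 ∧ c 1 ≤ min (c 0) (min (c 1) (c 2)) + 1
      omega
    · change min (c 0) (min (c 1) (c 2)) ≤ c 2 ∧ c 2 ≤ min (c 0) (min (c 1) (c 2)) + 1
      omega

theorem eq_vec_iff {c : Fin 3 → ℤ} {x y z : ℤ} : c = ![x, y, z] ↔ c 0 = x ∧ c 1 = y ∧ c 2 = z := by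
  constructor
  · rintro rfl
    exact ⟨rfl, rfl, rfl⟩
  · rintro ⟨rfl, rfl, rfl⟩
    funext i
    fin_cases i <;> rfl

theorem mem_links {c : Fin 3 → ℤ} : c ∈ links ↔ (c 1 = c 0 + 2 ∧ c 2 = c 0 + 1) ∨
    (c 0 = c 2 + 2 ∧ c 1 = c 2 + 1) ∨ c 2 = c 1 + 2 ∧ c 0 = c 1 + 1 := by
  constructor
  · rintro ⟨n, h⟩
    simp only [eq_vec_iff] at h
    omega
  · rintro (h | h | h)
    · exact ⟨c 0, Or.inl (eq_vec_iff.2 (by omega))⟩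
    · exact ⟨c 2, Or.inr (Or.inl (eq_vec_iff.2 (by omega)))⟩
    · exact ⟨c 1, Or.inr (Or.inr (eq_vec_iff.2 (by omega)))⟩

theorem mem_C {c : Fin 3 → ℤ} : c ∈ C ↔ c ∈ cubes ∨ c ∈ links := Iff.rfl

theorem mem_V {c : Fin 3 → ℤ} : c ∈ V ↔ 0 ≤ c 0 ∧ 0 ≤ c 1 ∧ 0 ≤ c 2 ∧ c 0 + c 1 + c 2 ≤ 1 := by
  change (c = _ ∨ c = _ ∨ c = _ ∨ c = _) ↔ _
  simp only [eq_vec_iff]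
  omega

theorem le_iff_fin {c d : Fin 3 → ℤ} : c ≤ d ↔ c 0 ≤ d 0 ∧ c 1 ≤ d 1 ∧ c 2 ≤ d 2 := by
  refine ⟨fun h => ⟨h 0, h 1, h 2⟩, fun h i => ?_⟩
  fin_cases i
  exacts [h.1, h.2.1, h.2.2]

/-- The points `b`, `c`, `d` are obtained from `a` by unit steps in the directions `i`, `j` and
both. -/
def IsStep (i j : Fin 3) (a b c d : Fin 3 → ℤ) : Prop :=
  ∀ l, b l = a l + (if l = i then 1 else 0) ∧ c l = a l + (if l = j then 1 else 0) ∧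
    d l = a l + (if l = i then 1 else 0) + (if l = j then 1 else 0)

/-- The exactness conditions on diagrams with values at points of `ℤ³`: the small squares are
bicartesian and the values at the links are zero. -/
def exZ : ExData (Fin 3 → ℤ) :=
    ⟨fun a b c d => ∃ i j, i ≠ j ∧ IsStep i j a b c d, fun c => c ∈ links⟩

/-- The exactness conditions which define `D^{C,ex}`. -/
def exC : ExData ↥C := exZ.pull Subtype.val

theorem exZ_cases {a b c d : Fin 3 → ℤ} (h : exZ.sq a b c d) :
    (b 0 + c 0 = a 0 + d 0 ∧ b 1 + c 1 = a 1 + d 1 ∧ b 2 + c 2 = a 2 + d 2) ∧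
    ((b 0 = a 0 + 1 ∧ c 0 = a 0 ∧ ((b 1 = a 1 ∧ c 1 = a 1 + 1 ∧ b 2 = a 2 ∧ c 2 = a 2) ∨
      (b 1 = a 1 ∧ c 1 = a 1 ∧ b 2 = a 2 ∧ c 2 = a 2 + 1))) ∨
    (b 0 = a 0 ∧ c 0 = a 0 + 1 ∧ ((b 1 = a 1 + 1 ∧ c 1 = a 1 ∧ b 2 = a 2 ∧ c 2 = a 2) ∨
      (b 1 = a 1 ∧ c 1 = a 1 ∧ b 2 = a 2 + 1 ∧ c 2 = a 2))) ∨
    (b 0 = a 0 ∧ c 0 = a 0 ∧ ((b 1 = a 1 + 1 ∧ c 1 = a 1 ∧ b 2 = a 2 ∧ c 2 = a 2 + 1) ∨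
      (b 1 = a 1 ∧ c 1 = a 1 + 1 ∧ b 2 = a 2 + 1 ∧ c 2 = a 2)))) := by
  obtain ⟨i, j, hij, h⟩ := h
  have h0 := h 0
  have h1 := h 1
  have h2 := h 2
  clear h
  revert hij h0 h1 h2
  fin_cases i <;> fin_cases j <;> simp <;> omega

/-- The points of `V` and the nonnegative links. -/
def C₁ : Set (Fin 3 → ℤ) := V ∪ {c | c ∈ links ∧ ∀ i, 0 ≤ c i}

/-- The nonnegative points of `C` and the links. -/
def C₂ : Set (Fin 3 → ℤ) := {c | c ∈ C ∧ ∀ i, 0 ≤ c i} ∪ links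

theorem mem_C₁ {c : Fin 3 → ℤ} : c ∈ C₁ ↔ c ∈ V ∨ c ∈ links ∧ 0 ≤ c 0 ∧ 0 ≤ c 1 ∧ 0 ≤ c 2 := by
  have h : (∀ i, 0 ≤ c i) ↔ 0 ≤ c 0 ∧ 0 ≤ c 1 ∧ 0 ≤ c 2 := (le_iff_fin (c := 0) (d := c))
  change c ∈ V ∨ (c ∈ links ∧ ∀ i, 0 ≤ c i) ↔ _
  rw [h]

theorem mem_C₂ {c : Fin 3 → ℤ} : c ∈ C₂ ↔ (c ∈ cubes ∧ 0 ≤ c 0 ∧ 0 ≤ c 1 ∧ 0 ≤ c 2) ∨ c ∈ links :=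
    by
  have h : (∀ i, 0 ≤ c i) ↔ 0 ≤ c 0 ∧ 0 ≤ c 1 ∧ 0 ≤ c 2 := (le_iff_fin (c := 0) (d := c))
  change (c ∈ C ∧ ∀ i, 0 ≤ c i) ∨ c ∈ links ↔ _
  rw [h, mem_C]
  tauto

/-- The point reached from `a` by a unit step in the direction `i`. -/
def stepPt (i : Fin 3) (a : Fin 3 → ℤ) : Fin 3 → ℤ := fun l => a l + if l = i then 1 else 0

theorem exZ_sq_stepPt {i j : Fin 3} (h : i ≠ j) (a : Fin 3 → ℤ) :
    exZ.sq a (stepPt i a) (stepPt j a) (stepPt j (stepPt i a)) :=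
  ⟨i, j, h, fun _ => ⟨rfl, rfl, rfl⟩⟩

/-- A point of a cube which is nonnegative and not in `V` is the end of a small square in the
nonnegative part of `C`. The directions are chosen so that the only link which can occur is the one
next to the point. -/
theorem exists_sq_to {p : Fin 3 → ℤ} (hp : p ∈ cubes) (h0 : 0 ≤ p 0 ∧ 0 ≤ p 1 ∧ 0 ≤ p 2)
    (hV : p ∉ V) : ∃ a b c : Fin 3 → ℤ, exZ.sq a b c p ∧ a ∈ C₂ ∧ b ∈ C₂ ∧ c ∈ C₂ ∧
      0 < p 0 + p 1 + p 2 ∧ b 0 + b 1 + b 2 + 1 = p 0 + p 1 + p 2 ∧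
      c 0 + c 1 + c 2 + 1 = p 0 + p 1 + p 2 ∧ a 0 + a 1 + a 2 + 2 = p 0 + p 1 + p 2 := by
  by_contra hn
  have key : ∀ i j : Fin 3, i ≠ j → ∀ a : Fin 3 → ℤ, stepPt j (stepPt i a) = p → a ∈ C₂ →
      stepPt i a ∈ C₂ → stepPt j a ∈ C₂ → False := fun i j hij a ha h1 h2 h3 =>
    hn ⟨a, stepPt i a, stepPt j a, ha ▸ exZ_sq_stepPt hij a, h1, h2, h3, by
      simp only [mem_cubes, mem_V] at *
      refine ⟨by omega, ?_⟩
      subst ha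
      clear hp h0 hV h1 h2 h3
      revert hij
      fin_cases i <;> fin_cases j <;> simp [stepPt] <;> omega⟩
  have e : ∀ {q : Fin 3 → ℤ}, q = p ↔ q 0 = p 0 ∧ q 1 = p 1 ∧ q 2 = p 2 := fun {q} =>
    ⟨fun h => h ▸ ⟨rfl, rfl, rfl⟩, fun h => (eq_vec_iff.2 h).trans
      (eq_vec_iff.2 ⟨rfl, rfl, rfl⟩).symm⟩
  simp only [mem_cubes, mem_V] at hp hV
  by_cases h1 : p 1 < p 0 ∧ p 2 ≤ p 0
  · refine key 0 2 (by decide) ![p 0 - 1, p 1, p 2 - 1] ?_ ?_ ?_ ?_ <;>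
    simp [stepPt, mem_C₂, mem_cubes, mem_links, e] <;> omega
  by_cases h2 : p 2 < p 1 ∧ p 0 ≤ p 1
  · refine key 1 0 (by decide) ![p 0 - 1, p 1 - 1, p 2] ?_ ?_ ?_ ?_ <;>
    simp [stepPt, mem_C₂, mem_cubes, mem_links, e] <;> omega
  by_cases h3 : p 0 < p 2 ∧ p 1 ≤ p 2
  · refine key 2 1 (by decide) ![p 0, p 1 - 1, p 2 - 1] ?_ ?_ ?_ ?_ <;>
    simp [stepPt, mem_C₂, mem_cubes, mem_links, e] <;> omega
  · refine key 0 1 (by decide) ![p 0 - 1, p 1 - 1, p 2] ?_ ?_ ?_ ?_ <;>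
    simp [stepPt, mem_C₂, mem_cubes, mem_links, e] <;> omega

/-- A point of a cube with a negative coordinate is the start of a small square in `C`. -/
theorem exists_sq_from {p : Fin 3 → ℤ} (hp : p ∈ cubes) (h0 : ¬ (0 ≤ p 0 ∧ 0 ≤ p 1 ∧ 0 ≤ p 2)) :
    ∃ b c d : Fin 3 → ℤ, exZ.sq p b c d ∧ b ∈ C ∧ c ∈ C ∧ d ∈ C ∧ p 0 + p 1 + p 2 < 0 ∧
      b 0 + b 1 + b 2 = p 0 + p 1 + p 2 + 1 ∧
      c 0 + c 1 + c 2 = p 0 + p 1 + p 2 + 1 ∧ d 0 + d 1 + d 2 = p 0 + p 1 + p 2 + 2 := by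
  by_contra hn
  have key : ∀ i j : Fin 3, i ≠ j → stepPt i p ∈ C → stepPt j p ∈ C →
      stepPt j (stepPt i p) ∈ C → False := fun i j hij h1 h2 h3 =>
    hn ⟨stepPt i p, stepPt j p, _, exZ_sq_stepPt hij p, h1, h2, h3, by
      simp only [mem_cubes] at *
      refine ⟨by omega, ?_⟩
      clear hp h0 h1 h2 h3
      revert hij
      fin_cases i <;> fin_cases j <;> simp [stepPt] <;> omega⟩
  simp only [mem_cubes] at hp
  by_cases h1 : p 1 < p 0 ∧ p 1 ≤ p 2
  · refine key 1 2 (by decide) ?_ ?_ ?_ <;> simp [stepPt, mem_C, mem_cubes, mem_links] <;> omega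
  by_cases h2 : p 2 < p 1 ∧ p 2 ≤ p 0
  · refine key 2 0 (by decide) ?_ ?_ ?_ <;> simp [stepPt, mem_C, mem_cubes, mem_links] <;> omega
  · refine key 0 1 (by decide) ?_ ?_ ?_ <;> simp [stepPt, mem_C, mem_cubes, mem_links] <;> omega

theorem V_sub_C₁ : V ⊆ C₁ := Set.subset_union_left

theorem C₁_sub_C₂ : C₁ ⊆ C₂ := by
  intro c h
  simp only [mem_C₁, mem_C₂, mem_V, mem_links, mem_cubes] at h ⊢
  omega

theorem C₂_sub_C : C₂ ⊆ C := by
  intro c h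
  simp only [mem_C₂, mem_C] at h ⊢
  tauto

theorem not_sq_V {a b c d : Fin 3 → ℤ} (hb : b ∈ V) (hc : c ∈ V) (hd : d ∈ V)
    (h : exZ.sq a b c d) : False := by
  have := exZ_cases h
  simp only [mem_V] at *
  omega

theorem not_sq_C₁ {a b c d : Fin 3 → ℤ} (ha : a ∈ C₁) (hb : b ∈ C₁) (hc : c ∈ C₁) (hd : d ∈ C₁)
    (h : exZ.sq a b c d) : False := by
  have h := exZ_cases h
  simp only [mem_C₁, mem_V, mem_links] at *
  omega

/-- The small squares of `C₂` satisfy the cover condition of `LCrit` for `C₁ ⊆ C₂`. -/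
theorem prime_C₂ {a b c d s : Fin 3 → ℤ} (ha : a ∈ C₂) (hb : b ∈ C₂) (hc : c ∈ C₂) (hd : d ∈ C₂)
    (hs : s ∈ C₁) (h : exZ.sq a b c d) (hl : s ≤ d) : s ≤ b ∨ s ≤ c := by
  have h := exZ_cases h
  simp only [mem_C₁, mem_C₂, mem_V, mem_links, mem_cubes, le_iff_fin] at *
  obtain ⟨h', ⟨h1, h2, h | h⟩ | ⟨h1, h2, h | h⟩ | ⟨h1, h2, h | h⟩⟩ := h <;>
  rcases ha with ha | ha <;> rcases hd with hd | hd <;> try omega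

/-- The small squares of `C` which are not in `C₂` satisfy the cover condition of `RCrit` for `C₂ ⊆
C`. -/
theorem prime_C {a b c d s : Fin 3 → ℤ} (ha : a ∈ C) (hb : b ∈ C) (hc : c ∈ C) (hd : d ∈ C)
    (hs : s ∈ C₂) (h : exZ.sq a b c d) (hl : a ≤ s) :
    (a ∈ C₂ ∧ b ∈ C₂ ∧ c ∈ C₂ ∧ d ∈ C₂) ∨ b ≤ s ∨ c ≤ s := by
  have h := exZ_cases h
  by_cases h0 : 0 ≤ a 0 ∧ 0 ≤ a 1 ∧ 0 ≤ a 2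
  · refine Or.inl ?_
    simp only [mem_C₂]
    simp only [mem_C] at ha hb hc hd
    refine ⟨ha.imp_left fun h => ⟨h, h0⟩, hb.imp_left fun h => ⟨h, ?_⟩,
      hc.imp_left fun h => ⟨h, ?_⟩, hd.imp_left fun h => ⟨h, ?_⟩⟩ <;> omega
  refine Or.inr ?_
  by_contra! hn
  simp only [mem_C₂, mem_C, le_iff_fin] at *
  obtain ⟨hn, hn'⟩ := hn
  obtain ⟨h', ⟨h1, h2, h | h⟩ | ⟨h1, h2, h | h⟩ | ⟨h1, h2, h | h⟩⟩ := h <;>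
  · rcases hs with hs | hs
    · clear hb hc
      simp only [mem_cubes, mem_links] at *
      rcases ha with ha | ha <;> omega
    · clear h0
      rw [mem_links] at hs
      rcases hs with hs | hs | hs <;> rcases ha with ha | ha <;> rcases hd with hd | hd <;>
      simp only [mem_cubes, mem_links] at * <;> omega

end ShapeC

end

end Der.Prederivator

namespace Der.Prederivator

noncomputable section

/-! ### Construction of exact diagrams by iterated Kan extensions -/

section Steps

variable {D : Prederivator.{v, u}} {A S T : Type} [Preorder A] [Preorder S] [Preorder T]

theorem Good.cls_congr {P Q : Prederivator.{v, u}} {p : ∀ K, P.obj K → Prop} {ρ ρ' : P ⟶ Q}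
    {L L' : Q ⟶ P}
    (h : Good p ρ L) (hp : ∀ K (X Y : P.obj K), (X ≅ Y) → p K X → p K Y) (hρ : cls ρ = cls ρ')
    (hL : cls L = cls L') : Good p ρ' L' := by
  obtain ⟨i⟩ := cls_eq_iff.1 hL
  exact h.congr hp hρ i

theorem exK_iso {e : ExData T} (K) (X Y : (D.shift T).obj K) (i : X ≅ Y) (h : D.ExK e K X) :
    D.ExK e K Y := h.of_iso i

/-- A left Kan extension, under the assumption that the conditions on the source are vacuous. -/
theorem IsStableKan.good_lan (hs : D.IsStableKan) (hK : D.HasKan) {u : S ⥤ T} {e : ExData T}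
    (hu : LCrit u e) (h : ∀ Y : D.val S, D.ExAt (e.pull u.obj) Y) :
    Good (D.ExK e) (D.restr u) (lan hK u) :=
  (Good.lan hs.kan hs.zero hK hu rfl (Good.base fun _ _ _ => h _)).cls_congr exK_iso
    (by rw [cls_comp, cls_id, Category.comp_id]) (by rw [cls_comp, cls_id, Category.id_comp])

theorem IsStableKan.good_ran (hs : D.IsStableKan) (hK : D.HasKan) {u : S ⥤ T} {e : ExData T}
    (hu : RCrit u e) (h : ∀ Y : D.val S, D.ExAt (e.pull u.obj) Y) :
    Good (D.ExK e) (D.restr u) (ran hK u) :=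
  (Good.ran hs.kan hs.zero hs.stable hK hu rfl (Good.base fun _ _ _ => h _)).cls_congr exK_iso
    (by rw [cls_comp, cls_id, Category.comp_id]) (by rw [cls_comp, cls_id, Category.id_comp])

theorem IsStableKan.good_lan_step (hs : D.IsStableKan) (hK : D.HasKan) {u : S ⥤ T} {e : ExData T}
    {e' : ExData S} {w : A ⥤ S} {L} (h : Good (D.ExK e') (D.restr w) L) (hu : LCrit u e)
    (he : e' = e.pull u.obj) : Good (D.ExK e) (D.restr (w ⋙ u)) (L ≫ lan hK u) :=
  (Good.lan hs.kan hs.zero hK hu he h).cls_congr exK_iso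
    (by rw [cls_comp, cls_restr_comp]) rfl

theorem IsStableKan.good_ran_step (hs : D.IsStableKan) (hK : D.HasKan) {u : S ⥤ T} {e : ExData T}
    {e' : ExData S} {w : A ⥤ S} {L} (h : Good (D.ExK e') (D.restr w) L) (hu : RCrit u e)
    (he : e' = e.pull u.obj) : Good (D.ExK e) (D.restr (w ⋙ u)) (L ≫ ran hK u) :=
  (Good.ran hs.kan hs.zero hs.stable hK hu he h).cls_congr exK_iso
    (by rw [cls_comp, cls_restr_comp]) rfl

theorem listed_incl {n : ℕ} {S T : Set (Fin n → ℤ)} (h : S ⊆ T) {lS lT : List (Fin n → ℤ)}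
    (hS : ∀ e, e ∈ S ↔ e ∈ lS) (hT : ∀ e, e ∈ T ↔ e ∈ lT) :
    Listed (incl h) Subtype.val lS lT where
  le _ _ h := h
  mono _ _ h := h
  inj _ _ h := Subtype.ext h
  mem t := (hT _).1 t.2
  surj p hp := ⟨⟨p, (hT _).2 hp⟩, rfl⟩
  memS s := (hS _).1 s.2
  surjS p hp := ⟨⟨p, (hS _).2 hp⟩, rfl⟩
  emb _ _ h := ⟨homOfLE h⟩

end Steps

/-! ### The exact diagrams on `C` and arbitrary diagrams on `V` -/

section GoodC

variable {D : Prederivator.{v, u}}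

theorem le_of_exZ {a b c d : Fin 3 → ℤ} (h : exZ.sq a b c d) :
    a ≤ b ∧ a ≤ c ∧ c ≤ d ∧ b ≤ d := by
  have h := exZ_cases h
  simp only [le_iff_fin]
  omega

theorem meet_of_exZ {a b c d x : Fin 3 → ℤ} (h : exZ.sq a b c d) (hb : x ≤ b) (hc : x ≤ c) :
    x ≤ a := by
  have h := exZ_cases h
  simp only [le_iff_fin] at *
  omega

theorem join_of_exZ {a b c d x : Fin 3 → ℤ} (h : exZ.sq a b c d) (hb : b ≤ x) (hc : c ≤ x) :
    d ≤ x := by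
  have h := exZ_cases h
  simp only [le_iff_fin] at *
  omega

/-- Right Kan extension along `V ⊆ C₁` extends diagrams by zero. -/
theorem rCrit_V : RCrit (incl V_sub_C₁) (exZ.pull Subtype.val) where
  emb _ _ h := ⟨homOfLE h⟩
  new := by
    refine ⟨fun _ => 0, fun p => ?_⟩
    obtain h | h := p.2
    · exact Or.inl ⟨⟨p.1, h⟩, rfl⟩
    · refine Or.inr (Or.inl ⟨h.1, fun s hs => ?_⟩)
      have h1 := mem_V.1 s.2
      have h2 := mem_links.1 h.1
      have h3 : p.1 ≤ s.1 := hs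
      have h4 := h.2 0
      have h5 := h.2 1
      have h6 := h.2 2
      rw [le_iff_fin] at h3
      omega
  sq a b c d h := (not_sq_C₁ a.2 b.2 c.2 d.2 h).elim
  zero t ht := by
    obtain h | h := t.2
    · exact Or.inl ⟨⟨t.1, h⟩, rfl⟩
    · refine Or.inr fun s hs => ?_
      have h1 := mem_V.1 s.2
      have h2 := mem_links.1 h.1
      have h3 : t.1 ≤ s.1 := hs
      have h4 := h.2 0
      have h5 := h.2 1
      have h6 := h.2 2
      rw [le_iff_fin] at h3
      omega

theorem not_le_link {s t : Fin 3 → ℤ} (hs : s ∈ C₁) (ht : t ∉ C₁) (h : t ∈ links) : ¬ s ≤ t := by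
  simp only [mem_C₁, mem_V, mem_links, le_iff_fin] at *
  omega

/-- Left Kan extension along `C₁ ⊆ C₂` builds the nonnegative part of `C`, by induction on the sum
of the coordinates, and adds zeros at the other links. -/
theorem lCrit_C₁ : LCrit (incl C₁_sub_C₂) (exZ.pull Subtype.val) where
  emb _ _ h := ⟨homOfLE h⟩
  new := by
    refine ⟨fun p => (p.1 0 + p.1 1 + p.1 2).toNat, fun p => ?_⟩
    by_cases h : p.1 ∈ C₁
    · exact Or.inl ⟨⟨p.1, h⟩, rfl⟩
    by_cases h' : p.1 ∈ links
    · exact Or.inr (Or.inl ⟨h', fun s hs => not_le_link s.2 h h' hs⟩)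
    · obtain ⟨h1, h2⟩ | h1 := mem_C₂.1 p.2
      · obtain ⟨a, b, c, h3, ha, hb, hc, h4⟩ := exists_sq_to h1 h2 fun h3 =>
          h (mem_C₁.2 (Or.inl h3))
        exact Or.inr (Or.inr ⟨⟨a, ha⟩, ⟨b, hb⟩, ⟨c, hc⟩, h3,
          show (a 0 + a 1 + a 2).toNat < (p.1 0 + p.1 1 + p.1 2).toNat by omega,
          show (b 0 + b 1 + b 2).toNat < (p.1 0 + p.1 1 + p.1 2).toNat by omega,
          show (c 0 + c 1 + c 2).toNat < (p.1 0 + p.1 1 + p.1 2).toNat by omega⟩)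
      · exact (h' h1).elim
  sq a b c d h := Or.inr ⟨le_of_exZ h, fun x hb hc => meet_of_exZ h hb hc,
    fun s hs => prime_C₂ a.2 b.2 c.2 d.2 s.2 h hs⟩
  zero t ht := by
    by_cases h : t.1 ∈ C₁
    · exact Or.inl ⟨⟨t.1, h⟩, rfl⟩
    · exact Or.inr fun s hs => not_le_link s.2 h ht hs

/-- Right Kan extension along `C₂ ⊆ C` builds the rest of `C`, by descending induction on the sum of
the coordinates. -/
theorem rCrit_C₂ : RCrit (incl C₂_sub_C) exC where
  emb _ _ h := ⟨homOfLE h⟩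
  new := by
    refine ⟨fun p => (- (p.1 0 + p.1 1 + p.1 2)).toNat, fun p => ?_⟩
    by_cases h : p.1 ∈ C₂
    · exact Or.inl ⟨⟨p.1, h⟩, rfl⟩
    obtain h1 | h1 := mem_C.1 p.2
    · obtain ⟨b, c, d, h3, hb, hc, hd, h4⟩ := exists_sq_from h1 fun h2 =>
        h (mem_C₂.2 (Or.inl ⟨h1, h2⟩))
      exact Or.inr (Or.inr ⟨⟨b, hb⟩, ⟨c, hc⟩, ⟨d, hd⟩, h3,
          show (-(b 0 + b 1 + b 2)).toNat < (-(p.1 0 + p.1 1 + p.1 2)).toNat by omega,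
          show (-(c 0 + c 1 + c 2)).toNat < (-(p.1 0 + p.1 1 + p.1 2)).toNat by omega,
          show (-(d 0 + d 1 + d 2)).toNat < (-(p.1 0 + p.1 1 + p.1 2)).toNat by omega⟩)
    · exact (h (mem_C₂.2 (Or.inr h1))).elim
  sq a b c d h := by
    by_cases h' : a.1 ∈ C₂ ∧ b.1 ∈ C₂ ∧ c.1 ∈ C₂ ∧ d.1 ∈ C₂
    · exact Or.inl ⟨⟨⟨_, h'.1⟩, rfl⟩, ⟨⟨_, h'.2.1⟩, rfl⟩, ⟨⟨_, h'.2.2.1⟩, rfl⟩,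
      ⟨⟨_, h'.2.2.2⟩, rfl⟩⟩
    · exact Or.inr ⟨le_of_exZ h, fun x hb hc => join_of_exZ h hb hc,
        fun s hs => (prime_C a.2 b.2 c.2 d.2 s.2 h hs).resolve_left h'⟩
  zero t ht := Or.inl ⟨⟨t.1, mem_C₂.2 (Or.inr ht)⟩, rfl⟩

/-- The extension of diagrams on `V` to exact diagrams on `C`. -/
def lC (hK : D.HasKan) : D.shift ↥V ⟶ D.shift ↥C :=
  (ran hK (incl V_sub_C₁) ≫ lan hK (incl C₁_sub_C₂)) ≫ ran hK (incl C₂_sub_C)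

/-- Exact diagrams on `C` are determined by their restriction to `V`, which is arbitrary. -/
theorem good_lC (hs : D.IsStableKan) (hK : D.HasKan) :
    Good (D.ExK exC) (D.restr iV) (lC hK) :=
  (hs.good_ran_step hK (hs.good_lan_step hK (hs.good_ran (e := exZ.pull Subtype.val) hK rCrit_V
    fun _ => ⟨fun _ b c d h => (not_sq_V b.2 c.2 d.2 h).elim, fun t h => by
      have h1 := (mem_V (c := t.1)).1 t.2
      have h2 := (mem_links (c := t.1)).1 h
      omega⟩) lCrit_C₁ rfl) rCrit_C₂ rfl).cls_congr exK_iso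
    (cls_restr_congr D (thinIso fun _ => rfl)) rfl

/-- The defining property of `D^{C,ex}` in terms of exactness conditions. -/
theorem exProp_iff (hst : ∀ Q, D.IsCocartesian Q ↔ D.IsCartesian Q) (K)
    (X : (D.shift ↥C).obj K) : (exProp D).prop K X ↔ D.ExK exC K X := by
  have hi : ∀ (k : Sq ⥤ ↥C) (a : K.unop), Nonempty ((D.res (atPt k a)).obj X ≅
      (D.res k).obj ((D.res (CategoryTheory.Prod.sectL ↥C a)).obj X)) := fun k a =>
    ⟨(D.resIso (v := k ⋙ CategoryTheory.Prod.sectL ↥C a) (NatIso.ofComponents (fun _ => Iso.refl _)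
      (map_comp_id_eq (atPt k a))) ≪≫ D.resComp _ _).app X⟩
  refine ⟨fun h a => ⟨fun x y z w hs => ?_, fun t ht =>
    (isZero_evalAt_res (CategoryTheory.Prod.sectL ↥C a) t).2 (h.2 t ht a)⟩, fun h =>
      ⟨fun k hk a => ?_,
    fun t ht a => (isZero_evalAt_res (CategoryTheory.Prod.sectL ↥C a) t).1 ((h a).zero t ht)⟩⟩
  · obtain ⟨h1, h2, h3, h4⟩ := le_of_exZ hs
    let k : Sq ⥤ ↥C := thinSq ⟨homOfLE (show x ≤ y from h1)⟩ ⟨homOfLE (show x ≤ z from h2)⟩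
      ⟨homOfLE (show z ≤ w from h3)⟩ ⟨homOfLE (show y ≤ w from h4)⟩
    have hk : IsSmallSquare k := by
      obtain ⟨i, j, hij, h⟩ := hs
      refine ⟨x.1, i, j, hij, fun s => ?_⟩
      funext l
      have hl := h l
      rw [Pi.add_apply, Pi.add_apply, Pi.single_apply, Pi.single_apply]
      obtain rfl | rfl | rfl | rfl := sq_cases s
      · change x.1 l = x.1 l + (if l = i then ((0 : ℕ) : ℤ) else 0) +
          if l = j then ((0 : ℕ) : ℤ) else 0
        simp
      · change y.1 l = x.1 l + (if l = i then ((1 : ℕ) : ℤ) else 0) +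
          if l = j then ((0 : ℕ) : ℤ) else 0
        simp [hl.1]
      · change z.1 l = x.1 l + (if l = i then ((0 : ℕ) : ℤ) else 0) +
          if l = j then ((1 : ℕ) : ℤ) else 0
        simp [hl.2.1]
      · change w.1 l = x.1 l + (if l = i then ((1 : ℕ) : ℤ) else 0) +
          if l = j then ((1 : ℕ) : ℤ) else 0
        simp [hl.2.2]
    obtain ⟨i⟩ := hi k a
    exact ⟨k, ⟨rfl, rfl, rfl, rfl⟩, (h.1 k hk a).1.of_iso i⟩
  · have hx : exZ.sq (k.obj (Sq.mk 0 0)).1 (k.obj (Sq.mk 1 0)).1 (k.obj (Sq.mk 0 1)).1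
        (k.obj (Sq.mk 1 1)).1 := by
      obtain ⟨x, i, j, hij, h⟩ := hk
      refine ⟨i, j, hij, fun l => ?_⟩
      rw [h, h, h, h]
      simp [Pi.single_apply, Sq.mk]
    obtain ⟨i⟩ := hi k a
    have h1 := ((h a).sq _ _ _ _ hx).isCocartesian.of_iso i.symm
    exact ⟨h1, (hst _).1 h1⟩

theorem cexRestr_iV_isEquiv (hs : D.IsStableKan) (hK : D.HasKan) : IsEquiv (cexRestr D iV) := by
  rw [isEquiv_iff, cexRestr, cls_comp]
  exact (good_lC hs hK).isIso_sub (exProp D) (exProp_iff hs.stable)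

end GoodC

end

end Der.Prederivator

namespace Der.Prederivator

noncomputable section

/-! ### The poset `E` -/

section ShapeE

variable {D : Prederivator.{v, u}}

/-- The square with initial vertex `x.1` and unit steps in the directions `x.2.1` and `x.2.2`. -/
def stepSq {n : ℕ} (x : (Fin n → ℤ) × Fin n × Fin n) :
    (Fin n → ℤ) × (Fin n → ℤ) × (Fin n → ℤ) × (Fin n → ℤ) :=
  (x.1, fun l => x.1 l + if l = x.2.1 then 1 else 0, fun l => x.1 l + if l = x.2.2 then 1 else 0,
    fun l => x.1 l + (if l = x.2.1 then 1 else 0) + if l = x.2.2 then 1 else 0)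

/-- The bicartesian squares of the diagrams in the image of `H`: the faces of the cube in the
layer `0`, the squares joining it to the layer `1`, and the squares which contain the other points
of `E`. The last square
belongs to an enlargement of `E` by the two points `(1, -2, -2, 0)` and `(0, -2, -2, 0)`. -/
def sqE : List ((Fin 4 → ℤ) × (Fin 4 → ℤ) × (Fin 4 → ℤ) × (Fin 4 → ℤ)) :=
  [(![0, 0, 0, 0], 0, 1), (![0, 0, 1, 0], 0, 1), (![0, 0, 0, 0], 1, 2), (![1, 0, 0, 0], 1, 2),
    (![0, 0, 0, 0], 0, 2), (![0, 1, 0, 0], 0, 2), (![0, 0, 0, 0], 0, 3), (![0, 0, 1, 0], 0, 3),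
    (![0, 1, 0, 0], 0, 3), (![0, 1, 1, 0], 0, 3), (![0, 0, 0, 0], 1, 3), (![0, 0, 1, 0], 1, 3),
    (![1, 0, 0, 0], 1, 3), (![1, 0, 1, 0], 1, 3), (![0, 0, 0, 0], 2, 3), (![0, 1, 0, 0], 2, 3),
    (![1, 0, 0, 0], 2, 3), (![1, 1, 0, 0], 2, 3), (![0, 1, 1, 1], 0, 1), (![1, 0, 1, 1], 1, 2),
    (![1, 1, 0, 1], 2, 0)].map stepSq ++
  [(![-1, -1, -1, 0], ![0, 0, 0, 0], ![-1, -1, -1, 1], ![0, 0, 0, 1]),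
    (![0, -2, -2, 0], ![0, 0, 0, 0], ![1, -2, -2, 0], ![1, 0, 0, 0])]

/-- The points at which the diagrams in the image of `H` vanish. -/
def zeroE : List (Fin 4 → ℤ) :=
  [![1, 1, 1, 0], ![-1, -1, -1, 1], ![0, 2, 1, 1], ![2, 1, 0, 1], ![1, 0, 2, 1], ![1, -2, -2, 0]]

def listV : List (Fin 3 → ℤ) := [![0, 0, 0], ![1, 0, 0], ![0, 1, 0], ![0, 0, 1]]

/-- The points of the image of `V` in `E₁`. -/
def listE₀ : List (Fin 4 → ℤ) := [![-1, -1, -1, 0], ![1, 1, 0, 0], ![0, 1, 1, 0], ![1, 0, 1, 0]]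

/-- The points of `E₁`, `E₂`, … are listed in the order in which the Kan extensions construct them.
-/
def listE₁ : List (Fin 4 → ℤ) := listE₀ ++ [![1, 1, 1, 0]]

def listE₂ : List (Fin 4 → ℤ) :=
  listE₁ ++ [![0, 1, 0, 0], ![1, 0, 0, 0], ![0, 0, 1, 0], ![0, 0, 0, 0]]

def listE₃ : List (Fin 4 → ℤ) := listE₂ ++ [![-1, -1, -1, 1]]

def listE₄ : List (Fin 4 → ℤ) := listE₃ ++ [![0, 0, 0, 1], ![1, 0, 0, 1], ![0, 1, 0, 1],
  ![0, 0, 1, 1], ![1, 1, 0, 1], ![0, 1, 1, 1], ![1, 0, 1, 1], ![1, 1, 1, 1]]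

def listE₅ : List (Fin 4 → ℤ) := listE₄ ++ [![0, 2, 1, 1], ![2, 1, 0, 1], ![1, 0, 2, 1]]

def listE₆ : List (Fin 4 → ℤ) := listE₅ ++ [![2, 1, 1, 1], ![1, 2, 1, 1], ![1, 1, 2, 1]]

def listE₇ : List (Fin 4 → ℤ) := listE₆ ++ [![1, -2, -2, 0]]

def listE₈ : List (Fin 4 → ℤ) := listE₇ ++ [![0, -2, -2, 0]]

theorem mem_V_iff (c : Fin 3 → ℤ) : c ∈ V ↔ c ∈ listV := by
  simp only [listV, V, List.mem_cons, List.not_mem_nil, or_false, Set.mem_insert_iff,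
    Set.mem_singleton_iff]

theorem mem_E₁_iff (e : Fin 4 → ℤ) : e ∈ E₁ ↔ e ∈ listE₁ := by
  simp [listE₁, listE₀, E₁]

theorem eq_vec₄ (e : Fin 4 → ℤ) : e = ![e 0, e 1, e 2, e 3] := by
  funext i
  fin_cases i <;> rfl

theorem mem_E₂_iff (e : Fin 4 → ℤ) : e ∈ E₂ ↔ e ∈ listE₂ := by
  have h : ∀ x ∈ [![0, 1, 0, 0], ![1, 0, 0, 0], ![0, 0, 1, 0], ![0, 0, 0, 0]],
      (∀ i, x i = 0 ∨ x i = 1) ∧ x 3 = (0 : ℤ) := by decide +kernel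
  rw [E₂, listE₂, Set.mem_union, mem_E₁_iff, List.mem_append]
  refine ⟨fun h1 => h1.elim Or.inl fun ⟨h1, h2⟩ => ?_, Or.imp_right (h e)⟩
  rw [eq_vec₄ e, h2]
  rcases h1 0 with h3 | h3 <;> rcases h1 1 with h4 | h4 <;> rcases h1 2 with h5 | h5 <;>
  rw [h3, h4, h5] <;> decide +kernel

theorem mem_E₃_iff (e : Fin 4 → ℤ) : e ∈ E₃ ↔ e ∈ listE₃ := by
  rw [E₃, listE₃, Set.mem_union, mem_E₂_iff, List.mem_append, List.mem_singleton,
    Set.mem_singleton_iff]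

theorem mem_E₄_iff (e : Fin 4 → ℤ) : e ∈ E₄ ↔ e ∈ listE₄ := by
  have h : ∀ x ∈ [![0, 0, 0, 1], ![1, 0, 0, 1], ![0, 1, 0, 1], ![0, 0, 1, 1], ![1, 1, 0, 1],
      ![0, 1, 1, 1], ![1, 0, 1, 1], ![1, 1, 1, 1]],
      (∀ i, x i = 0 ∨ x i = 1) ∧ x 3 = (1 : ℤ) := by decide +kernel
  rw [E₄, listE₄, Set.mem_union, mem_E₃_iff, List.mem_append]
  refine ⟨fun h1 => h1.imp_right fun ⟨h1, h2⟩ => ?_, Or.imp_right (h e)⟩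
  rw [eq_vec₄ e, h2]
  rcases h1 0 with h3 | h3 <;> rcases h1 1 with h4 | h4 <;> rcases h1 2 with h5 | h5 <;>
  rw [h3, h4, h5] <;> decide +kernel

theorem mem_E₅_iff (e : Fin 4 → ℤ) : e ∈ E₅ ↔ e ∈ listE₅ := by
  rw [E₅, listE₅, Set.mem_union, mem_E₄_iff, List.mem_append]
  simp

theorem mem_E₆_iff (e : Fin 4 → ℤ) : e ∈ E₆ ↔ e ∈ listE₆ := by
  rw [E₆, listE₆, Set.mem_union, mem_E₅_iff, List.mem_append]
  simp

/-- The poset `E` with the additional point `(1, -2, -2, 0)`. -/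
def E₇ : Set (Fin 4 → ℤ) := {e | e ∈ listE₇}

/-- The poset `E` with the additional points `(1, -2, -2, 0)` and `(0, -2, -2, 0)`. -/
def E₈ : Set (Fin 4 → ℤ) := {e | e ∈ listE₈}

theorem E₆_sub_E₇ : E₆ ⊆ E₇ := fun e h => List.mem_append_left _ ((mem_E₆_iff e).1 h)

theorem E₇_sub_E₈ : E₇ ⊆ E₈ := fun _ h => List.mem_append_left _ h

theorem listed_v₁ : Listed v₁ Subtype.val listE₀ listE₁ where
  le _ _ h := h
  mono _ _ h := h
  inj _ _ h := Subtype.ext h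
  mem t := (mem_E₁_iff _).1 t.2
  surj p hp := ⟨⟨p, (mem_E₁_iff _).2 hp⟩, rfl⟩
  memS s := by
    have h : ∀ c ∈ listV, v₁Fun c ∈ listE₀ := by decide +kernel
    exact h _ ((mem_V_iff _).1 s.2)
  surjS p hp := by
    have h : ∀ p ∈ listE₀, ∃ c ∈ listV, v₁Fun c = p := by decide +kernel
    obtain ⟨c, hc, h⟩ := h p hp
    exact ⟨⟨c, (mem_V_iff _).2 hc⟩, h⟩
  emb a b hab := by
    have h : ∀ c ∈ listV, ∀ d ∈ listV, v₁Fun c ≤ v₁Fun d → c ≤ d := by decide +kernel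
    exact ⟨homOfLE (h _ ((mem_V_iff _).1 a.2) _ ((mem_V_iff _).1 b.2) hab)⟩

/-- The exactness conditions on diagrams on posets of points of `ℤ⁴`. -/
def exE : ExData (Fin 4 → ℤ) := .ofList sqE zeroE

/-- The combinatorial conditions for the six Kan extensions which define `H`, and for the two Kan
extensions which enlarge `E`. -/
theorem rOk_E₁ : ROk listE₀ listE₁ sqE zeroE := by decide +kernel
theorem rOk_E₂ : ROk listE₁ listE₂ sqE zeroE := by decide +kernel
theorem rOk_E₃ : ROk listE₂ listE₃ sqE zeroE := by decide +kernel
theorem lOk_E₄ : LOk listE₃ listE₄ sqE zeroE := by decide +kernel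
theorem rOk_E₅ : ROk listE₄ listE₅ sqE zeroE := by decide +kernel
theorem lOk_E₆ : LOk listE₅ listE₆ sqE zeroE := by decide +kernel
theorem lOk_E₇ : LOk listE₆ listE₇ sqE zeroE := by decide +kernel
theorem rOk_E₈ : ROk listE₇ listE₈ sqE zeroE := by decide +kernel

/-- The functor from `V` to `E` through which `H` is a section of a restriction morphism. -/
def vE : ↥V ⥤ ↥E₆ := ((((v₁ ⋙ incl (T := E₂) Set.subset_union_left) ⋙
  incl (T := E₃) Set.subset_union_left) ⋙ incl (T := E₄) Set.subset_union_left) ⋙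
  incl (T := E₅) Set.subset_union_left) ⋙ incl (T := E₆) Set.subset_union_left

/-- The image of `H` consists of the diagrams on `E` which satisfy the exactness conditions, and
these are determined by their restriction along `vE`. -/
theorem good_bigH (hs : D.IsStableKan) (hK : D.HasKan) :
    Good (D.ExK (exE.pull Subtype.val)) (D.restr vE) (bigH hK) := by
  have h0 : ∀ Y : D.val ↥V, D.ExAt ((exE.pull Subtype.val).pull v₁.obj) Y := fun Y =>
    exAt_of_disjoint (f := fun s => (v₁.obj s).1) listed_v₁.memS (by decide +kernel)
      (by decide +kernel) Y
  have h1 := hs.good_ran hK (listed_v₁.rCrit rOk_E₁) h0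
  have h2 := hs.good_ran_step hK h1 ((listed_incl (Set.subset_union_left (s := E₁))
    mem_E₁_iff mem_E₂_iff).rCrit rOk_E₂) rfl
  have h3 := hs.good_ran_step hK h2 ((listed_incl (Set.subset_union_left (s := E₂))
    mem_E₂_iff mem_E₃_iff).rCrit rOk_E₃) rfl
  have h4 := hs.good_lan_step hK h3 ((listed_incl (Set.subset_union_left (s := E₃))
    mem_E₃_iff mem_E₄_iff).lCrit lOk_E₄) rfl
  have h5 := hs.good_ran_step hK h4 ((listed_incl (Set.subset_union_left (s := E₄))
    mem_E₄_iff mem_E₅_iff).rCrit rOk_E₅) rfl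
  have h6 := hs.good_lan_step hK h5 ((listed_incl (Set.subset_union_left (s := E₅))
    mem_E₅_iff mem_E₆_iff).lCrit lOk_E₆) rfl
  refine h6.cls_congr exK_iso rfl ?_
  simp only [cls_comp, Category.assoc]
  rfl

/-- The exact diagrams on the enlargement of `E`. The value at `(1, -2, -2, 0)` is zero and that at
`(0, -2, -2, 0)` is the fiber of `0000 → 1000`, which is the value at `0110`. -/
theorem good_E₈ (hs : D.IsStableKan) (hK : D.HasKan) :
    Good (D.ExK (exE.pull Subtype.val)) (D.restr ((vE ⋙ incl E₆_sub_E₇) ⋙ incl E₇_sub_E₈))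
      ((bigH hK ≫ lan hK (incl E₆_sub_E₇)) ≫ ran hK (incl E₇_sub_E₈)) :=
  hs.good_ran_step hK (hs.good_lan_step hK (good_bigH hs hK)
    ((listed_incl E₆_sub_E₇ mem_E₆_iff fun _ => Iff.rfl).lCrit lOk_E₇) rfl)
    ((listed_incl E₇_sub_E₈ (fun _ => Iff.rfl) fun _ => Iff.rfl).rCrit rOk_E₈) rfl

end ShapeE

end

end Der.Prederivator

namespace Der.Prederivator

noncomputable section

/-! ### Auxiliary finite shapes -/

section Aux

variable {D : Prederivator.{v, u}}

instance (c : Fin 3 → ℤ) : Decidable (c ∈ cubes) := decidable_of_iff _ mem_cubes.symm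

instance (c : Fin 3 → ℤ) : Decidable (c ∈ links) := decidable_of_iff _ mem_links.symm

instance (c : Fin 3 → ℤ) : Decidable (c ∈ C) := decidable_of_iff _ mem_C.symm

instance (e : Fin 4 → ℤ) : Decidable (e ∈ E₆) := decidable_of_iff _ (mem_E₆_iff e).symm

instance (i j : Fin 3) (a b c d : Fin 3 → ℤ) : Decidable (IsStep i j a b c d) := by
  unfold IsStep
  infer_instance

instance (a b c d : Fin 3 → ℤ) : Decidable (exZ.sq a b c d) :=
  inferInstanceAs (Decidable (∃ i j, i ≠ j ∧ IsStep i j a b c d))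

/-- A cocartesian square of an exact diagram on `C`, given by its vertices. -/
theorem coSqC {Y : D.val ↥C} (h : D.ExAt exC Y) (a b c d : Fin 3 → ℤ)
    (ha : a ∈ C := by decide +kernel) (hb : b ∈ C := by decide +kernel)
    (hc : c ∈ C := by decide +kernel) (hd : d ∈ C := by decide +kernel)
    (hs : exZ.sq a b c d := by decide +kernel) : D.CoSq Y ⟨a, ha⟩ ⟨b, hb⟩ ⟨c, hc⟩ ⟨d, hd⟩ :=
  h.sq _ _ _ _ hs

/-- A cocartesian square of an exact diagram on a part of `E` or its enlargement, given by its
vertices. -/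
theorem coSqE {T : Set (Fin 4 → ℤ)} {Y : D.val ↥T} (h : D.ExAt (exE.pull Subtype.val) Y)
    (a b c d : Fin 4 → ℤ)
    (ha : a ∈ T := by decide +kernel) (hb : b ∈ T := by decide +kernel)
    (hc : c ∈ T := by decide +kernel) (hd : d ∈ T := by decide +kernel)
    (hs : (a, b, c, d) ∈ sqE := by decide +kernel) : D.CoSq Y ⟨a, ha⟩ ⟨b, hb⟩ ⟨c, hc⟩ ⟨d, hd⟩ :=
  h.sq _ _ _ _ hs

/-- In a cube with a bicartesian face, if two opposite neighbours of this face are bicartesian, then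
so is the face opposite to it. -/
theorem CoSq.opposite {T : Type} [Preorder T] (hs : D.IsStableKan) {Y : D.val T}
    {a b c d a' b' c' d' : T} (h : D.CoSq Y a b c d) (h₁ : D.CoSq Y a b a' b')
    (h₂ : D.CoSq Y c d c' d') (ha : a' ≤ c') (hb : b' ≤ d') : D.CoSq Y a' b' c' d' :=
  ((((h₁.symm hs.kan).cancel hs.kan hs.zero
    ((h.symm hs.kan).paste hs.kan hs.zero (h₂.symm hs.kan)) ha hb)).symm hs.kan)

theorem isCocartesian_of_isZero (hs : D.IsStableKan) {X : D.val Sq}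
    (h : ∀ s, Limits.IsZero ((D.evalAt s).obj X)) : D.IsCocartesian X := by
  obtain ⟨l, ⟨adj⟩⟩ := (hs.kan.left spanIncl)
  have hX : Limits.IsZero X := hs.kan.isZero_of_evalAt h
  have h1 : Limits.IsZero ((D.res spanIncl).obj X) :=
    hs.kan.isZero_of_evalAt fun s => (isZero_evalAt_res _ s).2 (h _)
  refine ⟨l, adj, ⟨(D.res spanIncl).obj X, ⟨Limits.IsInitial.uniqueUpToIso ?_ hX.isInitial⟩⟩⟩
  have := adj.leftAdjoint_preservesColimits
  exact Limits.IsInitial.isInitialObj l _ h1.isInitial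

theorem IsStableKan.coSq_zero {T : Type} [Preorder T] (hs : D.IsStableKan) {Y : D.val T}
    {a b c d : T} (ho : a ≤ b ∧ a ≤ c ∧ c ≤ d ∧ b ≤ d)
    (ha : Limits.IsZero ((D.evalAt a).obj Y)) (hb : Limits.IsZero ((D.evalAt b).obj Y))
    (hc : Limits.IsZero ((D.evalAt c).obj Y)) (hd : Limits.IsZero ((D.evalAt d).obj Y)) :
    D.CoSq Y a b c d := by
  refine ⟨thinSq ⟨homOfLE ho.1⟩ ⟨homOfLE ho.2.1⟩ ⟨homOfLE ho.2.2.1⟩ ⟨homOfLE ho.2.2.2⟩,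
    ⟨rfl, rfl, rfl, rfl⟩, isCocartesian_of_isZero hs fun s => (isZero_evalAt_res _ s).2 ?_⟩
  obtain rfl | rfl | rfl | rfl := sq_cases s
  exacts [ha, hb, hc, hd]

theorem exAt_res_ofList {S T A : Type} [Preorder S] [Preorder T] {F : S ⥤ T} {Y : D.val T}
    {f : S → A} (hf : ∀ a b, f a = f b → a = b) {sqs : List (A × A × A × A)} {zs : List A}
    (hsq : ∀ q ∈ sqs, ∃ a b c d : S, (f a, f b, f c, f d) = q ∧
      (a ≤ b ∧ a ≤ c ∧ c ≤ d ∧ b ≤ d) ∧ D.CoSq Y (F.obj a) (F.obj b) (F.obj c) (F.obj d))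
    (hz : ∀ z ∈ zs, ∃ a : S, f a = z ∧ Limits.IsZero ((D.evalAt (F.obj a)).obj Y)) :
    D.ExAt ((ExData.ofList sqs zs).pull f) ((D.res F).obj Y) where
  sq a b c d h := by
    obtain ⟨a', b', c', d', h1, h2, h3⟩ := hsq _ h
    simp only [Prod.mk.injEq] at h1
    obtain rfl := hf _ _ h1.1
    obtain rfl := hf _ _ h1.2.1
    obtain rfl := hf _ _ h1.2.2.1
    obtain rfl := hf _ _ h1.2.2.2
    exact h3.res_of_le rfl rfl rfl rfl h2
  zero t ht := by
    obtain ⟨a, h1, h2⟩ := hz _ ht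
    obtain rfl := hf _ _ h1
    exact (isZero_evalAt_res _ _).2 h2

/-- The unit cube together with the points `102` and `112`. -/
def listQ : List (Fin 3 → ℤ) := [![0, 0, 0], ![1, 0, 0], ![0, 1, 0], ![0, 0, 1], ![1, 0, 2],
  ![1, 1, 0], ![1, 0, 1], ![0, 1, 1], ![1, 1, 1], ![1, 1, 2]]

/-- The points of `QC`, in the order in which they are constructed from the vertices of `j`. -/
def listQ' : List (Fin 3 → ℤ) := [![0, 1, 0], ![0, 1, 1], ![1, 1, 0], ![1, 1, 2], ![1, 0, 2],
  ![1, 1, 1], ![1, 0, 1], ![1, 0, 0], ![0, 0, 1], ![0, 0, 0]]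

/-- The small squares of `C` in the unit cube and its neighbourhood, except for a face of the cube
which is obtained from the other ones. -/
def sqQ : List ((Fin 3 → ℤ) × (Fin 3 → ℤ) × (Fin 3 → ℤ) × (Fin 3 → ℤ)) :=
  [(![0, 1, 0], 0, 2), (![0, 0, 1], 0, 1), (![1, 0, 1], 1, 2), (![0, 0, 0], 0, 1),
    (![0, 0, 0], 1, 2), (![1, 0, 0], 1, 2)].map stepSq

/-- The squares of `sqQ` and the remaining face of the cube. -/
def sqQ' : List ((Fin 3 → ℤ) × (Fin 3 → ℤ) × (Fin 3 → ℤ) × (Fin 3 → ℤ)) :=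
  stepSq (![0, 0, 0], 0, 2) :: sqQ

/-- The link in `QC`. -/
def zeroQ : List (Fin 3 → ℤ) := [![1, 0, 2]]

/-- The part of `C` consisting of the unit cube and the points `102` and `112`. -/
def QC : Set (Fin 3 → ℤ) := {c | c ∈ listQ}

/-- The points of `V` and the link `102`. -/
def Q₁ : Set (Fin 3 → ℤ) := {c | c ∈ listQ.take 5}

/-- The vertices of `j` and the points `102` and `111`. -/
def Q₂ : Set (Fin 3 → ℤ) := {c | c ∈ listQ'.take 6}

theorem mem_QC_iff (c : Fin 3 → ℤ) : c ∈ QC ↔ c ∈ listQ' := by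
  have h : ∀ c ∈ listQ, c ∈ listQ' := by decide +kernel
  have h' : ∀ c ∈ listQ', c ∈ listQ := by decide +kernel
  exact ⟨h c, h' c⟩

theorem V_sub_Q₁ : V ⊆ Q₁ := fun c h =>
  (List.mem_append_left _ ((mem_V_iff c).1 h) : c ∈ listV ++ [![1, 0, 2]])

theorem Q₁_sub_QC : Q₁ ⊆ QC := fun _ h => List.mem_of_mem_take h

theorem Q₂_sub_QC : Q₂ ⊆ QC := fun c h => (mem_QC_iff c).2 (List.mem_of_mem_take h)

theorem QC_sub_C : QC ⊆ C := by
  have h : ∀ c ∈ listQ, c ∈ C := by decide +kernel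
  exact h

theorem jFun_mem_take (s : Sq) : jFun s ∈ listQ'.take 6 := by
  revert s
  decide +kernel

/-- The square `j` with values in `Q₂`. -/
def jQ₂ : Sq ⥤ ↥Q₂ := mono (fun s => ⟨jFun s, jFun_mem_take s⟩) (by
  change ∀ a b : Sq, a ≤ b → jFun a ≤ jFun b
  decide +kernel)

theorem listed_jQ₂ : Listed jQ₂ Subtype.val (listQ'.take 4) (listQ'.take 6) where
  le _ _ h := h
  mono _ _ h := h
  inj _ _ h := Subtype.ext h
  mem t := t.2
  surj p hp := ⟨⟨p, hp⟩, rfl⟩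
  memS := by
    change ∀ s, jFun s ∈ listQ'.take 4
    decide +kernel
  surjS := by
    change ∀ p ∈ listQ'.take 4, ∃ s, jFun s = p
    decide +kernel
  emb a b h := by
    have h' : ∀ a b, jFun a ≤ jFun b → a ≤ b := by decide +kernel
    exact ⟨homOfLE (h' a b h)⟩

/-- Exact diagrams on `QC` are determined by their restriction to `V`. -/
theorem good_Q_of_V (hs : D.IsStableKan) (hK : D.HasKan) :
    Good (D.ExK ((ExData.ofList sqQ' zeroQ).pull Subtype.val))
      (D.restr (incl V_sub_Q₁ ⋙ incl Q₁_sub_QC))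
      (ran hK (incl V_sub_Q₁) ≫ lan hK (incl Q₁_sub_QC)) :=
  hs.good_lan_step hK (hs.good_ran hK ((listed_incl V_sub_Q₁ mem_V_iff fun _ => Iff.rfl).rCrit
      (sqs := sqQ') (zs := zeroQ) (by decide +kernel))
    (exAt_of_disjoint (l := listV) (fun s => (mem_V_iff _).1 s.2) (by decide +kernel)
      (by decide +kernel)))
    ((listed_incl Q₁_sub_QC (fun _ => Iff.rfl) fun _ => Iff.rfl).lCrit (by decide +kernel)) rfl

/-- Exact diagrams on `QC` are determined by their restriction along `j`. -/
theorem good_Q_of_Sq (hs : D.IsStableKan) (hK : D.HasKan) :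
    Good (D.ExK ((ExData.ofList sqQ zeroQ).pull Subtype.val))
      (D.restr (jQ₂ ⋙ incl Q₂_sub_QC)) (lan hK jQ₂ ≫ ran hK (incl Q₂_sub_QC)) :=
  hs.good_ran_step hK (hs.good_lan hK (listed_jQ₂.lCrit
      (sqs := sqQ) (zs := zeroQ) (by decide +kernel))
    (exAt_of_disjoint (l := listQ'.take 4) listed_jQ₂.memS (by decide +kernel)
      (by decide +kernel)))
    ((listed_incl Q₂_sub_QC (fun _ => Iff.rfl) mem_QC_iff).rCrit (by decide +kernel)) rfl

end Aux

end

end Der.Prederivator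

namespace Der.Prederivator

noncomputable section

section Compare

variable {D : Prederivator.{v, u}}

/-- A zero value of an exact diagram on `C`. -/
theorem zeroC {Y : D.val ↥C} (h : D.ExAt exC Y) (c : Fin 3 → ℤ) (hc : c ∈ C := by decide +kernel)
    (hl : c ∈ links := by decide +kernel) : Limits.IsZero ((D.evalAt (⟨c, hc⟩ : ↥C)).obj Y) :=
  h.zero ⟨c, hc⟩ hl

/-- A zero value of an exact diagram on a part of `E` or its enlargement. -/
theorem zeroE' {T : Set (Fin 4 → ℤ)} {Y : D.val ↥T} (h : D.ExAt (exE.pull Subtype.val) Y)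
    (c : Fin 4 → ℤ) (hc : c ∈ T := by decide +kernel) (hl : c ∈ zeroE := by decide +kernel) :
    Limits.IsZero ((D.evalAt (⟨c, hc⟩ : ↥T)).obj Y) :=
  h.zero ⟨c, hc⟩ hl

theorem exAt_QC_of_C {Y : D.val ↥C} (h : D.ExAt exC Y) :
    D.ExAt ((ExData.ofList sqQ' zeroQ).pull Subtype.val) ((D.res (incl QC_sub_C)).obj Y) where
  sq a b c d hs := by
    have h' : ∀ q ∈ sqQ', exZ.sq q.1 q.2.1 q.2.2.1 q.2.2.2 := by decide +kernel
    exact (h.sq ((incl QC_sub_C).obj a) ((incl QC_sub_C).obj b) ((incl QC_sub_C).obj c)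
      ((incl QC_sub_C).obj d) (h' _ hs)).res_of_le rfl rfl rfl rfl (le_of_exZ (h' _ hs))
  zero t ht := by
    have h' : ∀ q ∈ zeroQ, q ∈ links := by decide +kernel
    exact (isZero_evalAt_res _ _).2 (h.zero _ (h' _ ht))

/-- The face of the unit cube which is missing in `sqQ` is bicartesian. -/
theorem exAt_QC {Y : D.val ↥QC} (hs : D.IsStableKan)
    (h : D.ExAt ((ExData.ofList sqQ zeroQ).pull Subtype.val) Y) :
    D.ExAt ((ExData.ofList sqQ' zeroQ).pull Subtype.val) Y := by
  refine ⟨fun a b c d h' => ?_, h.zero⟩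
  obtain h' | h' := List.mem_cons.1 h'
  · have sq : ∀ (x y z w : Fin 3 → ℤ) (hx : x ∈ listQ) (hy : y ∈ listQ) (hz : z ∈ listQ)
        (hw : w ∈ listQ), (x, y, z, w) ∈ sqQ →
        D.CoSq Y (⟨x, hx⟩ : ↥QC) ⟨y, hy⟩ ⟨z, hz⟩ ⟨w, hw⟩ := fun x y z w _ _ _ _ h' =>
      h.sq _ _ _ _ h'
    have h1 := sq ![0, 0, 0] ![0, 1, 0] ![0, 0, 1] ![0, 1, 1] (by decide +kernel)
      (by decide +kernel) (by decide +kernel) (by decide +kernel) (by decide +kernel)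
    have h2 := sq ![0, 1, 0] ![1, 1, 0] ![0, 1, 1] ![1, 1, 1] (by decide +kernel)
      (by decide +kernel) (by decide +kernel) (by decide +kernel) (by decide +kernel)
    have h3 := sq ![1, 0, 0] ![1, 1, 0] ![1, 0, 1] ![1, 1, 1] (by decide +kernel)
      (by decide +kernel) (by decide +kernel) (by decide +kernel) (by decide +kernel)
    have h4 := h3.cancel' hs.kan hs.zero hs.stable (h1.paste hs.kan hs.zero h2)
      (le_iff_fin.2 (by decide)) (le_iff_fin.2 (by decide))
    rw [show stepSq (![0, 0, 0], (0 : Fin 3), (2 : Fin 3)) =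
      (![0, 0, 0], ![1, 0, 0], ![0, 0, 1], ![1, 0, 1]) by decide +kernel] at h'
    simp only [Prod.mk.injEq] at h'
    obtain ⟨ha, hb, hc, hd⟩ := h'
    rw [Subtype.ext (a1 := a) (a2 := ⟨![0, 0, 0], show _ ∈ listQ by decide +kernel⟩) ha,
      Subtype.ext (a1 := b) (a2 := ⟨![1, 0, 0], show _ ∈ listQ by decide +kernel⟩) hb,
      Subtype.ext (a1 := c) (a2 := ⟨![0, 0, 1], show _ ∈ listQ by decide +kernel⟩) hc,
      Subtype.ext (a1 := d) (a2 := ⟨![1, 0, 1], show _ ∈ listQ by decide +kernel⟩) hd]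
    exact h4
  · exact h.sq _ _ _ _ h'

theorem good_Q_of_Sq' (hs : D.IsStableKan) (hK : D.HasKan) :
    Good (D.ExK ((ExData.ofList sqQ' zeroQ).pull Subtype.val))
      (D.restr (jQ₂ ⋙ incl Q₂_sub_QC)) (lan hK jQ₂ ≫ ran hK (incl Q₂_sub_QC)) where
  sec := (good_Q_of_Sq hs hK).sec
  mem K X a := exAt_QC hs ((good_Q_of_Sq hs hK).mem K X a)
  uniq M hM := (good_Q_of_Sq hs hK).uniq M fun K X a =>
    ⟨fun x y z w h => (hM K X a).sq x y z w (List.mem_cons_of_mem _ h), (hM K X a).zero⟩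

/-- If exact diagrams of two shapes correspond to each other by restriction to a common subshape,
then another subshape of the second shape which determines its exact diagrams also determines the
exact diagrams of the first shape. -/
theorem Good.change {P Q F F' : Prederivator.{v, u}} {p : ∀ K, P.obj K → Prop}
    {q : ∀ K, Q.obj K → Prop} {ρ : P ⟶ F} {L : F ⟶ P} (h : Good p ρ L) {ρ' : Q ⟶ F} {L' : F ⟶ Q}
    (h' : Good q ρ' L') {ρ'' : Q ⟶ F'} {L'' : F' ⟶ Q} (h'' : Good q ρ'' L'') {φ : P ⟶ Q}
    (hφ : cls φ ≫ cls ρ' = cls ρ) (hm : ∀ K X, p K X → q K ((fn φ K).obj X)) :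
    Good p (φ ≫ ρ'') (L'' ≫ ρ' ≫ L) where
  sec := by
    have h1 := h.comp_eq h' hφ hm
    have h2 := h'.uniq L'' h''.mem
    rw [cls_comp, cls_comp, cls_comp, Category.assoc, Category.assoc, ← Category.assoc (cls L), h1,
      ← Category.assoc (cls ρ'), ← Category.assoc, h2, h''.sec]
  mem K X := h.mem K _
  uniq M hM := by
    have h1 := h''.uniq (M ≫ φ) fun K X => hm K _ (hM K X)
    simp only [cls_comp, Category.assoc] at h1 ⊢
    have h2 := congrArg (· ≫ cls ρ' ≫ cls L) h1
    simp only [Category.assoc] at h2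
    rw [h2, ← Category.assoc (cls φ), hφ, h.uniq M hM]

/-- The extension of squares to exact diagrams on `C`. -/
def lSq (hK : D.HasKan) : D.shift Sq ⟶ D.shift ↥C :=
  (lan hK jQ₂ ≫ ran hK (incl Q₂_sub_QC)) ≫ D.restr (incl V_sub_Q₁ ⋙ incl Q₁_sub_QC) ≫ lC hK

theorem cls_restr_QC_V : cls (D.restr (incl QC_sub_C)) ≫
    cls (D.restr (incl V_sub_Q₁ ⋙ incl Q₁_sub_QC)) = cls (D.restr iV) :=
  (cls_restr_comp D _ _).trans (cls_restr_congr D (thinIso fun _ => rfl))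

/-- Exact diagrams on `C` are determined by their restriction along `j`, which is arbitrary, since
exact diagrams on `QC` are determined both by their restriction to `V` and by that along `j`. -/
theorem good_lSq (hs : D.IsStableKan) (hK : D.HasKan) :
    Good (D.ExK exC) (D.restr jSq) (lSq hK) :=
  ((good_lC hs hK).change (good_Q_of_V hs hK) (good_Q_of_Sq' hs hK) cls_restr_QC_V
    (exK_restr fun _ => exAt_QC_of_C)).cls_congr exK_iso
    ((cls_comp _ _).trans ((cls_restr_comp D _ _).trans (cls_restr_congr D (thinIso fun _ => rfl))))
    rfl

theorem cexRestr_jSq_isEquiv (hs : D.IsStableKan) (hK : D.HasKan) : IsEquiv (cexRestr D jSq) := by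
  rw [isEquiv_iff, cexRestr, cls_comp]
  exact (good_lSq hs hK).isIso_sub (exProp D) (exProp_iff hs.stable)

end Compare

/-! ### A poset comparing `C` and `E` -/

section Om

/-- A partially ordered set with 18 elements and functors to `C` and to the enlarged poset `E`
which agree on `V`. -/
def Om : Type := Fin 18

instance : DecidableEq Om := inferInstanceAs (DecidableEq (Fin 18))

instance : Fintype Om := inferInstanceAs (Fintype (Fin 18))

/-- The elements which lie below a given one. -/
def Om.below (y : Om) : List Om :=
  (![[0], [0, 1], [0, 2, 16], [0, 3], [0, 4], [0, 1, 4, 5], [0, 3, 4, 6], [0, 1, 2, 7, 9, 16],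
    [0, 2, 3, 8, 14, 16], [9, 16], [9, 10, 15, 16], [0, 2, 4, 11, 15, 16],
    [0, 1, 2, 4, 5, 7, 9, 10, 11, 12, 15, 16], [0, 2, 3, 4, 6, 8, 11, 13, 14, 15, 16, 17],
    [14, 16], [15, 16], [16], [14, 15, 16, 17]] : Fin 18 → List (Fin 18)) y

/-- The order of `Om`. -/
def Om.le (x y : Om) : Prop := x ∈ y.below

instance : DecidableRel Om.le := fun x y => inferInstanceAs (Decidable (x ∈ y.below))

theorem Om.le_refl : ∀ x, Om.le x x := by decide +kernel

theorem Om.le_trans : ∀ x y z, Om.le x y → Om.le y z → Om.le x z := by decide +kernel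

instance : Preorder Om where
  le := Om.le
  le_refl := Om.le_refl
  le_trans := Om.le_trans

instance : DecidableLE Om := inferInstanceAs (DecidableRel Om.le)

/-- The elements of `Om`. -/
def Om.mk (x : Fin 18) : Om := x

/-- The values of the functor from `Om` to `C`. -/
def Om.ptC (x : Om) : Fin 3 → ℤ :=
  (![![0, 0, 0], ![1, 0, 0], ![0, 1, 0], ![0, 0, 1], ![1, 0, 2], ![1, 0, 2], ![1, 0, 2],
    ![2, 1, 0], ![0, 2, 1], ![2, 1, 0], ![2, 1, 0], ![1, 1, 2], ![2, 1, 2], ![1, 2, 2],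
    ![0, 2, 1], ![1, 1, 0], ![0, 1, 0], ![1, 2, 1]] : Fin 18 → Fin 3 → ℤ) x

/-- The values of the functor from `Om` to the enlarged poset `E`. -/
def Om.ptE (x : Om) : Fin 4 → ℤ :=
  (![![-1, -1, -1, 0], ![1, 1, 0, 0], ![0, 1, 1, 0], ![1, 0, 1, 0], ![-1, -1, -1, 1],
    ![2, 1, 0, 1], ![1, 0, 2, 1], ![1, 1, 1, 0], ![1, 1, 1, 0], ![1, -2, -2, 0], ![2, 1, 0, 1],
    ![0, 1, 1, 1], ![2, 1, 1, 1], ![1, 1, 2, 1], ![1, -2, -2, 0], ![0, 1, 0, 1],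
    ![0, -2, -2, 0], ![1, 1, 0, 1]] : Fin 18 → Fin 4 → ℤ) x

/-- The squares of `Om` which are to be cocartesian. The last one is degenerate; it forces the value
at `14` to be zero. -/
def sqOm : List (Om × Om × Om × Om) :=
  [(.mk 0, .mk 2, .mk 4, .mk 11), (.mk 1, .mk 7, .mk 5, .mk 12), (.mk 3, .mk 8, .mk 6, .mk 13),
    (.mk 15, .mk 11, .mk 10, .mk 12), (.mk 16, .mk 2, .mk 9, .mk 7),
      (.mk 16, .mk 15, .mk 14, .mk 17),
    (.mk 14, .mk 8, .mk 8, .mk 8)]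

/-- The elements of `Om` at which the values are to be zero. -/
def zeroOm : List Om := [.mk 4, .mk 5, .mk 6, .mk 7, .mk 8, .mk 9, .mk 10]

/-- The first `n` elements. -/
def listOm (n : ℕ) : List Om := (List.finRange 18).take n

/-- The subposet of the first `n` elements. -/
def OmSub (n : ℕ) : Set Om := {x | x ∈ listOm n}

/-- The inclusion of the first `m` elements into the first `n` elements. -/
def inclOm (m n : ℕ) (h : m ≤ n) : ↥(OmSub m) ⥤ ↥(OmSub n) :=
  mono (fun x => ⟨x.1, List.take_subset_take_left _ h x.2⟩) fun _ _ h => h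

theorem listed_inclOm (m n : ℕ) (h : m ≤ n) :
    Listed (inclOm m n h) Subtype.val (listOm m) (listOm n) where
  le _ _ h := h
  mono _ _ h := h
  inj _ _ h := Subtype.ext h
  mem t := t.2
  surj p hp := ⟨⟨p, hp⟩, rfl⟩
  memS s := s.2
  surjS p hp := ⟨⟨p, hp⟩, rfl⟩
  emb _ _ h := ⟨homOfLE h⟩

/-- The points of `V` as elements of `Om`. -/
def vOmFun (c : Fin 3 → ℤ) : Om :=
  if c = ![0, 0, 0] then .mk 0 else if c = ![1, 0, 0] then .mk 1 else
    if c = ![0, 1, 0] then .mk 2 else .mk 3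

/-- The functor from `V` to the first nine elements. -/
def vOm : ↥V ⥤ ↥(OmSub 9) := mono (fun c => ⟨vOmFun c.1, by
    have h : ∀ c ∈ listV, vOmFun c ∈ listOm 9 := by decide +kernel
    exact h _ ((mem_V_iff _).1 c.2)⟩) fun a b hab => by
  have h : ∀ c ∈ listV, ∀ d ∈ listV, c ≤ d → vOmFun c ≤ vOmFun d := by decide +kernel
  exact h _ ((mem_V_iff _).1 a.2) _ ((mem_V_iff _).1 b.2) hab

theorem listed_vOm : Listed vOm Subtype.val (listOm 4) (listOm 9) where
  le _ _ h := h
  mono _ _ h := h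
  inj _ _ h := Subtype.ext h
  mem t := t.2
  surj p hp := ⟨⟨p, hp⟩, rfl⟩
  memS s := by
    have h : ∀ c ∈ listV, vOmFun c ∈ listOm 4 := by decide +kernel
    exact h _ ((mem_V_iff _).1 s.2)
  surjS p hp := by
    have h : ∀ p ∈ listOm 4, ∃ c ∈ listV, vOmFun c = p := by decide +kernel
    obtain ⟨c, hc, h⟩ := h p hp
    exact ⟨⟨c, (mem_V_iff _).2 hc⟩, h⟩
  emb a b hab := by
    have h : ∀ c ∈ listV, ∀ d ∈ listV, vOmFun c ≤ vOmFun d → c ≤ d := by decide +kernel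
    exact ⟨homOfLE (h _ ((mem_V_iff _).1 a.2) _ ((mem_V_iff _).1 b.2) hab)⟩

variable {D : Prederivator.{v, u}}

/-- The embedding of `V` into `Om`. -/
def iOm : ↥V ⥤ ↥(OmSub 18) :=
  ((vOm ⋙ inclOm 9 14 (by decide)) ⋙ inclOm 14 17 (by decide)) ⋙ inclOm 17 18 (by decide)

theorem sqOm_disjoint : ∀ q ∈ sqOm, ¬ (q.1 ∈ listOm 4 ∧ q.2.1 ∈ listOm 4 ∧
    q.2.2.1 ∈ listOm 4 ∧ q.2.2.2 ∈ listOm 4) := by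
  have h : ∀ q ∈ sqOm.map fun q => q.2.2.1, q ∉ listOm 4 := by decide +kernel
  exact fun q hq hq' => h _ (List.mem_map_of_mem hq) hq'.2.2.1

theorem zeroOm_disjoint : ∀ z ∈ zeroOm, z ∉ listOm 4 := by
  rw [show listOm 4 = [.mk 0, .mk 1, .mk 2, .mk 3] from rfl]
  decide

/-- Exact diagrams on `Om` are determined by their restriction to `V`. -/
theorem good_Om (hs : D.IsStableKan) (hK : D.HasKan) :
    Good (D.ExK ((ExData.ofList sqOm zeroOm).pull Subtype.val)) (D.restr iOm)
      (((ran hK vOm ≫ lan hK (inclOm 9 14 (by decide))) ≫ ran hK (inclOm 14 17 (by decide))) ≫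
        lan hK (inclOm 17 18 (by decide))) :=
  hs.good_lan_step hK (hs.good_ran_step hK (hs.good_lan_step hK (hs.good_ran hK
      (listed_vOm.rCrit (sqs := sqOm) (zs := zeroOm) (by decide +kernel))
      (exAt_of_disjoint (f := fun s => (vOm.obj s).1) listed_vOm.memS sqOm_disjoint
        zeroOm_disjoint))
      ((listed_inclOm 9 14 (by decide)).lCrit (by decide +kernel)) rfl)
    ((listed_inclOm 14 17 (by decide)).rCrit (by decide +kernel)) rfl)
    ((listed_inclOm 17 18 (by decide)).lCrit (by decide +kernel)) rfl

theorem Om.ptC_mem : ∀ x : Om, x.ptC ∈ C := by decide +kernel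

theorem Om.ptC_mono : ∀ x y : Om, x ≤ y → x.ptC ≤ y.ptC := by decide +kernel

theorem Om.ptE_mem : ∀ x : Om, x.ptE ∈ listE₈ := by decide +kernel

theorem Om.ptE_mono : ∀ x y : Om, x ≤ y → x.ptE ≤ y.ptE := by decide +kernel

/-- The functor from `Om` to `C`. -/
def omC : ↥(OmSub 18) ⥤ ↥C := mono (fun x => ⟨x.1.ptC, x.1.ptC_mem⟩) fun _ _ h => Om.ptC_mono _ _ h

/-- The functor from `Om` to the enlargement of `E`. -/
def omE : ↥(OmSub 18) ⥤ ↥E₈ := mono (fun x => ⟨x.1.ptE, x.1.ptE_mem⟩) fun _ _ h => Om.ptE_mono _ _ h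

end Om

end

end Der.Prederivator

namespace Der.Prederivator

noncomputable section

section OmExact

variable {D : Prederivator.{v, u}}

theorem mem_listOm : ∀ n : Fin 18, Om.mk n ∈ listOm 18 := by decide +kernel

/-- The elements of `Om`, as elements of the full subposet. -/
def omPt (n : Fin 18) : ↥(OmSub 18) := ⟨.mk n, mem_listOm n⟩

theorem exAt_res_Om {T : Type} [Preorder T] {F : ↥(OmSub 18) ⥤ T} {Y : D.val T}
    (h0 : D.CoSq Y (F.obj (omPt 0)) (F.obj (omPt 2)) (F.obj (omPt 4)) (F.obj (omPt 11)))
    (h1 : D.CoSq Y (F.obj (omPt 1)) (F.obj (omPt 7)) (F.obj (omPt 5)) (F.obj (omPt 12)))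
    (h2 : D.CoSq Y (F.obj (omPt 3)) (F.obj (omPt 8)) (F.obj (omPt 6)) (F.obj (omPt 13)))
    (h3 : D.CoSq Y (F.obj (omPt 15)) (F.obj (omPt 11)) (F.obj (omPt 10)) (F.obj (omPt 12)))
    (h4 : D.CoSq Y (F.obj (omPt 16)) (F.obj (omPt 2)) (F.obj (omPt 9)) (F.obj (omPt 7)))
    (h5 : D.CoSq Y (F.obj (omPt 16)) (F.obj (omPt 15)) (F.obj (omPt 14)) (F.obj (omPt 17)))
    (h6 : D.CoSq Y (F.obj (omPt 14)) (F.obj (omPt 8)) (F.obj (omPt 8)) (F.obj (omPt 8)))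
    (hz : ∀ n ∈ [4, 5, 6, 7, 8, 9, 10], Limits.IsZero ((D.evalAt (F.obj (omPt n))).obj Y)) :
    D.ExAt ((ExData.ofList sqOm zeroOm).pull Subtype.val) ((D.res F).obj Y) := by
  refine exAt_res_ofList (fun a b => Subtype.ext) ?_ ?_
  · rw [sqOm]
    simp only [List.forall_mem_cons]
    exact ⟨⟨omPt 0, omPt 2, omPt 4, omPt 11, rfl, by decide +kernel, h0⟩,
      ⟨omPt 1, omPt 7, omPt 5, omPt 12, rfl, by decide +kernel, h1⟩,
      ⟨omPt 3, omPt 8, omPt 6, omPt 13, rfl, by decide +kernel, h2⟩,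
      ⟨omPt 15, omPt 11, omPt 10, omPt 12, rfl, by decide +kernel, h3⟩,
      ⟨omPt 16, omPt 2, omPt 9, omPt 7, rfl, by decide +kernel, h4⟩,
      ⟨omPt 16, omPt 15, omPt 14, omPt 17, rfl, by decide +kernel, h5⟩,
      ⟨omPt 14, omPt 8, omPt 8, omPt 8, rfl, by decide +kernel, h6⟩, fun _ h =>
        absurd h List.not_mem_nil⟩
  · intro z h
    exact ⟨omPt z, rfl, hz z h⟩

/-- Exact diagrams on `C` restrict to exact diagrams on `Om`: the squares of `Om` are composites of
small squares. -/
theorem exAt_Om_of_C (hs : D.IsStableKan) {Y : D.val ↥C} (h : D.ExAt exC Y) :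
    D.ExAt ((ExData.ofList sqOm zeroOm).pull Subtype.val) ((D.res omC).obj Y) := by
  refine exAt_res_Om ?_ ?_ ?_ ?_ ?_ ?_ ?_ ?_
  · exact (((coSqC h ![0, 0, 0] ![0, 0, 1] ![0, 1, 0] ![0, 1, 1]).paste hs.kan hs.zero
        (coSqC h ![0, 0, 1] ![1, 0, 1] ![0, 1, 1] ![1, 1, 1])).paste hs.kan hs.zero
        (coSqC h ![1, 0, 1] ![1, 0, 2] ![1, 1, 1] ![1, 1, 2])).symm hs.kan
  · exact ((((coSqC h ![1, 0, 0] ![1, 1, 0] ![1, 0, 1] ![1, 1, 1]).paste hs.kan hs.zero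
        (coSqC h ![1, 1, 0] ![2, 1, 0] ![1, 1, 1] ![2, 1, 1])).symm hs.kan).paste hs.kan hs.zero
        (((coSqC h ![1, 0, 1] ![1, 1, 1] ![1, 0, 2] ![1, 1, 2]).paste hs.kan hs.zero
        (coSqC h ![1, 1, 1] ![2, 1, 1] ![1, 1, 2] ![2, 1, 2])).symm hs.kan)).symm hs.kan
  · exact ((((coSqC h ![0, 0, 1] ![0, 1, 1] ![1, 0, 1] ![1, 1, 1]).paste hs.kan hs.zero
        (coSqC h ![0, 1, 1] ![0, 2, 1] ![1, 1, 1] ![1, 2, 1])).symm hs.kan).paste hs.kan hs.zero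
        (((coSqC h ![1, 0, 1] ![1, 1, 1] ![1, 0, 2] ![1, 1, 2]).paste hs.kan hs.zero
        (coSqC h ![1, 1, 1] ![1, 2, 1] ![1, 1, 2] ![1, 2, 2])).symm hs.kan)).symm hs.kan
  · exact (coSqC h ![1, 1, 0] ![1, 1, 1] ![2, 1, 0] ![2, 1, 1]).paste hs.kan hs.zero
        (coSqC h ![1, 1, 1] ![1, 1, 2] ![2, 1, 1] ![2, 1, 2])
  · exact hs.kan.coSq_refl (le_iff_fin.2 (by decide +kernel))
  · exact ((((coSqC h ![0, 1, 0] ![0, 1, 1] ![1, 1, 0] ![1, 1, 1]).paste hs.kan hs.zero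
        (coSqC h ![0, 1, 1] ![0, 2, 1] ![1, 1, 1] ![1, 2, 1])).symm hs.kan))
  · exact hs.kan.coSq_refl (le_refl _)
  · simp only [List.forall_mem_cons]
    exact ⟨zeroC h ![1, 0, 2], zeroC h ![1, 0, 2],
      zeroC h ![1, 0, 2], zeroC h ![2, 1, 0],
      zeroC h ![0, 2, 1], zeroC h ![2, 1, 0],
      zeroC h ![2, 1, 0], fun _ h => absurd h List.not_mem_nil⟩

instance (e : Fin 4 → ℤ) : Decidable (e ∈ E₈) := inferInstanceAs (Decidable (e ∈ listE₈))

/-- Exact diagrams on the enlargement of `E` restrict to exact diagrams on `Om`. -/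
theorem exAt_Om_of_E (hs : D.IsStableKan) {Y : D.val ↥E₈} (h : D.ExAt (exE.pull Subtype.val) Y) :
    D.ExAt ((ExData.ofList sqOm zeroOm).pull Subtype.val) ((D.res omE).obj Y) := by
  have ha := coSqE h ![0, 0, 0, 0] ![0, 1, 0, 0] ![0, 0, 0, 1] ![0, 1, 0, 1]
  have hb := coSqE h ![0, 0, 0, 0] ![1, 0, 0, 0] ![0, 1, 0, 0] ![1, 1, 0, 0]
  have hc := coSqE h ![0, 1, 0, 0] ![1, 1, 0, 0] ![0, 1, 0, 1] ![1, 1, 0, 1]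
  have hd := coSqE h ![0, 1, 0, 0] ![0, 1, 1, 0] ![0, 1, 0, 1] ![0, 1, 1, 1]
  have he := coSqE h ![0, 1, 0, 0] ![1, 1, 0, 0] ![0, 1, 1, 0] ![1, 1, 1, 0]
  have hf := coSqE h ![0, 1, 1, 0] ![1, 1, 1, 0] ![0, 1, 1, 1] ![1, 1, 1, 1]
  have hz := coSqE h ![0, -2, -2, 0] ![0, 0, 0, 0] ![1, -2, -2, 0] ![1, 0, 0, 0]
  refine exAt_res_Om ?_ ?_ ?_ ?_ ?_ ?_ ?_ ?_
  · exact ((coSqE h ![-1, -1, -1, 0] ![0, 0, 0, 0] ![-1, -1, -1, 1] ![0, 0, 0, 1]).paste hs.kan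
        hs.zero ha).paste hs.kan hs.zero hd
  · exact (((coSqE h ![1, 1, 0, 0] ![1, 1, 1, 0] ![1, 1, 0, 1] ![1, 1, 1, 1]).symm hs.kan).paste
        hs.kan hs.zero
        ((coSqE h ![1, 1, 0, 1] ![1, 1, 1, 1] ![2, 1, 0, 1] ![2, 1, 1, 1]).symm hs.kan)).symm hs.kan
  · exact (((coSqE h ![1, 0, 1, 0] ![1, 1, 1, 0] ![1, 0, 1, 1] ![1, 1, 1, 1]).symm hs.kan).paste
        hs.kan hs.zero ((coSqE h ![1, 0, 1, 1] ![1, 1, 1, 1] ![1, 0, 2, 1] ![1, 1, 2, 1]).symm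
          hs.kan)).symm hs.kan
  · exact (((he.opposite hs hc hf (by decide +kernel) (by decide +kernel)).paste hs.kan hs.zero
        ((coSqE h ![1, 1, 0, 1] ![1, 1, 1, 1] ![2, 1, 0, 1] ![2, 1, 1,
          1]).symm hs.kan)).symm hs.kan)
  · exact hz.paste hs.kan hs.zero ((hb.symm hs.kan).paste hs.kan hs.zero (he.symm hs.kan))
  · exact hz.paste hs.kan hs.zero ((hb.symm hs.kan).paste hs.kan hs.zero (hc.symm hs.kan))
  · exact hs.coSq_zero (by decide +kernel) (zeroE' h ![1, -2, -2, 0]) (zeroE' h ![1, 1, 1, 0])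
        (zeroE' h ![1, 1, 1, 0]) (zeroE' h ![1, 1, 1, 0])
  · simp only [List.forall_mem_cons]
    exact ⟨zeroE' h ![-1, -1, -1, 1], zeroE' h ![2, 1, 0, 1],
      zeroE' h ![1, 0, 2, 1], zeroE' h ![1, 1, 1, 0],
      zeroE' h ![1, 1, 1, 0], zeroE' h ![1, -2, -2, 0],
      zeroE' h ![2, 1, 0, 1], fun _ h => absurd h List.not_mem_nil⟩

/-- The point of `E` over a point of `ℤ³` in the layer with last coordinate `0`. -/
def upE (c : Fin 3 → ℤ) : Fin 4 → ℤ := ![c 0, c 1, c 2, 0]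

/-- The point of `E` over a point of `ℤ³` in the layer with last coordinate `1`. -/
def lowE (c : Fin 3 → ℤ) : Fin 4 → ℤ := ![c 0, c 1, c 2, 1]

theorem lowE_mem : ∀ c ∈ listQ, lowE c ∈ E₆ := by decide +kernel

theorem lowE_mono : ∀ c ∈ listQ, ∀ d ∈ listQ, c ≤ d → lowE c ≤ lowE d := by decide +kernel

/-- The embedding of `QC` into the layer of `E` with last coordinate `1`. -/
def qE : ↥QC ⥤ ↥E₆ :=
  mono (fun c => ⟨lowE c.1, lowE_mem _ c.2⟩) fun a b => lowE_mono _ a.2 _ b.2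

set_option synthInstance.maxSize 1000 in
set_option synthInstance.maxHeartbeats 200000 in
/-- The layer of `E` with last coordinate `1` restricts to an exact diagram on `QC`. The faces of
the cube are bicartesian as they are opposite to faces in the layer `0`. -/
theorem exAt_QC_of_E (hs : D.IsStableKan) {Y : D.val ↥E₆} (h : D.ExAt (exE.pull Subtype.val) Y) :
    D.ExAt ((ExData.ofList sqQ' zeroQ).pull Subtype.val) ((D.res qE).obj Y) where
  sq a b c d hq := by
    have key : ∀ q ∈ sqQ', (q.1 ≤ q.2.1 ∧ q.1 ≤ q.2.2.1 ∧ q.2.2.1 ≤ q.2.2.2 ∧ q.2.1 ≤ q.2.2.2) ∧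
        ((lowE q.1, lowE q.2.1, lowE q.2.2.1, lowE q.2.2.2) ∈ sqE ∨
        (upE q.1 ∈ E₆ ∧ upE q.2.1 ∈ E₆ ∧ upE q.2.2.1 ∈ E₆ ∧ upE q.2.2.2 ∈ E₆) ∧
        (upE q.1, upE q.2.1, upE q.2.2.1, upE q.2.2.2) ∈ sqE ∧
        (upE q.1, upE q.2.1, lowE q.1, lowE q.2.1) ∈ sqE ∧
        (upE q.2.2.1, upE q.2.2.2, lowE q.2.2.1, lowE q.2.2.2) ∈ sqE) := by decide +kernel
    obtain ⟨ho, h1 | ⟨⟨ha, hb, hc, hd⟩, h1, h2, h3⟩⟩ := key _ hq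
    · exact (h.sq (qE.obj a) (qE.obj b) (qE.obj c) (qE.obj d) h1).res_of_le rfl rfl rfl rfl ho
    · exact CoSq.res_of_le (F := qE) ((h.sq ⟨_, ha⟩ ⟨_, hb⟩ ⟨_, hc⟩ ⟨_, hd⟩ h1).opposite hs
        (h.sq _ _ (qE.obj a) (qE.obj b) h2) (h.sq _ _ (qE.obj c) (qE.obj d) h3)
        (qE.map (homOfLE ho.2.1)).le (qE.map (homOfLE ho.2.2.2)).le) rfl rfl rfl rfl ho
  zero t ht := by
    have h' : ∀ q ∈ zeroQ, lowE q ∈ zeroE := by decide +kernel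
    exact (isZero_evalAt_res _ _).2 (h.zero _ (h' _ ht))

end OmExact

end

end Der.Prederivator

namespace Der.Prederivator

noncomputable section

/-! ### The endomorphism `T` on exact diagrams -/

section BigT

variable {D : Prederivator.{v, u}}

theorem exK_subι (hs : D.IsStableKan) (K) (X : (cex D).obj K) :
    D.ExK exC K ((fn (subι (exProp D)) K).obj X) :=
  (exProp_iff hs.stable K X.1).1 X.2

theorem cls_subι_iV (hs : D.IsStableKan) (hK : D.HasKan) :
    cls (subι (exProp D)) ≫ cls (D.restr iV) ≫ cls (lC hK) = cls (subι (exProp D)) :=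
  (good_lC hs hK).uniq _ (exK_subι hs)

/-- The inverse of `i^*` is the iterated Kan extension `lC`. -/
theorem cls_inv_subι (hs : D.IsStableKan) (hK : D.HasKan) (hi : IsEquiv (cexRestr D iV)) :
    cls hi.inv ≫ cls (subι (exProp D)) = cls (lC hK) := by
  have := isEquiv_iff.1 hi
  rw [cls_inv hi, IsIso.inv_comp_eq, cexRestr, cls_comp, Category.assoc, cls_subι_iV hs hK]

theorem cls_lC_QC (hs : D.IsStableKan) (hK : D.HasKan) :
    cls (lC hK) ≫ cls (D.restr (incl QC_sub_C)) =
      cls (ran hK (incl V_sub_Q₁) ≫ lan hK (incl Q₁_sub_QC)) :=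
  (good_lC hs hK).comp_eq (good_Q_of_V hs hK) cls_restr_QC_V (exK_restr fun _ => exAt_QC_of_C)

theorem cls_bigH_QC (hs : D.IsStableKan) (hK : D.HasKan) :
    cls (bigH hK) ≫ cls (D.restr wE) ≫ cls (ran hK (incl V_sub_Q₁) ≫ lan hK (incl Q₁_sub_QC)) =
      cls (bigH hK) ≫ cls (D.restr qE) := by
  have h := (good_Q_of_V hs hK).uniq (bigH hK ≫ D.restr qE) fun K X =>
    exK_restr (fun _ => exAt_QC_of_E hs) K _ ((good_bigH hs hK).mem K X)
  have h' : cls (D.restr qE) ≫ cls (D.restr (incl V_sub_Q₁ ⋙ incl Q₁_sub_QC)) = cls (D.restr wE) :=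
    (cls_restr_comp D _ _).trans (cls_restr_congr D (thinIso fun _ => rfl))
  rw [← h', Category.assoc]
  exact (Category.assoc _ _ _).symm.trans h

/-- The values of `T` on the part `QC` of `C`. -/
theorem cls_bigT_QC (hs : D.IsStableKan) (hK : D.HasKan) (hi : IsEquiv (cexRestr D iV)) :
    cls (bigT hK hi) ≫ cls (cexRestr D (incl QC_sub_C)) =
      cls (cexRestr D iV) ≫ cls (bigH hK) ≫ cls (D.restr qE) := by
  rw [← cls_bigH_QC hs hK, ← cls_lC_QC hs hK, ← cls_inv_subι hs hK hi]
  simp only [bigT, bigT', cexRestr, cls_comp, Category.assoc]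

/-- The functor from the square to `Om` which describes the image of `j` under `T`. -/
def sqToOm : Sq ⥤ ↥(OmSub 18) :=
  mono (fun s => ⟨if s = Sq.mk 0 0 then .mk 15 else if s = Sq.mk 0 1 then .mk 11 else
    if s = Sq.mk 1 0 then .mk 17 else .mk 13, mem_listOm _⟩) (by
      have h : ∀ a b : Sq, a ≤ b →
        (if a = Sq.mk 0 0 then Om.mk 15 else if a = Sq.mk 0 1 then .mk 11 else
          if a = Sq.mk 1 0 then .mk 17 else .mk 13) ≤
        (if b = Sq.mk 0 0 then Om.mk 15 else if b = Sq.mk 0 1 then .mk 11 else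
          if b = Sq.mk 1 0 then .mk 17 else .mk 13) := by decide +kernel
      exact h)

/-- The exact extension to `C` of a diagram on `V` restricts to its exact extension to `Om`. -/
theorem cls_lOm_C (hs : D.IsStableKan) (hK : D.HasKan) :
    cls (lC hK) ≫ cls (D.restr omC) = cls (((ran hK vOm ≫ lan hK (inclOm 9 14 (by decide))) ≫
      ran hK (inclOm 14 17 (by decide))) ≫ lan hK (inclOm 17 18 (by decide))) := by
  refine (good_lC hs hK).comp_eq (good_Om hs hK) ((cls_restr_comp D _ _).trans
    (cls_restr_congr D (thinIso fun c => Subtype.ext ?_))) (exK_restr fun _ => exAt_Om_of_C hs)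
  have h : ∀ c ∈ listV, (vOmFun c).ptC = c := by decide +kernel
  exact h _ ((mem_V_iff _).1 c.2)

/-- The exact extension to `E` of a diagram on `V` restricts to its exact extension to `Om`.
Together with `cls_lOm_C` this computes values of `H` as values of the extension to `C`. -/
theorem cls_lOm_E (hs : D.IsStableKan) (hK : D.HasKan) :
    cls ((bigH hK ≫ lan hK (incl E₆_sub_E₇)) ≫ ran hK (incl E₇_sub_E₈)) ≫ cls (D.restr omE) =
      cls (((ran hK vOm ≫ lan hK (inclOm 9 14 (by decide))) ≫
      ran hK (inclOm 14 17 (by decide))) ≫ lan hK (inclOm 17 18 (by decide))) := by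
  refine (good_E₈ hs hK).comp_eq (good_Om hs hK) ((cls_restr_comp D _ _).trans
    (cls_restr_congr D (thinIso fun c => Subtype.ext ?_))) (exK_restr fun _ => exAt_Om_of_E hs)
  have h : ∀ c ∈ listV, (vOmFun c).ptE = v₁Fun c := by decide +kernel
  exact h _ ((mem_V_iff _).1 c.2)

theorem cls_E₈_E₆ (hs : D.IsStableKan) (hK : D.HasKan) :
    cls ((bigH hK ≫ lan hK (incl E₆_sub_E₇)) ≫ ran hK (incl E₇_sub_E₈)) ≫
      cls (D.restr (incl E₆_sub_E₇ ⋙ incl E₇_sub_E₈)) = cls (bigH hK) := by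
  refine (good_E₈ hs hK).comp_eq (good_bigH hs hK) ((cls_restr_comp D _ _).trans
    (cls_restr_congr D (thinIso fun c => rfl))) (exK_restr fun Y h => ?_)
  refine ⟨fun a b c d h' => ?_, fun t ht => (isZero_evalAt_res _ _).2 (h.zero _ ht)⟩
  have h'' := h.sq ((incl E₆_sub_E₇ ⋙ incl E₇_sub_E₈).obj a)
    ((incl E₆_sub_E₇ ⋙ incl E₇_sub_E₈).obj b) ((incl E₆_sub_E₇ ⋙ incl E₇_sub_E₈).obj c)
    ((incl E₆_sub_E₇ ⋙ incl E₇_sub_E₈).obj d) h'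
  exact h''.res_of_le rfl rfl rfl rfl ⟨h''.le.1, h''.le.2.1, h''.le.2.2.2, h''.le.2.2.1⟩

/-- The square `110, 112, 121, 122`. -/
def jSq₁ : Sq ⥤ ↥C := sqToOm ⋙ omC

/-- The restriction of `T Y` along `j` is the square `110, 112, 121, 122` of `Y`. -/
theorem cls_bigT_jSq (hs : D.IsStableKan) (hK : D.HasKan) (hi : IsEquiv (cexRestr D iV)) :
    cls (bigT hK hi) ≫ cls (cexRestr D jSq) = cls (cexRestr D jSq₁) := by
  have h1 : cls (cexRestr D jSq) = cls (cexRestr D (incl QC_sub_C)) ≫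
      cls (D.restr (jQ₂ ⋙ incl Q₂_sub_QC)) := by
    rw [cexRestr, cexRestr, cls_comp, cls_comp, Category.assoc]
    exact congrArg (_ ≫ ·) ((cls_restr_congr D (thinIso fun _ => rfl)).trans
      (cls_restr_comp D (jQ₂ ⋙ incl Q₂_sub_QC) (incl QC_sub_C)).symm)
  have h2 : cls (D.restr (incl E₆_sub_E₇ ⋙ incl E₇_sub_E₈)) ≫ cls (D.restr qE) ≫
      cls (D.restr (jQ₂ ⋙ incl Q₂_sub_QC)) = cls (D.restr omE) ≫ cls (D.restr sqToOm) := by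
    refine (congrArg (_ ≫ ·) (cls_restr_comp D _ _)).trans ((cls_restr_comp D _ _).trans
      (Eq.trans (cls_restr_congr D (thinIso fun s => Subtype.ext ?_)) (cls_restr_comp D _ _).symm))
    have h : ∀ s, lowE (jFun s) = (sqToOm.obj s).1.ptE := by decide +kernel
    exact h s
  have h3 := reassoc_of% (cls_bigT_QC hs hK hi)
  rw [h1, h3, ← cls_E₈_E₆ hs hK, Category.assoc, h2, reassoc_of% (cls_lOm_E hs hK),
    ← cls_lOm_C hs hK]
  simp only [cexRestr, cls_comp, Category.assoc]
  rw [reassoc_of% (cls_subι_iV hs hK)]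
  exact congrArg (_ ≫ ·) (cls_restr_comp D _ _)

end BigT

end

end Der.Prederivator

namespace Der.Prederivator

noncomputable section

/-! ### Relations between rotation, shift, `T` and cofibers -/

section Core

variable {D : Prederivator.{v, u}}

variable (D) in
theorem cls_rotRes {A : Type} [SmallCategory A] (g : A ⥤ ↥C) :
    cls (rotRes D) ≫ cls (cexRestr D g) = cls (cexRestr D (g ⋙ rot)) := by
  rw [cexRestr, cexRestr, cls_comp, cls_comp, ← Category.assoc, rotRes, cls_liftSub, Category.assoc]
  exact congrArg (_ ≫ ·) (cls_restr_comp D g rot)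

variable (D) in
theorem cls_shRes {A : Type} [SmallCategory A] (g : A ⥤ ↥C) :
    cls (shRes D) ≫ cls (cexRestr D g) = cls (cexRestr D (g ⋙ sh)) := by
  rw [cexRestr, cexRestr, cls_comp, cls_comp, ← Category.assoc, shRes, cls_liftSub, Category.assoc]
  exact congrArg (_ ≫ ·) (cls_restr_comp D g sh)

variable (D) in
theorem cls_cexRestr_ev {A : Type} [SmallCategory A] (g : A ⥤ ↥C) (a : A) :
    cls (cexRestr D g) ≫ cls (D.ev a) = cls (cexEv D (g.obj a)) := by
  rw [cexRestr, cexEv, cls_comp, cls_comp, Category.assoc]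
  exact congrArg (_ ≫ ·) (cls_restr_ev D g a)

variable (D) in
theorem cls_rotRes_ev (c : ↥C) : cls (rotRes D) ≫ cls (cexEv D c) = cls (cexEv D (rot.obj c)) := by
  rw [cexEv, cexEv, cls_comp, cls_comp, ← Category.assoc, rotRes, cls_liftSub, Category.assoc]
  exact congrArg (_ ≫ ·) (cls_restr_ev D rot c)

variable (D) in
theorem cls_shRes_ev (c : ↥C) : cls (shRes D) ≫ cls (cexEv D c) = cls (cexEv D (sh.obj c)) := by
  rw [cexEv, cexEv, cls_comp, cls_comp, ← Category.assoc, shRes, cls_liftSub, Category.assoc]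
  exact congrArg (_ ≫ ·) (cls_restr_ev D sh c)

variable (D) in
theorem cexRestr_congr {A : Type} [SmallCategory A] {g g' : A ⥤ ↥C}
    (h : ∀ a, (g.obj a).1 = (g'.obj a).1) :
    cls (cexRestr D g) = cls (cexRestr D g') := by
  rw [cexRestr, cexRestr, cls_comp, cls_comp,
    cls_restr_congr D (thinIso fun a => Subtype.ext (h a))]

variable (D) in
/-- The rotation has order three. -/
theorem cls_rotRes_cube : cls (rotRes D) ≫ cls (rotRes D) ≫ cls (rotRes D) = 𝟙 _ := by
  have := cls_subι_mono (exProp D)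
  have h : cls (subι (exProp D)) = cls (cexRestr D (𝟭 _)) := by
    rw [cexRestr, cls_comp, cls_restr_id]
    exact (Category.comp_id _).symm
  rw [← cancel_mono (cls (subι (exProp D))), h, Category.assoc, Category.assoc, cls_rotRes,
    cls_rotRes,
    cls_rotRes]
  refine (cexRestr_congr D fun c => ?_).trans (Category.id_comp _).symm
  change rotFun (rotFun (rotFun c.1)) = c.1
  funext i
  fin_cases i <;> rfl

instance : IsIso (cls (rotRes D)) :=
  ⟨cls (rotRes D) ≫ cls (rotRes D), cls_rotRes_cube D, by
    rw [Category.assoc]; exact cls_rotRes_cube D⟩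

/-- `(n₁, n₂, n₃) ↦ (n₁ - 1, n₂ - 1, n₃ - 1)`. -/
def unshFun (c : Fin 3 → ℤ) : Fin 3 → ℤ := fun i => c i - 1

theorem unsh_links {c : Fin 3 → ℤ} (h : c ∈ links) : unshFun c ∈ links := by
  obtain ⟨n, h⟩ := h
  refine ⟨n - 1, h.imp ?_ (Or.imp ?_ ?_)⟩ <;>
  · rintro rfl
    funext i
    fin_cases i <;> (simp [unshFun]; try ring)

theorem unsh_mem {c : Fin 3 → ℤ} (h : c ∈ C) : unshFun c ∈ C := by
  rcases h with ⟨n, h⟩ | h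
  · exact Or.inl ⟨n - 1, fun i => ⟨by simpa [unshFun] using (h i).1, by
      have := (h i).2
      simp only [unshFun]
      omega⟩⟩
  · exact Or.inr (unsh_links h)

/-- The inverse of the shift. -/
def unsh : ↥C ⥤ ↥C :=
  mono (fun c => ⟨unshFun c.1, unsh_mem c.2⟩) (fun _ _ h i => by simpa [unshFun] using h i)

theorem IsSmallSquare.unsh {k : Sq ⥤ ↥C} (hk : IsSmallSquare k) : IsSmallSquare (k ⋙ unsh) := by
  obtain ⟨x, i, j, hij, h⟩ := hk
  refine ⟨unshFun x, i, j, hij, fun s => ?_⟩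
  change unshFun (k.obj s).1 = _
  rw [h s]
  funext l
  simp only [unshFun, Pi.add_apply]
  ring

variable (D) in
/-- The inverse of `sh^*`. -/
def unshRes : cex D ⟶ cex D :=
  liftSub _ _ (D.restr unsh) (exProp_restr unsh (fun _ h => h.unsh) (fun _ h => unsh_links h))

instance : IsIso (cls (shRes D)) := by
  have := cls_subι_mono (exProp D)
  have h : cls (subι (exProp D)) = cls (cexRestr D (𝟭 _)) := by
    rw [cexRestr, cls_comp, cls_restr_id]
    exact (Category.comp_id _).symm
  have h' : ∀ {A : Type} [SmallCategory A] (g : A ⥤ ↥C),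
      cls (unshRes D) ≫ cls (cexRestr D g) = cls (cexRestr D (g ⋙ unsh)) := fun g => by
    rw [cexRestr, cexRestr, cls_comp, cls_comp, ← Category.assoc, unshRes, cls_liftSub,
      Category.assoc]
    exact congrArg (_ ≫ ·) (cls_restr_comp D g unsh)
  refine ⟨cls (unshRes D), ?_, ?_⟩
  · rw [← cancel_mono (cls (subι (exProp D))), h, Category.assoc, h', cls_shRes]
    refine (cexRestr_congr D fun c => ?_).trans (Category.id_comp _).symm
    change shFun (unshFun c.1) = c.1
    funext i
    simp [shFun, unshFun]
  · rw [← cancel_mono (cls (subι (exProp D))), h, Category.assoc, cls_shRes, h']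
    refine (cexRestr_congr D fun c => ?_).trans (Category.id_comp _).symm
    change unshFun (shFun c.1) = c.1
    funext i
    simp [shFun, unshFun]

/-- A functor to `C` given by a monotone family of squares. -/
def cubeC {B : Type} [Preorder B] (f : B → Sq → Fin 3 → ℤ) (hm : ∀ b t, f b t ∈ C)
    (hf : ∀ b b' t t', b ≤ b' → t ≤ t' → f b t ≤ f b' t') : B × Sq ⥤ ↥C where
  obj x := ⟨f x.1 x.2, hm _ _⟩
  map g := homOfLE (hf _ _ _ _ (leOfHom g.1) (leOfHom g.2))

theorem exAt_cofEx_res {T : Type} [Preorder T] (f : Sq ⥤ T) {Y : D.val T}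
    (hq : D.CoSq Y (f.obj (.mk 0 0)) (f.obj (.mk 1 0)) (f.obj (.mk 0 1)) (f.obj (.mk 1 1)))
    (hz : Limits.IsZero ((D.evalAt (f.obj (.mk 0 1))).obj Y)) : D.ExAt cofEx ((D.res f).obj Y) := by
  refine ⟨fun a b c d h' => ?_, fun t ht => ?_⟩
  · obtain ⟨rfl, rfl, rfl, rfl⟩ : a = .mk 0 0 ∧ b = .mk 1 0 ∧ c = .mk 0 1 ∧ d = .mk 1 1 := by
      simpa [cofEx, ExData.ofList] using h'
    exact hq.res_of_le rfl rfl rfl rfl (by decide)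
  · obtain rfl : t = .mk 0 1 := by simpa [cofEx, ExData.ofList] using ht
    exact (isZero_evalAt_res _ _).2 hz

theorem exAt_suspEx_res {T : Type} [Preorder T] (f : Sq ⥤ T) {Y : D.val T}
    (hq : D.CoSq Y (f.obj (.mk 0 0)) (f.obj (.mk 1 0)) (f.obj (.mk 0 1)) (f.obj (.mk 1 1)))
    (hz : Limits.IsZero ((D.evalAt (f.obj (.mk 1 0))).obj Y))
    (hz' : Limits.IsZero ((D.evalAt (f.obj (.mk 0 1))).obj Y)) :
    D.ExAt suspEx ((D.res f).obj Y) := by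
  refine ⟨fun a b c d h' => ?_, fun t ht => ?_⟩
  · obtain ⟨rfl, rfl, rfl, rfl⟩ : a = .mk 0 0 ∧ b = .mk 1 0 ∧ c = .mk 0 1 ∧ d = .mk 1 1 := by
      simpa [suspEx, ExData.ofList] using h'
    exact hq.res_of_le rfl rfl rfl rfl (by decide)
  · obtain rfl | rfl : t = .mk 1 0 ∨ t = .mk 0 1 := by simpa [suspEx, ExData.ofList] using ht
    · exact (isZero_evalAt_res _ _).2 hz
    · exact (isZero_evalAt_res _ _).2 hz'

/-- Cofibers computed by a family of squares in `C`, parametrized by an arrow, with links at `01`.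
-/
theorem cls_cof_cube (hs : D.IsStableKan) (hA : (D.shift Arr).HasKan) (f : Arr → Sq → Fin 3 → ℤ)
    (hm : ∀ b t, f b t ∈ C) (hf : ∀ b b' t t', b ≤ b' → t ≤ t' → f b t ≤ f b' t')
    (hq : ∀ (Y : D.val ↥C), D.ExAt exC Y → ∀ b, D.CoSq Y ⟨f b (.mk 0 0), hm _ _⟩
      ⟨f b (.mk 1 0), hm _ _⟩ ⟨f b (.mk 0 1), hm _ _⟩ ⟨f b (.mk 1 1), hm _ _⟩)
    (hz : ∀ b, f b (.mk 0 1) ∈ links) :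
    cls (subι (exProp D)) ≫ cls (D.cur (cubeC f hm hf)) ≫ cls ((D.shift Arr).restr arrInitial) ≫
      cls (cof hA) =
    cls (subι (exProp D)) ≫ cls (D.cur (cubeC f hm hf)) ≫ cls ((D.shift Arr).restr arrFinal) := by
  have h := cls_cof_eq (M := subι (exProp D) ≫ D.cur (cubeC f hm hf)) hA (hs.shift Arr)
    fun K X => hs.kan.exK_cur (cubeC f hm hf) (fun b Y hY =>
      exAt_cofEx_res (CategoryTheory.Prod.sectR b Sq ⋙ cubeC f hm hf) (hq Y hY b)
        (hY.zero _ (hz b))) K _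
      (exK_subι hs K X)
  rw [cls_comp] at h
  exact (Category.assoc _ _ _).symm.trans (h.trans (Category.assoc _ _ _))

/-- Cofibers in the first direction computed by two squares in `C`. -/
theorem cls_cof₁_cube (hs : D.IsStableKan) (hA : (D.shift Arr).HasKan) (f : Arr → Sq → Fin 3 → ℤ)
    (hm : ∀ b t, f b t ∈ C) (hf : ∀ b b' t t', b ≤ b' → t ≤ t' → f b t ≤ f b' t')
    (hq : ∀ (Y : D.val ↥C), D.ExAt exC Y → ∀ b, D.CoSq Y ⟨f b (.mk 0 0), hm _ _⟩
      ⟨f b (.mk 1 0), hm _ _⟩ ⟨f b (.mk 0 1), hm _ _⟩ ⟨f b (.mk 1 1), hm _ _⟩)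
    (hz : ∀ b, f b (.mk 0 1) ∈ links) (g g' : Sq ⥤ ↥C)
    (hg : ∀ s t, (g.obj (.mk t s)).1 = f s (.mk t 0))
    (hg' : ∀ x : Sq, f x.2 (.mk 1 x.1) = (g'.obj x).1) :
    cls (cexRestr D g) ≫ cls (cof₁ hA) = cls (cexRestr D g') := by
  have h := cls_cof_cube hs hA f hm hf hq hz
  have h1 := cls_restr_curry D g (fun s t => Sq.mk t s) (fun hs ht => ⟨ht, hs⟩)
    ((𝟭 Arr).prod arrInitial ⋙ cubeC f hm hf) fun s t => Subtype.ext (hg s t)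
  have h2 := cls_cur_restr D (cubeC f hm hf) arrInitial ((𝟭 Arr).prod arrInitial ⋙ cubeC f hm hf)
    fun _ _ => rfl
  have h3 := cls_cur_restr D (cubeC f hm hf) arrFinal ((𝟭 Arr).prod arrFinal ⋙ cubeC f hm hf)
    fun _ _ => rfl
  have h4 := cls_cur_uncurry D ((𝟭 Arr).prod arrFinal ⋙ cubeC f hm hf) (fun x => (x.2, x.1))
    (fun hx => ⟨hx.2, hx.1⟩) g' fun x => Subtype.ext (hg' x)
  rw [← h2] at h1
  rw [← h3] at h4
  rw [cexRestr, cexRestr, cls_comp, cls_comp, ← h4, cof₁, cls_comp, cls_comp, Category.assoc,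
    reassoc_of% h1]
  exact (by simpa only [Category.assoc] using congrArg (· ≫ cls (D.uncurry (fun x => (x.2, x.1))
    (fun hx => ⟨hx.2, hx.1⟩))) h)

/-- Cofibers in the second direction computed by two squares in `C`. -/
theorem cls_cof₂_cube (hs : D.IsStableKan) (hA : (D.shift Arr).HasKan) (f : Arr → Sq → Fin 3 → ℤ)
    (hm : ∀ b t, f b t ∈ C) (hf : ∀ b b' t t', b ≤ b' → t ≤ t' → f b t ≤ f b' t')
    (hq : ∀ (Y : D.val ↥C), D.ExAt exC Y → ∀ b, D.CoSq Y ⟨f b (.mk 0 0), hm _ _⟩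
      ⟨f b (.mk 1 0), hm _ _⟩ ⟨f b (.mk 0 1), hm _ _⟩ ⟨f b (.mk 1 1), hm _ _⟩)
    (hz : ∀ b, f b (.mk 0 1) ∈ links) (g g' : Sq ⥤ ↥C)
    (hg : ∀ s t, (g.obj (.mk s t)).1 = f s (.mk t 0))
    (hg' : ∀ x : Sq, f x.1 (.mk 1 x.2) = (g'.obj x).1) :
    cls (cexRestr D g) ≫ cls (cof₂ hA) = cls (cexRestr D g') := by
  have h := cls_cof_cube hs hA f hm hf hq hz
  have h1 := cls_restr_curry D g (fun s t => Sq.mk s t) (fun hs ht => ⟨hs, ht⟩)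
    ((𝟭 Arr).prod arrInitial ⋙ cubeC f hm hf) fun s t => Subtype.ext (hg s t)
  have h2 := cls_cur_restr D (cubeC f hm hf) arrInitial ((𝟭 Arr).prod arrInitial ⋙ cubeC f hm hf)
    fun _ _ => rfl
  have h3 := cls_cur_restr D (cubeC f hm hf) arrFinal ((𝟭 Arr).prod arrFinal ⋙ cubeC f hm hf)
    fun _ _ => rfl
  have h4 := cls_cur_uncurry D ((𝟭 Arr).prod arrFinal ⋙ cubeC f hm hf) (fun x => (x.1, x.2))
    (fun hx => ⟨hx.1, hx.2⟩) g' fun x => Subtype.ext (hg' x)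
  rw [← h2] at h1
  rw [← h3] at h4
  rw [cexRestr, cexRestr, cls_comp, cls_comp, ← h4, cof₂, cls_comp, cls_comp, Category.assoc,
    reassoc_of% h1]
  exact (by simpa only [Category.assoc] using congrArg (· ≫ cls (D.uncurry (fun x => (x.1, x.2))
    (fun hx => ⟨hx.1, hx.2⟩))) h)

end Core

end

end Der.Prederivator

namespace Der.Prederivator

noncomputable section

section Relations

variable {D : Prederivator.{v, u}}

/-- Two squares `a → b`, `z → c` in `C`, the first for `0` and the second for `1`. -/
def cofTable (a₀ b₀ z₀ c₀ a₁ b₁ z₁ c₁ : Fin 3 → ℤ) (s : Arr) (t : Sq) : Fin 3 → ℤ :=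
  (![![![a₀, z₀], ![b₀, c₀]], ![![a₁, z₁], ![b₁, c₁]]] :
    Fin 2 → Fin 2 → Fin 2 → Fin 3 → ℤ) s t.1 t.2

/-- The functor from the square to `C` with the given vertices `00`, `01`, `10`, `11`. -/
def sqC (a b c d : Fin 3 → ℤ)
    (hm : ∀ s : Sq, (![![a, b], ![c, d]] : Fin 2 → Fin 2 → Fin 3 → ℤ) s.1 s.2 ∈ C := by
      decide +kernel)
    (hf : ∀ s t : Sq, s ≤ t → (![![a, b], ![c, d]] : Fin 2 → Fin 2 → Fin 3 → ℤ) s.1 s.2 ≤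
      (![![a, b], ![c, d]] : Fin 2 → Fin 2 → Fin 3 → ℤ) t.1 t.2 := by decide +kernel) : Sq ⥤ ↥C :=
  mono (fun s => ⟨_, hm s⟩) hf

/-- The square `011, 211, 112, 212`. -/
def jSq₂ : Sq ⥤ ↥C := sqC ![0, 1, 1] ![2, 1, 1] ![1, 1, 2] ![2, 1, 2]

/-- The square `112, 212, 122, 322`. -/
def jSq₃ : Sq ⥤ ↥C := sqC ![1, 1, 2] ![2, 1, 2] ![1, 2, 2] ![3, 2, 2]

theorem jSq_cof₁ (hs : D.IsStableKan) (hA : (D.shift Arr).HasKan) :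
    cls (cexRestr D jSq) ≫ cls (cof₁ hA) = cls (cexRestr D jSq₁) := by
  refine cls_cof₁_cube hs hA (cofTable ![0, 1, 0] ![1, 1, 0] ![0, 2, 1] ![1, 2, 1]
    ![0, 1, 1] ![1, 1, 2] ![0, 2, 1] ![1, 2, 2]) (by decide +kernel) (by decide +kernel)
    (fun Y h => Fin.forall_fin_two.2 ⟨?_, ?_⟩) (by decide +kernel) _ _ (by decide +kernel)
    (by decide +kernel)
  · exact ((coSqC h ![0, 1, 0] ![0, 1, 1] ![1, 1, 0] ![1, 1, 1]).paste hs.kan hs.zero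
      (coSqC h ![0, 1, 1] ![0, 2, 1] ![1, 1, 1] ![1, 2, 1])).symm hs.kan
  · exact (coSqC h ![0, 1, 1] ![1, 1, 1] ![0, 2, 1] ![1, 2, 1]).paste hs.kan hs.zero
      (coSqC h ![1, 1, 1] ![1, 1, 2] ![1, 2, 1] ![1, 2, 2])

theorem jSq₁_cof₁ (hs : D.IsStableKan) (hA : (D.shift Arr).HasKan) :
    cls (cexRestr D jSq₁) ≫ cls (cof₁ hA) = cls (cexRestr D (jSq ⋙ sh)) := by
  refine cls_cof₁_cube hs hA (cofTable ![1, 1, 0] ![1, 2, 1] ![2, 1, 0] ![2, 2, 1]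
    ![1, 1, 2] ![1, 2, 2] ![2, 1, 3] ![2, 2, 3]) (by decide +kernel) (by decide +kernel)
    (fun Y h => Fin.forall_fin_two.2 ⟨?_, ?_⟩) (by decide +kernel) _ _ (by decide +kernel)
    (by decide +kernel)
  · exact (coSqC h ![1, 1, 0] ![1, 1, 1] ![2, 1, 0] ![2, 1, 1]).paste hs.kan hs.zero
      (coSqC h ![1, 1, 1] ![1, 2, 1] ![2, 1, 1] ![2, 2, 1])
  · exact ((coSqC h ![1, 1, 2] ![2, 1, 2] ![1, 2, 2] ![2, 2, 2]).paste hs.kan hs.zero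
      (coSqC h ![2, 1, 2] ![2, 1, 3] ![2, 2, 2] ![2, 2, 3])).symm hs.kan

theorem jSq_cof₂ (hs : D.IsStableKan) (hA : (D.shift Arr).HasKan) :
    cls (cexRestr D jSq) ≫ cls (cof₂ hA) = cls (cexRestr D jSq₂) := by
  refine cls_cof₂_cube hs hA (cofTable ![0, 1, 0] ![0, 1, 1] ![2, 1, 0] ![2, 1, 1]
    ![1, 1, 0] ![1, 1, 2] ![2, 1, 0] ![2, 1, 2]) (by decide +kernel) (by decide +kernel)
    (fun Y h => Fin.forall_fin_two.2 ⟨?_, ?_⟩) (by decide +kernel) _ _ (by decide +kernel)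
    (by decide +kernel)
  · exact ((coSqC h ![0, 1, 0] ![1, 1, 0] ![0, 1, 1] ![1, 1, 1]).paste hs.kan hs.zero
      (coSqC h ![1, 1, 0] ![2, 1, 0] ![1, 1, 1] ![2, 1, 1])).symm hs.kan
  · exact (coSqC h ![1, 1, 0] ![1, 1, 1] ![2, 1, 0] ![2, 1, 1]).paste hs.kan hs.zero
      (coSqC h ![1, 1, 1] ![1, 1, 2] ![2, 1, 1] ![2, 1, 2])

theorem jSq₁_cof₂ (hs : D.IsStableKan) (hA : (D.shift Arr).HasKan) :
    cls (cexRestr D jSq₁) ≫ cls (cof₂ hA) = cls (cexRestr D jSq₃) := by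
  refine cls_cof₂_cube hs hA (cofTable ![1, 1, 0] ![1, 1, 2] ![2, 1, 0] ![2, 1, 2]
    ![1, 2, 1] ![1, 2, 2] ![3, 2, 1] ![3, 2, 2]) (by decide +kernel) (by decide +kernel)
    (fun Y h => Fin.forall_fin_two.2 ⟨?_, ?_⟩) (by decide +kernel) _ _ (by decide +kernel)
    (by decide +kernel)
  · exact (coSqC h ![1, 1, 0] ![1, 1, 1] ![2, 1, 0] ![2, 1, 1]).paste hs.kan hs.zero
      (coSqC h ![1, 1, 1] ![1, 1, 2] ![2, 1, 1] ![2, 1, 2])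
  · exact ((coSqC h ![1, 2, 1] ![2, 2, 1] ![1, 2, 2] ![2, 2, 2]).paste hs.kan hs.zero
      (coSqC h ![2, 2, 1] ![3, 2, 1] ![2, 2, 2] ![3, 2, 2])).symm hs.kan

theorem jSq₂_cof₁ (hs : D.IsStableKan) (hA : (D.shift Arr).HasKan) :
    cls (cexRestr D jSq₂) ≫ cls (cof₁ hA) = cls (cexRestr D jSq₃) := by
  refine cls_cof₁_cube hs hA (cofTable ![0, 1, 1] ![1, 1, 2] ![0, 2, 1] ![1, 2, 2]
    ![2, 1, 1] ![2, 1, 2] ![3, 2, 1] ![3, 2, 2]) (by decide +kernel) (by decide +kernel)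
    (fun Y h => Fin.forall_fin_two.2 ⟨?_, ?_⟩) (by decide +kernel) _ _ (by decide +kernel)
    (by decide +kernel)
  · exact (coSqC h ![0, 1, 1] ![1, 1, 1] ![0, 2, 1] ![1, 2, 1]).paste hs.kan hs.zero
      (coSqC h ![1, 1, 1] ![1, 1, 2] ![1, 2, 1] ![1, 2, 2])
  · exact ((coSqC h ![2, 1, 1] ![2, 2, 1] ![2, 1, 2] ![2, 2, 2]).paste hs.kan hs.zero
      (coSqC h ![2, 2, 1] ![3, 2, 1] ![2, 2, 2] ![3, 2, 2])).symm hs.kan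

/-- The four squares in `C` which exhibit `221, 223, 232, 233` as suspensions of the vertices of
`j`. -/
def suspTable (s t : Sq) : Fin 3 → ℤ :=
  (![![![![![0, 1, 0], ![2, 1, 0]], ![![0, 2, 1], ![2, 2, 1]]],
      ![![![0, 1, 1], ![2, 1, 3]], ![![0, 2, 1], ![2, 2, 3]]]],
    ![![![![1, 1, 0], ![2, 1, 0]], ![![1, 3, 2], ![2, 3, 2]]],
      ![![![1, 1, 2], ![2, 1, 3]], ![![1, 3, 2], ![2, 3, 3]]]]] :
    Fin 2 → Fin 2 → Fin 2 → Fin 2 → Fin 3 → ℤ) s.1 s.2 t.1 t.2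

theorem suspTable_mem : ∀ b t, suspTable b t ∈ C := by decide +kernel

theorem suspTable_mono : ∀ b b' t t', b ≤ b' → t ≤ t' → suspTable b t ≤ suspTable b' t' := by
  decide +kernel

theorem coSq_suspTable (hs : D.IsStableKan) {Y : D.val ↥C} (h : D.ExAt exC Y) (b : Sq) :
    D.CoSq Y ⟨suspTable b (.mk 0 0), suspTable_mem _ _⟩ ⟨suspTable b (.mk 1 0), suspTable_mem _ _⟩
      ⟨suspTable b (.mk 0 1), suspTable_mem _ _⟩ ⟨suspTable b (.mk 1 1), suspTable_mem _ _⟩ := by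
  obtain ⟨s, t⟩ := b
  revert s t
  refine Fin.forall_fin_two.2 ⟨Fin.forall_fin_two.2 ⟨?_, ?_⟩, Fin.forall_fin_two.2 ⟨?_, ?_⟩⟩
  · exact ((((coSqC h ![0, 1, 0] ![0, 1, 1] ![1, 1, 0] ![1, 1, 1]).paste hs.kan hs.zero
      (coSqC h ![0, 1, 1] ![0, 2, 1] ![1, 1, 1] ![1, 2, 1])).symm hs.kan).paste hs.kan hs.zero
      (((coSqC h ![1, 1, 0] ![1, 1, 1] ![2, 1, 0] ![2, 1, 1]).paste hs.kan hs.zero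
      (coSqC h ![1, 1, 1] ![1, 2, 1] ![2, 1, 1] ![2, 2, 1])).symm hs.kan)).symm hs.kan
  · exact ((((coSqC h ![0, 1, 1] ![1, 1, 1] ![0, 2, 1] ![1, 2, 1]).paste hs.kan hs.zero
      (coSqC h ![1, 1, 1] ![1, 1, 2] ![1, 2, 1] ![1, 2, 2])).paste hs.kan hs.zero
      (coSqC h ![1, 1, 2] ![2, 1, 2] ![1, 2, 2] ![2, 2, 2])).paste hs.kan hs.zero
      (coSqC h ![2, 1, 2] ![2, 1, 3] ![2, 2, 2] ![2, 2, 3])).symm hs.kan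
  · exact (((coSqC h ![1, 1, 0] ![1, 1, 1] ![2, 1, 0] ![2, 1, 1]).paste hs.kan hs.zero
      (coSqC h ![1, 1, 1] ![1, 2, 1] ![2, 1, 1] ![2, 2, 1])).paste hs.kan hs.zero
      (coSqC h ![1, 2, 1] ![1, 2, 2] ![2, 2, 1] ![2, 2, 2])).paste hs.kan hs.zero
      (coSqC h ![1, 2, 2] ![1, 3, 2] ![2, 2, 2] ![2, 3, 2])
  · exact ((((coSqC h ![1, 1, 2] ![1, 2, 2] ![2, 1, 2] ![2, 2, 2]).paste hs.kan hs.zero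
      (coSqC h ![1, 2, 2] ![1, 3, 2] ![2, 2, 2] ![2, 3, 2])).symm hs.kan).paste hs.kan hs.zero
      (((coSqC h ![2, 1, 2] ![2, 2, 2] ![2, 1, 3] ![2, 2, 3]).paste hs.kan hs.zero
      (coSqC h ![2, 2, 2] ![2, 3, 2] ![2, 2, 3] ![2, 3, 3])).symm hs.kan)).symm hs.kan

/-- The suspension of the square at `j` is the square `221, 223, 232, 233`. -/
theorem jSq_susp (hs : D.IsStableKan) (hS : (D.shift Sq).HasKan) :
    cls (cexRestr D jSq) ≫ cls (susp hS) = cls (cexRestr D (jSq₁ ⋙ sh)) := by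
  have hz : ∀ b : Sq, suspTable b (.mk 1 0) ∈ links := by decide +kernel
  have hz' : ∀ b : Sq, suspTable b (.mk 0 1) ∈ links := by decide +kernel
  have hc : ∀ b : Sq, suspTable b (.mk 1 1) = shFun (jSq₁.obj b).1 := by decide +kernel
  have hj : ∀ b : Sq, suspTable b (.mk 0 0) = jFun b := by decide +kernel
  have : Nonempty Sq := ⟨.mk 0 0⟩
  have h := cls_susp_eq (M := subι (exProp D) ≫ D.cur (cubeC _ suspTable_mem suspTable_mono)) hS
    (hs.shift Sq) fun K X => hs.kan.exK_cur (cubeC _ suspTable_mem suspTable_mono) (fun b Y hY =>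
      exAt_suspEx_res (CategoryTheory.Prod.sectR b Sq ⋙ cubeC _ suspTable_mem suspTable_mono)
        (coSq_suspTable hs hY b) (hY.zero _ (hz b)) (hY.zero _ (hz' b))) K _ (exK_subι hs K X)
  have h1 := cls_cur_ev D (cubeC _ suspTable_mem suspTable_mono) (Sq.mk 0 0) jSq
    fun b => Subtype.ext (hj b)
  have h2 := cls_cur_ev D (cubeC _ suspTable_mem suspTable_mono) (Sq.mk 1 1) (jSq₁ ⋙ sh)
    fun b => Subtype.ext (hc b)
  rw [cls_comp, Category.assoc, Category.assoc, h2, reassoc_of% h1] at h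
  rw [cexRestr, cexRestr, cls_comp, cls_comp, Category.assoc]
  exact h

end Relations

end

end Der.Prederivator

namespace Der.Prederivator

noncomputable section

/-! ### Suspensions in exact diagrams -/

section Points

variable {D : Prederivator.{v, u}}

/-- Suspensions computed by squares in `C` with two links. -/
theorem cls_cexEv_susp (hs : D.IsStableKan) (hK : D.HasKan) (g : Sq ⥤ ↥C)
    (hq : ∀ (Y : D.val ↥C), D.ExAt exC Y →
      D.CoSq Y (g.obj (.mk 0 0)) (g.obj (.mk 1 0)) (g.obj (.mk 0 1)) (g.obj (.mk 1 1)))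
    (hz : (g.obj (.mk 1 0)).1 ∈ links) (hz' : (g.obj (.mk 0 1)).1 ∈ links) :
    cls (cexEv D (g.obj (.mk 0 0))) ≫ cls (susp hK) = cls (cexEv D (g.obj (.mk 1 1))) := by
  have h := cls_susp_eq (M := cexRestr D g) hK hs fun K X =>
    exK_restr (fun Y hY => exAt_suspEx_res g (hq Y hY) (hY.zero _ hz) (hY.zero _ hz')) K _
      (exK_subι hs K X)
  rw [← Category.assoc] at h
  rwa [cls_cexRestr_ev, cls_cexRestr_ev] at h

/-- The square `010, 021, 210, 221`. -/
def sq221 : Sq ⥤ ↥C := sqC ![0, 1, 0] ![2, 1, 0] ![0, 2, 1] ![2, 2, 1]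

theorem cls_ev010_susp (hs : D.IsStableKan) (hK : D.HasKan) :
    cls (cexEv D (sq221.obj (.mk 0 0))) ≫ cls (susp hK) = cls (cexEv D (sq221.obj (.mk 1 1))) :=
  cls_cexEv_susp hs hK sq221 (fun _ h => coSq_suspTable hs h (.mk 0 0)) (by decide +kernel)
    (by decide +kernel)

/-- On two links the suspension is the zero morphism. -/
theorem cls_link_susp (hs : D.IsStableKan) (hK : D.HasKan) {a b : ↥C} (h : a ≤ b) (ha : a.1 ∈ links)
    (hb : b.1 ∈ links) : cls (cexEv D a) ≫ cls (susp hK) = cls (cexEv D b) :=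
  cls_cexEv_susp hs hK (mono (fun s : Sq => (![a, b] : Fin 2 → ↥C) s.2) (by
    rintro ⟨_, x⟩ ⟨_, y⟩ ⟨-, hxy⟩
    revert x y
    refine Fin.forall_fin_two.2 ⟨Fin.forall_fin_two.2 ⟨fun _ => le_refl a, fun _ => h⟩,
      Fin.forall_fin_two.2 ⟨fun h' => absurd (show (1 : Fin 2) ≤ 0 from h') (by decide), fun _ =>
        le_refl b⟩⟩))
    (fun Y _ => hs.kan.coSq_refl h) ha hb

instance (c : Fin 3 → ℤ) : Decidable (c ∈ QC) := inferInstanceAs (Decidable (c ∈ listQ))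

/-- The square of `E` with the vertices `(-∞, 0)`, `1110`, `(-∞, 1)`, `1111`. -/
def sqInf : Sq ⥤ ↥E₆ :=
  mono (fun s => ⟨(![![![-1, -1, -1, 0], ![-1, -1, -1, 1]], ![![1, 1, 1, 0], ![1, 1, 1, 1]]] :
    Fin 2 → Fin 2 → Fin 4 → ℤ) s.1 s.2, by revert s; decide +kernel⟩) (by
    have h : ∀ s t : Sq, s ≤ t →
      (![![![-1, -1, -1, 0], ![-1, -1, -1, 1]], ![![1, 1, 1, 0], ![1, 1, 1, 1]]] :
        Fin 2 → Fin 2 → Fin 4 → ℤ) s.1 s.2 ≤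
      (![![![-1, -1, -1, 0], ![-1, -1, -1, 1]], ![![1, 1, 1, 0], ![1, 1, 1, 1]]] :
        Fin 2 → Fin 2 → Fin 4 → ℤ) t.1 t.2 := by decide +kernel
    exact h)

/-- The value of `T Y` at `111` is the suspension of the value of `Y` at `000`: this is seen from
the composite of the squares of `E` on the path `(-∞, 0) → 0000 → 0100 → 0110 → 1110`. -/
theorem cls_bigT_ev111 (hs : D.IsStableKan) (hK : D.HasKan) (hi : IsEquiv (cexRestr D iV)) :
    cls (bigT hK hi) ≫ cls (cexEv D ⟨![1, 1, 1], by decide +kernel⟩) =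
    cls (cexEv D ⟨![0, 0, 0], by decide +kernel⟩) ≫ cls (susp hK) := by
  have h := cls_susp_eq (M := bigH hK ≫ D.restr sqInf) hK hs fun K X =>
    exK_restr (fun Y hY => exAt_suspEx_res sqInf (by
      exact (((coSqE hY ![-1, -1, -1, 0] ![0, 0, 0, 0] ![-1, -1, -1, 1] ![0, 0, 0, 1]).paste hs.kan
        hs.zero (coSqE hY ![0, 0, 0, 0] ![0, 1, 0, 0] ![0, 0, 0, 1] ![0, 1, 0, 1])).paste hs.kan
        hs.zero (coSqE hY ![0, 1, 0, 0] ![0, 1, 1, 0] ![0, 1, 0, 1] ![0, 1, 1, 1])).paste hs.kan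
        hs.zero (coSqE hY ![0, 1, 1, 0] ![1, 1, 1, 0] ![0, 1, 1, 1] ![1, 1, 1, 1]))
      (hY.zero (sqInf.obj (.mk 1 0)) (show (sqInf.obj (.mk 1 0)).1 ∈ zeroE by decide +kernel))
      (hY.zero (sqInf.obj (.mk 0 1)) (show (sqInf.obj (.mk 0 1)).1 ∈ zeroE by decide +kernel))) K _
      ((good_bigH hs hK).mem K X)
  rw [cls_comp, Category.assoc, Category.assoc] at h
  have e1 : cls (D.restr sqInf) ≫ cls (D.ev (Sq.mk 1 1)) =
      cls (D.restr qE) ≫ cls (D.ev (⟨![1, 1, 1], by decide +kernel⟩ : ↥QC)) :=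
    (cls_restr_ev D sqInf _).trans ((congrArg (fun e => cls (D.ev e)) (Subtype.ext (by
      decide +kernel))).trans (cls_restr_ev D qE _).symm)
  have e2 : cls (D.restr sqInf) ≫ cls (D.ev (Sq.mk 0 0)) =
      cls (D.restr vE) ≫ cls (D.ev (⟨![0, 0, 0], Or.inl rfl⟩ : ↥V)) :=
    (cls_restr_ev D sqInf _).trans ((congrArg (fun e => cls (D.ev e)) (Subtype.ext (by
      decide +kernel))).trans (cls_restr_ev D vE _).symm)
  rw [e1, reassoc_of% e2, reassoc_of% (good_bigH hs hK).sec] at h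
  have e3 := cls_cexRestr_ev D (incl QC_sub_C) ⟨![1, 1, 1], by decide +kernel⟩
  have e4 := cls_cexRestr_ev D iV ⟨![0, 0, 0], Or.inl rfl⟩
  have e5 := reassoc_of% (cls_bigT_QC hs hK hi)
  refine (congrArg (_ ≫ ·) e3.symm).trans ((e5 _).trans ?_)
  rw [← h, ← Category.assoc]
  exact congrArg (· ≫ _) e4

end Points

end

end Der.Prederivator

namespace Der.Prederivator

noncomputable section

/-! ### The algebra of `T`, rotation and shift -/

section Algebra

variable {D : Prederivator.{v, u}}

theorem isIso_jSq (hs : D.IsStableKan) (hK : D.HasKan) : IsIso (cls (cexRestr D jSq)) :=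
  isEquiv_iff.1 (cexRestr_jSq_isEquiv hs hK)

/-- Cofibers in the first direction correspond to `T`. -/
theorem bigT_jSq (hs : D.IsStableKan) (hK : D.HasKan) (hi : IsEquiv (cexRestr D iV))
    (hA : (D.shift Arr).HasKan) :
    cls (cexRestr D jSq) ≫ cls (cof₁ hA) = cls (bigT hK hi) ≫ cls (cexRestr D jSq) := by
  rw [jSq_cof₁ hs hA, cls_bigT_jSq hs hK hi]

variable (D) in
theorem rot_jSq₁ : cls (rotRes D) ≫ cls (cexRestr D jSq₁) = cls (cexRestr D jSq₂) := by
  have h : ∀ s, rotFun (jSq₁.obj s).1 = (jSq₂.obj s).1 := by decide +kernel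
  exact (cls_rotRes D jSq₁).trans (cexRestr_congr D h)

/-- Cofibers in the second direction correspond to the composite of `T` and rotation. -/
theorem rot_bigT_jSq (hs : D.IsStableKan) (hK : D.HasKan) (hi : IsEquiv (cexRestr D iV))
    (hA : (D.shift Arr).HasKan) : cls (cexRestr D jSq) ≫ cls (cof₂ hA) =
      cls (rotRes D) ≫ cls (bigT hK hi) ≫ cls (cexRestr D jSq) := by
  rw [jSq_cof₂ hs hA, cls_bigT_jSq hs hK hi, rot_jSq₁]

/-- The square of `T` is the shift. -/
theorem bigT_bigT (hs : D.IsStableKan) (hK : D.HasKan) (hi : IsEquiv (cexRestr D iV)) :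
    cls (bigT hK hi) ≫ cls (bigT hK hi) = cls (shRes D) := by
  have := isIso_jSq hs hK
  have hA := (hs.shift Arr).kan.hasKan
  rw [← cancel_mono (cls (cexRestr D jSq)), Category.assoc, cls_shRes, ← jSq₁_cof₁ hs hA,
    ← cls_bigT_jSq hs hK hi, Category.assoc, bigT_jSq hs hK hi hA]

/-- `T` is invertible because its square is. -/
theorem isIso_bigT (hs : D.IsStableKan) (hK : D.HasKan) (hi : IsEquiv (cexRestr D iV)) :
    IsIso (cls (bigT hK hi)) := by
  have h := bigT_bigT hs hK hi
  have : Mono (cls (bigT hK hi) ≫ cls (bigT hK hi)) := by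
    rw [h]
    infer_instance
  have : Mono (cls (bigT hK hi)) := mono_of_mono (cls (bigT hK hi)) (cls (bigT hK hi))
  have : IsSplitEpi (cls (bigT hK hi)) :=
    ⟨⟨inv (cls (shRes D)) ≫ cls (bigT hK hi), by rw [Category.assoc, h, IsIso.inv_hom_id]⟩⟩
  exact isIso_of_mono_of_isSplitEpi _

/-- `T` commutes with rotation, because cofibers in the two directions commute: on the square `112,
212, 122, 322` both composites agree. -/
theorem bigT_rot (hs : D.IsStableKan) (hK : D.HasKan) (hi : IsEquiv (cexRestr D iV)) :
    cls (bigT hK hi) ≫ cls (rotRes D) = cls (rotRes D) ≫ cls (bigT hK hi) := by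
  have := isIso_jSq hs hK
  have := isIso_bigT hs hK hi
  have hA := (hs.shift Arr).kan.hasKan
  rw [← cancel_mono (cls (bigT hK hi)), ← cancel_mono (cls (cexRestr D jSq))]
  simp only [Category.assoc]
  rw [← rot_bigT_jSq hs hK hi hA, ← bigT_jSq hs hK hi hA, reassoc_of% (cls_bigT_jSq hs hK hi),
    jSq₁_cof₂ hs hA, reassoc_of% (cls_bigT_jSq hs hK hi), ← jSq₂_cof₁ hs hA, ← rot_jSq₁,
    Category.assoc]

/-- Suspension of squares corresponds to `T sh^*`. -/
theorem jSq_susp' (hs : D.IsStableKan) (hK : D.HasKan) (hi : IsEquiv (cexRestr D iV))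
    (hS : (D.shift Sq).HasKan) : cls (cexRestr D jSq) ≫ cls (susp hS) =
      cls (shRes D) ≫ cls (bigT hK hi) ≫ cls (cexRestr D jSq) := by
  rw [jSq_susp hs hS, cls_bigT_jSq hs hK hi, cls_shRes]

end Algebra

section Orbits

variable {D : Prederivator.{v, u}}

/-- The morphism `Φ` moves the value at `c` to the value at `d`: the value of `Φ Y` at `c` is the
value of `Y` at `d`. -/
def Moves (Φ : Ho.mk (cex D) ⟶ Ho.mk (cex D)) (c d : Fin 3 → ℤ) : Prop :=
  ∃ (hc : c ∈ C) (hd : d ∈ C), Φ ≫ cls (cexEv D ⟨c, hc⟩) = cls (cexEv D ⟨d, hd⟩)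

/-- On exact diagrams, the value at `d` is the suspension of the value at `c`. -/
def Susp (hK : D.HasKan) (c d : Fin 3 → ℤ) : Prop :=
  ∃ (hc : c ∈ C) (hd : d ∈ C), cls (cexEv D ⟨c, hc⟩) ≫ cls (susp hK) = cls (cexEv D ⟨d, hd⟩)

theorem Moves.comp {Φ Ψ : Ho.mk (cex D) ⟶ Ho.mk (cex D)} {c d e : Fin 3 → ℤ} (h : Moves Φ c d)
    (h' : Moves Ψ d e) : Moves (Ψ ≫ Φ) c e := by
  obtain ⟨hc, hd, h⟩ := h
  obtain ⟨_, he, h'⟩ := h'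
  exact ⟨hc, he, by rw [Category.assoc, h, h']⟩

/-- If `Ψ` moves `c` to `c'` and `d` to `d'`, and `Φ` commutes with `Ψ` and moves `c` to `d`, then
`Φ` moves `c'` to `d'`. -/
theorem Moves.conj {Φ Ψ : Ho.mk (cex D) ⟶ Ho.mk (cex D)} {c d c' d' : Fin 3 → ℤ} (h : Moves Φ c d)
    (hc : Moves Ψ c c') (hd : Moves Ψ d d') (hΦ : Φ ≫ Ψ = Ψ ≫ Φ) : Moves Φ c' d' := by
  obtain ⟨_, _, h⟩ := h
  obtain ⟨_, hc', hc⟩ := hc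
  obtain ⟨_, hd', hd⟩ := hd
  exact ⟨hc', hd', by rw [← hc, ← Category.assoc, hΦ, Category.assoc, h, hd]⟩

theorem Susp.conj {hK : D.HasKan} {Ψ : Ho.mk (cex D) ⟶ Ho.mk (cex D)} {c d c' d' : Fin 3 → ℤ}
    (h : Susp hK c d) (hc : Moves Ψ c c') (hd : Moves Ψ d d') : Susp hK c' d' := by
  obtain ⟨_, _, h⟩ := h
  obtain ⟨_, hc', hc⟩ := hc
  obtain ⟨_, hd', hd⟩ := hd
  exact ⟨hc', hd', by rw [← hc, Category.assoc, h, hd]⟩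

theorem moves_rot (c d : Fin 3 → ℤ) (h : rotFun c = d := by decide +kernel)
    (hc : c ∈ C := by decide +kernel) : Moves (cls (rotRes D)) c d := by
  subst h
  exact ⟨hc, rot_mem hc, cls_rotRes_ev D ⟨c, hc⟩⟩

theorem moves_sh (c d : Fin 3 → ℤ) (h : shFun c = d := by decide +kernel)
    (hc : c ∈ C := by decide +kernel) : Moves (cls (shRes D)) c d := by
  subst h
  exact ⟨hc, sh_mem hc, cls_shRes_ev D ⟨c, hc⟩⟩

theorem moves_bigT_010 (hs : D.IsStableKan) (hK : D.HasKan) (hi : IsEquiv (cexRestr D iV)) :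
    Moves (cls (bigT hK hi)) ![0, 1, 0] ![1, 1, 0] := by
  refine ⟨by decide +kernel, by decide +kernel, ?_⟩
  have h := congrArg (· ≫ cls (D.ev (Sq.mk 0 0))) (cls_bigT_jSq hs hK hi)
  simp only [Category.assoc, cls_cexRestr_ev] at h
  exact h

/-- Since `T² = sh^*`, the movement `c → d` by `T` is followed by `d → c + (1, 1, 1)`. -/
theorem Moves.bigT_next (hs : D.IsStableKan) (hK : D.HasKan) (hi : IsEquiv (cexRestr D iV))
    {c d : Fin 3 → ℤ} (h : Moves (cls (bigT hK hi)) c d) (e : Fin 3 → ℤ)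
    (he : shFun c = e := by decide +kernel) : Moves (cls (bigT hK hi)) d e := by
  subst he
  obtain ⟨hc, hd, h⟩ := h
  exact ⟨hd, sh_mem hc, by
    rw [← h, ← Category.assoc, bigT_bigT hs hK hi]; exact cls_shRes_ev D ⟨c, hc⟩⟩

end Orbits

end

end Der.Prederivator

namespace Der.Prederivator

noncomputable section

/-! ### The values of exact diagrams -/

section Table

variable {D : Prederivator.{v, u}}

theorem susp_010 (hs : D.IsStableKan) (hK : D.HasKan) : Susp hK ![0, 1, 0] ![2, 2, 1] :=
  ⟨by decide +kernel, by decide +kernel, cls_ev010_susp hs hK⟩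

/-- The values at `111` and `222` are related by `T` and suspension. -/
theorem susp_111 (hs : D.IsStableKan) (hK : D.HasKan) (hi : IsEquiv (cexRestr D iV)) :
    cls (bigT hK hi) ≫ cls (cexEv D ⟨![2, 2, 2], by decide +kernel⟩) =
      cls (cexEv D ⟨![1, 1, 1], by decide +kernel⟩) ≫ cls (susp hK) := by
  have h := cls_bigT_ev111 hs hK hi
  have h1 := cls_shRes_ev D ⟨![1, 1, 1], by decide +kernel⟩
  have h2 := cls_shRes_ev D ⟨![0, 0, 0], by decide +kernel⟩
  have e1 : sh.obj ⟨![1, 1, 1], by decide +kernel⟩ = ⟨![2, 2, 2], by decide +kernel⟩ :=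
    Subtype.ext (by decide +kernel)
  have e2 : sh.obj ⟨![0, 0, 0], by decide +kernel⟩ = ⟨![1, 1, 1], by decide +kernel⟩ :=
    Subtype.ext (by decide +kernel)
  rw [e1] at h1
  rw [e2] at h2
  rw [← h1, ← bigT_bigT hs hK hi, Category.assoc, h, ← Category.assoc (cls (bigT hK hi)),
    bigT_bigT hs hK hi, reassoc_of% h2]

/-- On exact diagrams, translation by `(3, 3, 3)` is the twofold suspension of the value at `c`. -/
def Period (hK : D.HasKan) (c : Fin 3 → ℤ) : Prop :=
  ∃ (hc : c ∈ C) (hc' : (fun i => c i + 3) ∈ C), cls (cexEv D ⟨c, hc⟩) ≫ cls (susp hK) ≫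
    cls (susp hK) = cls (cexEv D ⟨fun i => c i + 3, hc'⟩)

theorem Period.of_susp {hK : D.HasKan} {c d e : Fin 3 → ℤ} (h : Susp hK c d) (h' : Susp hK d e)
    (he : ∀ i, c i + 3 = e i) : Period hK c := by
  obtain ⟨hc, _, h⟩ := h
  obtain ⟨_, he', h'⟩ := h'
  obtain rfl : (fun i => c i + 3) = e := funext he
  exact ⟨hc, he', by rw [← h', ← h, Category.assoc]⟩

theorem Period.rotate {hK : D.HasKan} {c : Fin 3 → ℤ} (h : Period hK c) : Period hK (rotFun c) := by
  obtain ⟨hc, hc', h⟩ := h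
  have h1 := cls_rotRes_ev D ⟨c, hc⟩
  have h2 := cls_rotRes_ev D ⟨_, hc'⟩
  have e : rot.obj ⟨_, hc'⟩ = ⟨fun i => rotFun c i + 3, by
      have := rot_mem hc'
      rwa [show rotFun (fun i => c i + 3) = fun i => rotFun c i + 3 from
        funext fun i => by simp only [rotFun_apply]] at this⟩ :=
    Subtype.ext (funext fun i => by
      change rotFun (fun i => c i + 3) i = _
      simp only [rotFun_apply])
  rw [e] at h2
  exact ⟨rot_mem hc, _, by
    rw [← h2, ← h]
    exact (congrArg (· ≫ cls (susp hK) ≫ cls (susp hK)) h1.symm).trans (Category.assoc _ _ _)⟩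

theorem period_sh {hK : D.HasKan} {c : Fin 3 → ℤ} : Period hK (shFun c) ↔ Period hK c := by
  have key : ∀ (hc : c ∈ C) (hc' : (fun i => c i + 3) ∈ C)
      (hd' : (fun i => shFun c i + 3) ∈ C), (cls (cexEv D ⟨c, hc⟩) ≫ cls (susp hK) ≫
    cls (susp hK) = cls (cexEv D ⟨fun i => c i + 3, hc'⟩)) ↔
      (cls (cexEv D ⟨shFun c, sh_mem hc⟩) ≫ cls (susp hK) ≫
    cls (susp hK) = cls (cexEv D ⟨fun i => shFun c i + 3, hd'⟩)) := by
    intro hc hc' hd'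
    have h1 := cls_shRes_ev D ⟨c, hc⟩
    have h2 := cls_shRes_ev D ⟨_, hc'⟩
    have e : sh.obj ⟨_, hc'⟩ = ⟨fun i => shFun c i + 3, hd'⟩ :=
      Subtype.ext (funext fun i => by
        change c i + 3 + 1 = c i + 1 + 3
        ring)
    rw [e] at h2
    rw [← h2, ← cancel_epi (cls (shRes D)), ← Category.assoc]
    exact ⟨fun h => (congrArg (· ≫ _ ≫ _) h1.symm).trans h, fun h =>
      (congrArg (· ≫ _ ≫ _) h1).trans h⟩
  constructor
  · rintro ⟨hc, hc', h⟩
    have hd : c ∈ C := by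
      have := unsh_mem hc
      rwa [show unshFun (shFun c) = c from funext fun i => by simp [unshFun, shFun]] at this
    have hd' : (fun i => c i + 3) ∈ C := by
      have := unsh_mem hc'
      rwa [show unshFun (fun i => shFun c i + 3) = fun i => c i + 3 from funext fun i => by
        simp [unshFun, shFun]; ring] at this
    exact ⟨hd, hd', (key hd hd' hc').2 h⟩
  · rintro ⟨hc, hc', h⟩
    have hd' : (fun i => shFun c i + 3) ∈ C := by
      have := sh_mem hc'
      rwa [show shFun (fun i => c i + 3) = fun i => shFun c i + 3 from funext fun i => by
        simp [shFun]; ring] at this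
    exact ⟨sh_mem hc, hd', (key hc hc' hd').1 h⟩

theorem period_000 (hs : D.IsStableKan) (hK : D.HasKan) : Period hK ![0, 0, 0] := by
  have hi := cexRestr_iV_isEquiv hs hK
  have h := cls_bigT_ev111 hs hK hi
  have h1 := cls_shRes_ev D ⟨![2, 2, 2], by decide +kernel⟩
  refine ⟨by decide +kernel, by decide +kernel, ?_⟩
  rw [← Category.assoc, ← h, Category.assoc, ← susp_111 hs hK hi, ← Category.assoc,
    bigT_bigT hs hK hi,
    h1]
  exact congrArg (fun c => cls (cexEv D c)) (Subtype.ext (by decide +kernel))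

/-- The period of exact diagrams. -/
theorem period (hs : D.IsStableKan) (hK : D.HasKan) (c : Fin 3 → ℤ) (hc : c ∈ C) : Period hK c := by
  -- The points of the cubes are translates of points of the unit cube, and these are `000`,
  -- `111` and the rotations of `010` and `110`. On links all values are zero.
  obtain ⟨n, hn⟩ | hl := hc
  · have h0 := period_000 hs hK
    have hi := cexRestr_iV_isEquiv hs hK
    have t1 := moves_bigT_010 hs hK hi
    have t2 := t1.bigT_next hs hK hi ![1, 2, 1]
    have t3 := t2.bigT_next hs hK hi ![2, 2, 1]
    have t4 := t3.bigT_next hs hK hi ![2, 3, 2]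
    have t5 := t4.bigT_next hs hK hi ![3, 3, 2]
    have t6 := t5.bigT_next hs hK hi ![3, 4, 3]
    have t7 := t6.bigT_next hs hK hi ![4, 4, 3]
    have s1 := susp_010 hs hK
    have s2 := s1.conj t1 t4
    have s3 := s2.conj t2 t5
    have s4 := s3.conj t3 t6
    have s5 := s4.conj t4 t7
    have p1 := Period.of_susp s1 s4 (by decide +kernel)
    have p2 := Period.of_susp s2 s5 (by decide +kernel)
    have hcube : ∀ x y z : Fin 2, Period hK ![(x : ℤ), (y : ℤ), (z : ℤ)] := by
      have q1 : Period hK ![1, 1, 1] := by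
        rw [show (![1, 1, 1] : Fin 3 → ℤ) = shFun ![0, 0, 0] by decide +kernel]
        exact period_sh.2 h0
      have q2 : Period hK ![0, 0, 1] := by
        rw [show (![0, 0, 1] : Fin 3 → ℤ) = rotFun ![0, 1, 0] by decide +kernel]
        exact p1.rotate
      have q3 : Period hK ![1, 0, 0] := by
        rw [show (![1, 0, 0] : Fin 3 → ℤ) = rotFun ![0, 0, 1] by decide +kernel]
        exact q2.rotate
      have q4 : Period hK ![0, 1, 1] := by
        rw [show (![0, 1, 1] : Fin 3 → ℤ) = rotFun ![1, 1, 0] by decide +kernel]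
        exact p2.rotate
      have q5 : Period hK ![1, 0, 1] := by
        rw [show (![1, 0, 1] : Fin 3 → ℤ) = rotFun ![0, 1, 1] by decide +kernel]
        exact q4.rotate
      refine Fin.forall_fin_two.2 ⟨Fin.forall_fin_two.2 ⟨Fin.forall_fin_two.2 ⟨h0, q2⟩,
        Fin.forall_fin_two.2 ⟨p1, q4⟩⟩, Fin.forall_fin_two.2 ⟨Fin.forall_fin_two.2 ⟨q3, q5⟩,
        Fin.forall_fin_two.2 ⟨p2, q1⟩⟩⟩
    have hshift : ∀ (n : ℤ) (b : Fin 3 → ℤ), Period hK b → Period hK fun i => b i + n := by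
      intro n b hb
      induction n using Int.induction_on with
      | zero => simpa using hb
      | succ k ih =>
        have := period_sh.2 ih
        rwa [show shFun (fun i => b i + (k : ℤ)) = fun i => b i + ((k : ℤ) + 1) from funext fun i =>
          by
          simp only [shFun]; ring] at this
      | pred k ih =>
        refine period_sh.1 ?_
        rwa [show shFun (fun i => b i + (-(k : ℤ) - 1)) = fun i =>
          b i + -(k : ℤ) from funext fun i => by
          simp only [shFun]; ring]
    have hx : ∀ i, ∃ x : Fin 2, c i = (x : ℤ) + n := fun i => by
      have h1 := hn i
      obtain h2 | h2 : c i = n ∨ c i = n + 1 := by omega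
      · exact ⟨0, by simp [h2]⟩
      · exact ⟨1, by simp [h2, add_comm]⟩
    obtain ⟨x, hx0⟩ := hx 0
    obtain ⟨y, hy0⟩ := hx 1
    obtain ⟨z, hz0⟩ := hx 2
    have := hshift n _ (hcube x y z)
    rwa [show (fun i => (![(x : ℤ), (y : ℤ), (z : ℤ)] : Fin 3 → ℤ) i + n) = c from funext fun i =>
      by
      fin_cases i
      exacts [hx0.symm, hy0.symm, hz0.symm]] at this
  · have h2 := sh_links hl
    have h3 := sh_links (sh_links h2)
    have hle : c ≤ shFun c := fun i => by simp [shFun]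
    have hle' : shFun c ≤ shFun (shFun (shFun c)) := fun i => by simp only [shFun]; omega
    exact Period.of_susp ⟨Or.inr hl, Or.inr h2, cls_link_susp hs hK (a := ⟨c, Or.inr hl⟩)
        (b := ⟨_, Or.inr h2⟩) hle hl h2⟩
      ⟨Or.inr h2, Or.inr h3, cls_link_susp hs hK (a := ⟨_, Or.inr h2⟩) (b := ⟨_, Or.inr h3⟩)
        hle' h2 h3⟩ fun i => by simp only [shFun]; ring

end Table

end

end Der.Prederivator

namespace Der.Prederivator

noncomputable section

/-! ### Tensor products and morphisms of prederivators -/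

section Prod

variable {E E' F F' G G' : Prederivator.{v, u}}

theorem md_inv_hom {φ ψ : E ⟶ F} (e : φ ≅ ψ) (K) (X : E.obj K) :
    (md e.inv K).app X ≫ (md e.hom K).app X = 𝟙 _ := by
  have := congrArg (fun m => (md m K).app X) e.inv_hom_id
  exact this

theorem md_hom_inv {φ ψ : E ⟶ F} (e : φ ≅ ψ) (K) (X : E.obj K) :
    (md e.hom K).app X ≫ (md e.inv K).app X = 𝟙 _ := by
  have := congrArg (fun m => (md m K).app X) e.hom_inv_id
  exact this

/-- The product of morphisms is well defined on isomorphism classes. -/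
theorem cls_prodMap_congr {φ φ' : E ⟶ F} {ψ ψ' : E' ⟶ F'} (h : cls φ = cls φ')
    (h' : cls ψ = cls ψ') : cls (prodMap φ ψ) = cls (prodMap φ' ψ') := by
  obtain ⟨e⟩ := cls_eq_iff.1 h
  obtain ⟨e'⟩ := cls_eq_iff.1 h'
  refine cls_eq (isoMk (fun K => NatIso.ofComponents (fun X => Iso.prod
    ⟨(md e.hom K).app X.1, (md e.inv K).app X.1, md_hom_inv e K _, md_inv_hom e K _⟩
    ⟨(md e'.hom K).app X.2, (md e'.inv K).app X.2, md_hom_inv e' K _, md_inv_hom e' K _⟩)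
    fun f => Prod.ext ((md e.hom K).naturality f.1) ((md e'.hom K).naturality f.2)) ?_)
  intro K L f X
  exact Prod.ext (md_naturality e.hom f X.1) (md_naturality e'.hom f X.2)

theorem cls_prodMap_comp (φ : E ⟶ F) (ψ : E' ⟶ F') (φ' : F ⟶ G) (ψ' : F' ⟶ G') :
    cls (prodMap φ ψ) ≫ cls (prodMap φ' ψ') = cls (prodMap (φ ≫ φ') (ψ ≫ ψ')) := by
  refine cls_eq (φ := prodMap φ ψ ≫ prodMap φ' ψ')
    (isoMk (fun K => NatIso.ofComponents (fun X => Iso.refl _) fun f => ?_) ?_)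
  · exact map_comp_id_eq (fn (prodMap φ ψ) K ⋙ fn (prodMap φ' ψ') K) f
  · intro K L f X
    refine Eq.trans (Category.id_comp _) (Eq.trans ?_ (Eq.trans (Category.comp_id _).symm
      (congrArg (_ ≫ ·) (((rs (G.prod G') f).map_id _).symm))))
    rw [nt_comp_app]
    exact Prod.ext (nt_comp_app φ φ' f X.1) (nt_comp_app ψ ψ' f X.2)

theorem cls_prodMap_id : cls (prodMap (𝟙 E) (𝟙 E')) = 𝟙 _ := by
  refine cls_eq (ψ := 𝟙 (E.prod E'))
    (isoMk (fun K => NatIso.ofComponents (fun X => Iso.refl _) fun f => ?_) ?_)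
  · exact map_comp_id_eq (𝟭 _) f
  · intro K L f X
    refine Eq.trans (Category.id_comp _) (Eq.trans ?_ (Eq.trans (Category.comp_id _).symm
      (congrArg (_ ≫ ·) (((rs (E.prod E') f).map_id _).symm))))
    rw [nt_id_app]
    exact Prod.ext (nt_id_app (E := E) f X.1).symm (nt_id_app (E := E') f X.2).symm

end Prod

section Tensor

open MonoidalCategory

variable (D : Prederivator.{v, u}) [D.MonoidalStr]

instance monoidal_whisk {Φ Ψ : Cat.{0, 0}ᵒᵖ ⥤ᵖ Cat.{0, 0}ᵒᵖ} (α : Φ ⟶ Ψ) (K : Cat.{0, 0}ᵒᵖ) :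
    (fn (whisk α D) K).Monoidal :=
  inferInstanceAs (D.map (α.app K)).toFunctor.Monoidal

instance monoidal_rs {E : Prederivator.{v, u}} [E.MonoidalStr] {K L : Cat.{0, 0}ᵒᵖ} (f : K ⟶ L) :
    (rs E f).Monoidal :=
  inferInstanceAs (E.map f).toFunctor.Monoidal

theorem isMonoidal_nt_whisk {Φ Ψ : Cat.{0, 0}ᵒᵖ ⥤ᵖ Cat.{0, 0}ᵒᵖ} (α : Φ ⟶ Ψ) {K L} (f : K ⟶ L) :
    NatTrans.IsMonoidal (F₁ := (D.map (Φ.map f)).toFunctor ⋙ (D.map (α.app L)).toFunctor)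
      (F₂ := (D.map (α.app K)).toFunctor ⋙ (D.map (Ψ.map f)).toFunctor)
      (nt (whisk α D) f).hom := by
  have h₁ : NatTrans.IsMonoidal (F₁ := (D.map (Φ.map f ≫ α.app L)).toFunctor)
      (F₂ := (D.map (α.app K)).toFunctor ⋙ (D.map (Ψ.map f)).toFunctor)
      (D.map₂ (α.naturality f).hom ≫ (D.mapComp (α.app K) (Ψ.map f)).hom).toNatTrans :=
    NatTrans.IsMonoidal.comp (F₂ := (D.map (α.app K ≫ Ψ.map f)).toFunctor)
      (F₃ := (D.map (α.app K)).toFunctor ⋙ (D.map (Ψ.map f)).toFunctor)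
      (D.map₂ (α.naturality f).hom).toNatTrans (D.mapComp (α.app K) (Ψ.map f)).hom.toNatTrans
  let e : (D.map (Φ.map f ≫ α.app L)).toFunctor ≅
      (D.map (Φ.map f)).toFunctor ⋙ (D.map (α.app L)).toFunctor :=
    Cat.Hom.toNatIso (D.mapComp (Φ.map f) (α.app L))
  have : NatTrans.IsMonoidal e.hom := MonoidalStr.mapComp (D := D) (Φ.map f) (α.app L)
  exact NatTrans.IsMonoidal.comp (F₂ := (D.map (Φ.map f ≫ α.app L)).toFunctor)
    (F₃ := (D.map (α.app K)).toFunctor ⋙ (D.map (Ψ.map f)).toFunctor) e.inv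
    (D.map₂ (α.naturality f).hom ≫ (D.mapComp (α.app K) (Ψ.map f)).hom).toNatTrans

/-- Morphisms induced by index transformations preserve the tensor product. -/
theorem cls_tensor_whisk {Φ Ψ : Cat.{0, 0}ᵒᵖ ⥤ᵖ Cat.{0, 0}ᵒᵖ} (α : Φ ⟶ Ψ) :
    cls (tensor (Φ.comp D)) ≫ cls (whisk α D) =
      cls (prodMap (whisk α D) (whisk α D)) ≫ cls (tensor (Ψ.comp D)) := by
  refine (cls_eq (φ := prodMap (whisk α D) (whisk α D) ≫ tensor (Ψ.comp D))
    (ψ := tensor (Φ.comp D) ≫ whisk α D) (isoMk (fun K => NatIso.ofComponents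
      (fun X => Functor.Monoidal.μIso (fn (whisk α D) K) X.1 X.2)
      (fun f => Functor.LaxMonoidal.μ_natural _ f.1 f.2)) ?_)).symm
  intro K L f X
  rw [nt_comp_app, nt_comp_app]
  have h := (isMonoidal_nt_whisk D α f).tensor X.1 X.2
  exact ((Category.assoc _ _ _).symm.trans h).trans (Category.assoc _ _ _).symm

theorem cls_tensor_unitTrans :
    cls (tensor ((Pseudofunctor.id _).comp D)) ≫ cls (unitTrans D) =
      cls (prodMap (unitTrans D) (unitTrans D)) ≫ cls (tensor D) := by
  refine (cls_eq (φ := prodMap (unitTrans D) (unitTrans D) ≫ tensor D)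
    (ψ := tensor ((Pseudofunctor.id _).comp D) ≫ unitTrans D)
    (isoMk (fun K => NatIso.ofComponents (fun X => Iso.refl _) fun f => ?_) ?_)).symm
  · exact map_comp_id_eq (MonoidalCategory.tensor (D.obj K)) f
  · intro K L f X
    rw [nt_comp_app, nt_comp_app]
    have e : ∀ Z, (nt (unitTrans D) f).hom.app Z = 𝟙 _ := fun Z => Category.comp_id _
    refine Eq.trans (Category.id_comp _) (Eq.trans ?_ (Eq.trans (Category.comp_id _).symm
      (congrArg (_ ≫ ·) (((rs D f).map_id _).symm))))
    have h : MonoidalCategoryStruct.tensorHom ((nt (unitTrans D) f).hom.app X.1)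
        ((nt (unitTrans D) f).hom.app X.2) = 𝟙 _ := by
      rw [e, e]
      exact MonoidalCategory.id_tensorHom_id _ _
    refine Eq.trans (congrArg ((nt (tensor D) f).hom.app X ≫ ·) (e _)) ?_
    refine (Category.comp_id _).trans (Eq.trans (Category.id_comp _).symm ?_)
    exact congrArg (· ≫ (nt (tensor D) f).hom.app X) h.symm

theorem cls_tensor_restr {A B : Type} [SmallCategory A] [SmallCategory B] (u : A ⥤ B) :
    cls (tensor (D.shift B)) ≫ cls (D.restr u) =
      cls (prodMap (D.restr u) (D.restr u)) ≫ cls (tensor (D.shift A)) :=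
  cls_tensor_whisk D (prodIdxMap u)

theorem cls_tensor_ev {B : Type} [SmallCategory B] (b : B) :
    cls (tensor (D.shift B)) ≫ cls (D.ev b) =
      cls (prodMap (D.ev b) (D.ev b)) ≫ cls (tensor D) := by
  have h := cls_tensor_whisk D (prodIdxPt b)
  refine Eq.trans (congrArg (cls (tensor (D.shift B)) ≫ ·) (cls_comp _ _)) ?_
  refine Eq.trans (Category.assoc _ _ _).symm ?_
  refine Eq.trans (congrArg (· ≫ cls (unitTrans D)) h) ?_
  refine Eq.trans (Category.assoc _ _ _) ?_
  refine Eq.trans (congrArg (cls (prodMap (whisk (prodIdxPt b) D) (whisk (prodIdxPt b) D)) ≫ ·)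
    (cls_tensor_unitTrans D)) ?_
  refine Eq.trans (Category.assoc _ _ _).symm ?_
  exact congrArg (· ≫ cls (tensor D)) (cls_prodMap_comp _ _ _ _)

end Tensor

end

end Der.Prederivator

namespace Der.Prederivator

noncomputable section

/-! ### Left Kan extended diagrams and tensor products -/

section TensorExt

open MonoidalCategory

variable {D : Prederivator.{v, u}} [D.MonoidalStr] {A A' B : Type} [SmallCategory A]
  [SmallCategory A']

/-- Restriction preserves tensor products. -/
def resTensor {S T : Type} [SmallCategory S] [SmallCategory T] (f : S ⥤ T) {P Q : D.val T}
    {P' Q' : D.val S} (e : (D.res f).obj P ≅ P') (e' : (D.res f).obj Q ≅ Q') :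
    (D.res f).obj (P ⊗ Q) ≅ P' ⊗ Q' :=
  (Functor.Monoidal.μIso (D.res f) P Q).symm ≪≫ (e ⊗ᵢ e')

/-- The restriction of `X` along `w ∘ f`, in two steps. -/
def resResIso {S T U : Type} [SmallCategory S] [SmallCategory T] [SmallCategory U] {f : S ⥤ T}
    {w : T ⥤ U} {g : S ⥤ U} (e : f ⋙ w ≅ g) (X : D.val U) :
    (D.res f).obj ((D.res w).obj X) ≅ (D.res g).obj X :=
  ((D.resComp f w).symm ≪≫ D.resIso e).app X

theorem isIso_whiskerTensorRight {X M N : Type*} [Category* X] [Category* M] [MonoidalCategory M]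
    [Category* N] [MonoidalCategory N] {P : X ⥤ M} {Q : X ⥤ N} {K : N ⥤ M} [K.Monoidal]
    (α : P ≅ Q ⋙ K) {a : M} {b : N} (e : a ≅ K.obj b) (x : X) :
    IsIso ((whiskerTensorRight α.hom e.hom).app x) := by
  change IsIso ((α.hom.app x ⊗ₘ e.hom) ≫ Functor.LaxMonoidal.μ K (Q.obj x) b)
  infer_instance

theorem isIso_whiskerTensorLeft {X M N : Type*} [Category* X] [Category* M] [MonoidalCategory M]
    [Category* N] [MonoidalCategory N] {P : X ⥤ M} {Q : X ⥤ N} {K : N ⥤ M} [K.Monoidal]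
    (α : P ≅ Q ⋙ K) {a : M} {b : N} (e : a ≅ K.obj b) (x : X) :
    IsIso ((whiskerTensorLeft α.hom e.hom).app x) := by
  change IsIso ((e.hom ⊗ₘ α.hom.app x) ≫ Functor.LaxMonoidal.μ K b (Q.obj x))
  infer_instance

/-- Cocontinuity of the tensor product in the first variable, as exactness of a square. -/
theorem TensorCocontinuous.exL_left [SmallCategory B] (ht : D.TensorCocontinuous) (hD : D.IsKan)
    (u : A ⥤ A') (Y : D.val B) : ExL (D.extRightSquare u Y).natTrans := by
  have := hD.left u
  have := hD.left (u.prod (𝟭 B))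
  let adj := Adjunction.ofIsRightAdjoint (D.res u)
  let adj' := Adjunction.ofIsRightAdjoint (D.res (u.prod (𝟭 B)))
  have h := ht.left u Y _ adj _ adj'
  refine ExL.of_exists fun X => ⟨_, _, UnivL.of_adj adj X, ?_⟩
  have h1 := unit_mateEquiv_symm adj adj' (D.extRightSquare u Y) X
  have h2 := (UnivL.of_adj adj' ((D.extRight A Y).obj X)).comp_iso
    (((mateEquiv adj adj').symm (D.extRightSquare u Y)).natTrans.app X)
  exact cast (congrArg (UnivL _) h1.symm) h2

/-- Cocontinuity of the tensor product in the second variable, as exactness of a square. -/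
theorem TensorCocontinuous.exL_right [SmallCategory B] (ht : D.TensorCocontinuous) (hD : D.IsKan)
    (u : A ⥤ A') (Y : D.val B) : ExL (D.extLeftSquare u Y).natTrans := by
  have := hD.left u
  have := hD.left ((𝟭 B).prod u)
  let adj := Adjunction.ofIsRightAdjoint (D.res u)
  let adj' := Adjunction.ofIsRightAdjoint (D.res ((𝟭 B).prod u))
  have h := ht.right u Y _ adj _ adj'
  refine ExL.of_exists fun X => ⟨_, _, UnivL.of_adj adj X, ?_⟩
  have h1 := unit_mateEquiv_symm adj adj' (D.extLeftSquare u Y) X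
  have h2 := (UnivL.of_adj adj' ((D.extLeft A Y).obj X)).comp_iso
    (((mateEquiv adj adj').symm (D.extLeftSquare u Y)).natTrans.app X)
  exact cast (congrArg (UnivL _) h1.symm) h2

/-- Tensor products with a constant diagram on the right preserve left Kan extended diagrams. -/
theorem TensorCocontinuous.lExt_left [Preorder B] (ht : D.TensorCocontinuous) (hD : D.IsKan)
    {u : A ⥤ A'} {P Q : D.val A'} (h : D.LExt u P) {b : B} {W : D.val B}
    (e : Q ≅ (D.res ((Functor.const A').obj b)).obj W) : D.LExt u (P ⊗ Q) := by
  have h1 := ht.exL_left hD u W _ h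
  have : IsIso ((D.extRightSquare u W).natTrans.app P) :=
    isIso_whiskerTensorRight (_ ≪≫ D.fstIso u (𝟭 B))
      ((D.resIso _ ≪≫ D.sndIso u (𝟭 B)).app W) P
  rw [CategoryTheory.Functor.map_id] at h1
  have h2 : D.LExt (u.prod (𝟭 B)) ((D.extRight A' W).obj P) := by
    refine UnivL.lExt (η := (D.extRightSquare u W).natTrans.app P) ?_
    exact cast (congrArg (UnivL _) (Category.id_comp _)) h1
  have h3 := hD.lExt_res (sectSq u b).hom (initCrit_sectSq u b) h2
  let i : (D.res (CategoryTheory.Prod.sectL A' b)).obj ((D.extRight A' W).obj P) ≅ P ⊗ Q :=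
    resTensor _ (resResIso (g := 𝟭 A')
      (NatIso.ofComponents (fun _ => Iso.refl _) (map_comp_id_eq (𝟭 A'))) P ≪≫
      (D.resId A').app P)
      (resResIso (g := (Functor.const A').obj b) (NatIso.ofComponents (fun _ => Iso.refl _)) W ≪≫
        e.symm)
  exact h3.of_iso i.hom

/-- Tensor products with a constant diagram on the left preserve left Kan extended diagrams. -/
theorem TensorCocontinuous.lExt_right [Preorder B] [Quiver.IsThin A] [Quiver.IsThin A']
    (ht : D.TensorCocontinuous) (hD : D.IsKan)
    {u : A ⥤ A'} {P Q : D.val A'} (h : D.LExt u P) {b : B} {W : D.val B}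
    (e : Q ≅ (D.res ((Functor.const A').obj b)).obj W) : D.LExt u (Q ⊗ P) := by
  have h1 := ht.exL_right hD u W _ h
  have : IsIso ((D.extLeftSquare u W).natTrans.app P) :=
    isIso_whiskerTensorLeft (_ ≪≫ D.sndIso (𝟭 B) u)
      ((D.resIso _ ≪≫ D.fstIso (𝟭 B) u).app W) P
  rw [CategoryTheory.Functor.map_id] at h1
  have h2 : D.LExt ((𝟭 B).prod u) ((D.extLeft A' W).obj P) := by
    refine UnivL.lExt (η := (D.extLeftSquare u W).natTrans.app P) ?_
    exact cast (congrArg (UnivL _) (Category.id_comp _)) h1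
  have h3 := hD.lExt_res (sectRSq u b).inv (initCrit_sectRSq u b) h2
  let i : (D.res (CategoryTheory.Prod.sectR b A')).obj ((D.extLeft A' W).obj P) ≅ Q ⊗ P :=
    resTensor _ (resResIso (g := (Functor.const A').obj b)
      (NatIso.ofComponents (fun _ => Iso.refl _)) W ≪≫ e.symm)
      (resResIso (g := 𝟭 A')
      (NatIso.ofComponents (fun _ => Iso.refl _) (map_comp_id_eq (𝟭 A'))) P ≪≫ (D.resId A').app P)
  exact h3.of_iso i.hom

/-- The cube, with coordinates in an arrow and in a square. -/
def Cube : Type := Arr × Sq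

instance : PartialOrder Cube := inferInstanceAs (PartialOrder (Arr × Sq))

/-- The projection of the cube to the square. -/
def cubeSq : Cube ⥤ Sq := mono (fun x => x.2) fun _ _ h => h.2

/-- The projection of the cube to the arrow. -/
def cubeArr : Cube ⥤ Arr := mono (fun x => x.1) fun _ _ h => h.1

/-- The identification of the product with the cube. -/
def toCube : Arr × Sq ⥤ Cube where
  obj x := x
  map f := homOfLE ⟨leOfHom f.1, leOfHom f.2⟩

/-- The square of the cube at a point of the arrow. -/
def cubeAt (b : Arr) : Sq ⥤ Cube := mono (fun t => (b, t)) fun _ _ h => ⟨le_refl b, h⟩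

/-- The squares of the cube are cocartesian, with zero objects at the vertices `01`. -/
def cubeEx : ExData Cube where
  sq p q r s := ∃ b : Arr, p = (b, Sq.mk 0 0) ∧ q = (b, Sq.mk 1 0) ∧ r = (b, Sq.mk 0 1) ∧
    s = (b, Sq.mk 1 1)
  zero p := p.2 = Sq.mk 0 1

theorem ExAt.isCocartesian_cofEx {D : Prederivator.{v, u}} {Q : D.val Sq} (h : D.ExAt cofEx Q) :
    D.IsCocartesian Q := by
  have h1 := h.sq (.mk 0 0) (.mk 1 0) (.mk 0 1) (.mk 1 1) (by simp [cofEx, ExData.ofList])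
  exact (CoSq.isCocartesian (k := 𝟭 Sq) h1).of_iso ((D.resId Sq).app Q)

/-- The product of an exact square with an arrow is an exact cube. -/
theorem TensorCocontinuous.exAt_cube (ht : D.TensorCocontinuous) (hD : D.IsKan)
    (hz : Limits.HasZeroObject (D.val One)) {P : D.val Sq} {Q : D.val Arr} (h : D.ExAt cofEx P) :
    D.ExAt cubeEx ((D.res cubeSq).obj P ⊗ (D.res cubeArr).obj Q) := by
  constructor
  · rintro a b c d ⟨x, rfl, rfl, rfl, rfl⟩
    refine ⟨cubeAt x, ⟨rfl, rfl, rfl, rfl⟩, ?_⟩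
    have h1 := ht.lExt_left hD ((hD.isCocartesian_iff _).1 h.isCocartesian_cofEx) (W := Q)
      (Iso.refl ((D.res ((Functor.const Sq).obj x)).obj Q))
    refine ((hD.isCocartesian_iff _).2 h1).of_iso (resTensor (cubeAt x) ?_ ?_).symm
    · exact resResIso (g := 𝟭 Sq) (thinIso fun _ => rfl) P ≪≫ (D.resId Sq).app P
    · exact resResIso (g := (Functor.const Sq).obj x) (thinIso fun _ => rfl) Q
  · rintro ⟨x, t⟩ rfl
    have h1 := h.zero (.mk 0 1) (by simp [cofEx, ExData.ofList])
    have h2 : D.LExt (Functor.empty.{0} One) ((D.evalAt (.mk 0 1)).obj P) :=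
      hD.lExt_empty_iff.2 fun Z => h1.unique_to Z
    have h3 := ht.lExt_left hD h2 (W := Q)
      (Iso.refl ((D.res ((Functor.const One).obj x)).obj Q))
    refine (isZero_of_initial hz (hD.lExt_empty_iff.1 h3)).of_iso (resTensor _ ?_ ?_)
    · exact resResIso (T := Cube) (f := Functor.fromPUnit.{0} (x, .mk 0 1)) (w := cubeSq)
        (thinIso fun _ => rfl) P
    · exact resResIso (g := (Functor.const One).obj x) (thinIso fun _ => rfl) Q

/-- The product of an arrow with an exact square is an exact cube. -/
theorem TensorCocontinuous.exAt_cube' (ht : D.TensorCocontinuous) (hD : D.IsKan)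
    (hz : Limits.HasZeroObject (D.val One)) {P : D.val Sq} {Q : D.val Arr} (h : D.ExAt cofEx P) :
    D.ExAt cubeEx ((D.res cubeArr).obj Q ⊗ (D.res cubeSq).obj P) := by
  constructor
  · rintro a b c d ⟨x, rfl, rfl, rfl, rfl⟩
    refine ⟨cubeAt x, ⟨rfl, rfl, rfl, rfl⟩, ?_⟩
    have h1 := ht.lExt_right hD ((hD.isCocartesian_iff _).1 h.isCocartesian_cofEx) (W := Q)
      (Iso.refl ((D.res ((Functor.const Sq).obj x)).obj Q))
    refine ((hD.isCocartesian_iff _).2 h1).of_iso (resTensor (cubeAt x) ?_ ?_).symm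
    · exact resResIso (g := (Functor.const Sq).obj x) (thinIso fun _ => rfl) Q
    · exact resResIso (g := 𝟭 Sq) (thinIso fun _ => rfl) P ≪≫ (D.resId Sq).app P
  · rintro ⟨x, t⟩ rfl
    have h1 := h.zero (.mk 0 1) (by simp [cofEx, ExData.ofList])
    have h2 : D.LExt (Functor.empty.{0} One) ((D.evalAt (.mk 0 1)).obj P) :=
      hD.lExt_empty_iff.2 fun Z => h1.unique_to Z
    have h3 := ht.lExt_right hD h2 (W := Q)
      (Iso.refl ((D.res ((Functor.const One).obj x)).obj Q))
    refine (isZero_of_initial hz (hD.lExt_empty_iff.1 h3)).of_iso (resTensor _ ?_ ?_)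
    · exact resResIso (g := (Functor.const One).obj x) (thinIso fun _ => rfl) Q
    · exact resResIso (T := Cube) (f := Functor.fromPUnit.{0} (x, .mk 0 1)) (w := cubeSq)
        (thinIso fun _ => rfl) P

end TensorExt

end

end Der.Prederivator

namespace Der.Prederivator

noncomputable section

/-! ### Cofibers of external tensor products -/

section ExtTensor

open MonoidalCategory

variable {D : Prederivator.{v, u}}

/-- The morphism sending `x → y` to the cocartesian square with vertices `x`, `y`, `0`, `z`. -/
def cofSq (hK : D.HasKan) : D.shift Arr ⟶ D.shift Sq :=
  (𝟙 _ ≫ ran hK arrSpan) ≫ lan hK spanIncl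

theorem cls_cofSq_initial (hs : D.IsStableKan) (hK : D.HasKan) :
    cls (cofSq hK) ≫ cls (D.restr arrInitial) = 𝟙 _ :=
  (congrArg (cls (cofSq hK) ≫ ·) cls_arrSpan.symm).trans (cofEx_good hs hK).sec

theorem cls_cofSq_final (hK : D.HasKan) :
    cls (cofSq hK) ≫ cls (D.restr arrFinal) = cls (cof hK) := by
  simp only [cofSq, cof, cls_comp, cls_id, Category.id_comp, Category.assoc]

/-- Cofibers in the first direction are computed by exact cubes. -/
theorem cls_cof₁_cubeEx (hs : D.IsStableKan) (hA : (D.shift Arr).HasKan) {E : Prederivator.{v, u}}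
    (M : E ⟶ D.shift Cube) (hM : ∀ K X, D.ExK cubeEx K ((fn M K).obj X)) {g g' : Sq ⥤ Cube}
    (hg : ∀ s t, g.obj (.mk t s) = (s, Sq.mk t 0)) (hg' : ∀ x : Sq, g'.obj x = (x.2, Sq.mk 1 x.1)) :
    cls M ≫ cls (D.restr g) ≫ cls (cof₁ hA) = cls M ≫ cls (D.restr g') := by
  have h := cls_cof_eq hA (hs.shift Arr) (M := M ≫ D.cur toCube) fun K X =>
    hs.kan.exK_cur (e' := cubeEx) toCube (fun b Y hY => exAt_cofEx_res
      (CategoryTheory.Prod.sectR b Sq ⋙ toCube)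
      (hY.sq _ _ _ _ ⟨b, rfl, rfl, rfl, rfl⟩) (hY.zero _ rfl)) K _ (hM K X)
  have h1 := cls_restr_curry D g (fun s t => Sq.mk t s) (fun hs ht => ⟨ht, hs⟩)
    ((𝟭 Arr).prod arrInitial ⋙ toCube) hg
  have h2 := cls_cur_restr D toCube arrInitial ((𝟭 Arr).prod arrInitial ⋙ toCube) fun _ _ => rfl
  have h3 := cls_cur_restr D toCube arrFinal ((𝟭 Arr).prod arrFinal ⋙ toCube) fun _ _ => rfl
  have h4 := cls_cur_uncurry D ((𝟭 Arr).prod arrFinal ⋙ toCube) (fun x => (x.2, x.1))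
    (fun hx => ⟨hx.2, hx.1⟩) g' fun x => (hg' x).symm
  rw [← h2] at h1
  rw [← h3] at h4
  rw [cls_comp, Category.assoc, Category.assoc] at h
  rw [cof₁, cls_comp, cls_comp, reassoc_of% h1, reassoc_of% h, ← h4, Category.assoc]

/-- Cofibers in the second direction are computed by exact cubes. -/
theorem cls_cof₂_cubeEx (hs : D.IsStableKan) (hA : (D.shift Arr).HasKan) {E : Prederivator.{v, u}}
    (M : E ⟶ D.shift Cube) (hM : ∀ K X, D.ExK cubeEx K ((fn M K).obj X)) {g g' : Sq ⥤ Cube}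
    (hg : ∀ s t, g.obj (.mk s t) = (s, Sq.mk t 0)) (hg' : ∀ x : Sq, g'.obj x = (x.1, Sq.mk 1 x.2)) :
    cls M ≫ cls (D.restr g) ≫ cls (cof₂ hA) = cls M ≫ cls (D.restr g') := by
  have h := cls_cof_eq hA (hs.shift Arr) (M := M ≫ D.cur toCube) fun K X =>
    hs.kan.exK_cur (e' := cubeEx) toCube (fun b Y hY => exAt_cofEx_res
      (CategoryTheory.Prod.sectR b Sq ⋙ toCube)
      (hY.sq _ _ _ _ ⟨b, rfl, rfl, rfl, rfl⟩) (hY.zero _ rfl)) K _ (hM K X)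
  have h1 := cls_restr_curry D g (fun s t => Sq.mk s t) (fun hs ht => ⟨hs, ht⟩)
    ((𝟭 Arr).prod arrInitial ⋙ toCube) hg
  have h2 := cls_cur_restr D toCube arrInitial ((𝟭 Arr).prod arrInitial ⋙ toCube) fun _ _ => rfl
  have h3 := cls_cur_restr D toCube arrFinal ((𝟭 Arr).prod arrFinal ⋙ toCube) fun _ _ => rfl
  have h4 := cls_cur_uncurry D ((𝟭 Arr).prod arrFinal ⋙ toCube) (fun x => (x.1, x.2))
    (fun hx => ⟨hx.1, hx.2⟩) g' fun x => (hg' x).symm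
  rw [← h2] at h1
  rw [← h3] at h4
  rw [cls_comp, Category.assoc, Category.assoc] at h
  rw [cof₂, cls_comp, cls_comp, reassoc_of% h1, reassoc_of% h, ← h4, Category.assoc]

theorem cls_cofSq_restr (hK : D.HasKan) {g : Sq ⥤ Cube} {p : Sq ⥤ Arr} {w : Arr ⥤ Sq}
    (h : ∀ x, (g.obj x).2 = w.obj (p.obj x)) :
    cls ((cofSq hK ≫ D.restr cubeSq) ≫ D.restr g) =
      (cls (cofSq hK) ≫ cls (D.restr w)) ≫ cls (D.restr p) := by
  rw [cls_comp, cls_comp, Category.assoc, Category.assoc, cls_restr_comp, cls_restr_comp]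
  exact congrArg (cls (cofSq hK) ≫ ·) (cls_restr_congr D (thinIso h))

theorem cls_cubeArr_restr {g : Sq ⥤ Cube} {p : Sq ⥤ Arr} (h : ∀ x, (g.obj x).1 = p.obj x) :
    cls (D.restr cubeArr ≫ D.restr g) = cls (D.restr p) := by
  rw [cls_comp, cls_restr_comp]
  exact cls_restr_congr D (thinIso h)

variable [D.MonoidalStr]

theorem cls_prodMap_tensor_restr {E E' : Prederivator.{v, u}} {S T : Type} [SmallCategory S]
    [SmallCategory T] (φ : E ⟶ D.shift T) (ψ : E' ⟶ D.shift T) (g : S ⥤ T) :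
    cls (prodMap φ ψ ≫ (D.shift T).tensor) ≫ cls (D.restr g) =
      cls (prodMap (φ ≫ D.restr g) (ψ ≫ D.restr g)) ≫ cls ((D.shift S).tensor) := by
  rw [cls_comp, Category.assoc, cls_tensor_restr, ← Category.assoc, cls_prodMap_comp]

/-- The exact cubes computing cofibers in the first variable of a tensor product. -/
def cubeL (hK : D.HasKan) : (D.shift Arr).prod (D.shift Arr) ⟶ D.shift Cube :=
  prodMap (cofSq hK ≫ D.restr cubeSq) (D.restr cubeArr) ≫ (D.shift Cube).tensor

/-- The exact cubes computing cofibers in the second variable of a tensor product. -/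
def cubeR (hK : D.HasKan) : (D.shift Arr).prod (D.shift Arr) ⟶ D.shift Cube :=
  prodMap (D.restr cubeArr) (cofSq hK ≫ D.restr cubeSq) ≫ (D.shift Cube).tensor

theorem TensorCocontinuous.exK_cubeL (ht : D.TensorCocontinuous) (hs : D.IsStableKan)
    (hK : D.HasKan) (K) (X : ((D.shift Arr).prod (D.shift Arr)).obj K) :
    D.ExK cubeEx K ((fn (cubeL hK) K).obj X) := fun a =>
  (ht.exAt_cube hs.kan hs.zero (Q := (D.res (CategoryTheory.Prod.sectL Arr a)).obj X.2)
    ((cofEx_good hs hK).mem K X.1 a)).of_iso (resTensor _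
      (((D.resComp _ _).symm ≪≫ D.resIso (sectSq cubeSq a) ≪≫ D.resComp _ _).app _)
      (((D.resComp _ _).symm ≪≫ D.resIso (sectSq cubeArr a) ≪≫ D.resComp _ _).app _)).symm

theorem TensorCocontinuous.exK_cubeR (ht : D.TensorCocontinuous) (hs : D.IsStableKan)
    (hK : D.HasKan) (K) (X : ((D.shift Arr).prod (D.shift Arr)).obj K) :
    D.ExK cubeEx K ((fn (cubeR hK) K).obj X) := fun a =>
  (ht.exAt_cube' hs.kan hs.zero (Q := (D.res (CategoryTheory.Prod.sectL Arr a)).obj X.1)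
    ((cofEx_good hs hK).mem K X.2 a)).of_iso (resTensor _
      (((D.resComp _ _).symm ≪≫ D.resIso (sectSq cubeArr a) ≪≫ D.resComp _ _).app _)
      (((D.resComp _ _).symm ≪≫ D.resIso (sectSq cubeSq a) ≪≫ D.resComp _ _).app _)).symm

/-- Cofibers in the first variable of external tensor products. -/
theorem cls_cof_extTensor (ht : D.TensorCocontinuous) (hs : D.IsStableKan) (hK : D.HasKan)
    (hA : (D.shift Arr).HasKan) : cls (prodMap (cof hK) (𝟙 _)) ≫ cls (extTensor D) =
      cls (extTensor D) ≫ cls (cof₁ hA) := by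
  let g : Sq ⥤ Cube := mono (fun x => (x.2, Sq.mk x.1 0)) fun _ _ h => ⟨h.2, h.1, le_refl _⟩
  let g' : Sq ⥤ Cube := mono (fun x => (x.2, Sq.mk 1 x.1)) fun _ _ h => ⟨h.2, le_refl _, h.1⟩
  have h := cls_cof₁_cubeEx hs hA (cubeL hK) (ht.exK_cubeL hs hK) (g := g) (g' := g')
    (fun _ _ => rfl) fun _ => rfl
  have h1 : cls (cubeL hK) ≫ cls (D.restr g) = cls (extTensor D) := by
    rw [cubeL, cls_prodMap_tensor_restr]
    refine congrArg (· ≫ cls ((D.shift Sq).tensor)) (cls_prodMap_congr ?_ ?_)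
    · refine (cls_cofSq_restr hK (p := sqFst) (w := arrInitial) fun _ => rfl).trans ?_
      rw [cls_cofSq_initial hs]
      exact Category.id_comp _
    · exact cls_cubeArr_restr fun _ => rfl
  have h2 : cls (cubeL hK) ≫ cls (D.restr g') =
      cls (prodMap (cof hK) (𝟙 _)) ≫ cls (extTensor D) := by
    rw [cubeL, cls_prodMap_tensor_restr, extTensor, cls_comp, ← Category.assoc, cls_prodMap_comp]
    refine congrArg (· ≫ cls ((D.shift Sq).tensor)) (cls_prodMap_congr ?_ ?_)
    · refine (cls_cofSq_restr hK (p := sqFst) (w := arrFinal) fun _ => rfl).trans ?_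
      rw [cls_cofSq_final]
      rfl
    · exact (cls_cubeArr_restr fun _ => rfl).trans (Category.id_comp _).symm
  rw [← h2, ← h, reassoc_of% h1]

/-- Cofibers in the second variable of external tensor products. -/
theorem cls_extTensor_cof (ht : D.TensorCocontinuous) (hs : D.IsStableKan) (hK : D.HasKan)
    (hA : (D.shift Arr).HasKan) : cls (prodMap (𝟙 _) (cof hK)) ≫ cls (extTensor D) =
      cls (extTensor D) ≫ cls (cof₂ hA) := by
  let g : Sq ⥤ Cube := mono (fun x => (x.1, Sq.mk x.2 0)) fun _ _ h => ⟨h.1, h.2, le_refl _⟩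
  let g' : Sq ⥤ Cube := mono (fun x => (x.1, Sq.mk 1 x.2)) fun _ _ h => ⟨h.1, le_refl _, h.2⟩
  have h := cls_cof₂_cubeEx hs hA (cubeR hK) (ht.exK_cubeR hs hK) (g := g) (g' := g')
    (fun _ _ => rfl) fun _ => rfl
  have h1 : cls (cubeR hK) ≫ cls (D.restr g) = cls (extTensor D) := by
    rw [cubeR, cls_prodMap_tensor_restr]
    refine congrArg (· ≫ cls ((D.shift Sq).tensor)) (cls_prodMap_congr ?_ ?_)
    · exact cls_cubeArr_restr fun _ => rfl
    · refine (cls_cofSq_restr hK (p := sqSnd) (w := arrInitial) fun _ => rfl).trans ?_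
      rw [cls_cofSq_initial hs]
      exact Category.id_comp _
  have h2 : cls (cubeR hK) ≫ cls (D.restr g') =
      cls (prodMap (𝟙 _) (cof hK)) ≫ cls (extTensor D) := by
    rw [cubeR, cls_prodMap_tensor_restr, extTensor, cls_comp, ← Category.assoc, cls_prodMap_comp]
    refine congrArg (· ≫ cls ((D.shift Sq).tensor)) (cls_prodMap_congr ?_ ?_)
    · exact (cls_cubeArr_restr fun _ => rfl).trans (Category.id_comp _).symm
    · refine (cls_cofSq_restr hK (p := sqSnd) (w := arrFinal) fun _ => rfl).trans ?_
      rw [cls_cofSq_final]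
      rfl
  rw [← h2, ← h, reassoc_of% h1]

/-- The vertices of an external tensor product. -/
theorem cls_extTensor_ev (x : Sq) :
    cls (extTensor D) ≫ cls (D.ev x) = cls (tens (D.ev x.1) (D.ev x.2)) := by
  rw [extTensor, cls_comp, Category.assoc, cls_tensor_ev, ← Category.assoc, cls_prodMap_comp, tens]
  exact congrArg (· ≫ cls D.tensor)
    (cls_prodMap_congr (cls_restr_ev D sqFst x) (cls_restr_ev D sqSnd x))

end ExtTensor

end

end Der.Prederivator

namespace Der.Prederivator

noncomputable section

/-! ### The values of external tensor products -/

section Values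

variable {D E : Prederivator.{v, u}}

/-- The family of exact diagrams `A` has the value `f` at `c`, up to isomorphism. -/
def Val (A : Ho.mk E ⟶ Ho.mk (cex D)) (c : Fin 3 → ℤ) (f : Ho.mk E ⟶ Ho.mk D) : Prop :=
  ∃ hc : c ∈ C, A ≫ cls (cexEv D ⟨c, hc⟩) = f

theorem Val.move {A : Ho.mk E ⟶ Ho.mk (cex D)} {c d : Fin 3 → ℤ} {f : Ho.mk E ⟶ Ho.mk D}
    (h : Val A d f) {Φ : Ho.mk (cex D) ⟶ Ho.mk (cex D)} (hΦ : Moves Φ c d) : Val (A ≫ Φ) c f := by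
  obtain ⟨_, rfl⟩ := h
  obtain ⟨hc, _, hΦ⟩ := hΦ
  exact ⟨hc, by rw [Category.assoc, hΦ]⟩

theorem Val.of_move {A : Ho.mk E ⟶ Ho.mk (cex D)} {c d : Fin 3 → ℤ} {f : Ho.mk E ⟶ Ho.mk D}
    {Φ : Ho.mk (cex D) ⟶ Ho.mk (cex D)} (h : Val (A ≫ Φ) c f) (hΦ : Moves Φ c d) : Val A d f := by
  obtain ⟨_, rfl⟩ := h
  obtain ⟨_, hd, hΦ⟩ := hΦ
  exact ⟨hd, by rw [Category.assoc, hΦ]⟩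

theorem hasValue_iff [D.MonoidalStr] {M : (D.shift Arr).prod (D.shift Arr) ⟶ cex D}
    {c : Fin 3 → ℤ} {p : (D.shift Arr).prod (D.shift Arr) ⟶ D} :
    HasValue M c p ↔ Val (cls M) c (cls p) := by
  constructor
  · rintro ⟨hc, ⟨e⟩⟩
    exact ⟨hc, cls_eq e⟩
  · rintro ⟨hc, h⟩
    exact ⟨hc, cls_eq_iff.1 h⟩

/-- Transport of values along suspensions. -/
theorem HasValue.susp [D.MonoidalStr] {M : (D.shift Arr).prod (D.shift Arr) ⟶ cex D}
    {p : (D.shift Arr).prod (D.shift Arr) ⟶ D} {hK : D.HasKan} {c d : Fin 3 → ℤ}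
    (h : HasValue M c p) (hcd : Susp hK c d) : HasValue M d (p ≫ susp hK) := by
  obtain ⟨hc, h⟩ := hasValue_iff.1 h
  obtain ⟨_, hd, hcd⟩ := hcd
  exact hasValue_iff.2 ⟨hd, by rw [cls_comp, ← h, Category.assoc, hcd]⟩

theorem HasValue.loop [D.MonoidalStr] {M : (D.shift Arr).prod (D.shift Arr) ⟶ cex D}
    {p : (D.shift Arr).prod (D.shift Arr) ⟶ D} {hK : D.HasKan} {c d : Fin 3 → ℤ}
    (h : HasValue M d p) (hs : D.IsStableKan) (hcd : Susp hK c d) :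
    HasValue M c (p ≫ loop hK) := by
  obtain ⟨_, h⟩ := hasValue_iff.1 h
  obtain ⟨hc, _, hcd⟩ := hcd
  exact hasValue_iff.2 ⟨hc, by
    rw [cls_comp, ← h, ← hcd, Category.assoc, Category.assoc, cls_susp_loop hK hs,
      Category.comp_id]⟩

theorem hasValue_period [D.MonoidalStr] (hs : D.IsStableKan) (hK : D.HasKan)
    (M : (D.shift Arr).prod (D.shift Arr) ⟶ cex D) (c : Fin 3 → ℤ) (hc : c ∈ C) :
    HasValue M (fun i => c i + 3) (M ≫ cexEv D ⟨c, hc⟩ ≫ susp hK ≫ susp hK) := by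
  obtain ⟨_, hc', h⟩ := period hs hK c hc
  exact hasValue_iff.2 ⟨hc', congrArg (cls M ≫ ·) h.symm⟩

end Values

/-- The orbit of `010` under `T`, and its rotations. -/
structure Orbits (D : Prederivator.{v, u}) (T : Ho.mk (cex D) ⟶ Ho.mk (cex D)) : Prop where
  m010 : Moves T ![0, 1, 0] ![1, 1, 0]
  m110 : Moves T ![1, 1, 0] ![1, 2, 1]
  m121 : Moves T ![1, 2, 1] ![2, 2, 1]
  m221 : Moves T ![2, 2, 1] ![2, 3, 2]
  m232 : Moves T ![2, 3, 2] ![3, 3, 2]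
  m332 : Moves T ![3, 3, 2] ![3, 4, 3]
  m001 : Moves T ![0, 0, 1] ![0, 1, 1]
  m011 : Moves T ![0, 1, 1] ![1, 1, 2]
  m112 : Moves T ![1, 1, 2] ![1, 2, 2]
  m122 : Moves T ![1, 2, 2] ![2, 2, 3]
  m223 : Moves T ![2, 2, 3] ![2, 3, 3]
  m233 : Moves T ![2, 3, 3] ![3, 3, 4]
  m100 : Moves T ![1, 0, 0] ![1, 0, 1]
  m101 : Moves T ![1, 0, 1] ![2, 1, 1]
  m211 : Moves T ![2, 1, 1] ![2, 1, 2]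
  m212 : Moves T ![2, 1, 2] ![3, 2, 2]
  m322 : Moves T ![3, 2, 2] ![3, 2, 3]
  m323 : Moves T ![3, 2, 3] ![4, 3, 3]

/-- The suspensions between the points of `C`. -/
structure Susps {D : Prederivator.{v, u}} (hK : D.HasKan) : Prop where
  s010 : Susp hK ![0, 1, 0] ![2, 2, 1]
  s110 : Susp hK ![1, 1, 0] ![2, 3, 2]
  s121 : Susp hK ![1, 2, 1] ![3, 3, 2]
  s221 : Susp hK ![2, 2, 1] ![3, 4, 3]
  s001 : Susp hK ![0, 0, 1] ![1, 2, 2]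
  s011 : Susp hK ![0, 1, 1] ![2, 2, 3]
  s112 : Susp hK ![1, 1, 2] ![2, 3, 3]
  s122 : Susp hK ![1, 2, 2] ![3, 3, 4]
  s100 : Susp hK ![1, 0, 0] ![2, 1, 2]
  s101 : Susp hK ![1, 0, 1] ![3, 2, 2]
  s211 : Susp hK ![2, 1, 1] ![3, 2, 3]
  s212 : Susp hK ![2, 1, 2] ![4, 3, 3]

section Table

variable {D : Prederivator.{v, u}}

theorem orbits_bigT (hs : D.IsStableKan) (hK : D.HasKan) (hi : IsEquiv (cexRestr D iV)) :
    Orbits D (cls (bigT hK hi)) := by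
  have r := bigT_rot hs hK hi
  have m1 := moves_bigT_010 hs hK hi
  have m2 := m1.bigT_next hs hK hi ![1, 2, 1]
  have m3 := m2.bigT_next hs hK hi ![2, 2, 1]
  have m4 := m3.bigT_next hs hK hi ![2, 3, 2]
  have m5 := m4.bigT_next hs hK hi ![3, 3, 2]
  have m6 := m5.bigT_next hs hK hi ![3, 4, 3]
  have n1 := m1.conj (moves_rot _ ![0, 0, 1]) (moves_rot _ ![0, 1, 1]) r
  have n2 := n1.bigT_next hs hK hi ![1, 1, 2]
  have n3 := n2.bigT_next hs hK hi ![1, 2, 2]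
  have n4 := n3.bigT_next hs hK hi ![2, 2, 3]
  have n5 := n4.bigT_next hs hK hi ![2, 3, 3]
  have n6 := n5.bigT_next hs hK hi ![3, 3, 4]
  have p1 := n1.conj (moves_rot _ ![1, 0, 0]) (moves_rot _ ![1, 0, 1]) r
  have p2 := p1.bigT_next hs hK hi ![2, 1, 1]
  have p3 := p2.bigT_next hs hK hi ![2, 1, 2]
  have p4 := p3.bigT_next hs hK hi ![3, 2, 2]
  have p5 := p4.bigT_next hs hK hi ![3, 2, 3]
  have p6 := p5.bigT_next hs hK hi ![4, 3, 3]
  exact ⟨m1, m2, m3, m4, m5, m6, n1, n2, n3, n4, n5, n6, p1, p2, p3, p4, p5, p6⟩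

theorem susps (hs : D.IsStableKan) (hK : D.HasKan) : Susps hK := by
  have o := orbits_bigT hs hK (cexRestr_iV_isEquiv hs hK)
  have s1 := susp_010 hs hK
  have s2 := s1.conj o.m010 o.m221
  have s3 := s2.conj o.m110 o.m232
  have s4 := s3.conj o.m121 o.m332
  have t1 := s1.conj (moves_rot _ ![0, 0, 1]) (moves_rot _ ![1, 2, 2])
  have t2 := t1.conj o.m001 o.m122
  have t3 := t2.conj o.m011 o.m223
  have t4 := t3.conj o.m112 o.m233
  have q1 := t1.conj (moves_rot _ ![1, 0, 0]) (moves_rot _ ![2, 1, 2])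
  have q2 := q1.conj o.m100 o.m212
  have q3 := q2.conj o.m101 o.m322
  have q4 := q3.conj o.m211 o.m323
  exact ⟨s1, s2, s3, s4, t1, t2, t3, t4, q1, q2, q3, q4⟩

variable [D.MonoidalStr]

theorem cls_prodMap_tens {E E' : Prederivator.{v, u}} (φ : E ⟶ D.shift Arr)
    (ψ : E' ⟶ D.shift Arr) (p q : D.shift Arr ⟶ D) {p' : E ⟶ D} {q' : E' ⟶ D}
    (hp : cls (φ ≫ p) = cls p') (hq : cls (ψ ≫ q) = cls q') :
    cls (prodMap φ ψ) ≫ cls (tens p q) = cls (prodMap p' q' ≫ D.tensor) := by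
  rw [tens, cls_comp, ← Category.assoc, cls_prodMap_comp, cls_prodMap_congr hp hq, cls_comp]

variable {hK : D.HasKan} {A : Ho.mk ((D.shift Arr).prod (D.shift Arr)) ⟶ Ho.mk (cex D)}
  {Φ : Ho.mk (cex D) ⟶ Ho.mk (cex D)} {p q : D.shift Arr ⟶ D} {c d : Fin 3 → ℤ}

/-- If cofibers in the first variable correspond to `Φ`, a value `p ⊗ q` at `c` gives the value `cof
p ⊗ q` at the point to which `Φ` moves `c`. -/
theorem Val.cof_left (h : Val A c (cls (tens p q)))
    (hA : cls (prodMap (cof hK) (𝟙 _)) ≫ A = A ≫ Φ) (hΦ : Moves Φ c d) :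
    Val A d (cls (tens (cof hK ≫ p) q)) := by
  refine Val.of_move (Φ := Φ) ?_ hΦ
  obtain ⟨hc, h⟩ := h
  refine ⟨hc, ?_⟩
  rw [← hA, Category.assoc, h]
  exact cls_prodMap_tens _ _ _ _ rfl (Category.id_comp (cls q))

theorem Val.cof_right (h : Val A c (cls (tens p q)))
    (hA : cls (prodMap (𝟙 _) (cof hK)) ≫ A = A ≫ Φ) (hΦ : Moves Φ c d) :
    Val A d (cls (tens p (cof hK ≫ q))) := by
  refine Val.of_move (Φ := Φ) ?_ hΦ
  obtain ⟨hc, h⟩ := h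
  refine ⟨hc, ?_⟩
  rw [← hA, Category.assoc, h]
  exact cls_prodMap_tens _ _ _ _ (Category.id_comp (cls p)) rfl

theorem cof_left_bigT (hs : D.IsStableKan) (hK : D.HasKan) (hi : IsEquiv (cexRestr D iV))
    (ht : D.TensorCocontinuous) (hA : A ≫ cls (cexRestr D jSq) = cls (extTensor D)) :
    cls (prodMap (cof hK) (𝟙 _)) ≫ A = A ≫ cls (bigT hK hi) := by
  have := isIso_jSq hs hK
  have hR := (hs.shift Arr).kan.hasKan
  rw [← cancel_mono (cls (cexRestr D jSq)), Category.assoc, hA, cls_cof_extTensor ht hs hK hR,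
    Category.assoc, ← bigT_jSq hs hK hi hR, ← Category.assoc, hA]

theorem cof_right_bigT (hs : D.IsStableKan) (hK : D.HasKan) (hi : IsEquiv (cexRestr D iV))
    (ht : D.TensorCocontinuous) (hA : A ≫ cls (cexRestr D jSq) = cls (extTensor D)) :
    cls (prodMap (𝟙 _) (cof hK)) ≫ A = A ≫ cls (rotRes D) ≫ cls (bigT hK hi) := by
  have := isIso_jSq hs hK
  have hR := (hs.shift Arr).kan.hasKan
  rw [← cancel_mono (cls (cexRestr D jSq)), Category.assoc, hA, cls_extTensor_cof ht hs hK hR,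
    Category.assoc, Category.assoc, ← rot_bigT_jSq hs hK hi hR, ← Category.assoc, hA]

theorem val_jSq (hA : A ≫ cls (cexRestr D jSq) = cls (extTensor D)) (x : Sq) :
    Val A (jFun x) (cls (tens (D.ev x.1) (D.ev x.2))) :=
  ⟨jFun_mem x, by rw [← cls_extTensor_ev, ← hA, Category.assoc, cls_cexRestr_ev]; rfl⟩

/-- The values on which the tables for `M` and `τ⁻¹ M` are based. -/
structure TensVals (hK : D.HasKan) (M : (D.shift Arr).prod (D.shift Arr) ⟶ cex D) : Prop where
  v010 : HasValue M ![0, 1, 0] (tens (arrX D) (arrX D))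
  v110 : HasValue M ![1, 1, 0] (tens (arrY D) (arrX D))
  v011 : HasValue M ![0, 1, 1] (tens (arrX D) (arrY D))
  v112 : HasValue M ![1, 1, 2] (tens (arrY D) (arrY D))
  v121 : HasValue M ![1, 2, 1] (tens (arrZ hK) (arrX D))
  v122 : HasValue M ![1, 2, 2] (tens (arrZ hK) (arrY D))
  v211 : HasValue M ![2, 1, 1] (tens (arrX D) (arrZ hK))
  v212 : HasValue M ![2, 1, 2] (tens (arrY D) (arrZ hK))
  v322 : HasValue M ![3, 2, 2] (tens (arrZ hK) (arrZ hK))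

/-- The values of the square at `j` are `x ⊗ x'`, `x ⊗ y'`, `y ⊗ x'`, `y ⊗ y'`; the others follow by
taking cofibers in one variable, that is, by applying `T` and rotations. -/
theorem tensVals (hs : D.IsStableKan) (hK : D.HasKan) (ht : D.TensorCocontinuous)
    {M : (D.shift Arr).prod (D.shift Arr) ⟶ cex D}
    (hM : cls M ≫ cls (cexRestr D jSq) = cls (extTensor D)) : TensVals hK M := by
  have hi := cexRestr_iV_isEquiv hs hK
  have o := orbits_bigT hs hK hi
  have hl := cof_left_bigT hs hK hi ht hM
  have hr := cof_right_bigT hs hK hi ht hM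
  have v010 : Val (cls M) ![0, 1, 0] (cls (tens (arrX D) (arrX D))) := val_jSq hM (.mk 0 0)
  have v110 : Val (cls M) ![1, 1, 0] (cls (tens (arrY D) (arrX D))) := val_jSq hM (.mk 1 0)
  have v011 : Val (cls M) ![0, 1, 1] (cls (tens (arrX D) (arrY D))) := val_jSq hM (.mk 0 1)
  have v112 : Val (cls M) ![1, 1, 2] (cls (tens (arrY D) (arrY D))) := val_jSq hM (.mk 1 1)
  have v122 := v112.cof_left hl o.m112
  exact ⟨hasValue_iff.2 v010, hasValue_iff.2 v110, hasValue_iff.2 v011, hasValue_iff.2 v112,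
    hasValue_iff.2 (v110.cof_left hl o.m110), hasValue_iff.2 v122,
    hasValue_iff.2 (v011.cof_right hr (o.m011.comp (moves_rot _ ![2, 1, 1]))),
    hasValue_iff.2 (v112.cof_right hr (o.m112.comp (moves_rot _ ![2, 1, 2]))),
    hasValue_iff.2 (v122.cof_right hr (o.m122.comp (moves_rot _ ![3, 2, 2])))⟩

end Table

end

end Der.Prederivator

namespace Der.Prederivator

noncomputable section

/-! ### The tables -/

section TC

variable {D : Prederivator.{v, u}}

/-- The values at `000` and `222` are related by `T`. -/
theorem bigT_ev000 (hs : D.IsStableKan) (hK : D.HasKan) (hi : IsEquiv (cexRestr D iV)) :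
    cls (bigT hK hi) ≫ cls (cexEv D ⟨![0, 0, 0], by decide +kernel⟩) =
      cls (cexEv D ⟨![2, 2, 2], by decide +kernel⟩) ≫ cls (loop hK) := by
  have h := cls_bigT_ev111 hs hK hi
  obtain ⟨_, _, h1⟩ := moves_sh (D := D) ![1, 1, 1] ![2, 2, 2]
  rw [← h1, ← bigT_bigT hs hK hi, Category.assoc, Category.assoc, reassoc_of% h,
    cls_susp_loop hK hs, Category.comp_id]

/-- The values of `τ⁻¹ A` at the points `(n, n, n)`, where `τ⁻¹ = T (r^*)²`. -/
theorem cls_tau_diag (hs : D.IsStableKan) (hK : D.HasKan) (hi : IsEquiv (cexRestr D iV))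
    {U : Ho.mk (cex D) ⟶ Ho.mk (cex D)} (hU : U = cls (rotRes D) ≫ cls (rotRes D) ≫ cls
      (bigT hK hi)) :
    U ≫ cls (cexEv D ⟨![0, 0, 0], by decide +kernel⟩) =
        cls (cexEv D ⟨![2, 2, 2], by decide +kernel⟩) ≫ cls (loop hK) ∧
      U ≫ cls (cexEv D ⟨![1, 1, 1], by decide +kernel⟩) =
        cls (cexEv D ⟨![0, 0, 0], by decide +kernel⟩) ≫ cls (susp hK) ∧
      U ≫ cls (cexEv D ⟨![2, 2, 2], by decide +kernel⟩) =
        cls (cexEv D ⟨![1, 1, 1], by decide +kernel⟩) ≫ cls (susp hK) := by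
  obtain ⟨_, _, r0⟩ := moves_rot (D := D) ![0, 0, 0] ![0, 0, 0]
  obtain ⟨_, _, r1⟩ := moves_rot (D := D) ![1, 1, 1] ![1, 1, 1]
  obtain ⟨_, _, r2⟩ := moves_rot (D := D) ![2, 2, 2] ![2, 2, 2]
  subst hU
  simp only [Category.assoc, bigT_ev000 hs hK hi, cls_bigT_ev111 hs hK hi, susp_111 hs hK hi]
  rw [reassoc_of% r2, reassoc_of% r2, reassoc_of% r0, reassoc_of% r0, reassoc_of% r1,
    reassoc_of% r1]
  exact ⟨rfl, rfl, rfl⟩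

variable [D.MonoidalStr] {M : (D.shift Arr).prod (D.shift Arr) ⟶ cex D}

/-- The table (TC3), with `u`, `v`, `w` the values `Σ⁻¹(222)`, `111` and `Σ(000)`. -/
theorem isTC3 (hs : D.IsStableKan) (hK : D.HasKan) (ht : D.TensorCocontinuous)
    (hM : cls M ≫ cls (cexRestr D jSq) = cls (extTensor D)) :
    IsTC3 hK M (M ≫ cexEv D ⟨![2, 2, 2], by decide +kernel⟩ ≫ loop hK)
      (M ≫ cexEv D ⟨![1, 1, 1], by decide +kernel⟩)
      (M ≫ cexEv D ⟨![0, 0, 0], by decide +kernel⟩ ≫ susp hK) := by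
  have s := susps hs hK
  have t := tensVals hs hK ht hM
  exact {
    at000 := hasValue_iff.2 ⟨by decide +kernel, by
      simp only [cls_comp, Category.assoc, cls_susp_loop hK hs, Category.comp_id]⟩
    at100 := t.v212.loop hs s.s100
    at010 := t.v010
    at001 := t.v122.loop hs s.s001
    at110 := t.v110
    at101 := t.v322.loop hs s.s101
    at011 := t.v011
    at111 := hasValue_iff.2 ⟨by decide +kernel, rfl⟩
    at211 := t.v211
    at121 := t.v121
    at112 := t.v112
    at221 := t.v010.susp s.s010
    at212 := t.v212
    at122 := t.v122
    at222 := hasValue_iff.2 ⟨by decide +kernel, by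
      simp only [cls_comp, Category.assoc, cls_loop_susp hK hs, Category.comp_id]⟩
    at322 := t.v322
    at232 := t.v110.susp s.s110
    at223 := t.v011.susp s.s011
    at332 := t.v121.susp s.s121
    at323 := t.v211.susp s.s211
    at233 := t.v112.susp s.s112
    period := hasValue_period hs hK M }

/-- Transport of values from `M` to `τ⁻¹ M`. -/
theorem HasValue.tau {N : (D.shift Arr).prod (D.shift Arr) ⟶ cex D} {hK : D.HasKan}
    {hi : IsEquiv (cexRestr D iV)} (hN : cls N = cls M ≫ cls (rotRes D) ≫ cls (rotRes D) ≫ cls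
      (bigT hK hi)) {c d f : Fin 3 → ℤ} {p}
    (hv : HasValue M f p) (hm : Moves (cls (bigT hK hi)) c d)
    (h : rotFun (rotFun d) = f := by decide +kernel) : HasValue N c p := by
  have hd : d ∈ C := hm.2.1
  rw [hasValue_iff, hN, ← Category.assoc (cls (rotRes D))]
  exact (hasValue_iff.1 hv).move
    (hm.comp ((moves_rot d _ rfl hd).comp (moves_rot _ f h (rot_mem hd))))

/-- The table (TC3'). Up to rotation, `τ⁻¹` moves the values of the first table along the orbits of
`T`, except for those at the points `(n, n, n)`, which are given by `cls_tau_diag`. -/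
theorem isTC3' (hs : D.IsStableKan) (hK : D.HasKan) (ht : D.TensorCocontinuous)
    (hM : cls M ≫ cls (cexRestr D jSq) = cls (extTensor D)) (hi : IsEquiv (cexRestr D iV))
    {N : (D.shift Arr).prod (D.shift Arr) ⟶ cex D}
    (hN : cls N = cls M ≫ cls (rotRes D) ≫ cls (rotRes D) ≫ cls (bigT hK hi)) :
    IsTC3' hK N (M ≫ cexEv D ⟨![2, 2, 2], by decide +kernel⟩ ≫ loop hK)
      (M ≫ cexEv D ⟨![1, 1, 1], by decide +kernel⟩)
      (M ≫ cexEv D ⟨![0, 0, 0], by decide +kernel⟩ ≫ susp hK) := by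
  have s := susps hs hK
  have t := tensVals hs hK ht hM
  have o := orbits_bigT hs hK hi
  obtain ⟨h0, h1, h2⟩ := cls_tau_diag hs hK hi rfl
  have h343 : HasValue M ![3, 4, 3] (tens (arrX D) (arrX D) ≫ susp hK ≫ susp hK) := by
    have h := (t.v010.susp s.s010).susp s.s221
    rw [hasValue_iff, cls_comp, cls_comp, Category.assoc, ← cls_comp, ← cls_comp] at h
    exact hasValue_iff.2 h
  exact {
    at000 := hasValue_iff.2 ⟨by decide +kernel, by rw [hN, Category.assoc, h0]; rfl⟩
    at100 := HasValue.tau hN t.v011 o.m100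
    at010 := HasValue.tau hN (t.v322.loop hs s.s101) o.m010
    at001 := HasValue.tau hN t.v110 o.m001
    at110 := HasValue.tau hN t.v211 o.m110
    at101 := HasValue.tau hN t.v112 o.m101
    at011 := HasValue.tau hN t.v121 o.m011
    at111 := hasValue_iff.2 ⟨by decide +kernel, by rw [hN, Category.assoc, h1]; rfl⟩
    at211 := HasValue.tau hN t.v122 o.m211
    at121 := HasValue.tau hN t.v212 o.m121
    at112 := HasValue.tau hN (t.v010.susp s.s010) o.m112
    at221 := HasValue.tau hN t.v322 o.m221
    at212 := HasValue.tau hN (t.v011.susp s.s011) o.m212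
    at122 := HasValue.tau hN (t.v110.susp s.s110) o.m122
    at222 := hasValue_iff.2 ⟨by decide +kernel, by
      rw [hN, Category.assoc, h2, cls_comp, cls_comp, Category.assoc]⟩
    at322 := HasValue.tau hN (t.v112.susp s.s112) o.m322
    at232 := HasValue.tau hN (t.v211.susp s.s211) o.m232
    at223 := HasValue.tau hN (t.v121.susp s.s121) o.m223
    at332 := HasValue.tau hN (t.v212.susp s.s212) o.m332
    at323 := HasValue.tau hN (t.v122.susp s.s122) o.m323
    at233 := HasValue.tau hN h343 o.m233
    period := hasValue_period hs hK N }

end TC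

end

end Der.Prederivator

namespace Der.Prederivator

noncomputable section

/-! ### Cofibers and fibers in terms of `τ` and the Serre functor -/

section Main

variable {D : Prederivator.{v, u}}

/-- The inverse of `τ` is `T (r^*)²`. -/
theorem cls_arTau_inv {hK : D.HasKan} {hi : IsEquiv (cexRestr D iV)}
    (hT : IsEquiv (bigT hK hi)) (hτ : IsEquiv (arTau hT)) :
    cls hτ.inv = cls (rotRes D) ≫ cls (rotRes D) ≫ cls (bigT hK hi) := by
  have := isEquiv_iff.1 hT
  have := isEquiv_iff.1 hτ
  have h : cls (arTau hT) = inv (cls (bigT hK hi)) ≫ cls (rotRes D) := by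
    rw [arTau, cls_comp, cls_inv hT]
  rw [cls_inv hτ]
  refine IsIso.inv_eq_of_hom_inv_id ?_
  have h3 := congrArg (· ≫ cls (bigT hK hi)) (cls_rotRes_cube D)
  simp only [Category.assoc, Category.id_comp] at h3
  rw [h, Category.assoc, h3, IsIso.inv_hom_id]

theorem isEquiv_arTau {hK : D.HasKan} {hi : IsEquiv (cexRestr D iV)}
    (hT : IsEquiv (bigT hK hi)) : IsEquiv (arTau hT) := by
  have := isEquiv_iff.1 hT
  rw [isEquiv_iff, arTau, cls_comp, cls_inv hT]
  infer_instance

/-- Cofibers in the first direction correspond to `T = r^* τ⁻¹`. -/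
theorem cls_cof₁_jSq_inv (hs : D.IsStableKan) (hK : D.HasKan) (hA : (D.shift Arr).HasKan)
    {hi : IsEquiv (cexRestr D iV)} (hj : IsEquiv (cexRestr D jSq)) (hT : IsEquiv (bigT hK hi))
    (hτ : IsEquiv (arTau hT)) :
    cls (cof₁ hA) ≫ cls hj.inv = cls hj.inv ≫ cls hτ.inv ≫ cls (rotRes D) := by
  have := isEquiv_iff.1 hj
  rw [cls_inv hj, cls_arTau_inv, IsIso.eq_inv_comp, ← Category.assoc, bigT_jSq hs hK hi,
    Category.assoc, IsIso.hom_inv_id, Category.comp_id]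
  simp only [Category.assoc]
  rw [bigT_rot hs hK hi]
  have h3 := congrArg (· ≫ cls (bigT hK hi)) (cls_rotRes_cube D)
  simp only [Category.assoc, Category.id_comp] at h3
  exact h3.symm

/-- Cofibers in the second direction correspond to `T r^* = (r^*)⁻¹ τ⁻¹`. -/
theorem cls_cof₂_jSq_inv (hs : D.IsStableKan) (hK : D.HasKan) (hA : (D.shift Arr).HasKan)
    {hi : IsEquiv (cexRestr D iV)} (hj : IsEquiv (cexRestr D jSq)) (hT : IsEquiv (bigT hK hi))
    (hr : IsEquiv (rotRes D)) (hτ : IsEquiv (arTau hT)) :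
    cls (cof₂ hA) ≫ cls hj.inv = cls hj.inv ≫ cls hτ.inv ≫ cls hr.inv := by
  have := isEquiv_iff.1 hj
  rw [cls_inv hj, cls_inv hr, cls_arTau_inv, IsIso.eq_inv_comp, ← Category.assoc,
    rot_bigT_jSq hs hK hi]
  simp only [Category.assoc]
  rw [IsIso.hom_inv_id, Category.comp_id, ← cancel_mono (cls (rotRes D))]
  simp only [Category.assoc]
  rw [IsIso.inv_hom_id, Category.comp_id, bigT_rot hs hK hi]

variable [D.MonoidalStr]

/-- The product of cofibers corresponds to the Serre functor, because `T r^* T = sh^* r^*`. -/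
theorem cls_cof_cof_extTensor (ht : D.TensorCocontinuous) (hs : D.IsStableKan) (hK : D.HasKan)
    {A : Ho.mk ((D.shift Arr).prod (D.shift Arr)) ⟶ Ho.mk (cex D)}
    (hA : A ≫ cls (cexRestr D jSq) = cls (extTensor D)) :
    cls (prodMap (cof hK) (cof hK)) ≫ A = A ≫ cls (serre D) := by
  have hi := cexRestr_iV_isEquiv hs hK
  have h : cls (prodMap (cof hK) (cof hK)) =
      cls (prodMap (cof hK) (𝟙 _)) ≫ cls (prodMap (𝟙 _) (cof hK)) :=
    (cls_prodMap_congr (Category.comp_id (cls (cof hK))).symm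
      (Category.id_comp (cls (cof hK))).symm).trans (cls_prodMap_comp _ _ _ _).symm
  rw [h, Category.assoc, cof_right_bigT hs hK hi ht hA, ← Category.assoc,
    cof_left_bigT hs hK hi ht hA, Category.assoc, ← bigT_rot hs hK hi, ← Category.assoc
      (cls (bigT hK hi)), bigT_bigT hs hK hi]
  rfl

/-- The suspended product of fibers corresponds to `τ⁻¹`, because taking fibers is inverse to
taking cofibers and suspension of squares corresponds to `T sh^*`. -/
theorem cls_fib_fib_extTensor (ht : D.TensorCocontinuous) (hs : D.IsStableKan) (hK : D.HasKan)
    (hS : (D.shift Sq).HasKan) {hi : IsEquiv (cexRestr D iV)} (hj : IsEquiv (cexRestr D jSq))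
    (hT : IsEquiv (bigT hK hi)) (hτ : IsEquiv (arTau hT)) :
    cls (prodMap (fib hK) (fib hK)) ≫ cls (extTensor D) ≫ cls (susp hS) ≫ cls hj.inv =
      cls (extTensor D) ≫ cls hj.inv ≫ cls hτ.inv := by
  have := isEquiv_iff.1 hj
  have h1 : cls (susp hS) ≫ cls hj.inv = cls hj.inv ≫ cls (shRes D) ≫ cls (bigT hK hi) := by
    rw [cls_inv hj, IsIso.eq_inv_comp, ← Category.assoc, jSq_susp' hs hK hi, Category.assoc,
      Category.assoc, IsIso.hom_inv_id, Category.comp_id]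
  have hA : (cls (extTensor D) ≫ cls hj.inv) ≫ cls (cexRestr D jSq) = cls (extTensor D) := by
    rw [cls_inv hj, Category.assoc, IsIso.inv_hom_id, Category.comp_id]
  have h2 := congrArg (cls (prodMap (fib hK) (fib hK)) ≫ ·) (cls_cof_cof_extTensor ht hs hK hA)
  have h3 : cls (prodMap (fib hK) (fib hK)) ≫ cls (prodMap (cof hK) (cof hK)) = 𝟙 _ :=
    (cls_prodMap_comp _ _ _ _).trans ((cls_prodMap_congr (cls_fib_cof hK hs)
      (cls_fib_cof hK hs)).trans cls_prodMap_id)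
  rw [← Category.assoc, h3, Category.id_comp, serre, cls_comp] at h2
  have h4 := congrArg (· ≫ cls (rotRes D) ≫ cls (rotRes D) ≫ cls (bigT hK hi)) h2
  have h5 := congrArg (· ≫ cls (bigT hK hi)) (cls_rotRes_cube D)
  simp only [Category.assoc, Category.id_comp] at h4 h5
  rw [h1, cls_arTau_inv, h4, h5]

end Main

end

end Der.Prederivator

theorem mainTheorem12 (D : Prederivator.{v, u}) (hD : D.IsStable) :
    ∃ (hK : D.HasKan) (hArr : (D.shift Arr).HasKan) (hSq : (D.shift Sq).HasKan)
      (hi : IsEquiv (cexRestr D iV)) (hj : IsEquiv (cexRestr D jSq))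
      (hT : IsEquiv (bigT hK hi)) (hr : IsEquiv (rotRes D)) (hτ : IsEquiv (arTau hT)),
      Nonempty (cof₁ hArr ≫ hj.inv ≅ hj.inv ≫ hτ.inv ≫ rotRes D) ∧
      Nonempty (cof₂ hArr ≫ hj.inv ≅ hj.inv ≫ hτ.inv ≫ hr.inv) ∧
      ∀ [D.MonoidalStr], D.TensorCocontinuous →
        Nonempty (prodMap (cof hK) (cof hK) ≫ extTensor D ≫ hj.inv ≅
          extTensor D ≫ hj.inv ≫ serre D) ∧
        Nonempty (prodMap (fib hK) (fib hK) ≫ extTensor D ≫ susp hSq ≫ hj.inv ≅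
          extTensor D ≫ hj.inv ≫ hτ.inv) ∧
        ∃ u v w : (D.shift Arr).prod (D.shift Arr) ⟶ D,
          IsTC3 hK (extTensor D ≫ hj.inv) u v w ∧
          IsTC3' hK (extTensor D ≫ hj.inv ≫ hτ.inv) u v w := by
  have hs := hD.isStableKan
  have hK := hs.kan.hasKan
  have hA := (hs.shift Arr).kan.hasKan
  have hS := (hs.shift Sq).kan.hasKan
  have hi := cexRestr_iV_isEquiv hs hK
  have hj := cexRestr_jSq_isEquiv hs hK
  have hT : IsEquiv (bigT hK hi) := isEquiv_iff.2 (isIso_bigT hs hK hi)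
  have hr : IsEquiv (rotRes D) := isEquiv_iff.2 inferInstance
  have hτ := isEquiv_arTau hT
  refine ⟨hK, hA, hS, hi, hj, hT, hr, hτ, cls_eq_iff.1 (cls_cof₁_jSq_inv hs hK hA hj hT hτ),
    cls_eq_iff.1 (cls_cof₂_jSq_inv hs hK hA hj hT hr hτ), ?_⟩
  intro _ ht
  have := isEquiv_iff.1 hj
  have hM : cls (extTensor D ≫ hj.inv) ≫ cls (cexRestr D jSq) = cls (extTensor D) := by
    rw [cls_comp, cls_inv hj, Category.assoc, IsIso.inv_hom_id, Category.comp_id]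
  have hc := cls_cof_cof_extTensor ht hs hK hM
  rw [cls_comp, Category.assoc] at hc
  refine ⟨cls_eq_iff.1 hc,
    cls_eq_iff.1 (cls_fib_fib_extTensor ht hs hK hS hj hT hτ), _, _, _, isTC3 hs hK ht hM,
    isTC3' hs hK ht hM hi ?_⟩
  rw [cls_comp, cls_comp, cls_comp, cls_arTau_inv, Category.assoc]
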